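/- **The source $\mathcal U^*$.** Let $\mathcal U^*$ be the graded additive 2-category (Lauda) with objects $n\in\mathbb Z$; 1-morphisms the finite formal direct sums of shifts $\{s\}$, $s\in\mathbb Z$, of composites of $\mathcal E\mathbf 1_n\colon n\to n+2$ and $\mathcal F\mathbf 1_{n+2}\colon n+2\to n$; and 2-morphisms generated over $\mathbb Z$ by identities, isomorphisms $x\simeq x\{s\}$ (of degree $s$), the inclusions and projections of direct sums (degree $0$), and $z_n\colon\mathcal E\mathbf 1_n\to\mathcal E\mathbf 1_n$, $\hat z_n\colon\mathcal F\mathbf 1_{n+2}\to\mathcal F\mathbf 1_{n+2}$ (degree $2$), $U_n\colon\mathcal{EE}\mathbf 1_n\to\mathcal{EE}\mathbf 1_n$, $\hat U_n\colon\mathcal{FF}\mathbf 1_{n+4}\to\mathcal{FF}\mathbf 1_{n+4}$ (degree $-2$), $\eta_n\colon\mathbf 1_n\to\mathcal{FE}\mathbf 1_n$, $\hat\eta_n\colon\mathcal{FE}\mathbf 1_n\to\mathbf 1_n$ (degree $n+1$), $\hat\varepsilon_n\colon\mathbf 1_n\to\mathcal{EF}\mathbf 1_n$, $\varepsilon_n\colon\mathcal{EF}\mathbf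 1_n\to\mathbf 1_n$ (degree $1-n$). Write $z^d$ for $d$-fold vertical composites and $\mathrm c_n(d)=\varepsilon_n\circ(z_{n-2}^{d}\,\mathcal F)\circ\hat\varepsilon_n$, $\mathrm{cc}_n(d)=\hat\eta_n\circ(\mathcal F z_n^{d})\circ\eta_n$ for the clockwise and counterclockwise bubbles with $d\ge0$ dots in the region $n$. For $d<0$ the (fake) bubbles $\mathrm c_n(n-1+i)$, $\mathrm{cc}_n(-n-1+i)$, $i\ge0$, are defined as the coefficients of $t^i$ in the inverse of the power series $1+\sum_{j\ge1}\mathrm{cc}_n(-n-1+j)t^j$, respectively $1+\sum_{j\ge1}\mathrm c_n(n-1+j)t^j$. The relations, for all $n$ (sums over empty ranges being $0$), are: (1) $(\eta_n,\varepsilon_{n+2})$ and $(\hat\varepsilon_{n+2},\hat\eta_{n})$ are units and counits of adjunctions making $\mathcal E\mathbf 1_n$ and $\mathcal F\mathbf 1_{n+2}$ biadjoint; (2) $\hat z_n$ is both the left and the right mate of $z_n$, and $\hat U_n$ is both the left and the right mate of $U_n$; (3) $\mathrm c_n(d)=0$ for $0\le d<n-1$, $\mathrm{cc}_n(d)=0$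 for $0\le d<-n-1$, $\mathrm c_n(n-1)=1$ if $n\ge 1$, $\mathrm{cc}_n(-n-1)=1$ if $n\le-1$, and $\sum_{i=0}^{k}\mathrm{cc}_n(-n-1+i)\,\mathrm c_n(n-1+k-i)=0$ for $k\ge1$; (4) $U_n^2=0$; $\;U_n\circ(z_{n+2}\mathcal E)-(\mathcal E z_n)\circ U_n=\mathrm{id}=(z_{n+2}\mathcal E)\circ U_n-U_n\circ(\mathcal E z_n)$; $\;(U_{n+2}\mathcal E)(\mathcal EU_n)(U_{n+2}\mathcal E)=(\mathcal EU_n)(U_{n+2}\mathcal E)(\mathcal EU_n)$; (5) $(\mathcal E\varepsilon_n)\circ(U_{n-2}\mathcal F)\circ(\mathcal E\hat\varepsilon_n)=-\sum_{\ell=0}^{-n}z_n^{-n-\ell}\cdot\mathrm c_n(n-1+\ell)$ on $\mathcal E\mathbf 1_n$ (bubble on the right), and $(\hat\eta_n\mathcal E)\circ(\mathcal FU_{n-2})\circ(\eta_n\mathcal E)=\sum_{j=0}^{n}\mathrm{cc}_n(-n-1+j)\cdot z_{n-2}^{\,n-j}$ on $\mathcal E\mathbf 1_{n-2}$ (bubble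 on the left); (6) with the sideways crossings $\sigma=(\mathcal{FE}\varepsilon_n)(\mathcal FU_{n-2}\mathcal F)(\eta_n\mathcal{EF})\colon\mathcal{EF}\mathbf 1_n\to\mathcal{FE}\mathbf 1_n$ and $\tau=(\hat\eta_n\mathcal{EF})(\mathcal FU_{n-2}\mathcal F)(\mathcal{FE}\hat\varepsilon_n)\colon\mathcal{FE}\mathbf 1_n\to\mathcal{EF}\mathbf 1_n$, $$\mathrm{id}_{\mathcal{EF}\mathbf 1_n}=-\tau\sigma+\sum_{\ell=0}^{n-1}\sum_{j=0}^{\ell}(z^{n-1-\ell}\mathcal F)\,\hat\varepsilon_n\,\mathrm{cc}_n(-n-1+j)\,\varepsilon_n\,(z^{\ell-j}\mathcal F),$$ $$\mathrm{id}_{\mathcal{FE}\mathbf 1_n}=-\sigma\tau+\sum_{\ell=0}^{-n-1}\sum_{j=0}^{\ell}(\mathcal Fz^{-n-1-\ell})\,\eta_n\,\mathrm c_n(n-1+j)\,\hat\eta_n\,(\mathcal Fz^{\ell-j}).$$ $\mathcal U$ denotes the 2-category with the same objects and 1-morphisms and the 2-morphisms of degree $0$ of $\mathcal U^*$. **The target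 $\mathrm{EqFlag}^*_N$.** Fix an integer $N\ge1$. For $0\le k\le N$ let $H_k=\mathbb Q[x_1,\dots,x_k;y_1,\dots,y_{N-k}]=H^*_{GL(N)}(Gr(k,N);\mathbb Q)$, $\deg x_j=\deg y_j=2j$, with $x_0=y_0=1$ and $x_j=0$ for $j>k$, $y_j=0$ for $j>N-k$; define $X_j,Y_j\in H_k$ by $(\sum_jX_jt^j)(\sum_jy_jt^j)=1=(\sum_jY_jt^j)(\sum_jx_jt^j)$. For $0\le k<N$ let $H_{k,k+1}=\mathbb Q[w_1,\dots,w_k;\xi;z_1,\dots,z_{N-k-1}]$, $\deg w_j=\deg z_j=2j$, $\deg\xi=2$, the $GL(N)$-equivariant cohomology ring of the variety of flags of dimensions $k<k+1$ in $\mathbb C^N$, with the ring maps $H_k\to H_{k,k+1}$, $x_j\mapsto w_j$, $y_j\mapsto z_j+\xi z_{j-1}$, and $H_{k+1}\to H_{k,k+1}$, $x_j\mapsto w_j+\xi w_{j-1}$, $y_j\mapsto z_j$ (where $w_0=z_0=1$, $w_j=0$ for $j>k$, $z_j=0$ for $j>N-k-1$). It is an $(H_k,H_{k+1})$-bimodule,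 and $H_{k+1,k}$ is the same ring as an $(H_{k+1},H_k)$-bimodule. The objects of $\mathrm{EqFlag}^*_N$ are the graded rings $H_k$, $0\le k\le N$, and the zero ring. Its 1-morphisms $R\to S$ are the graded $(R,S)$-bimodules obtained from the identity bimodules, the $H_{k,k+1}$ and the $H_{k+1,k}$ by tensor products over the intermediate rings, grading shifts ($M\{s\}_d=M_{d-s}$), finite direct sums and graded direct summands; its 2-morphisms are the finite sums of homogeneous bimodule maps. In $\mathrm{EqFlag}_N$ only the bimodule maps of degree $0$ are kept. The composite "first $M$, then $M'$" is $M\otimes M'$. **Theorem.** For each positive integer $N$ the following assignments define a graded additive (weak) 2-functor $\Gamma^G_N\colon\mathcal U^*\to\mathrm{EqFlag}^*_N$, that is, a pseudofunctor that is additive on 2-morphisms, maps direct sums of 1-morphisms to direct sums, and preserves the degrees of 2-morphisms. Here $n=2k-N$, and everything that involves a ring $H_j$ with $j\notin\{0,\dots,N\}$ is zero. - $n\mapsto H_k$; $\;\mathbf 1_n\mapsto H_k$, $\;\mathcal E\mathbf 1_n\mapsto H_{k,k+1}\{1-N+k\}$, $\;\mathcal F\mathbf 1_{n}\mapsto H_{k,k-1}\{1-k\}$;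 weights not of the form $2k-N$ with $0\le k\le N$ go to the zero ring. Composites, shifts and direct sums of 1-morphisms go to tensor products, shifts and direct sums of bimodules, with the evident identity maps as coherence isomorphisms; the isomorphisms $x\simeq x\{s\}$ go to identity maps, inclusions and projections to inclusions and projections. - $z_n$, $\hat z_n$: $\xi^m\mapsto\xi^{m+1}$. - $U_n$: with $\xi_1^{m_1}\xi_2^{m_2}$ standing for $\xi^{m_2}\otimes\xi^{m_1}\in H_{k,k+1}\otimes_{H_{k+1}}H_{k+1,k+2}$ (so $\xi_1$ belongs to the left strand of the diagram), $\;\xi_1^{m_1}\xi_2^{m_2}\mapsto\sum_{j=0}^{m_1-1}\xi_1^{m_1+m_2-1-j}\xi_2^{j}-\sum_{j=0}^{m_2-1}\xi_1^{m_1+m_2-1-j}\xi_2^{j}$ (the divided difference). - $\hat U_n$: with $\xi_1^{m_1}\xi_2^{m_2}$ standing for $\xi^{m_2}\otimes\xi^{m_1}\in H_{k+2,k+1}\otimes_{H_{k+1}}H_{k+1,k}$, $\;\xi_1^{m_1}\xi_2^{m_2}\mapsto\sum_{j=0}^{m_2-1}\xi_1^{m_1+m_2-1-j}\xi_2^{j}-\sum_{j=0}^{m_1-1}\xi_1^{m_1+m_2-1-j}\xi_2^{j}$.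 - $\eta_n\colon H_k\to (H_{k,k+1}\otimes_{H_{k+1}}H_{k+1,k})\{1-N\}$, $\;1\mapsto\sum_{j=0}^{k}(-1)^jx_j\otimes\xi^{k-j}=\sum_{j=0}^{k}(-1)^j\xi^{k-j}\otimes x_j$. - $\hat\varepsilon_n\colon H_k\to(H_{k,k-1}\otimes_{H_{k-1}}H_{k-1,k})\{1-N\}$, $\;1\mapsto\sum_{j=0}^{N-k}(-1)^jy_j\otimes\xi^{N-k-j}=\sum_{j=0}^{N-k}(-1)^j\xi^{N-k-j}\otimes y_j$. - $\hat\eta_n\colon(H_{k,k+1}\otimes_{H_{k+1}}H_{k+1,k})\{1-N\}\to H_k$, $\;\xi^{a}\otimes\xi^{b}\mapsto(-1)^{e}X_{e}$ with $e=a+b+1+k-N$ (zero if $e<0$). - $\varepsilon_n\colon(H_{k,k-1}\otimes_{H_{k-1}}H_{k-1,k})\{1-N\}\to H_k$, $\;\xi^{a}\otimes\xi^{b}\mapsto(-1)^{e}Y_{e}$ with $e=a+b+1-k$ (zero if $e<0$). Restricting $\Gamma_N^G$ to the 2-morphisms of degree $0$ gives an additive 2-functor $\mathcal U\to\mathrm{EqFlag}_N$.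 -/

import Mathlib

open CategoryTheory Bicategory
open scoped TensorProduct DirectSum

noncomputable section

namespace EqFlagRep

/-! ### Graded commutative rings and graded bimodules -/

/-- A `ℤ`-graded commutative ring. -/
structure GrRing where
  carrier : Type
  [ring : CommRing carrier]
  gr : ℤ → AddSubgroup carrier
  one_mem : (1 : carrier) ∈ gr 0
  mul_mem : ∀ {i j : ℤ} {a b : carrier}, a ∈ gr i → b ∈ gr j → a * b ∈ gr (i + j)
  isInternal : DirectSum.IsInternal gr

instance : CoeSort GrRing Type := ⟨GrRing.carrier⟩
instance (R : GrRing) : CommRing R := R.ring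

/-- A `ℤ`-graded `(R, S)`-bimodule: an abelian group with commuting actions of `R` (on the left) and
of the commutative ring `S` (on the right), and a compatible decomposition into homogeneous parts. -/
structure GrBimod (R S : GrRing) where
  carrier : Type
  [grp : AddCommGroup carrier]
  lact : R →+* AddMonoid.End carrier
  ract : S →+* AddMonoid.End carrier
  comm : ∀ (r : R) (s : S) (m : carrier), lact r (ract s m) = ract s (lact r m)
  gr : ℤ → AddSubgroup carrier
  lact_mem : ∀ {i j : ℤ} {r : R} {m : carrier}, r ∈ R.gr i → m ∈ gr j → lact r m ∈ gr (i + j)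
  ract_mem : ∀ {i j : ℤ} {s : S} {m : carrier}, s ∈ S.gr i → m ∈ gr j → ract s m ∈ gr (i + j)
  isInternal : DirectSum.IsInternal gr

instance (R S : GrRing) : CoeSort (GrBimod R S) Type := ⟨GrBimod.carrier⟩
instance {R S : GrRing} (M : GrBimod R S) : AddCommGroup M := M.grp

section Internal

variable {A : Type} [AddCommGroup A] {gr : ℤ → AddSubgroup A}

theorem isInternal_of_proj (p : A →+ (ℤ →₀ A)) (hmem : ∀ a d, p a d ∈ gr d)
    (hsum : ∀ a, (p a).sum (fun _ x => x) = a)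
    (hgr : ∀ d a, a ∈ gr d → p a = Finsupp.single d a) : DirectSum.IsInternal gr := by
  have key : ∀ (x : ⨁ i, gr i) (d : ℤ), p (DirectSum.coeAddMonoidHom gr x) d = (x d : A) := by
    intro x d
    induction x using DirectSum.induction_on with
    | zero => simp
    | of i y =>
      rw [DirectSum.coeAddMonoidHom_of, hgr i _ y.2]
      by_cases h : i = d
      · subst h; simp
      · rw [Finsupp.single_eq_of_ne' h, DirectSum.of_eq_of_ne _ _ _ (Ne.symm h)]; rfl
    | add x y hx hy => simp [hx, hy]
  constructor
  · intro x y h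
    ext d
    rw [← key x d, ← key y d, h]
  · intro a
    refine ⟨∑ d ∈ (p a).support, DirectSum.of (fun i => gr i) d ⟨p a d, hmem a d⟩, ?_⟩
    rw [map_sum]
    simp only [DirectSum.coeAddMonoidHom_of]
    exact hsum a

theorem exists_proj (h : DirectSum.IsInternal gr) : ∃ p : A →+ (ℤ →₀ A), (∀ a d, p a d ∈ gr d) ∧
    (∀ a, (p a).sum (fun _ x => x) = a) ∧ (∀ d a, a ∈ gr d → p a = Finsupp.single d a) := by
  let e := AddEquiv.ofBijective (DirectSum.coeAddMonoidHom gr) h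
  let q : (⨁ i, gr i) →+ (ℤ →₀ A) :=
    DirectSum.toAddMonoid (fun d => (Finsupp.singleAddHom d).comp (gr d).subtype)
  have hq : ∀ (d : ℤ) (y : gr d), q (DirectSum.of (fun i => gr i) d y) = Finsupp.single d (y : A) := by
    intro d y; simp [q]
  have hA : ∀ a, ∃ x : ⨁ i, gr i, e x = a := fun a => ⟨e.symm a, by simp⟩
  refine ⟨q.comp e.symm.toAddMonoidHom, ?_, ?_, ?_⟩
  · intro a d
    obtain ⟨x, rfl⟩ := hA a
    simp only [AddMonoidHom.comp_apply, AddEquiv.coe_toAddMonoidHom, AddEquiv.symm_apply_apply]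
    induction x using DirectSum.induction_on with
    | zero => simp
    | of i y =>
      rw [hq]
      by_cases h : i = d
      · subst h; simp
      · rw [Finsupp.single_eq_of_ne' h]; exact zero_mem _
    | add x y hx hy => rw [map_add]; exact add_mem hx hy
  · intro a
    obtain ⟨x, rfl⟩ := hA a
    simp only [AddMonoidHom.comp_apply, AddEquiv.coe_toAddMonoidHom, AddEquiv.symm_apply_apply]
    induction x using DirectSum.induction_on with
    | zero => simp
    | of i y =>
      rw [hq, Finsupp.sum_single_index rfl]
      exact (DirectSum.coeAddMonoidHom_of _ i y).symm
    | add x y hx hy =>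
      rw [map_add, Finsupp.sum_add_index' (fun _ => rfl) (fun _ _ _ => rfl), hx, hy, map_add]
  · intro d a ha
    have : e (DirectSum.of (fun i => gr i) d ⟨a, ha⟩) = a :=
      DirectSum.coeAddMonoidHom_of _ d ⟨a, ha⟩
    rw [← this]
    simp only [AddMonoidHom.comp_apply, AddEquiv.coe_toAddMonoidHom, AddEquiv.symm_apply_apply]
    rw [hq, this]

theorem induction_gr (h : DirectSum.IsInternal gr) {P : A → Prop} (h0 : P 0)
    (hom : ∀ d a, a ∈ gr d → P a) (hadd : ∀ a b, P a → P b → P (a + b)) (a : A) : P a := by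
  obtain ⟨x, rfl⟩ := h.2 a
  induction x using DirectSum.induction_on with
  | zero => simpa using h0
  | of i y => rw [DirectSum.coeAddMonoidHom_of]; exact hom i _ y.2
  | add x y hx hy => rw [map_add]; exact hadd _ _ hx hy

end Internal

namespace GrBimod

variable {R S T V W : GrRing}

section Actions

variable (M : GrBimod R S)

theorem lact_one (m : M) : M.lact 1 m = m := by rw [map_one]; rfl
theorem lact_zero (m : M) : M.lact 0 m = 0 := by rw [map_zero]; rfl
theorem lact_mul (a b : R) (m : M) : M.lact (a * b) m = M.lact a (M.lact b m) := by
  rw [map_mul]; rfl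
theorem lact_add (a b : R) (m : M) : M.lact (a + b) m = M.lact a m + M.lact b m := by
  rw [map_add]; rfl
theorem ract_one (m : M) : M.ract 1 m = m := by rw [map_one]; rfl
theorem ract_zero (m : M) : M.ract 0 m = 0 := by rw [map_zero]; rfl
theorem ract_mul (a b : S) (m : M) : M.ract (a * b) m = M.ract a (M.ract b m) := by
  rw [map_mul]; rfl
theorem ract_add (a b : S) (m : M) : M.ract (a + b) m = M.ract a m + M.ract b m := by
  rw [map_add]; rfl

end Actions

/-! ### Constructions: the bimodule of a ring under two rings, shift, direct sum, tensor product -/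

/-- A graded commutative ring `A` with graded ring maps `R → A ← S`, seen as an
`(R, S)`-bimodule. -/
abbrev ofMaps (A : GrRing) (p : R →+* A) (q : S →+* A)
    (hp : ∀ {i : ℤ} {r : R}, r ∈ R.gr i → p r ∈ A.gr i)
    (hq : ∀ {i : ℤ} {s : S}, s ∈ S.gr i → q s ∈ A.gr i) : GrBimod R S where
  carrier := A
  lact := (Module.toAddMonoidEnd A A).comp p
  ract := (Module.toAddMonoidEnd A A).comp q
  comm r s m := by
    change p r * (q s * m) = q s * (p r * m)
    ring
  gr := A.gr
  lact_mem hr hm := A.mul_mem (hp hr) hm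
  ract_mem hs hm := A.mul_mem (hq hs) hm
  isInternal := A.isInternal

/-- The identity bimodule. -/
abbrev unit (R : GrRing) : GrBimod R R := ofMaps R (RingHom.id R) (RingHom.id R) id id

/-- The same abelian group with the roles of the two commutative rings exchanged. -/
abbrev flip (M : GrBimod R S) : GrBimod S R where
  carrier := M
  lact := M.ract
  ract := M.lact
  comm s r m := (M.comm r s m).symm
  gr := M.gr
  lact_mem := M.ract_mem
  ract_mem := M.lact_mem
  isInternal := M.isInternal

/-- The grading shift `M{s}`: an element of degree `d` of `M` has degree `d + s` in `M{s}`. -/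
abbrev shift (M : GrBimod R S) (s : ℤ) : GrBimod R S where
  carrier := M
  lact := M.lact
  ract := M.ract
  comm := M.comm
  gr d := M.gr (d - s)
  lact_mem {i j r m} hr hm := by
    have := M.lact_mem hr hm
    rwa [← add_sub_assoc] at this
  ract_mem {i j r m} hr hm := by
    have := M.ract_mem hr hm
    rwa [← add_sub_assoc] at this
  isInternal := by
    obtain ⟨p, h1, h2, h3⟩ := exists_proj M.isInternal
    refine isInternal_of_proj ((Finsupp.mapDomain.addMonoidHom (· + s)).comp p) ?_ ?_ ?_
    · intro a d
      have : (Finsupp.mapDomain (· + s) (p a)) ((d - s) + s) = p a (d - s) :=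
        Finsupp.mapDomain_apply (add_left_injective s) _ _
      rw [sub_add_cancel] at this
      change Finsupp.mapDomain (· + s) (p a) d ∈ _
      rw [this]
      exact h1 a _
    · intro a
      change (Finsupp.mapDomain (· + s) (p a)).sum _ = a
      rw [Finsupp.sum_mapDomain_index (fun _ => rfl) (fun _ _ _ => rfl)]
      exact h2 a
    · intro d a ha
      change Finsupp.mapDomain (· + s) (p a) = _
      rw [h3 _ a ha, Finsupp.mapDomain_single, sub_add_cancel]

/-- The zero bimodule. -/
abbrev zero (R S : GrRing) : GrBimod R S where
  carrier := PUnit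
  lact := { toFun := fun _ => 1, map_one' := rfl, map_mul' := fun _ _ => rfl,
            map_zero' := rfl, map_add' := fun _ _ => rfl }
  ract := { toFun := fun _ => 1, map_one' := rfl, map_mul' := fun _ _ => rfl,
            map_zero' := rfl, map_add' := fun _ _ => rfl }
  comm _ _ _ := rfl
  gr _ := ⊤
  lact_mem _ _ := trivial
  ract_mem _ _ := trivial
  isInternal := isInternal_of_proj 0 (fun _ _ => trivial) (fun _ => rfl)
    (fun _ _ _ => Subsingleton.elim _ _)

/-- The direct sum of two graded bimodules. -/
abbrev sum (M N : GrBimod R S) : GrBimod R S where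
  carrier := M × N
  lact :=
    { toFun := fun r => (M.lact r).prodMap (N.lact r)
      map_one' := AddMonoidHom.ext fun x => Prod.ext (M.lact_one x.1) (N.lact_one x.2)
      map_mul' := fun a b => AddMonoidHom.ext fun x =>
        Prod.ext (M.lact_mul a b x.1) (N.lact_mul a b x.2)
      map_zero' := AddMonoidHom.ext fun x => Prod.ext (M.lact_zero x.1) (N.lact_zero x.2)
      map_add' := fun a b => AddMonoidHom.ext fun x =>
        Prod.ext (M.lact_add a b x.1) (N.lact_add a b x.2) }
  ract :=
    { toFun := fun r => (M.ract r).prodMap (N.ract r)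
      map_one' := AddMonoidHom.ext fun x => Prod.ext (M.ract_one x.1) (N.ract_one x.2)
      map_mul' := fun a b => AddMonoidHom.ext fun x =>
        Prod.ext (M.ract_mul a b x.1) (N.ract_mul a b x.2)
      map_zero' := AddMonoidHom.ext fun x => Prod.ext (M.ract_zero x.1) (N.ract_zero x.2)
      map_add' := fun a b => AddMonoidHom.ext fun x =>
        Prod.ext (M.ract_add a b x.1) (N.ract_add a b x.2) }
  comm r s m := Prod.ext (M.comm r s m.1) (N.comm r s m.2)
  gr d := (M.gr d).prod (N.gr d)
  lact_mem hr hm := ⟨M.lact_mem hr hm.1, N.lact_mem hr hm.2⟩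
  ract_mem hr hm := ⟨M.ract_mem hr hm.1, N.ract_mem hr hm.2⟩
  isInternal := by
    obtain ⟨p, h1, h2, h3⟩ := exists_proj M.isInternal
    obtain ⟨q, k1, k2, k3⟩ := exists_proj N.isInternal
    refine isInternal_of_proj
      (((Finsupp.mapRange.addMonoidHom (AddMonoidHom.inl M N)).comp p).comp (AddMonoidHom.fst M N) +
      ((Finsupp.mapRange.addMonoidHom (AddMonoidHom.inr M N)).comp q).comp (AddMonoidHom.snd M N))
      ?_ ?_ ?_
    · intro a d
      simp only [AddMonoidHom.add_apply, AddMonoidHom.comp_apply, Finsupp.add_apply,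
        Finsupp.mapRange.addMonoidHom_apply, Finsupp.mapRange_apply]
      refine ⟨?_, ?_⟩
      · simpa using h1 a.1 d
      · simpa using k1 a.2 d
    · intro a
      simp only [AddMonoidHom.add_apply, AddMonoidHom.comp_apply,
        Finsupp.mapRange.addMonoidHom_apply]
      rw [Finsupp.sum_add_index' (fun _ => rfl) (fun _ _ _ => rfl),
        Finsupp.sum_mapRange_index (fun _ => rfl), Finsupp.sum_mapRange_index (fun _ => rfl)]
      simp only [AddMonoidHom.coe_fst, AddMonoidHom.coe_snd]
      have e1 := congrArg (AddMonoidHom.inl M N) (h2 a.1)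
      have e2 := congrArg (AddMonoidHom.inr M N) (k2 a.2)
      rw [map_finsuppSum] at e1 e2
      rw [e1, e2]
      simp
    · intro d a ha
      simp only [AddMonoidHom.add_apply, AddMonoidHom.comp_apply, AddMonoidHom.coe_fst,
        AddMonoidHom.coe_snd, h3 d _ ha.1, k3 d _ ha.2, Finsupp.mapRange.addMonoidHom_apply,
        Finsupp.mapRange_single, ← Finsupp.single_add]
      simp

/-- The relations `m s ⊗ n = m ⊗ s n`. -/
def balance (M : GrBimod R S) (N : GrBimod S T) : AddSubgroup (M ⊗[ℤ] N) :=
  AddSubgroup.closure {x | ∃ (m : M) (s : S) (n : N), x = M.ract s m ⊗ₜ n - m ⊗ₜ N.lact s n}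

/-- The abelian group `M ⊗_S N`. -/
def Tens (M : GrBimod R S) (N : GrBimod S T) : Type := (M ⊗[ℤ] N) ⧸ balance M N

instance (M : GrBimod R S) (N : GrBimod S T) : AddCommGroup (Tens M N) :=
  inferInstanceAs (AddCommGroup ((M ⊗[ℤ] N) ⧸ balance M N))

section Tens

variable {M : GrBimod R S} {N : GrBimod S T} {A : Type} [AddCommGroup A]

/-- Pure tensors as a biadditive map. -/
def tmulHom (M : GrBimod R S) (N : GrBimod S T) : M →+ N →+ Tens M N :=
  AddMonoidHom.mk' (fun m => AddMonoidHom.mk'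
      (fun n => (QuotientAddGroup.mk (m ⊗ₜ n) : (M ⊗[ℤ] N) ⧸ balance M N))
      (fun a b => by rw [TensorProduct.tmul_add]; rfl))
    (fun a b => by
      ext n
      exact congrArg (QuotientAddGroup.mk (s := balance M N)) (TensorProduct.add_tmul a b n))

/-- The pure tensor `m ⊗ n` in `M ⊗_S N`. -/
def tmul (m : M) (n : N) : Tens M N := tmulHom M N m n

theorem tmul_add (m : M) (n n' : N) : tmul m (n + n') = tmul m n + tmul m n' := map_add _ _ _
theorem add_tmul (m m' : M) (n : N) : tmul (m + m') n = tmul m n + tmul m' n := by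
  simp [tmul]
theorem tmul_zero (m : M) : tmul m (0 : N) = 0 := map_zero _
theorem zero_tmul (n : N) : tmul (0 : M) n = 0 := by simp [tmul]

theorem tmul_bal (m : M) (s : S) (n : N) : tmul (M.ract s m) n = tmul m (N.lact s n) := by
  apply QuotientAddGroup.eq_iff_sub_mem.2
  exact AddSubgroup.subset_closure ⟨m, s, n, rfl⟩

/-- The universal property of `M ⊗_S N`. -/
def lift (f : M →+ N →+ A) (hf : ∀ m s n, f (M.ract s m) n = f m (N.lact s n)) : Tens M N →+ A :=
  QuotientAddGroup.lift (balance M N)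
    (TensorProduct.liftAddHom f (fun r m n => by simp)) (by
      rw [balance, AddSubgroup.closure_le]
      rintro x ⟨m, s, n, rfl⟩
      change _ = _
      rw [map_sub, TensorProduct.liftAddHom_tmul, TensorProduct.liftAddHom_tmul, hf, sub_self])

@[simp]
theorem lift_tmul (f : M →+ N →+ A) (hf) (m : M) (n : N) : lift f hf (tmul m n) = f m n := rfl

theorem tens_induction {P : Tens M N → Prop} (h0 : P 0) (ht : ∀ m n, P (tmul m n))
    (hadd : ∀ x y, P x → P y → P (x + y)) (x : Tens M N) : P x := by
  obtain ⟨y, rfl⟩ := QuotientAddGroup.mk_surjective x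
  induction y using TensorProduct.induction_on with
  | zero => exact h0
  | tmul m n => exact ht m n
  | add a b ha hb => exact hadd _ _ ha hb

theorem tens_ext {f g : Tens M N →+ A} (h : ∀ m n, f (tmul m n) = g (tmul m n)) : f = g := by
  ext x
  induction x using tens_induction with
  | h0 => simp
  | ht m n => exact h m n
  | hadd x y hx hy => simp [hx, hy]

/-- The map `f ⊗ g`, for a right linear `f` and a left linear `g`. -/
def tmap {M' : GrBimod V S} {N' : GrBimod S W} (f : M →+ M') (g : N →+ N')
    (hf : ∀ s m, f (M.ract s m) = M'.ract s (f m))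
    (hg : ∀ s n, g (N.lact s n) = N'.lact s (g n)) : Tens M N →+ Tens M' N' :=
  lift (((tmulHom M' N').comp f).compl₂ g) (fun m s n => by
    change tmul (f (M.ract s m)) (g n) = tmul (f m) (g (N.lact s n))
    rw [hf, hg, tmul_bal])

@[simp]
theorem tmap_tmul {M' : GrBimod V S} {N' : GrBimod S W} (f : M →+ M') (g : N →+ N') (hf) (hg)
    (m : M) (n : N) : tmap f g hf hg (tmul m n) = tmul (f m) (g n) := rfl

/-- The homogeneous part of degree `d` of `M ⊗_S N`. -/
def tensGr (M : GrBimod R S) (N : GrBimod S T) (d : ℤ) : AddSubgroup (Tens M N) :=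
  AddSubgroup.closure {x | ∃ (i j : ℤ) (m : M) (n : N),
    i + j = d ∧ m ∈ M.gr i ∧ n ∈ N.gr j ∧ x = tmul m n}

theorem tmul_mem {i j d : ℤ} {m : M} {n : N} (h : i + j = d) (hm : m ∈ M.gr i) (hn : n ∈ N.gr j) :
    tmul m n ∈ tensGr M N d :=
  AddSubgroup.subset_closure ⟨i, j, m, n, h, hm, hn, rfl⟩

theorem map_tensGr {f : Tens M N →+ A} {d : ℤ} {B : AddSubgroup A}
    (h : ∀ i j m n, i + j = d → m ∈ M.gr i → n ∈ N.gr j → f (tmul m n) ∈ B)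
    {x : Tens M N} (hx : x ∈ tensGr M N d) : f x ∈ B := by
  have : tensGr M N d ≤ B.comap f := by
    rw [tensGr, AddSubgroup.closure_le]
    rintro y ⟨i, j, m, n, e, hm, hn, rfl⟩
    exact h i j m n e hm hn
  exact this hx

theorem tens_isInternal (M : GrBimod R S) (N : GrBimod S T) :
    DirectSum.IsInternal (tensGr M N) := by
  obtain ⟨p, h1, h2, h3⟩ := exists_proj M.isInternal
  obtain ⟨q, k1, k2, k3⟩ := exists_proj N.isInternal
  let b : (ℤ →₀ M) →+ (ℤ →₀ N) →+ (ℤ →₀ Tens M N) :=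
    Finsupp.liftAddHom (fun i => AddMonoidHom.flip (Finsupp.liftAddHom (fun j =>
      AddMonoidHom.flip (AddMonoidHom.compr₂ (tmulHom M N) (Finsupp.singleAddHom (i + j))))))
  have hb : ∀ i j m n, b (Finsupp.single i m) (Finsupp.single j n)
      = Finsupp.single (i + j) (tmul m n) := by
    intro i j m n
    simp [b, tmul]
  let c : M →+ N →+ (ℤ →₀ Tens M N) := (b.comp p).compl₂ q
  have hc : ∀ i j m n, m ∈ M.gr i → n ∈ N.gr j → c m n = Finsupp.single (i + j) (tmul m n) := by
    intro i j m n hm hn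
    change b (p m) (q n) = _
    rw [h3 i m hm, k3 j n hn, hb]
  have hbal : ∀ m s n, c (M.ract s m) n = c m (N.lact s n) := by
    intro m s n
    induction m using induction_gr M.isInternal with
    | h0 => simp
    | hadd a b ha hb => simp [ha, hb]
    | hom i m hm =>
      induction n using induction_gr N.isInternal with
      | h0 => simp
      | hadd a b ha hb => simp [ha, hb]
      | hom j n hn =>
        induction s using induction_gr S.isInternal with
        | h0 => rw [lact_zero, ract_zero, map_zero, map_zero, AddMonoidHom.zero_apply]
        | hadd a b ha hb =>
          rw [lact_add, ract_add, map_add, map_add, AddMonoidHom.add_apply, ha, hb]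
        | hom l s hs =>
          rw [hc _ _ _ _ (M.ract_mem hs hm) hn, hc _ _ _ _ hm (N.lact_mem hs hn), tmul_bal]
          congr 1
          ring
  let P := lift c hbal
  have hP : ∀ i j m n, m ∈ M.gr i → n ∈ N.gr j →
      P (tmul m n) = Finsupp.single (i + j) (tmul m n) := fun i j m n hm hn => hc i j m n hm hn
  have main : ∀ x : Tens M N, (∀ d, P x d ∈ tensGr M N d) ∧ (P x).sum (fun _ y => y) = x := by
    intro x
    induction x using tens_induction with
    | h0 => simp
    | hadd x y hx hy =>
      refine ⟨fun d => ?_, ?_⟩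
      · rw [map_add]; exact add_mem (hx.1 d) (hy.1 d)
      · rw [map_add, Finsupp.sum_add_index' (fun _ => rfl) (fun _ _ _ => rfl), hx.2, hy.2]
    | ht m n =>
      induction m using induction_gr M.isInternal with
      | h0 => simp [zero_tmul]
      | hadd a b hx hy =>
        rw [add_tmul]
        refine ⟨fun d => ?_, ?_⟩
        · rw [map_add]; exact add_mem (hx.1 d) (hy.1 d)
        · rw [map_add, Finsupp.sum_add_index' (fun _ => rfl) (fun _ _ _ => rfl), hx.2, hy.2]
      | hom i m hm =>
        induction n using induction_gr N.isInternal with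
        | h0 => simp [tmul_zero]
        | hadd a b hx hy =>
          rw [tmul_add]
          refine ⟨fun d => ?_, ?_⟩
          · rw [map_add]; exact add_mem (hx.1 d) (hy.1 d)
          · rw [map_add, Finsupp.sum_add_index' (fun _ => rfl) (fun _ _ _ => rfl), hx.2, hy.2]
        | hom j n hn =>
          rw [hP i j m n hm hn]
          refine ⟨fun d => ?_, by simp⟩
          by_cases h : i + j = d
          · subst h; simpa using tmul_mem rfl hm hn
          · rw [Finsupp.single_eq_of_ne' h]; exact zero_mem _
  refine isInternal_of_proj P (fun a d => (main a).1 d) (fun a => (main a).2) ?_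
  intro d a ha
  have := map_tensGr (f := P - Finsupp.singleAddHom d) (B := ⊥) (d := d) ?_ ha
  · simpa [sub_eq_zero] using this
  · intro i j m n e hm hn
    subst e
    simp [hP i j m n hm hn]

end Tens

/-- The graded bimodule `M ⊗_S N`. -/
abbrev tensor (M : GrBimod R S) (N : GrBimod S T) : GrBimod R T where
  carrier := Tens M N
  lact :=
    { toFun := fun r => tmap (M.lact r) (AddMonoidHom.id N) (M.comm r) (fun _ _ => rfl)
      map_one' := tens_ext (fun m n => congrArg (tmul · n) (M.lact_one m))
      map_mul' := fun a b => tens_ext (fun m n => congrArg (tmul · n) (M.lact_mul a b m))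
      map_zero' := tens_ext (fun m n =>
        (congrArg (tmul · n) (M.lact_zero m)).trans (zero_tmul n))
      map_add' := fun a b => tens_ext (fun m n =>
        (congrArg (tmul · n) (M.lact_add a b m)).trans (add_tmul _ _ n)) }
  ract :=
    { toFun := fun t => tmap (AddMonoidHom.id M) (N.ract t) (fun _ _ => rfl)
        (fun s n => (N.comm s t n).symm)
      map_one' := tens_ext (fun m n => congrArg (tmul m) (N.ract_one n))
      map_mul' := fun a b => tens_ext (fun m n => congrArg (tmul m) (N.ract_mul a b n))
      map_zero' := tens_ext (fun m n =>
        (congrArg (tmul m) (N.ract_zero n)).trans (tmul_zero m))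
      map_add' := fun a b => tens_ext (fun m n =>
        (congrArg (tmul m) (N.ract_add a b n)).trans (tmul_add m _ _)) }
  comm r s x := by
    induction x using tens_induction with
    | h0 => simp
    | ht m n => rfl
    | hadd x y hx hy => simp only [map_add, hx, hy]
  gr := tensGr M N
  lact_mem {i j r x} hr hx := by
    refine map_tensGr (fun a b m n e hm hn => ?_) hx
    exact tmul_mem (by rw [← e]; ring) (M.lact_mem hr hm) hn
  ract_mem {i j r x} hr hx := by
    refine map_tensGr (fun a b m n e hm hn => ?_) hx
    exact tmul_mem (by rw [← e]; ring) hm (N.ract_mem hr hn)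
  isInternal := tens_isInternal M N

@[simp]
theorem tensor_lact (M : GrBimod R S) (N : GrBimod S T) (r : R) (m : M) (n : N) :
    (tensor M N).lact r (tmul m n) = tmul (M.lact r m) n := rfl

@[simp]
theorem tensor_ract (M : GrBimod R S) (N : GrBimod S T) (t : T) (m : M) (n : N) :
    (tensor M N).ract t (tmul m n) = tmul m (N.ract t n) := rfl

end GrBimod

end EqFlagRep

namespace EqFlagRep

namespace GrBimod

variable {R S T V W : GrRing}

/-! ### Maps of graded bimodules and the bicategory of graded bimodules -/

/-- The bimodule maps `M → N`. -/
def lin (M N : GrBimod R S) : AddSubgroup (M →+ N) where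
  carrier := {f | (∀ r m, f (M.lact r m) = N.lact r (f m)) ∧
    ∀ s m, f (M.ract s m) = N.ract s (f m)}
  zero_mem' := ⟨fun r m => by simp, fun s m => by simp⟩
  add_mem' {f g} hf hg := ⟨fun r m => by simp [hf.1, hg.1], fun s m => by simp [hf.2, hg.2]⟩
  neg_mem' {f} hf := ⟨fun r m => by simp [hf.1], fun s m => by simp [hf.2]⟩

/-- The bimodule maps `M → N` that are homogeneous of degree `d`. -/
def homogMaps (M N : GrBimod R S) (d : ℤ) : AddSubgroup (M →+ N) where
  carrier := {f | f ∈ lin M N ∧ ∀ i m, m ∈ M.gr i → f m ∈ N.gr (i + d)}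
  zero_mem' := ⟨zero_mem _, fun _ _ _ => zero_mem _⟩
  add_mem' hf hg := ⟨add_mem hf.1 hg.1, fun i m hm => add_mem (hf.2 i m hm) (hg.2 i m hm)⟩
  neg_mem' hf := ⟨neg_mem hf.1, fun i m hm => neg_mem (hf.2 i m hm)⟩

/-- The bimodule maps `M → N` that are finite sums of homogeneous ones. -/
def gradedMaps (M N : GrBimod R S) : AddSubgroup (M →+ N) := ⨆ d, homogMaps M N d

theorem homogMaps_le (M N : GrBimod R S) (d : ℤ) : homogMaps M N d ≤ gradedMaps M N :=
  le_iSup (homogMaps M N) d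

theorem gradedMaps_le (M N : GrBimod R S) : gradedMaps M N ≤ lin M N :=
  iSup_le fun _ _ hf => hf.1

theorem id_homog (M : GrBimod R S) : AddMonoidHom.id M ∈ homogMaps M M 0 :=
  ⟨⟨fun _ _ => rfl, fun _ _ => rfl⟩, fun i m hm => by simpa using hm⟩

theorem comp_homog {M N P : GrBimod R S} {f : M →+ N} {g : N →+ P} {d e : ℤ}
    (hf : f ∈ homogMaps M N d) (hg : g ∈ homogMaps N P e) : g.comp f ∈ homogMaps M P (d + e) :=
  ⟨⟨fun r m => by simp [hf.1.1, hg.1.1], fun s m => by simp [hf.1.2, hg.1.2]⟩, fun i m hm => by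
    rw [← add_assoc]; exact hg.2 _ _ (hf.2 _ _ hm)⟩

theorem comp_graded {M N P : GrBimod R S} {f : M →+ N} {g : N →+ P}
    (hf : f ∈ gradedMaps M N) (hg : g ∈ gradedMaps N P) : g.comp f ∈ gradedMaps M P := by
  induction hf using AddSubgroup.iSup_induction' with
  | h1 => rw [AddMonoidHom.comp_zero]; exact zero_mem _
  | hadd a b _ _ ha hb => rw [AddMonoidHom.comp_add]; exact add_mem ha hb
  | hp d f hf =>
    induction hg using AddSubgroup.iSup_induction' with
    | h1 => rw [AddMonoidHom.zero_comp]; exact zero_mem _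
    | hadd a b _ _ ha hb => rw [AddMonoidHom.add_comp]; exact add_mem ha hb
    | hp e g hg => exact homogMaps_le _ _ _ (comp_homog hf hg)

/-- Graded `(R, S)`-bimodules, with the finite sums of homogeneous bimodule maps. -/
instance : Category (GrBimod R S) where
  Hom M N := gradedMaps M N
  id M := ⟨AddMonoidHom.id M, homogMaps_le _ _ _ (id_homog M)⟩
  comp f g := ⟨g.1.comp f.1, comp_graded f.2 g.2⟩

instance (M N : GrBimod R S) : AddCommGroup (M ⟶ N) :=
  inferInstanceAs (AddCommGroup (gradedMaps M N))

instance : Preadditive (GrBimod R S) where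
  add_comp _ _ _ f f' g := Subtype.ext (AddMonoidHom.ext fun m => map_add g.1 _ _)
  comp_add _ _ _ f g g' := rfl

/-- A bimodule map, applied to an element. -/
def app {M N : GrBimod R S} (f : M ⟶ N) (m : M) : N := f.1 m

theorem hom_ext {M N : GrBimod R S} {f g : M ⟶ N} (h : ∀ m, app f m = app g m) : f = g :=
  Subtype.ext (AddMonoidHom.ext h)

theorem tens_hom_ext {M : GrBimod R S} {N : GrBimod S T} {P : GrBimod R T}
    {f g : tensor M N ⟶ P} (h : ∀ m n, app f (tmul m n) = app g (tmul m n)) : f = g :=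
  Subtype.ext (tens_ext h)

theorem tens_hom_ext₃ {M : GrBimod R S} {N : GrBimod S T} {P : GrBimod T V} {Q : GrBimod R V}
    {f g : tensor (tensor M N) P ⟶ Q}
    (h : ∀ m n p, app f (tmul (tmul m n) p) = app g (tmul (tmul m n) p)) : f = g := by
  refine tens_hom_ext fun x p => ?_
  have : f.1.comp (AddMonoidHom.flip (tmulHom (tensor M N) P) p) =
      g.1.comp (AddMonoidHom.flip (tmulHom (tensor M N) P) p) := tens_ext fun m n => h m n p
  exact DFunLike.congr_fun this x

theorem tens_hom_ext₃' {M : GrBimod R S} {N : GrBimod S T} {P : GrBimod T V} {Q : GrBimod R V}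
    {f g : tensor M (tensor N P) ⟶ Q}
    (h : ∀ m n p, app f (tmul m (tmul n p)) = app g (tmul m (tmul n p))) : f = g := by
  refine tens_hom_ext fun m x => ?_
  have : f.1.comp (tmulHom M (tensor N P) m) = g.1.comp (tmulHom M (tensor N P) m) :=
    tens_ext fun n p => h m n p
  exact DFunLike.congr_fun this x

theorem tens_hom_ext₄ {M : GrBimod R S} {N : GrBimod S T} {P : GrBimod T V} {Q : GrBimod V W}
    {L : GrBimod R W} {f g : tensor (tensor (tensor M N) P) Q ⟶ L}
    (h : ∀ m n p q, app f (tmul (tmul (tmul m n) p) q) = app g (tmul (tmul (tmul m n) p) q)) :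
    f = g := by
  refine tens_hom_ext₃ fun x p q => ?_
  have : (f.1.comp (AddMonoidHom.flip (tmulHom (tensor (tensor M N) P) Q) q)).comp
        (AddMonoidHom.flip (tmulHom (tensor M N) P) p) =
      (g.1.comp (AddMonoidHom.flip (tmulHom (tensor (tensor M N) P) Q) q)).comp
        (AddMonoidHom.flip (tmulHom (tensor M N) P) p) := tens_ext fun m n => h m n p q
  exact DFunLike.congr_fun this x

/-- A homogeneous bimodule map as a morphism. -/
def ofHomog {M N : GrBimod R S} {d : ℤ} (f : M →+ N) (h : f ∈ homogMaps M N d) : M ⟶ N :=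
  ⟨f, homogMaps_le _ _ _ h⟩

/-- An isomorphism of graded bimodules from two mutually inverse maps of degree zero. -/
def isoMk {M N : GrBimod R S} (f : M →+ N) (g : N →+ M) (hf : f ∈ homogMaps M N 0)
    (hg : g ∈ homogMaps N M 0) (h : ∀ m, g (f m) = m) (h' : ∀ n, f (g n) = n) : M ≅ N where
  hom := ofHomog f hf
  inv := ofHomog g hg
  hom_inv_id := hom_ext h
  inv_hom_id := hom_ext h'

theorem isoMk_hom_mem {M N : GrBimod R S} (f : M →+ N) (g : N →+ M) (hf : f ∈ homogMaps M N 0)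
    (hg : g ∈ homogMaps N M 0) (h h') : (isoMk f g hf hg h h').hom.1 ∈ homogMaps M N 0 := hf

theorem isoMk_inv_mem {M N : GrBimod R S} (f : M →+ N) (g : N →+ M) (hf : f ∈ homogMaps M N 0)
    (hg : g ∈ homogMaps N M 0) (h h') : (isoMk f g hf hg h h').inv.1 ∈ homogMaps N M 0 := hg

section Whisker

/-- The map `id_M ⊗ η`. -/
def wl (M : GrBimod R S) {N N' : GrBimod S T} (η : lin N N') : Tens M N →+ Tens M N' :=
  tmap (AddMonoidHom.id M) η.1 (fun _ _ => rfl) η.2.1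

/-- The map `η ⊗ id_N`. -/
def wr {M M' : GrBimod R S} (η : lin M M') (N : GrBimod S T) : Tens M N →+ Tens M' N :=
  tmap η.1 (AddMonoidHom.id N) η.2.2 (fun _ _ => rfl)

theorem wl_homog (M : GrBimod R S) {N N' : GrBimod S T} {d : ℤ} (η : lin N N')
    (h : η.1 ∈ homogMaps N N' d) : wl M η ∈ homogMaps (tensor M N) (tensor M N') d := by
  refine ⟨⟨fun r x => ?_, fun t x => ?_⟩, fun i x hx => ?_⟩
  · induction x using tens_induction with
    | h0 => simp
    | ht m n => rfl
    | hadd x y hx hy => simp only [map_add, hx, hy]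
  · induction x using tens_induction with
    | h0 => simp
    | ht m n => exact congrArg (tmul m) (η.2.2 t n)
    | hadd x y hx hy => simp only [map_add, hx, hy]
  · refine map_tensGr (fun a b m n e hm hn => ?_) hx
    exact tmul_mem (by rw [← e]; ring) hm (h.2 _ _ hn)

theorem wr_homog {M M' : GrBimod R S} {d : ℤ} (η : lin M M') (N : GrBimod S T)
    (h : η.1 ∈ homogMaps M M' d) : wr η N ∈ homogMaps (tensor M N) (tensor M' N) d := by
  refine ⟨⟨fun r x => ?_, fun t x => ?_⟩, fun i x hx => ?_⟩
  · induction x using tens_induction with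
    | h0 => simp
    | ht m n => exact congrArg (tmul · n) (η.2.1 r m)
    | hadd x y hx hy => simp only [map_add, hx, hy]
  · induction x using tens_induction with
    | h0 => simp
    | ht m n => rfl
    | hadd x y hx hy => simp only [map_add, hx, hy]
  · refine map_tensGr (fun a b m n e hm hn => ?_) hx
    exact tmul_mem (by rw [← e]; ring) (h.2 _ _ hm) hn

theorem wl_graded (M : GrBimod R S) {N N' : GrBimod S T} (η : N →+ N')
    (h : η ∈ gradedMaps N N') :
    wl M ⟨η, gradedMaps_le _ _ h⟩ ∈ gradedMaps (tensor M N) (tensor M N') := by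
  induction h using AddSubgroup.iSup_induction' with
  | h1 =>
    have : wl M ⟨(0 : N →+ N'), gradedMaps_le _ _ (zero_mem _)⟩ = 0 :=
      tens_ext fun m n => tmul_zero m
    rw [this]
    exact zero_mem _
  | hadd a b ha hb hx hy =>
    convert add_mem hx hy using 1
    exact tens_ext fun m n => tmul_add m _ _
  | hp d f hf => exact homogMaps_le _ _ _ (wl_homog M _ hf)

theorem wr_graded {M M' : GrBimod R S} (η : M →+ M') (N : GrBimod S T)
    (h : η ∈ gradedMaps M M') :
    wr ⟨η, gradedMaps_le _ _ h⟩ N ∈ gradedMaps (tensor M N) (tensor M' N) := by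
  induction h using AddSubgroup.iSup_induction' with
  | h1 =>
    have : wr ⟨(0 : M →+ M'), gradedMaps_le _ _ (zero_mem _)⟩ N = 0 :=
      tens_ext fun m n => zero_tmul n
    rw [this]
    exact zero_mem _
  | hadd a b ha hb hx hy =>
    convert add_mem hx hy using 1
    exact tens_ext fun m n => add_tmul _ _ n
  | hp d f hf => exact homogMaps_le _ _ _ (wr_homog _ N hf)

end Whisker

section Structure

variable (M : GrBimod R S) (N : GrBimod S T) (P : GrBimod T V)

/-- The map `(m ⊗ n) ⊗ p ↦ m ⊗ (n ⊗ p)`. -/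
def assocHom : Tens (tensor M N) P →+ Tens M (tensor N P) :=
  lift (lift (AddMonoidHom.mk' (fun m =>
      (AddMonoidHom.compHom (tmulHom M (tensor N P) m)).comp (tmulHom N P))
      (fun a b => by ext n p; exact add_tmul a b (N := tensor N P) (tmul n p)))
      (fun m s n => by ext p; exact tmul_bal m s (N := tensor N P) (tmul n p)))
    (fun x t p => by
      induction x using tens_induction with
      | h0 => simp
      | ht m n => exact congrArg (fun y : tensor N P => tmul m y) (tmul_bal n t p)
      | hadd x y hx hy => simp only [map_add, AddMonoidHom.add_apply, hx, hy])

/-- The map `m ⊗ (n ⊗ p) ↦ (m ⊗ n) ⊗ p`. -/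
def assocInv : Tens M (tensor N P) →+ Tens (tensor M N) P :=
  lift (AddMonoidHom.mk' (fun m =>
      lift ((tmulHom (tensor M N) P).comp (tmulHom M N m))
        (fun n t p => tmul_bal (M := tensor M N) (tmul m n) t p))
      (fun a b => tens_ext fun n p => by
        refine (congrArg (fun y : tensor M N => tmul y p) (add_tmul a b n)).trans ?_
        exact add_tmul (M := tensor M N) _ _ p))
    (fun m s x => by
      induction x using tens_induction with
      | h0 => simp
      | ht n p => exact congrArg (fun y : tensor M N => tmul y p) (tmul_bal m s n)
      | hadd x y hx hy => simp only [map_add, hx, hy])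

/-- The associativity isomorphism `(M ⊗ N) ⊗ P ≅ M ⊗ (N ⊗ P)`. -/
def assoc : tensor (tensor M N) P ≅ tensor M (tensor N P) :=
  isoMk (assocHom M N P) (assocInv M N P)
    (by
      refine ⟨⟨fun r x => ?_, fun t x => ?_⟩, fun i x hx => ?_⟩
      · induction x using tens_induction with
        | h0 => simp
        | hadd x y hx hy => simp only [map_add, hx, hy]
        | ht y p =>
          induction y using tens_induction with
          | h0 => rw [zero_tmul]; simp
          | hadd x y hx hy => rw [add_tmul]; simp only [map_add, hx, hy]
          | ht m n => rfl
      · induction x using tens_induction with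
        | h0 => simp
        | hadd x y hx hy => simp only [map_add, hx, hy]
        | ht y p =>
          induction y using tens_induction with
          | h0 => rw [zero_tmul]; simp
          | hadd x y hx hy => rw [add_tmul]; simp only [map_add, hx, hy]
          | ht m n => rfl
      · refine map_tensGr (fun a b y p e hy hp => ?_) hx
        have := map_tensGr (f := (AddMonoidHom.flip (tmulHom (tensor M N) P) p))
          (B := (tensGr M (tensor N P) (i + 0)).comap (assocHom M N P)) (d := a) ?_ hy
        · exact this
        · intro c d m n e' hm hn
          exact tmul_mem (N := tensor N P) (j := d + b) (by omega) hm (tmul_mem rfl hn hp))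
    (by
      refine ⟨⟨fun r x => ?_, fun t x => ?_⟩, fun i x hx => ?_⟩
      · induction x using tens_induction with
        | h0 => simp
        | hadd x y hx hy => simp only [map_add, hx, hy]
        | ht m y =>
          induction y using tens_induction with
          | h0 => rw [tmul_zero]; simp
          | hadd x y hx hy => rw [tmul_add]; simp only [map_add, hx, hy]
          | ht n p => rfl
      · induction x using tens_induction with
        | h0 => simp
        | hadd x y hx hy => simp only [map_add, hx, hy]
        | ht m y =>
          induction y using tens_induction with
          | h0 => rw [tmul_zero]; simp
          | hadd x y hx hy => rw [tmul_add]; simp only [map_add, hx, hy]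
          | ht n p => rfl
      · refine map_tensGr (fun a b m y e hm hy => ?_) hx
        have := map_tensGr (f := tmulHom M (tensor N P) m)
          (B := (tensGr (tensor M N) P (i + 0)).comap (assocInv M N P)) (d := b) ?_ hy
        · exact this
        · intro c d n p e' hn hp
          exact tmul_mem (M := tensor M N) (i := a + c) (by omega) (tmul_mem rfl hm hn) hp)
    (fun x => by
      induction x using tens_induction with
      | h0 => simp
      | hadd x y hx hy => simp only [map_add, hx, hy]
      | ht y p =>
        induction y using tens_induction with
        | h0 => rw [zero_tmul]; simp
        | hadd x y hx hy => rw [add_tmul]; simp only [map_add, hx, hy]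
        | ht m n => rfl)
    (fun x => by
      induction x using tens_induction with
      | h0 => simp
      | hadd x y hx hy => simp only [map_add, hx, hy]
      | ht m y =>
        induction y using tens_induction with
        | h0 => rw [tmul_zero]; simp
        | hadd x y hx hy => rw [tmul_add]; simp only [map_add, hx, hy]
        | ht n p => rfl)

/-- The isomorphism `R ⊗_R M ≅ M`, `r ⊗ m ↦ r m`. -/
def leftUnit : tensor (unit R) M ≅ M :=
  isoMk (lift (M := unit R) (AddMonoidHom.mk' (fun r : R => (M.lact r : M →+ M))
      (fun a b => AddMonoidHom.ext (M.lact_add a b)))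
      (fun r s m => by
        change M.lact (s * r) m = M.lact r (M.lact s m)
        rw [mul_comm, M.lact_mul]))
    (tmulHom (unit R) M (1 : R))
    (by
      refine ⟨⟨fun r x => ?_, fun t x => ?_⟩, fun i x hx => ?_⟩
      · induction x using tens_induction with
        | h0 => simp
        | hadd x y hx hy => simp only [map_add, hx, hy]
        | ht a m => exact M.lact_mul r a m
      · induction x using tens_induction with
        | h0 => simp
        | hadd x y hx hy => simp only [map_add, hx, hy]
        | ht a m => exact M.comm a t m
      · refine map_tensGr (fun a b r m e hr hm => ?_) hx
        rw [add_zero, ← e]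
        exact M.lact_mem hr hm)
    (by
      refine ⟨⟨fun r x => ?_, fun t x => rfl⟩, fun i x hx => ?_⟩
      · refine (tmul_bal (M := unit R) (1 : R) r x).symm.trans ?_
        refine congrArg (fun y : unit R => tmul y x) ?_
        change r * 1 = r * 1
        rfl
      · exact tmul_mem (M := unit R) (i := 0) (j := i) (by ring) R.one_mem hx)
    (fun x => by
      induction x using tens_induction with
      | h0 => simp
      | hadd x y hx hy => simp only [map_add, hx, hy]
      | ht r m =>
        refine (tmul_bal (M := unit R) (1 : R) r m).symm.trans ?_
        refine congrArg (fun y : unit R => tmul y m) ?_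
        exact mul_one (M := R) r)
    (fun m => M.lact_one m)

/-- The isomorphism `M ⊗_S S ≅ M`, `m ⊗ s ↦ m s`. -/
def rightUnit : tensor M (unit S) ≅ M :=
  isoMk (lift (N := unit S) (AddMonoidHom.flip (AddMonoidHom.mk' (fun s : S => (M.ract s : M →+ M))
      (fun a b => AddMonoidHom.ext (M.ract_add a b))))
      (fun m s s' => by
        change M.ract s' (M.ract s m) = M.ract (s * s') m
        rw [mul_comm, M.ract_mul]))
    (AddMonoidHom.flip (tmulHom M (unit S)) (1 : S))
    (by
      refine ⟨⟨fun r x => ?_, fun t x => ?_⟩, fun i x hx => ?_⟩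
      · induction x using tens_induction with
        | h0 => simp
        | hadd x y hx hy => simp only [map_add, hx, hy]
        | ht m a => exact (M.comm r a m).symm
      · induction x using tens_induction with
        | h0 => simp
        | hadd x y hx hy => simp only [map_add, hx, hy]
        | ht m a => exact M.ract_mul t a m
      · refine map_tensGr (fun a b m s e hm hs => ?_) hx
        rw [add_zero, ← e, add_comm]
        exact M.ract_mem hs hm)
    (by
      refine ⟨⟨fun r x => rfl, fun t x => ?_⟩, fun i x hx => ?_⟩
      · exact tmul_bal (N := unit S) x t (1 : S)
      · exact tmul_mem (N := unit S) (i := i) (j := 0) (by ring) hx S.one_mem)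
    (fun x => by
      induction x using tens_induction with
      | h0 => simp
      | hadd x y hx hy => simp only [map_add, hx, hy]
      | ht m s =>
        refine (tmul_bal (N := unit S) m s (1 : S)).trans ?_
        refine congrArg (fun y : unit S => tmul m y) ?_
        exact mul_one (M := S) s)
    (fun m => M.ract_one m)

theorem assoc_mem : (assoc M N P).hom.1 ∈ homogMaps _ _ 0 ∧ (assoc M N P).inv.1 ∈ homogMaps _ _ 0 := by
  unfold assoc
  exact ⟨isoMk_hom_mem _ _ _ _ _ _, isoMk_inv_mem _ _ _ _ _ _⟩

theorem leftUnit_mem : (leftUnit M).hom.1 ∈ homogMaps _ _ 0 ∧ (leftUnit M).inv.1 ∈ homogMaps _ _ 0 := by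
  unfold leftUnit
  exact ⟨isoMk_hom_mem _ _ _ _ _ _, isoMk_inv_mem _ _ _ _ _ _⟩

theorem rightUnit_mem :
    (rightUnit M).hom.1 ∈ homogMaps _ _ 0 ∧ (rightUnit M).inv.1 ∈ homogMaps _ _ 0 := by
  unfold rightUnit
  exact ⟨isoMk_hom_mem _ _ _ _ _ _, isoMk_inv_mem _ _ _ _ _ _⟩

end Structure

end GrBimod

open GrBimod

/-- The bicategory of graded commutative rings, graded bimodules and finite sums of homogeneous
bimodule maps. A 1-morphism `R ⟶ S` is an `(R, S)`-bimodule and `M ≫ N` is `M ⊗_S N`. -/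
instance bimStar : Bicategory GrRing where
  Hom R S := GrBimod R S
  id R := unit R
  comp M N := tensor M N
  homCategory R S := inferInstanceAs (Category (GrBimod R S))
  whiskerLeft M _ _ η := ⟨wl M ⟨η.1, gradedMaps_le _ _ η.2⟩, wl_graded M η.1 η.2⟩
  whiskerRight η N := ⟨wr ⟨η.1, gradedMaps_le _ _ η.2⟩ N, wr_graded η.1 N η.2⟩
  associator M N P := assoc M N P
  leftUnitor M := leftUnit M
  rightUnitor M := rightUnit M
  whiskerLeft_id M N := tens_hom_ext fun m n => rfl
  whiskerLeft_comp M _ _ _ η θ := tens_hom_ext fun m n => rfl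
  id_whiskerLeft {R _ M N} η := tens_hom_ext fun r m => by
    change tmul (M := unit R) r (η.1 m) = tmul (M := unit R) (1 : R) (η.1 (M.lact r m))
    rw [(gradedMaps_le _ _ η.2).1 r m, ← tmul_bal]
    exact congrArg (fun y : unit R => tmul y (η.1 m)) (mul_one (M := R) r).symm
  comp_whiskerLeft M N _ _ η := tens_hom_ext₃ fun m n p => rfl
  id_whiskerRight M N := tens_hom_ext fun m n => rfl
  comp_whiskerRight η θ P := tens_hom_ext fun m n => rfl
  whiskerRight_id {_ S M N} η := tens_hom_ext fun m s => by
    change tmul (N := unit S) (η.1 m) s = tmul (N := unit S) (η.1 (M.ract s m)) (1 : S)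
    rw [(gradedMaps_le _ _ η.2).2 s m, tmul_bal]
    exact congrArg (fun y : unit S => tmul (η.1 m) y) (mul_one (M := S) s).symm
  whiskerRight_comp η N P := tens_hom_ext₃' fun m n p => rfl
  whisker_assoc M _ _ η P := tens_hom_ext₃ fun m n p => rfl
  whisker_exchange η θ := tens_hom_ext fun m n => rfl
  pentagon M N P Q := tens_hom_ext₄ fun m n p q => rfl
  triangle M N := tens_hom_ext₃ fun m s n => (tmul_bal m s n).symm

end EqFlagRep

namespace EqFlagRep

universe w v u w' v' u'

/-! ### Graded additive bicategories -/

/-- A grading on a bicategory whose hom-categories are preadditive: horizontal composition is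
additive, every 2-morphism is a finite sum of homogeneous ones, degrees add under vertical
composition, are unchanged by whiskering, and the structure isomorphisms have degree zero. -/
class GradedBicategory (B : Type u) [Bicategory.{w, v} B] [∀ a b : B, Preadditive (a ⟶ b)] where
  whiskerLeft_add {a b c : B} (f : a ⟶ b) {g h : b ⟶ c} (η θ : g ⟶ h) :
    f ◁ (η + θ) = f ◁ η + f ◁ θ
  add_whiskerRight {a b c : B} {f g : a ⟶ b} (η θ : f ⟶ g) (h : b ⟶ c) :
    (η + θ) ▷ h = η ▷ h + θ ▷ h
  homog {a b : B} (f g : a ⟶ b) (d : ℤ) : AddSubgroup (f ⟶ g)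
  iSup_homog {a b : B} (f g : a ⟶ b) : ⨆ d, homog f g d = ⊤
  id_mem {a b : B} (f : a ⟶ b) : 𝟙 f ∈ homog f f 0
  comp_mem {a b : B} {f g h : a ⟶ b} {η : f ⟶ g} {θ : g ⟶ h} {d e : ℤ} :
    η ∈ homog f g d → θ ∈ homog g h e → η ≫ θ ∈ homog f h (d + e)
  whiskerLeft_mem {a b c : B} (f : a ⟶ b) {g h : b ⟶ c} {η : g ⟶ h} {d : ℤ} :
    η ∈ homog g h d → f ◁ η ∈ homog (f ≫ g) (f ≫ h) d
  whiskerRight_mem {a b c : B} {f g : a ⟶ b} {η : f ⟶ g} {d : ℤ} (h : b ⟶ c) :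
    η ∈ homog f g d → η ▷ h ∈ homog (f ≫ h) (g ≫ h) d
  associator_hom_mem {a b c d : B} (f : a ⟶ b) (g : b ⟶ c) (h : c ⟶ d) :
    (α_ f g h).hom ∈ homog _ _ 0
  associator_inv_mem {a b c d : B} (f : a ⟶ b) (g : b ⟶ c) (h : c ⟶ d) :
    (α_ f g h).inv ∈ homog _ _ 0
  leftUnitor_hom_mem {a b : B} (f : a ⟶ b) : (λ_ f).hom ∈ homog _ _ 0
  leftUnitor_inv_mem {a b : B} (f : a ⟶ b) : (λ_ f).inv ∈ homog _ _ 0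
  rightUnitor_hom_mem {a b : B} (f : a ⟶ b) : (ρ_ f).hom ∈ homog _ _ 0
  rightUnitor_inv_mem {a b : B} (f : a ⟶ b) : (ρ_ f).inv ∈ homog _ _ 0

open GradedBicategory

/-- The bicategory with the objects and 1-morphisms of `B` and the 2-morphisms of degree zero. -/
structure DegZero (B : Type u) where
  as : B

/-- The 1-morphisms of `DegZero B`. -/
structure DegZeroHom {B : Type u} [Quiver.{v} B] (a b : DegZero B) where
  as : a.as ⟶ b.as

section DegZero

variable {B : Type u} [Bicategory.{w, v} B] [∀ a b : B, Preadditive (a ⟶ b)] [GradedBicategory B]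

instance : CategoryStruct.{v} (DegZero B) where
  Hom a b := DegZeroHom a b
  id a := ⟨𝟙 a.as⟩
  comp f g := ⟨f.as ≫ g.as⟩

theorem comp_mem_zero {a b : B} {f g h : a ⟶ b} {η : f ⟶ g} {θ : g ⟶ h}
    (h1 : η ∈ homog f g 0) (h2 : θ ∈ homog g h 0) : η ≫ θ ∈ homog f h 0 := by
  simpa using comp_mem h1 h2

instance (a b : DegZero B) : Category.{w} (a ⟶ b) where
  Hom f g := homog f.as g.as 0
  id f := ⟨𝟙 f.as, id_mem f.as⟩
  comp η θ := ⟨η.1 ≫ θ.1, comp_mem_zero η.2 θ.2⟩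
  id_comp η := Subtype.ext (Category.id_comp η.1)
  comp_id η := Subtype.ext (Category.comp_id η.1)
  assoc η θ ζ := Subtype.ext (Category.assoc η.1 θ.1 ζ.1)

instance {a b : DegZero B} (f g : a ⟶ b) : AddCommGroup (f ⟶ g) :=
  inferInstanceAs (AddCommGroup (homog f.as g.as 0))

instance (a b : DegZero B) : Preadditive (a ⟶ b) where
  add_comp _ _ _ f f' g := Subtype.ext (Preadditive.add_comp _ _ _ f.1 f'.1 g.1)
  comp_add _ _ _ f g g' := Subtype.ext (Preadditive.comp_add _ _ _ f.1 g.1 g'.1)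

/-- An isomorphism that is homogeneous of degree zero together with its inverse. -/
def isoZero {a b : DegZero B} {f g : a ⟶ b} (e : f.as ≅ g.as) (h1 : e.hom ∈ homog f.as g.as 0)
    (h2 : e.inv ∈ homog g.as f.as 0) : f ≅ g where
  hom := ⟨e.hom, h1⟩
  inv := ⟨e.inv, h2⟩
  hom_inv_id := Subtype.ext e.hom_inv_id
  inv_hom_id := Subtype.ext e.inv_hom_id

instance : Bicategory.{w, v} (DegZero B) where
  homCategory _ _ := inferInstance
  whiskerLeft f _ _ η := ⟨f.as ◁ η.1, whiskerLeft_mem f.as η.2⟩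
  whiskerRight η h := ⟨η.1 ▷ h.as, whiskerRight_mem h.as η.2⟩
  associator f g h := isoZero (α_ f.as g.as h.as) (associator_hom_mem _ _ _)
    (associator_inv_mem _ _ _)
  leftUnitor f := isoZero (λ_ f.as) (leftUnitor_hom_mem _) (leftUnitor_inv_mem _)
  rightUnitor f := isoZero (ρ_ f.as) (rightUnitor_hom_mem _) (rightUnitor_inv_mem _)
  whiskerLeft_id f g := Subtype.ext (Bicategory.whiskerLeft_id f.as g.as)
  whiskerLeft_comp f _ _ _ η θ := Subtype.ext (Bicategory.whiskerLeft_comp f.as η.1 θ.1)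
  id_whiskerLeft η := Subtype.ext (Bicategory.id_whiskerLeft η.1)
  comp_whiskerLeft f g _ _ η := Subtype.ext (Bicategory.comp_whiskerLeft f.as g.as η.1)
  id_whiskerRight f g := Subtype.ext (Bicategory.id_whiskerRight f.as g.as)
  comp_whiskerRight η θ h := Subtype.ext (Bicategory.comp_whiskerRight η.1 θ.1 h.as)
  whiskerRight_id η := Subtype.ext (Bicategory.whiskerRight_id η.1)
  whiskerRight_comp η g h := Subtype.ext (Bicategory.whiskerRight_comp η.1 g.as h.as)
  whisker_assoc f _ _ η h := Subtype.ext (Bicategory.whisker_assoc f.as η.1 h.as)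
  whisker_exchange η θ := Subtype.ext (Bicategory.whisker_exchange η.1 θ.1)
  pentagon f g h i := Subtype.ext (Bicategory.pentagon f.as g.as h.as i.as)
  triangle f g := Subtype.ext (Bicategory.triangle f.as g.as)

end DegZero

/-- A (weak) 2-functor whose effect on objects and 1-morphisms is the given prefunctor `F`. -/
structure PseudofunctorOn {B : Type u} [Bicategory.{w, v} B] {C : Type u'} [Bicategory.{w', v'} C]
    (F : B ⥤q C) where
  map₂ {a b : B} {f g : a ⟶ b} (η : f ⟶ g) : F.map f ⟶ F.map g
  map₂_id {a b : B} (f : a ⟶ b) : map₂ (𝟙 f) = 𝟙 (F.map f)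
  map₂_comp {a b : B} {f g h : a ⟶ b} (η : f ⟶ g) (θ : g ⟶ h) :
    map₂ (η ≫ θ) = map₂ η ≫ map₂ θ
  mapId (a : B) : F.map (𝟙 a) ≅ 𝟙 (F.obj a)
  mapComp {a b c : B} (f : a ⟶ b) (g : b ⟶ c) : F.map (f ≫ g) ≅ F.map f ≫ F.map g
  map₂_whisker_left {a b c : B} (f : a ⟶ b) {g h : b ⟶ c} (η : g ⟶ h) :
    map₂ (f ◁ η) = (mapComp f g).hom ≫ F.map f ◁ map₂ η ≫ (mapComp f h).inv
  map₂_whisker_right {a b c : B} {f g : a ⟶ b} (η : f ⟶ g) (h : b ⟶ c) :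
    map₂ (η ▷ h) = (mapComp f h).hom ≫ map₂ η ▷ F.map h ≫ (mapComp g h).inv
  map₂_associator {a b c d : B} (f : a ⟶ b) (g : b ⟶ c) (h : c ⟶ d) :
    map₂ (α_ f g h).hom = (mapComp (f ≫ g) h).hom ≫ (mapComp f g).hom ▷ F.map h ≫
      (α_ (F.map f) (F.map g) (F.map h)).hom ≫ F.map f ◁ (mapComp g h).inv ≫
      (mapComp f (g ≫ h)).inv
  map₂_left_unitor {a b : B} (f : a ⟶ b) :
    map₂ (λ_ f).hom = (mapComp (𝟙 a) f).hom ≫ (mapId a).hom ▷ F.map f ≫ (λ_ (F.map f)).hom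
  map₂_right_unitor {a b : B} (f : a ⟶ b) :
    map₂ (ρ_ f).hom = (mapComp f (𝟙 b)).hom ≫ F.map f ◁ (mapId b).hom ≫ (ρ_ (F.map f)).hom

/-- The Mathlib pseudofunctor underlying a `PseudofunctorOn`. -/
def PseudofunctorOn.toPseudofunctor {B : Type u} [Bicategory.{w, v} B] {C : Type u'}
    [Bicategory.{w', v'} C] {F : B ⥤q C} (G : PseudofunctorOn F) : B ⥤ᵖ C where
  toPrefunctor := F
  map₂ := G.map₂
  map₂_id := G.map₂_id
  map₂_comp := G.map₂_comp
  mapId := G.mapId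
  mapComp := G.mapComp
  map₂_whisker_left := G.map₂_whisker_left
  map₂_whisker_right := G.map₂_whisker_right
  map₂_associator := G.map₂_associator
  map₂_left_unitor := G.map₂_left_unitor
  map₂_right_unitor := G.map₂_right_unitor

/-- `G` is additive on 2-morphisms. -/
def PseudofunctorOn.IsAdditive {B : Type u} [Bicategory.{w, v} B] {C : Type u'}
    [Bicategory.{w', v'} C] [∀ a b : B, Preadditive (a ⟶ b)] [∀ a b : C, Preadditive (a ⟶ b)]
    {F : B ⥤q C} (G : PseudofunctorOn F) : Prop :=
  ∀ {a b : B} {f g : a ⟶ b} (η θ : f ⟶ g), G.map₂ (η + θ) = G.map₂ η + G.map₂ θ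

/-- `G` preserves degrees of 2-morphisms, and its coherence isomorphisms have degree zero. -/
def PseudofunctorOn.IsGraded {B : Type u} [Bicategory.{w, v} B] {C : Type u'}
    [Bicategory.{w', v'} C] [∀ a b : B, Preadditive (a ⟶ b)] [∀ a b : C, Preadditive (a ⟶ b)]
    [GradedBicategory B] [GradedBicategory C] {F : B ⥤q C} (G : PseudofunctorOn F) : Prop :=
  (∀ {a b : B} {f g : a ⟶ b} (d : ℤ) (η : f ⟶ g), η ∈ homog f g d →
    G.map₂ η ∈ homog (F.map f) (F.map g) d) ∧
  (∀ a : B, (G.mapId a).hom ∈ homog _ _ 0 ∧ (G.mapId a).inv ∈ homog _ _ 0) ∧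
  ∀ {a b c : B} (f : a ⟶ b) (g : b ⟶ c),
    (G.mapComp f g).hom ∈ homog _ _ 0 ∧ (G.mapComp f g).inv ∈ homog _ _ 0

/-- A prefunctor, seen between the bicategories with 2-morphisms of degree zero. -/
def degZeroPrefunctor {B : Type u} [Bicategory.{w, v} B] {C : Type u'} [Bicategory.{w', v'} C]
    [∀ a b : B, Preadditive (a ⟶ b)] [∀ a b : C, Preadditive (a ⟶ b)]
    [GradedBicategory B] [GradedBicategory C] (F : B ⥤q C) : DegZero B ⥤q DegZero C where
  obj a := ⟨F.obj a.as⟩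
  map f := ⟨F.map f.as⟩

/-- The underlying 2-morphism of a 2-morphism of degree zero. -/
def DegZero.val {B : Type u} [Bicategory.{w, v} B] [∀ a b : B, Preadditive (a ⟶ b)]
    [GradedBicategory B] {a b : DegZero B} {f g : a ⟶ b} (η : f ⟶ g) :
    DegZeroHom.as f ⟶ DegZeroHom.as g := Subtype.val (p := (· ∈ homog f.as g.as 0)) η

/-- `G₀` is the restriction of `G` to the 2-morphisms of degree zero. -/
def PseudofunctorOn.IsRestriction {B : Type u} [Bicategory.{w, v} B] {C : Type u'}
    [Bicategory.{w', v'} C] [∀ a b : B, Preadditive (a ⟶ b)] [∀ a b : C, Preadditive (a ⟶ b)]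
    [GradedBicategory B] [GradedBicategory C] {F : B ⥤q C}
    (G₀ : PseudofunctorOn (degZeroPrefunctor F)) (G : PseudofunctorOn F) : Prop :=
  (∀ {a b : DegZero B} {f g : a ⟶ b} (η : f ⟶ g),
    DegZero.val (G₀.map₂ η) = G.map₂ (DegZero.val η)) ∧
  (∀ a : DegZero B, DegZero.val (G₀.mapId a).hom = (G.mapId a.as).hom) ∧
  ∀ {a b c : DegZero B} (f : a ⟶ b) (g : b ⟶ c),
    DegZero.val (G₀.mapComp f g).hom = (G.mapComp (DegZeroHom.as f) (DegZeroHom.as g)).hom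

end EqFlagRep

namespace EqFlagRep

open GrBimod

/-! ### Equivariant cohomology rings of Grassmannians and one step flag varieties -/

/-- The polynomial ring over `ℚ` in the variables `σ`, graded by `deg X_i = w i`. -/
def wPoly (σ : Type) (w : σ → ℤ) : GrRing where
  carrier := MvPolynomial σ ℚ
  gr d := (MvPolynomial.weightedHomogeneousSubmodule ℚ w d).toAddSubgroup
  one_mem := MvPolynomial.isWeightedHomogeneous_one ℚ w
  mul_mem ha hb := MvPolynomial.IsWeightedHomogeneous.mul ha hb
  isInternal :=
    letI := MvPolynomial.weightedDecomposition ℚ w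
    DirectSum.Decomposition.isInternal (MvPolynomial.weightedHomogeneousSubmodule ℚ w)

/-- The zero ring. -/
def zeroRing : GrRing where
  carrier := PUnit
  gr _ := ⊤
  one_mem := trivial
  mul_mem _ _ := trivial
  isInternal := isInternal_of_proj 0 (fun _ _ => trivial) (fun _ => rfl)
    (fun _ _ _ => Subsingleton.elim _ _)

/-- The sequence `1, v₁, …, v_k, 0, 0, …` of Chern classes. -/
def chern {A : Type} [CommRing A] {k : ℕ} (v : Fin k → A) : ℕ → A
  | 0 => 1
  | j + 1 => if h : j < k then v ⟨j, h⟩ else 0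

/-- The degrees of the generators `x₁, …, x_a; y₁, …, y_b`. -/
def grassWt (a b : ℕ) : Fin a ⊕ Fin b → ℤ :=
  Sum.elim (fun j => 2 * ((j : ℤ) + 1)) (fun j => 2 * ((j : ℤ) + 1))

/-- The degrees of the generators `w₁, …, w_a; ξ; z₁, …, z_b`. -/
def flagWt (a b : ℕ) : Fin a ⊕ Unit ⊕ Fin b → ℤ :=
  Sum.elim (fun j => 2 * ((j : ℤ) + 1)) (Sum.elim (fun _ => 2) (fun j => 2 * ((j : ℤ) + 1)))

/-- `ℚ[x₁, …, x_a; y₁, …, y_b] = H*_{GL(a+b)}(Gr(a, a+b))`. -/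
abbrev grass (a b : ℕ) : GrRing := wPoly (Fin a ⊕ Fin b) (grassWt a b)

/-- `ℚ[w₁, …, w_a; ξ; z₁, …, z_b]`, the equivariant cohomology of the variety of flags of
subspaces of dimensions `a` and `a + 1` in a space of dimension `a + 1 + b`. -/
abbrev flag (a b : ℕ) : GrRing := wPoly (Fin a ⊕ Unit ⊕ Fin b) (flagWt a b)

namespace flag

variable (a b : ℕ)

/-- The generator `ξ`. -/
def xi : flag a b := (MvPolynomial.X (Sum.inr (Sum.inl ())) : MvPolynomial _ ℚ)

/-- The generators `w_j`. -/
def w : ℕ → flag a b := chern fun j => (MvPolynomial.X (Sum.inl j) : MvPolynomial _ ℚ)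

/-- The generators `z_j`. -/
def z : ℕ → flag a b := chern fun j => (MvPolynomial.X (Sum.inr (Sum.inr j)) : MvPolynomial _ ℚ)

/-- The pullback from the Grassmannian of `a`-planes: `x_j ↦ w_j`, `y_j ↦ z_j + ξ z_{j-1}`.
The number `c` of variables `y_j` is `b + 1` wherever this is used. -/
def fromLower (c : ℕ) : grass a c →+* flag a b :=
  (MvPolynomial.aeval (R := ℚ) (S₁ := MvPolynomial (Fin a ⊕ Unit ⊕ Fin b) ℚ)
    (Sum.elim (fun j : Fin a => w a b (j + 1))
      (fun j : Fin c => z a b (j + 1) + xi a b * z a b j))).toRingHom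

/-- The pullback from the Grassmannian of `(a+1)`-planes: `x_j ↦ w_j + ξ w_{j-1}`,
`y_j ↦ z_j`. The number `c` of variables `x_j` is `a + 1` wherever this is used. -/
def fromUpper (c : ℕ) : grass c b →+* flag a b :=
  (MvPolynomial.aeval (R := ℚ) (S₁ := MvPolynomial (Fin a ⊕ Unit ⊕ Fin b) ℚ)
    (Sum.elim (fun j : Fin c => w a b (j + 1) + xi a b * w a b j)
      (fun j : Fin b => z a b (j + 1)))).toRingHom

end flag

theorem aeval_mem {σ τ : Type} {w : σ → ℤ} {w' : τ → ℤ} (f : σ → MvPolynomial τ ℚ)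
    (hf : ∀ i, MvPolynomial.IsWeightedHomogeneous w' (f i) (w i)) {d : ℤ} {p : MvPolynomial σ ℚ}
    (hp : MvPolynomial.IsWeightedHomogeneous w p d) :
    MvPolynomial.IsWeightedHomogeneous w' (MvPolynomial.aeval f p) d := by
  induction hp using MvPolynomial.IsWeightedHomogeneous.induction_on with
  | zero => simpa using MvPolynomial.isWeightedHomogeneous_zero ℚ w' d
  | add p q hp hq h1 h2 => rw [map_add]; exact h1.add h2
  | monomial e r hr =>
    rw [MvPolynomial.aeval_monomial]
    refine MvPolynomial.IsWeightedHomogeneous.C_mul ?_ r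
    rw [← hr, Finsupp.weight_apply, Finsupp.sum, Finsupp.prod]
    refine MvPolynomial.IsWeightedHomogeneous.prod _ _ _ fun i _ => ?_
    exact (hf i).pow _

theorem flag.xi_mem (a b : ℕ) : flag.xi a b ∈ (flag a b).gr 2 :=
  MvPolynomial.isWeightedHomogeneous_X ℚ (flagWt a b) _

theorem chern_mem {A : GrRing} {k : ℕ} (v : Fin k → A) (hv : ∀ j : Fin k, v j ∈ A.gr (2 * (((j : ℕ) : ℤ) + 1)))
    (j : ℕ) : chern v j ∈ A.gr (2 * j) := by
  cases j with
  | zero => exact A.one_mem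
  | succ j =>
    by_cases h : j < k
    · rw [chern.eq_2, dif_pos h]
      exact_mod_cast hv ⟨j, h⟩
    · rw [chern.eq_2, dif_neg h]
      exact zero_mem _

theorem flag.w_mem (a b j : ℕ) : flag.w a b j ∈ (flag a b).gr (2 * j) :=
  chern_mem _ (fun _ => MvPolynomial.isWeightedHomogeneous_X ℚ (flagWt a b) _) j

theorem flag.z_mem (a b j : ℕ) : flag.z a b j ∈ (flag a b).gr (2 * j) :=
  chern_mem _ (fun _ => MvPolynomial.isWeightedHomogeneous_X ℚ (flagWt a b) _) j

theorem flag.xi_mul_mem {a b j : ℕ} {p : flag a b} (h : p ∈ (flag a b).gr (2 * j)) :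
    flag.xi a b * p ∈ (flag a b).gr (2 * ((j : ℤ) + 1)) := by
  have := (flag a b).mul_mem (flag.xi_mem a b) h
  rwa [show (2 : ℤ) + 2 * j = 2 * ((j : ℤ) + 1) by ring] at this

theorem flag.fromLower_mem (a b c : ℕ) {d : ℤ} {r : grass a c}
    (h : r ∈ (grass a c).gr d) : flag.fromLower a b c r ∈ (flag a b).gr d := by
  refine aeval_mem (w := grassWt a c) (w' := flagWt a b) _ ?_ h
  rintro (j | j)
  · exact_mod_cast flag.w_mem a b (j + 1)
  · refine MvPolynomial.IsWeightedHomogeneous.add ?_ (flag.xi_mul_mem (flag.z_mem a b j))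
    exact_mod_cast flag.z_mem a b (j + 1)

theorem flag.fromUpper_mem (a b c : ℕ) {d : ℤ} {r : grass c b}
    (h : r ∈ (grass c b).gr d) : flag.fromUpper a b c r ∈ (flag a b).gr d := by
  refine aeval_mem (w := grassWt c b) (w' := flagWt a b) _ ?_ h
  rintro (j | j)
  · refine MvPolynomial.IsWeightedHomogeneous.add ?_ (flag.xi_mul_mem (flag.w_mem a b j))
    exact_mod_cast flag.w_mem a b (j + 1)
  · exact_mod_cast flag.z_mem a b (j + 1)

end EqFlagRep

namespace EqFlagRep

open GrBimod

/-! ### The 2-categories of equivariant flag bimodules -/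

/-- A graded ring `A` with graded ring maps `R → A ← S` and an element `ξ` of `A`. -/
structure Cospan (R S : GrRing) where
  A : GrRing
  left : R →+* A
  right : S →+* A
  left_mem : ∀ {i : ℤ} {r : R}, r ∈ R.gr i → left r ∈ A.gr i
  right_mem : ∀ {i : ℤ} {s : S}, s ∈ S.gr i → right s ∈ A.gr i
  xi : A

/-- The bimodule of a cospan. -/
abbrev Cospan.bim {R S : GrRing} (c : Cospan R S) : GrBimod R S :=
  ofMaps c.A c.left c.right c.left_mem c.right_mem

/-- The ring map to the zero ring. -/
def toZeroRing (R : GrRing) : R →+* zeroRing where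
  toFun _ := 0
  map_one' := rfl
  map_mul' _ _ := rfl
  map_zero' := rfl
  map_add' _ _ := rfl

/-- The zero ring as a cospan. -/
def Cospan.zero (R S : GrRing) : Cospan R S where
  A := zeroRing
  left := toZeroRing R
  right := toZeroRing S
  left_mem _ := trivial
  right_mem _ := trivial
  xi := 0

/-- The objects of the target 2-categories: `some k`, for `0 ≤ k ≤ N`, stands for the ring `H_k`,
and `none` for the zero ring. -/
structure EqFlagStar (N : ℕ) where
  index : Option (Fin (N + 1))

/-- The ring `H_k = ℚ[x₁, …, x_k; y₁, …, y_{N-k}]`, or the zero ring. -/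
def ring {N : ℕ} : Option (Fin (N + 1)) → GrRing
  | some k => grass k (N - k)
  | none => zeroRing

/-- The number `k` for the ring `H_k` (and `0` for the zero ring). -/
def idx {N : ℕ} : Option (Fin (N + 1)) → ℕ
  | some k => k
  | none => 0

/-- The classes `x_j` of `H_k`, with `x_0 = 1` and `x_j = 0` for `j > k`. -/
def xcl {N : ℕ} : (o : Option (Fin (N + 1))) → ℕ → ring o
  | some k => chern (A := grass k (N - k)) fun j =>
      (MvPolynomial.X (Sum.inl j) : MvPolynomial (Fin k ⊕ Fin (N - k)) ℚ)
  | none => fun _ => (0 : zeroRing)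

/-- The classes `y_j` of `H_k`, with `y_0 = 1` and `y_j = 0` for `j > N - k`. -/
def ycl {N : ℕ} : (o : Option (Fin (N + 1))) → ℕ → ring o
  | some k => chern (A := grass k (N - k)) fun j =>
      (MvPolynomial.X (Sum.inr j) : MvPolynomial (Fin k ⊕ Fin (N - k)) ℚ)
  | none => fun _ => (0 : zeroRing)

/-- The coefficients `b_i` of the inverse of the power series `1 + a₁ t + a₂ t² + ⋯`:
`b_0 = 1` and `∑_{i ≤ k} a_{k-i} b_i = 0` for `k ≥ 1`, with `a_0` read as `1`. -/
def invCoeff {A : Type*} [Ring A] (a : ℕ → A) : ℕ → A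
  | 0 => 1
  | k + 1 => -∑ i : Fin (k + 1), a (k + 1 - i) * invCoeff a i

/-- The classes `X_j` of `H_k`, defined by `(∑ X_i)(∑ y_j) = 1`. -/
def Xcl {N : ℕ} (o : Option (Fin (N + 1))) : ℕ → ring o := invCoeff (ycl o)

/-- The classes `Y_j` of `H_k`, defined by `(∑ Y_i)(∑ x_j) = 1`. -/
def Ycl {N : ℕ} (o : Option (Fin (N + 1))) : ℕ → ring o := invCoeff (xcl o)

/-- The ring `H_{k,k+1} = ℚ[w₁, …, w_k; ξ; z₁, …, z_{N-k-1}]` under `H_k` and `H_{k+1}`, and the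
zero ring for all other pairs of objects. -/
def step {N : ℕ} : (o o' : Option (Fin (N + 1))) → Cospan (ring o) (ring o')
  | some k, some l =>
    if (l : ℕ) = k + 1 then
      { A := flag k (N - l)
        left := flag.fromLower k (N - l) (N - k)
        right := flag.fromUpper k (N - l) l
        left_mem := flag.fromLower_mem k (N - l) (N - k)
        right_mem := flag.fromUpper_mem k (N - l) l
        xi := flag.xi k (N - l) }
    else Cospan.zero _ _
  | none, _ => Cospan.zero _ _
  | some _, none => Cospan.zero _ _

/-- The bimodules that are 1-morphisms of the target: the closure of the identity bimodules, the
`(H_k, H_{k+1})`-bimodules `H_{k,k+1}` and the `(H_{k+1}, H_k)`-bimodules `H_{k+1,k}` under tensor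
products, grading shifts, finite direct sums and graded direct summands. -/
inductive IsEqFlag {N : ℕ} :
    (o o' : Option (Fin (N + 1))) → GrBimod (ring o) (ring o') → Prop
  | unit (o : Option (Fin (N + 1))) : IsEqFlag o o (GrBimod.unit (ring o))
  | up (o o' : Option (Fin (N + 1))) : IsEqFlag o o' (step o o').bim
  | down (o o' : Option (Fin (N + 1))) : IsEqFlag o' o (step o o').bim.flip
  | tensor {o o' o'' : Option (Fin (N + 1))} {M : GrBimod (ring o) (ring o')}
      {M' : GrBimod (ring o') (ring o'')} :
      IsEqFlag o o' M → IsEqFlag o' o'' M' → IsEqFlag o o'' (M.tensor M')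
  | shift {o o' : Option (Fin (N + 1))} {M : GrBimod (ring o) (ring o')} (s : ℤ) :
      IsEqFlag o o' M → IsEqFlag o o' (M.shift s)
  | zero (o o' : Option (Fin (N + 1))) : IsEqFlag o o' (GrBimod.zero _ _)
  | sum {o o' : Option (Fin (N + 1))} {M M' : GrBimod (ring o) (ring o')} :
      IsEqFlag o o' M → IsEqFlag o o' M' → IsEqFlag o o' (M.sum M')
  | summand {o o' : Option (Fin (N + 1))} {M M' : GrBimod (ring o) (ring o')}
      (i : M' →+ M) (p : M →+ M') (hi : i ∈ homogMaps M' M 0) (hp : p ∈ homogMaps M M' 0)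
      (hpi : ∀ m, p (i m) = m) : IsEqFlag o o' M → IsEqFlag o o' M'

/-- A 1-morphism of the target: a graded bimodule in the class `IsEqFlag`. -/
structure EqFlagHom {N : ℕ} (a b : EqFlagStar N) where
  bim : GrBimod (ring a.index) (ring b.index)
  prop : IsEqFlag a.index b.index bim

variable {N : ℕ}

instance : CategoryStruct (EqFlagStar N) where
  Hom a b := EqFlagHom a b
  id _ := ⟨GrBimod.unit _, .unit _⟩
  comp f g := ⟨f.bim.tensor g.bim, .tensor f.prop g.prop⟩

/-- The 2-morphisms are the finite sums of homogeneous bimodule maps. -/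
instance (a b : EqFlagStar N) : Category (a ⟶ b) where
  Hom f g := EqFlagHom.bim f ⟶ EqFlagHom.bim g
  id f := 𝟙 (EqFlagHom.bim f)
  comp η θ := CategoryStruct.comp (obj := GrBimod _ _) η θ
  id_comp η := Category.id_comp (obj := GrBimod _ _) η
  comp_id η := Category.comp_id (obj := GrBimod _ _) η
  assoc η θ ζ := Category.assoc (obj := GrBimod _ _) η θ ζ

instance {a b : EqFlagStar N} (f g : a ⟶ b) : AddCommGroup (f ⟶ g) :=
  inferInstanceAs (AddCommGroup (EqFlagHom.bim f ⟶ EqFlagHom.bim g))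

instance (a b : EqFlagStar N) : Preadditive (a ⟶ b) where
  add_comp x y z f f' g := hom_ext (M := EqFlagHom.bim x) (N := EqFlagHom.bim z)
    fun m => map_add (Subtype.val (p := (· ∈ gradedMaps (EqFlagHom.bim y) (EqFlagHom.bim z))) g) _ _
  comp_add x y z f g g' := hom_ext (M := EqFlagHom.bim x) (N := EqFlagHom.bim z) fun m => rfl

/-- An isomorphism of bimodules, as an isomorphism of 1-morphisms. -/
def eqFlagIso {a b : EqFlagStar N} {f g : a ⟶ b} (e : EqFlagHom.bim f ≅ EqFlagHom.bim g) :
    f ≅ g where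
  hom := e.hom
  inv := e.inv
  hom_inv_id := e.hom_inv_id
  inv_hom_id := e.inv_hom_id

instance : Bicategory (EqFlagStar N) where
  homCategory _ _ := inferInstance
  whiskerLeft f _ _ η := bimStar.whiskerLeft (EqFlagHom.bim f) η
  whiskerRight η h := bimStar.whiskerRight η (EqFlagHom.bim h)
  associator f g h := eqFlagIso (assoc (EqFlagHom.bim f) (EqFlagHom.bim g) (EqFlagHom.bim h))
  leftUnitor f := eqFlagIso (leftUnit (EqFlagHom.bim f))
  rightUnitor f := eqFlagIso (rightUnit (EqFlagHom.bim f))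
  whiskerLeft_id f g := bimStar.whiskerLeft_id (EqFlagHom.bim f) (EqFlagHom.bim g)
  whiskerLeft_comp f _ _ _ η θ := bimStar.whiskerLeft_comp (EqFlagHom.bim f) η θ
  id_whiskerLeft η := bimStar.id_whiskerLeft η
  comp_whiskerLeft f g _ _ η := bimStar.comp_whiskerLeft (EqFlagHom.bim f) (EqFlagHom.bim g) η
  id_whiskerRight f g := bimStar.id_whiskerRight (EqFlagHom.bim f) (EqFlagHom.bim g)
  comp_whiskerRight η θ h := bimStar.comp_whiskerRight η θ (EqFlagHom.bim h)
  whiskerRight_id η := bimStar.whiskerRight_id η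
  whiskerRight_comp η g h := bimStar.whiskerRight_comp η (EqFlagHom.bim g) (EqFlagHom.bim h)
  whisker_assoc f _ _ η h := bimStar.whisker_assoc (EqFlagHom.bim f) η (EqFlagHom.bim h)
  whisker_exchange η θ := bimStar.whisker_exchange η θ
  pentagon f g h i := bimStar.pentagon (EqFlagHom.bim f) (EqFlagHom.bim g) (EqFlagHom.bim h)
    (EqFlagHom.bim i)
  triangle f g := bimStar.triangle (EqFlagHom.bim f) (EqFlagHom.bim g)

/-- A 2-morphism of the target, applied to an element of the source bimodule. -/
def eval {a b : EqFlagStar N} {f g : a ⟶ b} (η : f ⟶ g) (m : EqFlagHom.bim f) :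
    EqFlagHom.bim g := GrBimod.app (M := EqFlagHom.bim f) (N := EqFlagHom.bim g) η m

/-- Degrees of 2-morphisms of the target: degrees of bimodule maps. -/
instance : GradedBicategory (EqFlagStar N) where
  whiskerLeft_add f _ _ η θ := tens_hom_ext fun m n => tmul_add m _ _
  add_whiskerRight η θ h := tens_hom_ext fun m n => add_tmul _ _ n
  homog f g d := (homogMaps (EqFlagHom.bim f) (EqFlagHom.bim g) d).comap
    (gradedMaps (EqFlagHom.bim f) (EqFlagHom.bim g)).subtype
  iSup_homog f g := by
    rw [eq_top_iff]
    rintro ⟨η, hη⟩ -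
    induction hη using AddSubgroup.iSup_induction' with
    | h1 => exact zero_mem _
    | hadd x y hx hy h1 h2 => exact add_mem h1 h2
    | hp d x hx => exact AddSubgroup.mem_iSup_of_mem d hx
  id_mem f := id_homog _
  comp_mem h1 h2 := comp_homog h1 h2
  whiskerLeft_mem f _ _ _ _ h := wl_homog _ _ h
  whiskerRight_mem h hη := wr_homog _ _ hη
  associator_hom_mem _ _ _ := (assoc_mem _ _ _).1
  associator_inv_mem _ _ _ := (assoc_mem _ _ _).2
  leftUnitor_hom_mem _ := (leftUnit_mem _).1
  leftUnitor_inv_mem _ := (leftUnit_mem _).2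
  rightUnitor_hom_mem _ := (rightUnit_mem _).1
  rightUnitor_inv_mem _ := (rightUnit_mem _).2

/-- The 2-category with the degree-preserving 2-morphisms of `EqFlagStar N`. -/
abbrev EqFlag (N : ℕ) := DegZero (EqFlagStar N)

end EqFlagRep

namespace EqFlagRep

/-! ### Presented additive bicategories with translation on the weight lattice of `sl₂` -/

/-- 1-morphisms: formal direct sums of shifts of composites of `ℰ 1_n : n → n + 2` and
`ℱ 1_{n+2} : n + 2 → n`. Composition is written in the order of application. -/
inductive UHom : ℤ → ℤ → Type
  | id (n : ℤ) : UHom n n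
  | E (n : ℤ) : UHom n (n + 2)
  | F (n : ℤ) : UHom (n + 2) n
  | comp {a b c : ℤ} : UHom a b → UHom b c → UHom a c
  | shift {a b : ℤ} : UHom a b → ℤ → UHom a b
  | zero (a b : ℤ) : UHom a b
  | sum {a b : ℤ} : UHom a b → UHom a b → UHom a b

/-- Formal expressions for 2-morphisms. The generators are the dots `z`, `ẑ`, the crossings `U`,
`Û`, and the cups and caps `η_n`, `ε_{n+2}`, `ε̂_{n+2}`, `η̂_n` (each indexed by `n`), the
isomorphisms `f ≃ f{s}`, and the inclusions and projections of direct sums. -/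
inductive Pre : {a b : ℤ} → UHom a b → UHom a b → Type
  | id {a b : ℤ} (f : UHom a b) : Pre f f
  | vcomp {a b : ℤ} {f g h : UHom a b} : Pre f g → Pre g h → Pre f h
  | whiskerLeft {a b c : ℤ} (f : UHom a b) {g h : UHom b c} :
      Pre g h → Pre (f.comp g) (f.comp h)
  | whiskerRight {a b c : ℤ} {f g : UHom a b} (η : Pre f g) (h : UHom b c) :
      Pre (f.comp h) (g.comp h)
  | associator {a b c d : ℤ} (f : UHom a b) (g : UHom b c) (h : UHom c d) :
      Pre ((f.comp g).comp h) (f.comp (g.comp h))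
  | associatorInv {a b c d : ℤ} (f : UHom a b) (g : UHom b c) (h : UHom c d) :
      Pre (f.comp (g.comp h)) ((f.comp g).comp h)
  | leftUnitor {a b : ℤ} (f : UHom a b) : Pre ((UHom.id a).comp f) f
  | leftUnitorInv {a b : ℤ} (f : UHom a b) : Pre f ((UHom.id a).comp f)
  | rightUnitor {a b : ℤ} (f : UHom a b) : Pre (f.comp (UHom.id b)) f
  | rightUnitorInv {a b : ℤ} (f : UHom a b) : Pre f (f.comp (UHom.id b))
  | zero {a b : ℤ} (f g : UHom a b) : Pre f g
  | add {a b : ℤ} {f g : UHom a b} : Pre f g → Pre f g → Pre f g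
  | neg {a b : ℤ} {f g : UHom a b} : Pre f g → Pre f g
  | z (n : ℤ) : Pre (UHom.E n) (UHom.E n)
  | zh (n : ℤ) : Pre (UHom.F n) (UHom.F n)
  | U (n : ℤ) : Pre ((UHom.E n).comp (UHom.E (n + 2))) ((UHom.E n).comp (UHom.E (n + 2)))
  | Uh (n : ℤ) : Pre ((UHom.F (n + 2)).comp (UHom.F n)) ((UHom.F (n + 2)).comp (UHom.F n))
  | eta (n : ℤ) : Pre (UHom.id n) ((UHom.E n).comp (UHom.F n))
  | eps (n : ℤ) : Pre ((UHom.F n).comp (UHom.E n)) (UHom.id (n + 2))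
  | epsh (n : ℤ) : Pre (UHom.id (n + 2)) ((UHom.F n).comp (UHom.E n))
  | etah (n : ℤ) : Pre ((UHom.E n).comp (UHom.F n)) (UHom.id n)
  | shiftHom {a b : ℤ} (f : UHom a b) (s : ℤ) : Pre f (f.shift s)
  | shiftInv {a b : ℤ} (f : UHom a b) (s : ℤ) : Pre (f.shift s) f
  | inl {a b : ℤ} (f g : UHom a b) : Pre f (f.sum g)
  | inr {a b : ℤ} (f g : UHom a b) : Pre g (f.sum g)
  | fst {a b : ℤ} (f g : UHom a b) : Pre (f.sum g) f
  | snd {a b : ℤ} (f g : UHom a b) : Pre (f.sum g) g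

/-- A family of relations between parallel expressions. -/
abbrev RelFam := ∀ {a b : ℤ} {f g : UHom a b}, Pre f g → Pre f g → Prop

/-- The congruence generated by the axioms of a bicategory, the additivity of vertical and horizontal
composition, the axioms of the shift isomorphisms and of finite direct sums, and the relations
`R`. -/
inductive Rel (R : RelFam) : {a b : ℤ} → {f g : UHom a b} → Pre f g → Pre f g → Prop
  | of {a b : ℤ} {f g : UHom a b} {η θ : Pre f g} : R η θ → Rel R η θ
  | refl {a b : ℤ} {f g : UHom a b} (η : Pre f g) : Rel R η η
  | symm {a b : ℤ} {f g : UHom a b} {η θ : Pre f g} : Rel R η θ → Rel R θ η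
  | trans {a b : ℤ} {f g : UHom a b} {η θ ι : Pre f g} : Rel R η θ → Rel R θ ι → Rel R η ι
  | vcomp {a b : ℤ} {f g h : UHom a b} {η η' : Pre f g} {θ θ' : Pre g h} :
      Rel R η η' → Rel R θ θ' → Rel R (η.vcomp θ) (η'.vcomp θ')
  | whiskerLeft {a b c : ℤ} (f : UHom a b) {g h : UHom b c} {η η' : Pre g h} :
      Rel R η η' → Rel R (Pre.whiskerLeft f η) (Pre.whiskerLeft f η')
  | whiskerRight {a b c : ℤ} {f g : UHom a b} {η η' : Pre f g} (h : UHom b c) :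
      Rel R η η' → Rel R (Pre.whiskerRight η h) (Pre.whiskerRight η' h)
  | add {a b : ℤ} {f g : UHom a b} {η η' θ θ' : Pre f g} :
      Rel R η η' → Rel R θ θ' → Rel R (η.add θ) (η'.add θ')
  | neg {a b : ℤ} {f g : UHom a b} {η η' : Pre f g} : Rel R η η' → Rel R η.neg η'.neg
  | id_comp {a b : ℤ} {f g : UHom a b} (η : Pre f g) : Rel R ((Pre.id f).vcomp η) η
  | comp_id {a b : ℤ} {f g : UHom a b} (η : Pre f g) : Rel R (η.vcomp (Pre.id g)) η
  | assoc {a b : ℤ} {f g h i : UHom a b} (η : Pre f g) (θ : Pre g h) (ι : Pre h i) :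
      Rel R ((η.vcomp θ).vcomp ι) (η.vcomp (θ.vcomp ι))
  | whiskerLeft_id {a b c : ℤ} (f : UHom a b) (g : UHom b c) :
      Rel R (Pre.whiskerLeft f (Pre.id g)) (Pre.id (f.comp g))
  | whiskerLeft_comp {a b c : ℤ} (f : UHom a b) {g h i : UHom b c} (η : Pre g h) (θ : Pre h i) :
      Rel R (Pre.whiskerLeft f (η.vcomp θ))
        ((Pre.whiskerLeft f η).vcomp (Pre.whiskerLeft f θ))
  | id_whiskerLeft {a b : ℤ} {f g : UHom a b} (η : Pre f g) :
      Rel R (Pre.whiskerLeft (UHom.id a) η)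
        ((Pre.leftUnitor f).vcomp (η.vcomp (Pre.leftUnitorInv g)))
  | comp_whiskerLeft {a b c d : ℤ} (f : UHom a b) (g : UHom b c) {h h' : UHom c d}
      (η : Pre h h') :
      Rel R (Pre.whiskerLeft (f.comp g) η)
        ((Pre.associator f g h).vcomp
          ((Pre.whiskerLeft f (Pre.whiskerLeft g η)).vcomp (Pre.associatorInv f g h')))
  | id_whiskerRight {a b c : ℤ} (f : UHom a b) (g : UHom b c) :
      Rel R (Pre.whiskerRight (Pre.id f) g) (Pre.id (f.comp g))
  | comp_whiskerRight {a b c : ℤ} {f g h : UHom a b} (η : Pre f g) (θ : Pre g h) (i : UHom b c) :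
      Rel R (Pre.whiskerRight (η.vcomp θ) i)
        ((Pre.whiskerRight η i).vcomp (Pre.whiskerRight θ i))
  | whiskerRight_id {a b : ℤ} {f g : UHom a b} (η : Pre f g) :
      Rel R (Pre.whiskerRight η (UHom.id b))
        ((Pre.rightUnitor f).vcomp (η.vcomp (Pre.rightUnitorInv g)))
  | whiskerRight_comp {a b c d : ℤ} {f f' : UHom a b} (η : Pre f f') (g : UHom b c)
      (h : UHom c d) :
      Rel R (Pre.whiskerRight η (g.comp h))
        ((Pre.associatorInv f g h).vcomp
          ((Pre.whiskerRight (Pre.whiskerRight η g) h).vcomp (Pre.associator f' g h)))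
  | whisker_assoc {a b c d : ℤ} (f : UHom a b) {g g' : UHom b c} (η : Pre g g') (h : UHom c d) :
      Rel R (Pre.whiskerRight (Pre.whiskerLeft f η) h)
        ((Pre.associator f g h).vcomp
          ((Pre.whiskerLeft f (Pre.whiskerRight η h)).vcomp (Pre.associatorInv f g' h)))
  | whisker_exchange {a b c : ℤ} {f g : UHom a b} {h i : UHom b c} (η : Pre f g) (θ : Pre h i) :
      Rel R ((Pre.whiskerLeft f θ).vcomp (Pre.whiskerRight η i))
        ((Pre.whiskerRight η h).vcomp (Pre.whiskerLeft g θ))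
  | associator_hom_inv {a b c d : ℤ} (f : UHom a b) (g : UHom b c) (h : UHom c d) :
      Rel R ((Pre.associator f g h).vcomp (Pre.associatorInv f g h)) (Pre.id _)
  | associator_inv_hom {a b c d : ℤ} (f : UHom a b) (g : UHom b c) (h : UHom c d) :
      Rel R ((Pre.associatorInv f g h).vcomp (Pre.associator f g h)) (Pre.id _)
  | leftUnitor_hom_inv {a b : ℤ} (f : UHom a b) :
      Rel R ((Pre.leftUnitor f).vcomp (Pre.leftUnitorInv f)) (Pre.id _)
  | leftUnitor_inv_hom {a b : ℤ} (f : UHom a b) :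
      Rel R ((Pre.leftUnitorInv f).vcomp (Pre.leftUnitor f)) (Pre.id _)
  | rightUnitor_hom_inv {a b : ℤ} (f : UHom a b) :
      Rel R ((Pre.rightUnitor f).vcomp (Pre.rightUnitorInv f)) (Pre.id _)
  | rightUnitor_inv_hom {a b : ℤ} (f : UHom a b) :
      Rel R ((Pre.rightUnitorInv f).vcomp (Pre.rightUnitor f)) (Pre.id _)
  | pentagon {a b c d e : ℤ} (f : UHom a b) (g : UHom b c) (h : UHom c d) (i : UHom d e) :
      Rel R ((Pre.whiskerRight (Pre.associator f g h) i).vcomp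
          ((Pre.associator f (g.comp h) i).vcomp (Pre.whiskerLeft f (Pre.associator g h i))))
        ((Pre.associator (f.comp g) h i).vcomp (Pre.associator f g (h.comp i)))
  | triangle {a b c : ℤ} (f : UHom a b) (g : UHom b c) :
      Rel R ((Pre.associator f (UHom.id b) g).vcomp (Pre.whiskerLeft f (Pre.leftUnitor g)))
        (Pre.whiskerRight (Pre.rightUnitor f) g)
  | add_assoc {a b : ℤ} {f g : UHom a b} (η θ ι : Pre f g) :
      Rel R ((η.add θ).add ι) (η.add (θ.add ι))
  | add_comm {a b : ℤ} {f g : UHom a b} (η θ : Pre f g) : Rel R (η.add θ) (θ.add η)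
  | zero_add {a b : ℤ} {f g : UHom a b} (η : Pre f g) : Rel R ((Pre.zero f g).add η) η
  | neg_add_cancel {a b : ℤ} {f g : UHom a b} (η : Pre f g) :
      Rel R (η.neg.add η) (Pre.zero f g)
  | add_comp {a b : ℤ} {f g h : UHom a b} (η η' : Pre f g) (θ : Pre g h) :
      Rel R ((η.add η').vcomp θ) ((η.vcomp θ).add (η'.vcomp θ))
  | comp_add {a b : ℤ} {f g h : UHom a b} (η : Pre f g) (θ θ' : Pre g h) :
      Rel R (η.vcomp (θ.add θ')) ((η.vcomp θ).add (η.vcomp θ'))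
  | whiskerLeft_add {a b c : ℤ} (f : UHom a b) {g h : UHom b c} (η θ : Pre g h) :
      Rel R (Pre.whiskerLeft f (η.add θ)) ((Pre.whiskerLeft f η).add (Pre.whiskerLeft f θ))
  | add_whiskerRight {a b c : ℤ} {f g : UHom a b} (η θ : Pre f g) (h : UHom b c) :
      Rel R (Pre.whiskerRight (η.add θ) h) ((Pre.whiskerRight η h).add (Pre.whiskerRight θ h))
  | shift_hom_inv {a b : ℤ} (f : UHom a b) (s : ℤ) :
      Rel R ((Pre.shiftHom f s).vcomp (Pre.shiftInv f s)) (Pre.id _)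
  | shift_inv_hom {a b : ℤ} (f : UHom a b) (s : ℤ) :
      Rel R ((Pre.shiftInv f s).vcomp (Pre.shiftHom f s)) (Pre.id _)
  | zero_id (a b : ℤ) : Rel R (Pre.id (UHom.zero a b)) (Pre.zero _ _)
  | inl_fst {a b : ℤ} (f g : UHom a b) : Rel R ((Pre.inl f g).vcomp (Pre.fst f g)) (Pre.id f)
  | inl_snd {a b : ℤ} (f g : UHom a b) : Rel R ((Pre.inl f g).vcomp (Pre.snd f g)) (Pre.zero f g)
  | inr_fst {a b : ℤ} (f g : UHom a b) : Rel R ((Pre.inr f g).vcomp (Pre.fst f g)) (Pre.zero g f)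
  | inr_snd {a b : ℤ} (f g : UHom a b) : Rel R ((Pre.inr f g).vcomp (Pre.snd f g)) (Pre.id g)
  | sum_total {a b : ℤ} (f g : UHom a b) :
      Rel R (((Pre.fst f g).vcomp (Pre.inl f g)).add ((Pre.snd f g).vcomp (Pre.inr f g)))
        (Pre.id (f.sum g))

/-- The objects of the bicategory presented by the relations `R`. -/
structure Pres (R : RelFam) where
  wt : ℤ

section Pres

variable {R : RelFam}

instance : CategoryStruct (Pres R) where
  Hom a b := UHom a.wt b.wt
  id a := UHom.id a.wt
  comp f g := UHom.comp f g

/-- 2-morphisms: expressions modulo the congruence. -/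
def Cell (R : RelFam) {a b : ℤ} (f g : UHom a b) : Type := Quot (Rel R (f := f) (g := g))

/-- The 2-morphism given by an expression. -/
def Cell.mk (R : RelFam) {a b : ℤ} {f g : UHom a b} (η : Pre f g) : Cell R f g := Quot.mk _ η

namespace Cell

variable {a b c d : ℤ}

theorem ind {f g : UHom a b} {P : Cell R f g → Prop} (h : ∀ η, P (Cell.mk R η)) (x : Cell R f g) :
    P x := Quot.ind h x

theorem sound {f g : UHom a b} {η θ : Pre f g} (h : Rel R η θ) : Cell.mk R η = Cell.mk R θ :=
  Quot.sound h

/-- Vertical composition. -/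
def vcomp {f g h : UHom a b} : Cell R f g → Cell R g h → Cell R f h :=
  Quot.map₂ Pre.vcomp (fun _ _ _ h => .vcomp (.refl _) h) (fun _ _ _ h => .vcomp h (.refl _))

/-- Whiskering with a 1-morphism that is applied first. -/
def whiskerLeft (f : UHom a b) {g h : UHom b c} : Cell R g h → Cell R (f.comp g) (f.comp h) :=
  Quot.map (Pre.whiskerLeft f) (fun _ _ h => .whiskerLeft f h)

/-- Whiskering with a 1-morphism that is applied last. -/
def whiskerRight {f g : UHom a b} (η : Cell R f g) (h : UHom b c) :
    Cell R (f.comp h) (g.comp h) :=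
  Quot.map (fun η => Pre.whiskerRight η h) (fun _ _ e => .whiskerRight h e) η

instance {f g : UHom a b} : Zero (Cell R f g) := ⟨Cell.mk R (Pre.zero f g)⟩

instance {f g : UHom a b} : Add (Cell R f g) :=
  ⟨Quot.map₂ Pre.add (fun _ _ _ h => .add (.refl _) h) (fun _ _ _ h => .add h (.refl _))⟩

instance {f g : UHom a b} : Neg (Cell R f g) := ⟨Quot.map Pre.neg (fun _ _ h => .neg h)⟩

instance {f g : UHom a b} : AddCommGroup (Cell R f g) where
  nsmul := nsmulRec
  zsmul := zsmulRec
  add_assoc := by rintro ⟨η⟩ ⟨θ⟩ ⟨ι⟩; exact sound (.add_assoc η θ ι)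
  zero_add := by rintro ⟨η⟩; exact sound (.zero_add η)
  add_zero := by rintro ⟨η⟩; exact sound (.trans (.add_comm _ _) (.zero_add η))
  neg_add_cancel := by rintro ⟨η⟩; exact sound (.neg_add_cancel η)
  add_comm := by rintro ⟨η⟩ ⟨θ⟩; exact sound (.add_comm η θ)

end Cell

instance (a b : Pres R) : Category (a ⟶ b) where
  Hom f g := Cell R (a := a.wt) (b := b.wt) f g
  id f := Cell.mk R (Pre.id f)
  comp := Cell.vcomp
  id_comp := by rintro _ _ ⟨η⟩; exact Cell.sound (.id_comp η)
  comp_id := by rintro _ _ ⟨η⟩; exact Cell.sound (.comp_id η)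
  assoc := by rintro _ _ _ _ ⟨η⟩ ⟨θ⟩ ⟨ι⟩; exact Cell.sound (.assoc η θ ι)

instance {a b : Pres R} (f g : a ⟶ b) : AddCommGroup (f ⟶ g) :=
  inferInstanceAs (AddCommGroup (Cell R (a := a.wt) (b := b.wt) f g))

instance (a b : Pres R) : Preadditive (a ⟶ b) where
  add_comp := by rintro _ _ _ ⟨η⟩ ⟨η'⟩ ⟨θ⟩; exact Cell.sound (.add_comp η η' θ)
  comp_add := by rintro _ _ _ ⟨η⟩ ⟨θ⟩ ⟨θ'⟩; exact Cell.sound (.comp_add η θ θ')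

/-- The bicategory presented by the relations `R`. -/
instance : Bicategory (Pres R) where
  homCategory _ _ := inferInstance
  whiskerLeft f _ _ η := Cell.whiskerLeft f η
  whiskerRight η h := Cell.whiskerRight η h
  associator f g h :=
    { hom := Cell.mk R (Pre.associator f g h)
      inv := Cell.mk R (Pre.associatorInv f g h)
      hom_inv_id := Cell.sound (.associator_hom_inv f g h)
      inv_hom_id := Cell.sound (.associator_inv_hom f g h) }
  leftUnitor f :=
    { hom := Cell.mk R (Pre.leftUnitor f)
      inv := Cell.mk R (Pre.leftUnitorInv f)
      hom_inv_id := Cell.sound (.leftUnitor_hom_inv f)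
      inv_hom_id := Cell.sound (.leftUnitor_inv_hom f) }
  rightUnitor f :=
    { hom := Cell.mk R (Pre.rightUnitor f)
      inv := Cell.mk R (Pre.rightUnitorInv f)
      hom_inv_id := Cell.sound (.rightUnitor_hom_inv f)
      inv_hom_id := Cell.sound (.rightUnitor_inv_hom f) }
  whiskerLeft_id f g := Cell.sound (.whiskerLeft_id f g)
  whiskerLeft_comp := by rintro _ _ _ f _ _ _ ⟨η⟩ ⟨θ⟩; exact Cell.sound (.whiskerLeft_comp f η θ)
  id_whiskerLeft := by rintro _ _ _ _ ⟨η⟩; exact Cell.sound (.id_whiskerLeft η)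
  comp_whiskerLeft := by
    rintro _ _ _ _ f g _ _ ⟨η⟩; exact Cell.sound (.comp_whiskerLeft f g η)
  id_whiskerRight f g := Cell.sound (.id_whiskerRight f g)
  comp_whiskerRight := by
    rintro _ _ _ _ _ _ ⟨η⟩ ⟨θ⟩ i; exact Cell.sound (.comp_whiskerRight η θ i)
  whiskerRight_id := by rintro _ _ _ _ ⟨η⟩; exact Cell.sound (.whiskerRight_id η)
  whiskerRight_comp := by
    rintro _ _ _ _ _ _ ⟨η⟩ g h; exact Cell.sound (.whiskerRight_comp η g h)
  whisker_assoc := by rintro _ _ _ _ f _ _ ⟨η⟩ h; exact Cell.sound (.whisker_assoc f η h)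
  whisker_exchange := by rintro _ _ _ _ _ _ _ ⟨η⟩ ⟨θ⟩; exact Cell.sound (.whisker_exchange η θ)
  pentagon f g h i := Cell.sound (.pentagon f g h i)
  triangle f g := Cell.sound (.triangle f g)

namespace Pres

variable (R)

/-- `ℰ 1_n`. -/
def E (n : ℤ) : (⟨n⟩ : Pres R) ⟶ ⟨n + 2⟩ := UHom.E n
/-- `ℱ 1_{n+2}`. -/
def F (n : ℤ) : (⟨n + 2⟩ : Pres R) ⟶ ⟨n⟩ := UHom.F n
/-- The dot on an upward strand with the weight `n` on its right. -/
def z (n : ℤ) : E R n ⟶ E R n := Cell.mk R (Pre.z n)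
/-- The dot on a downward strand with the weight `n` on its left. -/
def zh (n : ℤ) : F R n ⟶ F R n := Cell.mk R (Pre.zh n)
/-- The upward crossing with the weight `n` on its right. -/
def U (n : ℤ) : E R n ≫ E R (n + 2) ⟶ E R n ≫ E R (n + 2) := Cell.mk R (Pre.U n)
/-- The downward crossing with the weight `n` on its left. -/
def Uh (n : ℤ) : F R (n + 2) ≫ F R n ⟶ F R (n + 2) ≫ F R n := Cell.mk R (Pre.Uh n)
/-- `η_n : 1_n ⟶ ℱℰ 1_n`. -/
def eta (n : ℤ) : 𝟙 (⟨n⟩ : Pres R) ⟶ E R n ≫ F R n := Cell.mk R (Pre.eta n)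
/-- `ε_{n+2} : ℰℱ 1_{n+2} ⟶ 1_{n+2}`. -/
def eps (n : ℤ) : F R n ≫ E R n ⟶ 𝟙 (⟨n + 2⟩ : Pres R) := Cell.mk R (Pre.eps n)
/-- `ε̂_{n+2} : 1_{n+2} ⟶ ℰℱ 1_{n+2}`. -/
def epsh (n : ℤ) : 𝟙 (⟨n + 2⟩ : Pres R) ⟶ F R n ≫ E R n := Cell.mk R (Pre.epsh n)
/-- `η̂_n : ℱℰ 1_n ⟶ 1_n`. -/
def etah (n : ℤ) : E R n ≫ F R n ⟶ 𝟙 (⟨n⟩ : Pres R) := Cell.mk R (Pre.etah n)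

variable {R}
variable {a b : Pres R}

/-- The shift `f{s}` of a 1-morphism. -/
def shift (f : a ⟶ b) (s : ℤ) : a ⟶ b := UHom.shift f s
/-- The isomorphism `f ≃ f{s}`. -/
def shiftIso (f : a ⟶ b) (s : ℤ) : f ≅ shift f s where
  hom := Cell.mk R (Pre.shiftHom f s)
  inv := Cell.mk R (Pre.shiftInv f s)
  hom_inv_id := Cell.sound (.shift_hom_inv f s)
  inv_hom_id := Cell.sound (.shift_inv_hom f s)
/-- The zero 1-morphism. -/
def zero (a b : Pres R) : a ⟶ b := UHom.zero a.wt b.wt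
/-- The direct sum of two 1-morphisms. -/
def sum (f g : a ⟶ b) : a ⟶ b := UHom.sum f g
/-- The first inclusion. -/
def inl (f g : a ⟶ b) : f ⟶ sum f g := Cell.mk R (Pre.inl f g)
/-- The second inclusion. -/
def inr (f g : a ⟶ b) : g ⟶ sum f g := Cell.mk R (Pre.inr f g)
/-- The first projection. -/
def fst (f g : a ⟶ b) : sum f g ⟶ f := Cell.mk R (Pre.fst f g)
/-- The second projection. -/
def snd (f g : a ⟶ b) : sum f g ⟶ g := Cell.mk R (Pre.snd f g)

end Pres

/-- Degrees of 2-morphisms: `z`, `ẑ` have degree `2`, `U`, `Û` degree `-2`, `η_n`, `η̂_n` degree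
`n + 1`, `ε_n`, `ε̂_n` degree `1 - n`, the isomorphism `f ⟶ f{s}` has degree `s`, and identities,
structure isomorphisms, inclusions and projections have degree `0`. -/
inductive HasDeg : {a b : Pres R} → {f g : a ⟶ b} → ℤ → (f ⟶ g) → Prop
  | zero {a b : Pres R} (f g : a ⟶ b) (d : ℤ) : HasDeg d (0 : f ⟶ g)
  | add {a b : Pres R} {f g : a ⟶ b} {d : ℤ} {η θ : f ⟶ g} :
      HasDeg d η → HasDeg d θ → HasDeg d (η + θ)
  | neg {a b : Pres R} {f g : a ⟶ b} {d : ℤ} {η : f ⟶ g} : HasDeg d η → HasDeg d (-η)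
  | id {a b : Pres R} (f : a ⟶ b) : HasDeg 0 (𝟙 f)
  | comp {a b : Pres R} {f g h : a ⟶ b} {d e : ℤ} {η : f ⟶ g} {θ : g ⟶ h} :
      HasDeg d η → HasDeg e θ → HasDeg (d + e) (η ≫ θ)
  | whiskerLeft {a b c : Pres R} (f : a ⟶ b) {g h : b ⟶ c} {d : ℤ} {η : g ⟶ h} :
      HasDeg d η → HasDeg d (f ◁ η)
  | whiskerRight {a b c : Pres R} {f g : a ⟶ b} {d : ℤ} {η : f ⟶ g} (h : b ⟶ c) :
      HasDeg d η → HasDeg d (η ▷ h)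
  | associator {a b c d : Pres R} (f : a ⟶ b) (g : b ⟶ c) (h : c ⟶ d) :
      HasDeg 0 (α_ f g h).hom
  | associatorInv {a b c d : Pres R} (f : a ⟶ b) (g : b ⟶ c) (h : c ⟶ d) :
      HasDeg 0 (α_ f g h).inv
  | leftUnitor {a b : Pres R} (f : a ⟶ b) : HasDeg 0 (λ_ f).hom
  | leftUnitorInv {a b : Pres R} (f : a ⟶ b) : HasDeg 0 (λ_ f).inv
  | rightUnitor {a b : Pres R} (f : a ⟶ b) : HasDeg 0 (ρ_ f).hom
  | rightUnitorInv {a b : Pres R} (f : a ⟶ b) : HasDeg 0 (ρ_ f).inv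
  | z (n : ℤ) : HasDeg 2 (Pres.z R n)
  | zh (n : ℤ) : HasDeg 2 (Pres.zh R n)
  | U (n : ℤ) : HasDeg (-2) (Pres.U R n)
  | Uh (n : ℤ) : HasDeg (-2) (Pres.Uh R n)
  | eta (n : ℤ) : HasDeg (n + 1) (Pres.eta R n)
  | eps (n : ℤ) : HasDeg (1 - (n + 2)) (Pres.eps R n)
  | epsh (n : ℤ) : HasDeg (1 - (n + 2)) (Pres.epsh R n)
  | etah (n : ℤ) : HasDeg (n + 1) (Pres.etah R n)
  | shiftHom {a b : Pres R} (f : a ⟶ b) (s : ℤ) : HasDeg s (Pres.shiftIso f s).hom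
  | shiftInv {a b : Pres R} (f : a ⟶ b) (s : ℤ) : HasDeg (-s) (Pres.shiftIso f s).inv
  | inl {a b : Pres R} (f g : a ⟶ b) : HasDeg 0 (Pres.inl f g)
  | inr {a b : Pres R} (f g : a ⟶ b) : HasDeg 0 (Pres.inr f g)
  | fst {a b : Pres R} (f g : a ⟶ b) : HasDeg 0 (Pres.fst f g)
  | snd {a b : Pres R} (f g : a ⟶ b) : HasDeg 0 (Pres.snd f g)

/-- The 2-morphisms of degree `d`. -/
def degSubgroup {a b : Pres R} (f g : a ⟶ b) (d : ℤ) : AddSubgroup (f ⟶ g) where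
  carrier := {η | HasDeg d η}
  zero_mem' := .zero f g d
  add_mem' := .add
  neg_mem' := .neg

theorem iSup_comp {a b : Pres R} {f g h : a ⟶ b} {η : f ⟶ g} {θ : g ⟶ h}
    (h1 : η ∈ ⨆ d, degSubgroup f g d) (h2 : θ ∈ ⨆ d, degSubgroup g h d) :
    η ≫ θ ∈ ⨆ d, degSubgroup f h d := by
  induction h1 using AddSubgroup.iSup_induction' with
  | h1 => rw [Limits.zero_comp]; exact zero_mem _
  | hadd x y _ _ hx hy => rw [Preadditive.add_comp]; exact add_mem hx hy
  | hp d x hx =>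
    induction h2 using AddSubgroup.iSup_induction' with
    | h1 => rw [Limits.comp_zero]; exact zero_mem _
    | hadd x y _ _ hx hy => rw [Preadditive.comp_add]; exact add_mem hx hy
    | hp e y hy => exact AddSubgroup.mem_iSup_of_mem (d + e) (.comp hx hy)

theorem whiskerLeft_add' {a b c : Pres R} (f : a ⟶ b) {g h : b ⟶ c} (η θ : g ⟶ h) :
    f ◁ (η + θ) = f ◁ η + f ◁ θ := by
  induction η using Cell.ind with | _ η =>
  induction θ using Cell.ind with | _ θ =>
  exact Cell.sound (.whiskerLeft_add f η θ)

theorem add_whiskerRight' {a b c : Pres R} {f g : a ⟶ b} (η θ : f ⟶ g) (h : b ⟶ c) :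
    (η + θ) ▷ h = η ▷ h + θ ▷ h := by
  induction η using Cell.ind with | _ η =>
  induction θ using Cell.ind with | _ θ =>
  exact Cell.sound (.add_whiskerRight η θ h)

theorem iSup_whiskerLeft {a b c : Pres R} (f : a ⟶ b) {g h : b ⟶ c} {η : g ⟶ h}
    (hη : η ∈ ⨆ d, degSubgroup g h d) : f ◁ η ∈ ⨆ d, degSubgroup (f ≫ g) (f ≫ h) d := by
  let φ : (g ⟶ h) →+ (f ≫ g ⟶ f ≫ h) := AddMonoidHom.mk' (f ◁ ·) (whiskerLeft_add' f)
  have : ⨆ d, degSubgroup g h d ≤ (⨆ d, degSubgroup (f ≫ g) (f ≫ h) d).comap φ :=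
    iSup_le fun d x hx => AddSubgroup.mem_iSup_of_mem d (.whiskerLeft f hx)
  exact this hη

theorem iSup_whiskerRight {a b c : Pres R} {f g : a ⟶ b} (h : b ⟶ c) {η : f ⟶ g}
    (hη : η ∈ ⨆ d, degSubgroup f g d) : η ▷ h ∈ ⨆ d, degSubgroup (f ≫ h) (g ≫ h) d := by
  let φ : (f ⟶ g) →+ (f ≫ h ⟶ g ≫ h) :=
    AddMonoidHom.mk' (· ▷ h) (fun x y => add_whiskerRight' x y h)
  have : ⨆ d, degSubgroup f g d ≤ (⨆ d, degSubgroup (f ≫ h) (g ≫ h) d).comap φ :=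
    iSup_le fun d x hx => AddSubgroup.mem_iSup_of_mem d (.whiskerRight h hx)
  exact this hη

theorem iSup_deg {a b : ℤ} {f g : UHom a b} (η : Pre f g) :
    (Cell.mk R η : (show (⟨a⟩ : Pres R) ⟶ ⟨b⟩ from f) ⟶ g) ∈ ⨆ d, degSubgroup _ _ d := by
  induction η with
  | vcomp η θ h1 h2 => exact iSup_comp h1 h2
  | whiskerLeft f η h => exact iSup_whiskerLeft (a := ⟨_⟩) (b := ⟨_⟩) (c := ⟨_⟩) f h
  | whiskerRight η f h => exact iSup_whiskerRight (a := ⟨_⟩) (b := ⟨_⟩) (c := ⟨_⟩) f h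
  | zero f g => exact zero_mem _
  | add η θ h1 h2 => exact add_mem h1 h2
  | neg η h => exact neg_mem h
  | id f => exact AddSubgroup.mem_iSup_of_mem 0 (.id (R := R) (a := ⟨_⟩) (b := ⟨_⟩) f)
  | associator f g h =>
    exact AddSubgroup.mem_iSup_of_mem 0
      (.associator (R := R) (a := ⟨_⟩) (b := ⟨_⟩) (c := ⟨_⟩) (d := ⟨_⟩) f g h)
  | associatorInv f g h =>
    exact AddSubgroup.mem_iSup_of_mem 0
      (.associatorInv (R := R) (a := ⟨_⟩) (b := ⟨_⟩) (c := ⟨_⟩) (d := ⟨_⟩) f g h)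
  | leftUnitor f =>
    exact AddSubgroup.mem_iSup_of_mem 0 (.leftUnitor (R := R) (a := ⟨_⟩) (b := ⟨_⟩) f)
  | leftUnitorInv f =>
    exact AddSubgroup.mem_iSup_of_mem 0 (.leftUnitorInv (R := R) (a := ⟨_⟩) (b := ⟨_⟩) f)
  | rightUnitor f =>
    exact AddSubgroup.mem_iSup_of_mem 0 (.rightUnitor (R := R) (a := ⟨_⟩) (b := ⟨_⟩) f)
  | rightUnitorInv f =>
    exact AddSubgroup.mem_iSup_of_mem 0 (.rightUnitorInv (R := R) (a := ⟨_⟩) (b := ⟨_⟩) f)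
  | z n => exact AddSubgroup.mem_iSup_of_mem _ (.z n)
  | zh n => exact AddSubgroup.mem_iSup_of_mem _ (.zh n)
  | U n => exact AddSubgroup.mem_iSup_of_mem _ (.U n)
  | Uh n => exact AddSubgroup.mem_iSup_of_mem _ (.Uh n)
  | eta n => exact AddSubgroup.mem_iSup_of_mem _ (.eta n)
  | eps n => exact AddSubgroup.mem_iSup_of_mem _ (.eps n)
  | epsh n => exact AddSubgroup.mem_iSup_of_mem _ (.epsh n)
  | etah n => exact AddSubgroup.mem_iSup_of_mem _ (.etah n)
  | shiftHom f s =>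
    exact AddSubgroup.mem_iSup_of_mem _ (.shiftHom (R := R) (a := ⟨_⟩) (b := ⟨_⟩) f s)
  | shiftInv f s =>
    exact AddSubgroup.mem_iSup_of_mem _ (.shiftInv (R := R) (a := ⟨_⟩) (b := ⟨_⟩) f s)
  | inl f g => exact AddSubgroup.mem_iSup_of_mem _ (.inl (R := R) (a := ⟨_⟩) (b := ⟨_⟩) f g)
  | inr f g => exact AddSubgroup.mem_iSup_of_mem _ (.inr (R := R) (a := ⟨_⟩) (b := ⟨_⟩) f g)
  | fst f g => exact AddSubgroup.mem_iSup_of_mem _ (.fst (R := R) (a := ⟨_⟩) (b := ⟨_⟩) f g)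
  | snd f g => exact AddSubgroup.mem_iSup_of_mem _ (.snd (R := R) (a := ⟨_⟩) (b := ⟨_⟩) f g)

instance : GradedBicategory (Pres R) where
  whiskerLeft_add := whiskerLeft_add'
  add_whiskerRight := add_whiskerRight'
  homog := degSubgroup
  iSup_homog f g := by
    rw [eq_top_iff]
    intro η _
    induction η using Cell.ind with | _ η => exact iSup_deg η
  id_mem f := .id f
  comp_mem h1 h2 := .comp h1 h2
  whiskerLeft_mem f _ _ _ _ h := .whiskerLeft f h
  whiskerRight_mem h hη := .whiskerRight h hη
  associator_hom_mem f g h := .associator f g h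
  associator_inv_mem f g h := .associatorInv f g h
  leftUnitor_hom_mem f := .leftUnitor f
  leftUnitor_inv_mem f := .leftUnitorInv f
  rightUnitor_hom_mem f := .rightUnitor f
  rightUnitor_inv_mem f := .rightUnitorInv f

end Pres

end EqFlagRep

namespace EqFlagRep

/-! ### The relations of the 2-category `U*` -/

/-- No relations. -/
def noRel : RelFam := fun _ _ => False

/-- The additive bicategory with translation that is free on the generators of `U*`. -/
abbrev FreeU := Pres noRel

namespace FreeU

/-- `ℰ 1_n`. -/
abbrev E (n : ℤ) : (⟨n⟩ : FreeU) ⟶ ⟨n + 2⟩ := Pres.E noRel n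
/-- `ℱ 1_{n+2}`. -/
abbrev F (n : ℤ) : (⟨n + 2⟩ : FreeU) ⟶ ⟨n⟩ := Pres.F noRel n
/-- `z_n`. -/
abbrev z (n : ℤ) : E n ⟶ E n := Pres.z noRel n
/-- `ẑ_n`. -/
abbrev zh (n : ℤ) : F n ⟶ F n := Pres.zh noRel n
/-- `U_n`. -/
abbrev U (n : ℤ) : E n ≫ E (n + 2) ⟶ E n ≫ E (n + 2) := Pres.U noRel n
/-- `Û_n`. -/
abbrev Uh (n : ℤ) : F (n + 2) ≫ F n ⟶ F (n + 2) ≫ F n := Pres.Uh noRel n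
/-- `η_n`. -/
abbrev eta (n : ℤ) : 𝟙 (⟨n⟩ : FreeU) ⟶ E n ≫ F n := Pres.eta noRel n
/-- `ε_{n+2}`. -/
abbrev eps (n : ℤ) : F n ≫ E n ⟶ 𝟙 (⟨n + 2⟩ : FreeU) := Pres.eps noRel n
/-- `ε̂_{n+2}`. -/
abbrev epsh (n : ℤ) : 𝟙 (⟨n + 2⟩ : FreeU) ⟶ F n ≫ E n := Pres.epsh noRel n
/-- `η̂_n`. -/
abbrev etah (n : ℤ) : E n ≫ F n ⟶ 𝟙 (⟨n⟩ : FreeU) := Pres.etah noRel n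

/-- `d` dots on an upward strand. -/
def dots (n : ℤ) (d : ℕ) : E n ⟶ E n := (show End (E n) from z n) ^ d

/-- The clockwise bubble with `d` dots in the region of weight `m + 2`. -/
def cBub (m : ℤ) (d : ℕ) : End (𝟙 (⟨m + 2⟩ : FreeU)) := epsh m ≫ F m ◁ dots m d ≫ eps m

/-- The counterclockwise bubble with `d` dots in the region of weight `n`. -/
def ccBub (n : ℤ) (d : ℕ) : End (𝟙 (⟨n⟩ : FreeU)) := eta n ≫ dots n d ▷ F n ≫ etah n

/-- The clockwise bubble with label `n - 1 + i` in the region of weight `n = m + 2`. If the label is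
negative, this is a fake bubble: the coefficient of `t^i` in the inverse of the generating
series of the counterclockwise bubbles with labels `-n - 1 + j`. -/
def cB (m : ℤ) (i : ℕ) : End (𝟙 (⟨m + 2⟩ : FreeU)) :=
  if 0 ≤ m + 1 + i then cBub m (m + 1 + i).toNat
  else invCoeff (fun j => ccBub (m + 2) (-(m + 2) - 1 + j).toNat) i

/-- The counterclockwise bubble with label `-n - 1 + i` in the region of weight `n = m + 2`. If the
label is negative, this is a fake bubble: the coefficient of `t^i` in the inverse of the
generating series of the clockwise bubbles with labels `n - 1 + j`. -/
def ccB (m : ℤ) (i : ℕ) : End (𝟙 (⟨m + 2⟩ : FreeU)) :=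
  if 0 ≤ -(m + 2) - 1 + i then ccBub (m + 2) (-(m + 2) - 1 + i).toNat
  else invCoeff (fun j => cBub m (m + 1 + j).toNat) i

/-- The sideways crossing `ℰℱ 1_n ⟶ ℱℰ 1_n`, for `n = m + 2`. -/
def crossEF (m : ℤ) : F m ≫ E m ⟶ E (m + 2) ≫ F (m + 2) :=
  𝟙 _ ⊗≫ (F m ≫ E m) ◁ eta (m + 2) ⊗≫ F m ◁ U m ▷ F (m + 2) ⊗≫
    eps m ▷ (E (m + 2) ≫ F (m + 2)) ⊗≫ 𝟙 _

/-- The sideways crossing `ℱℰ 1_n ⟶ ℰℱ 1_n`, for `n = m + 2`. -/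
def crossFE (m : ℤ) : E (m + 2) ≫ F (m + 2) ⟶ F m ≫ E m :=
  𝟙 _ ⊗≫ epsh m ▷ (E (m + 2) ≫ F (m + 2)) ⊗≫ F m ◁ U m ▷ F (m + 2) ⊗≫
    (F m ≫ E m) ◁ etah (m + 2) ⊗≫ 𝟙 _

/-- The defining relations of `U*`. In the comments `n = m + 2`. -/
inductive URel : {a b : FreeU} → {f g : a ⟶ b} → (f ⟶ g) → (f ⟶ g) → Prop
  -- `ℰ` and `ℱ` are biadjoint
  | zigzagE (n : ℤ) : URel (𝟙 (E n) ⊗≫ eta n ▷ E n ⊗≫ E n ◁ eps n ⊗≫ 𝟙 (E n)) (𝟙 (E n))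
  | zigzagF (n : ℤ) : URel (𝟙 (F n) ⊗≫ F n ◁ eta n ⊗≫ eps n ▷ F n ⊗≫ 𝟙 (F n)) (𝟙 (F n))
  | zigzagF' (n : ℤ) : URel (𝟙 (F n) ⊗≫ epsh n ▷ F n ⊗≫ F n ◁ etah n ⊗≫ 𝟙 (F n)) (𝟙 (F n))
  | zigzagE' (n : ℤ) : URel (𝟙 (E n) ⊗≫ E n ◁ epsh n ⊗≫ etah n ▷ E n ⊗≫ 𝟙 (E n)) (𝟙 (E n))
  -- dots and crossings are cyclic
  | cyclicZ (n : ℤ) :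
      URel (𝟙 (F n) ⊗≫ epsh n ▷ F n ⊗≫ F n ◁ z n ▷ F n ⊗≫ F n ◁ etah n ⊗≫ 𝟙 (F n)) (zh n)
  | cyclicZ' (n : ℤ) :
      URel (𝟙 (F n) ⊗≫ F n ◁ eta n ⊗≫ F n ◁ z n ▷ F n ⊗≫ eps n ▷ F n ⊗≫ 𝟙 (F n)) (zh n)
  | cyclicU (n : ℤ) :
      URel (𝟙 (F (n + 2) ≫ F n) ⊗≫
        epsh (n + 2) ▷ (F (n + 2) ≫ F n) ⊗≫
        F (n + 2) ◁ epsh n ▷ (E (n + 2) ≫ F (n + 2) ≫ F n) ⊗≫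
        (F (n + 2) ≫ F n) ◁ U n ▷ (F (n + 2) ≫ F n) ⊗≫
        (F (n + 2) ≫ F n ≫ E n) ◁ etah (n + 2) ▷ F n ⊗≫
        (F (n + 2) ≫ F n) ◁ etah n ⊗≫ 𝟙 (F (n + 2) ≫ F n)) (Uh n)
  | cyclicU' (n : ℤ) :
      URel (𝟙 (F (n + 2) ≫ F n) ⊗≫
        (F (n + 2) ≫ F n) ◁ eta n ⊗≫
        (F (n + 2) ≫ F n ≫ E n) ◁ eta (n + 2) ▷ F n ⊗≫
        (F (n + 2) ≫ F n) ◁ U n ▷ (F (n + 2) ≫ F n) ⊗≫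
        F (n + 2) ◁ eps n ▷ (E (n + 2) ≫ F (n + 2) ≫ F n) ⊗≫
        eps (n + 2) ▷ (F (n + 2) ≫ F n) ⊗≫ 𝟙 (F (n + 2) ≫ F n)) (Uh n)
  -- bubbles of negative degree are zero, bubbles of degree zero are one
  | cBub_neg (m : ℤ) (d : ℕ) (h : d < m + 1) : URel (cBub m d) 0
  | ccBub_neg (n : ℤ) (d : ℕ) (h : d < -n - 1) : URel (ccBub n d) 0
  | cBub_zero (m : ℤ) (d : ℕ) (h : d = m + 1) : URel (cBub m d) (𝟙 _)
  | ccBub_zero (n : ℤ) (d : ℕ) (h : d = -n - 1) : URel (ccBub n d) (𝟙 _)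
  -- the generating series of the two kinds of bubbles are mutually inverse
  | grassmannian (m : ℤ) (k : ℕ) (h : 0 < k) :
      URel (∑ i ∈ Finset.range (k + 1), ccB m i * cB m (k - i)) 0
  -- the nilHecke relations
  | nilpotent (n : ℤ) : URel (U n ≫ U n) 0
  | nilHecke (n : ℤ) :
      URel (E n ◁ z (n + 2) ≫ U n - U n ≫ z n ▷ E (n + 2)) (𝟙 (E n ≫ E (n + 2)))
  | nilHecke' (n : ℤ) :
      URel (U n ≫ E n ◁ z (n + 2) - z n ▷ E (n + 2) ≫ U n) (𝟙 (E n ≫ E (n + 2)))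
  | reidemeister (n : ℤ) :
      URel (E n ◁ U (n + 2) ⊗≫ U n ▷ E (n + 2 + 2) ⊗≫ E n ◁ U (n + 2))
        (𝟙 (E n ≫ E (n + 2) ≫ E (n + 2 + 2)) ⊗≫ U n ▷ E (n + 2 + 2) ⊗≫ E n ◁ U (n + 2) ⊗≫
          U n ▷ E (n + 2 + 2) ⊗≫ 𝟙 (E n ≫ E (n + 2) ≫ E (n + 2 + 2)))
  -- reduction of curls
  | curlRight (m : ℤ) :
      URel (𝟙 (E (m + 2)) ⊗≫ epsh m ▷ E (m + 2) ⊗≫ F m ◁ U m ⊗≫ eps m ▷ E (m + 2) ⊗≫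
          𝟙 (E (m + 2)))
        (-∑ l ∈ Finset.range (1 - (m + 2)).toNat,
          (𝟙 (E (m + 2)) ⊗≫ cB m l ▷ E (m + 2) ⊗≫ dots (m + 2) (-(m + 2) - l).toNat))
  | curlLeft (m : ℤ) :
      URel (𝟙 (E m) ⊗≫ E m ◁ eta (m + 2) ⊗≫ U m ▷ F (m + 2) ⊗≫ E m ◁ etah (m + 2) ⊗≫ 𝟙 (E m))
        (∑ j ∈ Finset.range (m + 2 + 1).toNat,
          (𝟙 (E m) ⊗≫ E m ◁ ccB m j ⊗≫ dots m (m + 2 - j).toNat))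
  -- the decompositions of the identities of `ℰℱ 1_n` and `ℱℰ 1_n`
  | decompEF (m : ℤ) :
      URel (-(crossEF m ≫ crossFE m) +
        ∑ l ∈ Finset.range (m + 2).toNat, ∑ j ∈ Finset.range (l + 1),
          F m ◁ dots m (l - j) ≫ eps m ≫ ccB m j ≫ epsh m ≫ F m ◁ dots m (m + 2 - 1 - l).toNat)
        (𝟙 (F m ≫ E m))
  | decompFE (m : ℤ) :
      URel (-(crossFE m ≫ crossEF m) +
        ∑ l ∈ Finset.range (-(m + 2)).toNat, ∑ j ∈ Finset.range (l + 1),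
          dots (m + 2) (l - j) ▷ F (m + 2) ≫ etah (m + 2) ≫ cB m j ≫ eta (m + 2) ≫
            dots (m + 2) (-(m + 2) - 1 - l).toNat ▷ F (m + 2))
        (𝟙 (E (m + 2) ≫ F (m + 2)))

end FreeU

/-- The relations of `U*`, as relations between expressions. -/
def uRel : RelFam := fun {a b f g} η θ =>
  FreeU.URel (a := ⟨a⟩) (b := ⟨b⟩) (f := f) (g := g) (Cell.mk noRel η) (Cell.mk noRel θ)

/-- The graded additive 2-category `U*`. -/
abbrev UStar := Pres uRel

/-- The 2-category `U`: the degree-preserving 2-morphisms of `U*`. -/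
abbrev UZero := DegZero UStar

end EqFlagRep

namespace EqFlagRep

open GrBimod

/-! ### The 2-functor on objects and 1-morphisms -/

open Classical in
/-- The object assigned to the weight `n`: the ring `H_k` if `n = 2k - N` with `0 ≤ k ≤ N`, and the
zero ring otherwise. -/
def ofWeight (N : ℕ) (n : ℤ) : Option (Fin (N + 1)) :=
  if h : ∃ k : Fin (N + 1), n = 2 * ((k : ℕ) : ℤ) - N then some h.choose else none

/-- The cospan `H_k → H_{k,k+1} ← H_{k+1}` for `n = 2k - N` with `0 ≤ k < N`, and zero rings for all
other weights `n`. -/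
abbrev stepAt (N : ℕ) (n : ℤ) : Cospan (ring (ofWeight N n)) (ring (ofWeight N (n + 2))) :=
  step (ofWeight N n) (ofWeight N (n + 2))

/-- The number `k` with `n = 2k - N`, for the weights `n` of non-zero rings. -/
abbrev kAt (N : ℕ) (n : ℤ) : ℕ := idx (ofWeight N n)

/-- The bimodule assigned to a 1-morphism: `ℰ 1_n ↦ H_{k,k+1}{1 - N + k}` and
`ℱ 1_{n+2} ↦ H_{k+1,k}{-k}`, for `n = 2k - N`. -/
def bimod (N : ℕ) : {a b : ℤ} → UHom a b → GrBimod (ring (ofWeight N a)) (ring (ofWeight N b))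
  | _, _, .id n => unit (ring (ofWeight N n))
  | _, _, .E n => (stepAt N n).bim.shift (1 - N + kAt N n)
  | _, _, .F n => (stepAt N n).bim.flip.shift (-kAt N n)
  | _, _, .comp f g => (bimod N f).tensor (bimod N g)
  | _, _, .shift f s => (bimod N f).shift s
  | _, _, .zero a b => zero (ring (ofWeight N a)) (ring (ofWeight N b))
  | _, _, .sum f g => (bimod N f).sum (bimod N g)

theorem isEqFlag_bimod (N : ℕ) {a b : ℤ} (f : UHom a b) :
    IsEqFlag (ofWeight N a) (ofWeight N b) (bimod N f) := by
  induction f with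
  | id n => exact .unit _
  | E n => exact .shift _ (.up _ _)
  | F n => exact .shift _ (.down _ _)
  | comp f g hf hg => exact .tensor hf hg
  | shift f s hf => exact .shift s hf
  | zero a b => exact .zero _ _
  | sum f g hf hg => exact .sum hf hg

/-- The assignments on objects and 1-morphisms. -/
def gamma (N : ℕ) : UStar ⥤q EqFlagStar N where
  obj a := ⟨ofWeight N a.wt⟩
  map f := ⟨bimod N f, isEqFlag_bimod N f⟩

theorem gamma_id (N : ℕ) (a : UStar) : (gamma N).map (𝟙 a) = 𝟙 ((gamma N).obj a) := rfl

theorem gamma_comp (N : ℕ) {a b c : UStar} (f : a ⟶ b) (g : b ⟶ c) :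
    (gamma N).map (f ≫ g) = (gamma N).map f ≫ (gamma N).map g := rfl

/-! ### The assignments on the generating 2-morphisms -/

section Values

variable (N : ℕ) (n : ℤ)

/-- The element `ξ^m` of the bimodule of `ℰ 1_n`, and of `ℱ 1_{n+2}`. -/
def xiPow (m : ℕ) : (stepAt N n).A := (stepAt N n).xi ^ m

/-- The element `ξ^a ⊗ ξ^b` of the bimodule of `ℱℰ 1_n`. -/
def xiEF (a b : ℕ) : bimod N ((UHom.E n).comp (UHom.F n)) :=
  tmul (M := bimod N (UHom.E n)) (N := bimod N (UHom.F n)) (xiPow N n a) (xiPow N n b)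

/-- The element `ξ^a ⊗ ξ^b` of the bimodule of `ℰℱ 1_{n+2}`. -/
def xiFE (a b : ℕ) : bimod N ((UHom.F n).comp (UHom.E n)) :=
  tmul (M := bimod N (UHom.F n)) (N := bimod N (UHom.E n)) (xiPow N n a) (xiPow N n b)

/-- The element `ξ^a ⊗ ξ^b` of the bimodule of `ℰℰ 1_n`; the factor `ξ^a` lies in `H_{k,k+1}`. -/
def xiEE (a b : ℕ) : bimod N ((UHom.E n).comp (UHom.E (n + 2))) :=
  tmul (M := bimod N (UHom.E n)) (N := bimod N (UHom.E (n + 2)))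
    (xiPow N n a) (xiPow N (n + 2) b)

/-- The element `ξ^a ⊗ ξ^b` of the bimodule of `ℱℱ 1_{n+4}`; the factor `ξ^a` lies in
`H_{k+2,k+1}`. -/
def xiFF (a b : ℕ) : bimod N ((UHom.F (n + 2)).comp (UHom.F n)) :=
  tmul (M := bimod N (UHom.F (n + 2))) (N := bimod N (UHom.F n))
    (xiPow N (n + 2) a) (xiPow N n b)

/-- `(-1)^e c_e`, read as `0` if `e < 0`. -/
def signed {A : Type} [Ring A] (c : ℕ → A) (e : ℤ) : A :=
  if 0 ≤ e then (-1) ^ e.toNat * c e.toNat else 0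

end Values

/-- The values of the 2-functor on the generating 2-morphisms, for all weights `n`. Here
`n = 2k - N`, `H_k` is the ring of `n` and `H_{k+1}` the ring of `n + 2`; all formulas are
trivially true in the bimodules that are zero. -/
structure HasValues {N : ℕ} (Γ : PseudofunctorOn (gamma N)) : Prop where
  /-- Dots act as multiplication by `ξ`. -/
  z (n : ℤ) (m : ℕ) : eval (Γ.map₂ (Pres.z uRel n)) (xiPow N n m) = xiPow N n (m + 1)
  zh (n : ℤ) (m : ℕ) : eval (Γ.map₂ (Pres.zh uRel n)) (xiPow N n m) = xiPow N n (m + 1)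
  /-- Crossings act as divided differences. -/
  U (n : ℤ) (a b : ℕ) : eval (Γ.map₂ (Pres.U uRel n)) (xiEE N n a b) =
    ∑ j ∈ Finset.range b, xiEE N n j (a + b - 1 - j) -
      ∑ j ∈ Finset.range a, xiEE N n j (a + b - 1 - j)
  Uh (n : ℤ) (a b : ℕ) : eval (Γ.map₂ (Pres.Uh uRel n)) (xiFF N n a b) =
    ∑ j ∈ Finset.range a, xiFF N n j (a + b - 1 - j) -
      ∑ j ∈ Finset.range b, xiFF N n j (a + b - 1 - j)
  /-- `η_n : 1 ↦ ∑ (-1)^j x_j ⊗ ξ^{k-j} = ∑ (-1)^j ξ^{k-j} ⊗ x_j`. -/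
  eta (n : ℤ) : eval (Γ.map₂ (Pres.eta uRel n)) (1 : ring (ofWeight N n)) =
    ∑ j ∈ Finset.range (kAt N n + 1), (-1 : ℤ) ^ j •
      (bimod N ((UHom.E n).comp (UHom.F n))).lact (xcl _ j) (xiEF N n 0 (kAt N n - j))
  eta_right (n : ℤ) : eval (Γ.map₂ (Pres.eta uRel n)) (1 : ring (ofWeight N n)) =
    ∑ j ∈ Finset.range (kAt N n + 1), (-1 : ℤ) ^ j •
      (bimod N ((UHom.E n).comp (UHom.F n))).ract (xcl _ j) (xiEF N n (kAt N n - j) 0)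
  /-- `ε̂_{n+2} : 1 ↦ ∑ (-1)^j y_j ⊗ ξ^{N-k-1-j} = ∑ (-1)^j ξ^{N-k-1-j} ⊗ y_j`. -/
  epsh (n : ℤ) : eval (Γ.map₂ (Pres.epsh uRel n)) (1 : ring (ofWeight N (n + 2))) =
    ∑ j ∈ Finset.range (N - kAt N (n + 2) + 1), (-1 : ℤ) ^ j •
      (bimod N ((UHom.F n).comp (UHom.E n))).lact (ycl _ j)
        (xiFE N n 0 (N - kAt N (n + 2) - j))
  epsh_right (n : ℤ) : eval (Γ.map₂ (Pres.epsh uRel n)) (1 : ring (ofWeight N (n + 2))) =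
    ∑ j ∈ Finset.range (N - kAt N (n + 2) + 1), (-1 : ℤ) ^ j •
      (bimod N ((UHom.F n).comp (UHom.E n))).ract (ycl _ j)
        (xiFE N n (N - kAt N (n + 2) - j) 0)
  /-- `η̂_n : ξ^a ⊗ ξ^b ↦ (-1)^e X_e` with `e = a + b + 1 + k - N`. -/
  etah (n : ℤ) (a b : ℕ) : eval (Γ.map₂ (Pres.etah uRel n)) (xiEF N n a b) =
    signed (Xcl (ofWeight N n)) (a + b + 1 + kAt N n - N)
  /-- `ε_{n+2} : ξ^a ⊗ ξ^b ↦ (-1)^e Y_e` with `e = a + b + 1 - (k + 1)`. -/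
  eps (n : ℤ) (a b : ℕ) : eval (Γ.map₂ (Pres.eps uRel n)) (xiFE N n a b) =
    signed (Ycl (ofWeight N (n + 2))) (a + b + 1 - kAt N (n + 2))
  /-- The isomorphisms `f ≃ f{s}` are given by identity maps. -/
  shiftHom {a b : UStar} (f : a ⟶ b) (s : ℤ) (m : bimod N f) :
    eval (Γ.map₂ (Pres.shiftIso f s).hom) m = m
  shiftInv {a b : UStar} (f : a ⟶ b) (s : ℤ) (m : bimod N f) :
    eval (Γ.map₂ (Pres.shiftIso f s).inv) m = m
  /-- Direct sums are mapped to direct sums. -/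
  inl {a b : UStar} (f g : a ⟶ b) (m : bimod N f) :
    eval (Γ.map₂ (Pres.inl f g)) m = ((m, 0) : bimod N f × bimod N g)
  inr {a b : UStar} (f g : a ⟶ b) (m : bimod N g) :
    eval (Γ.map₂ (Pres.inr f g)) m = ((0, m) : bimod N f × bimod N g)
  fst {a b : UStar} (f g : a ⟶ b) (m : bimod N f × bimod N g) :
    eval (Γ.map₂ (Pres.fst f g)) m = m.1
  snd {a b : UStar} (f g : a ⟶ b) (m : bimod N f × bimod N g) :
    eval (Γ.map₂ (Pres.snd f g)) m = m.2

end EqFlagRep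

end

open EqFlagRep

noncomputable section

namespace EqFlagRep

/-! ### Symmetric functions of the roots -/

section Series

open PowerSeries

variable {R S : Type} [CommRing R] [CommRing S]

/-! All the structure comes from one observation: `H_{k,k+1}` is obtained from `H_{k+1}` by
adjoining a root `ξ` of the monic polynomial `∑ (-1)^j x_j u^{k+1-j}`, and equally from `H_k` by
adjoining a root of `∑ (-1)^j y_j u^{N-k-j}` (`flag.rootExt_upper`, `flag.rootExt_lower`). It is
therefore a Frobenius extension of both rings. The trace sends `ξ^m` to a signed complete symmetric
class (`RootExt.exists_trace`), and the dual element of the trace form is the cofactor of `u - ξ`,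
with coefficients in one copy of the ring and evaluated at the root in the other copy
(`FrobStep.dual`).

Caps are traces, cups are dual elements, dots are multiplication by `ξ`. Biadjointness and cyclicity
of dots say that trace and dual element invert each other (`FrobStep.sum_dual`,
`FrobStep.sum_dual_symm`). A bubble is a trace of dots applied to the dual element, hence a
coefficient of `E_y / E_x` or of `E_x / E_y`, where `E` denotes the alternating generating series.
These two series are inverse to each other, which settles all bubble relations, including those for
fake bubbles (`bubVal_cB`, `bubVal_ccB`).

Crossings are divided differences on the ring of two step flags (`exists_isDemazure`). Dot relations
hold by the twisted Leibniz rule. Nilpotency and the braid relation follow formally: the maps to be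
compared behave alike under adding dots and both kill the tensor of ones (`evEq_nilpotent`,
`braid_ker`). Cyclicity of the crossing is the self-adjointness of the divided difference for the
trace of the two step flags (`demEnd_adjoint`, `trDownTwo_demEnd`, `trUpTwo_demEnd`). Curls are
convolutions of bubble coefficients (`sum_curl`).

For the decompositions, the sideways crossings exchange `1 ⊗ ξ^b` and `ξ^b ⊗ 1` up to sign, in the
ranges of exponents where only the leading value of a trace survives. The remaining generators are
leading terms of dotted cups. On these the crossing vanishes by the root relation, and the bubble
sum is the identity because the two bubble series are inverse; triangularity gives the claim
(`evEq_decompEF`, `evEq_decompFE`).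

The formal part is an interpretation of expressions by recursion (`preMap`). Bicategory axioms hold
among bimodules, so only the defining relations need checking, and this is done by evaluating
2-morphisms of the free 2-category on elements (`ev`, `EvEq`). Degrees and linearity need be checked
only on generators. At the ends of the weight range a step ring is zero, but the facts in
`CospanFacts` are arranged to hold there too, so that case distinctions are rare. -/

/-- The series `∑ (-1)^j x_j t^j`. -/
def elemSeries (x : ℕ → R) : PowerSeries R := PowerSeries.mk fun j => (-1) ^ j * x j

/-- The inverse of `elemSeries x`, with coefficients `(-1)^j X_j`. -/
def complSeries (x : ℕ → R) : PowerSeries R := PowerSeries.mk fun j => (-1) ^ j * invCoeff x j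

theorem sum_mul_invCoeff (x : ℕ → R) (hx : x 0 = 1) (k : ℕ) :
    ∑ i ∈ Finset.range (k + 2), x (k + 1 - i) * invCoeff x i = 0 := by
  rw [Finset.sum_range_succ, Nat.sub_self, hx, one_mul, invCoeff,
    Finset.sum_range fun i => x (k + 1 - i) * invCoeff x i, add_neg_cancel]

theorem elemSeries_mul_complSeries (x : ℕ → R) (hx : x 0 = 1) :
    elemSeries x * complSeries x = 1 := by
  ext k
  rw [mul_comm, PowerSeries.coeff_mul, Finset.Nat.sum_antidiagonal_eq_sum_range_succ_mk,
    PowerSeries.coeff_one]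
  cases k with
  | zero => simp [elemSeries, complSeries, hx, invCoeff]
  | succ k =>
    have := congrArg (fun y => (-1) ^ (k + 1) * y) (sum_mul_invCoeff x hx k)
    rw [mul_zero, Finset.mul_sum] at this
    rw [if_neg (Nat.succ_ne_zero k), ← this]
    refine Finset.sum_congr rfl fun i hi => ?_
    have hi' : i ≤ k + 1 := Nat.lt_succ_iff.1 (Finset.mem_range.1 hi)
    simp only [elemSeries, complSeries, PowerSeries.coeff_mk]
    have : ((-1 : R)) ^ (k + 1) = (-1) ^ i * (-1) ^ (k + 1 - i) := by
      rw [← pow_add, Nat.add_sub_of_le hi']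
    rw [this]
    ring

theorem signed_of_neg (c : ℕ → R) {e : ℤ} (h : e < 0) : signed c e = 0 := by
  rw [signed, if_neg (not_le.2 h)]

theorem signed_natCast (c : ℕ → R) (e : ℕ) : signed c (e : ℤ) = (-1) ^ e * c e := by
  rw [signed, if_pos (Int.natCast_nonneg e), Int.toNat_natCast]

theorem signed_invCoeff_zero (x : ℕ → R) : signed (invCoeff x) 0 = 1 := by
  have := signed_natCast (invCoeff x) 0
  simpa [invCoeff] using this

/-- A finite convolution with the complete symmetric functions, as a coefficient of a series. -/
theorem sum_mul_signed (y x : ℕ → R) (d : ℕ) (hy : ∀ j, d < j → y j = 0) (e : ℤ) :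
    ∑ j ∈ Finset.range (d + 1), (-1) ^ j * y j * signed (invCoeff x) (e - j) =
      if 0 ≤ e then PowerSeries.coeff e.toNat (elemSeries y * complSeries x) else 0 := by
  split_ifs with he
  · lift e to ℕ using he
    rw [Int.toNat_natCast, PowerSeries.coeff_mul,
      Finset.Nat.sum_antidiagonal_eq_sum_range_succ_mk]
    -- The two ranges are compared inside a common larger one: beyond `d` the factor `y j` vanishes,
    -- beyond `e` the signed class has negative index.
    have h1 : ∑ j ∈ Finset.range (d + 1), (-1) ^ j * y j * signed (invCoeff x) ((e : ℤ) - j) =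
        ∑ j ∈ Finset.range (d + e + 1), (-1) ^ j * y j * signed (invCoeff x) ((e : ℤ) - j) := by
      refine Finset.sum_subset (Finset.range_mono (by omega)) fun j _ hj => ?_
      rw [hy j (by simpa using hj), mul_zero, zero_mul]
    have h2 : ∑ j ∈ Finset.range (e + 1), (-1) ^ j * y j * signed (invCoeff x) ((e : ℤ) - j) =
        ∑ j ∈ Finset.range (d + e + 1), (-1) ^ j * y j * signed (invCoeff x) ((e : ℤ) - j) := by
      refine Finset.sum_subset (Finset.range_mono (by omega)) fun j _ hj => ?_
      rw [Finset.mem_range, not_lt] at hj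
      rw [signed_of_neg _ (by omega), mul_zero]
    rw [h1, ← h2]
    refine Finset.sum_congr rfl fun j hj => ?_
    have hj' : j ≤ e := Nat.lt_succ_iff.1 (Finset.mem_range.1 hj)
    rw [← Nat.cast_sub hj', signed_natCast]
    simp [elemSeries, complSeries]
  · refine Finset.sum_eq_zero fun j _ => ?_
    rw [signed_of_neg _ (by omega), mul_zero]

/-- A coefficient of `E · E⁻¹ = 1`. This identity is what makes the traces well defined on the
quotient by the characteristic polynomial. -/
theorem sum_mul_signed_self (x : ℕ → R) (hx : x 0 = 1) (d : ℕ) (hd : ∀ j, d < j → x j = 0)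
    (e : ℤ) : ∑ j ∈ Finset.range (d + 1), (-1) ^ j * x j * signed (invCoeff x) (e - j) =
      if e = 0 then 1 else 0 := by
  rw [sum_mul_signed x x d hd e, elemSeries_mul_complSeries x hx, PowerSeries.coeff_one]
  by_cases h : 0 ≤ e
  · rw [if_pos h]
    congr 1
    exact propext ⟨fun h' => by omega, fun h' => by omega⟩
  · rw [if_neg h, if_neg (by omega)]

/-- The uniqueness of inverse series, for sequences that are only known in positive degrees up to
`k`. -/
theorem invCoeff_eq_coeff (a : ℕ → R) (f g : PowerSeries R) (hf : PowerSeries.coeff 0 f = 1)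
    (hfg : f * g = 1) (k : ℕ) (h : ∀ j, 0 < j → j ≤ k → a j = PowerSeries.coeff j f) :
    invCoeff a k = PowerSeries.coeff k g := by
  induction k using Nat.strong_induction_on with
  | _ k ih =>
    cases k with
    | zero =>
      have := congrArg (PowerSeries.coeff 0) hfg
      rw [PowerSeries.coeff_mul, Finset.Nat.sum_antidiagonal_eq_sum_range_succ_mk,
        Finset.sum_range_one, hf, one_mul] at this
      rw [this, invCoeff]
      simp
    | succ k =>
      have := congrArg (PowerSeries.coeff (k + 1)) hfg
      rw [mul_comm, PowerSeries.coeff_mul, Finset.Nat.sum_antidiagonal_eq_sum_range_succ_mk,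
        Finset.sum_range_succ, Nat.sub_self, hf, mul_one, PowerSeries.coeff_one,
        if_neg (Nat.succ_ne_zero k)] at this
      rw [invCoeff, eq_comm, eq_neg_iff_add_eq_zero, add_comm, ← this,
        ← Finset.sum_range fun i => a (k + 1 - i) * invCoeff a i]
      congr 1
      refine Finset.sum_congr rfl fun i hi => ?_
      have hi' := Finset.mem_range.1 hi
      -- The index `k + 1 - i` is at least one, so the value of `a` at `0` is never read.
      rw [ih i hi' (fun j h0 hj => h j h0 (by omega)), h _ (by omega) (by omega), mul_comm]

/-- Commutativity is not assumed because fake bubbles are formed in the endomorphism ring of an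
identity 1-morphism. -/
theorem map_invCoeff {A B : Type*} [Ring A] [Ring B] (φ : A →+* B) (a : ℕ → A) (k : ℕ) :
    φ (invCoeff a k) = invCoeff (fun j => φ (a j)) k := by
  induction k using Nat.strong_induction_on with
  | _ k ih =>
    cases k with
    | zero => simp [invCoeff]
    | succ k =>
      rw [invCoeff, invCoeff, map_neg, map_sum]
      congr 1
      refine Finset.sum_congr rfl fun i _ => ?_
      rw [map_mul, ih i (by omega)]

end Series

/-! ### Characteristic polynomials and divided differences -/

section Poly

open Polynomial

variable {R S A : Type} [CommRing R] [CommRing S] [CommRing A]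

/-- The polynomial `∑ (-1)^j x_j u^{d-j}`. -/
def cpoly (x : ℕ → R) (d : ℕ) : R[X] :=
  ∑ j ∈ Finset.range (d + 1), C ((-1) ^ j * x j) * X ^ (d - j)

theorem eval₂_cpoly (f : R →+* A) (a : A) (x : ℕ → R) (d : ℕ) :
    (cpoly x d).eval₂ f a = ∑ j ∈ Finset.range (d + 1), (-1) ^ j * f (x j) * a ^ (d - j) := by
  simp [cpoly, eval₂_finsetSum, eval₂_mul, eval₂_pow]

theorem eval_map_cpoly (f : R →+* A) (a : A) (x : ℕ → R) (d : ℕ) :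
    ((cpoly x d).map f).eval a =
      ∑ j ∈ Finset.range (d + 1), (-1) ^ j * f (x j) * a ^ (d - j) := by
  rw [Polynomial.eval_map, eval₂_cpoly]

/-- The relation `h` is the Whitney formula for adding the root `ξ`; read on polynomials it becomes
a factorisation. Hypothesis `hd` removes the one term that has no partner in the product. -/
theorem map_cpoly_succ (l : R →+* A) (r : S →+* A) (ξ : A) (x : ℕ → R) (x' : ℕ → S) (d : ℕ)
    (h0 : r (x' 0) = l (x 0)) (h : ∀ j, r (x' (j + 1)) = l (x (j + 1)) + ξ * l (x j))
    (hd : l (x (d + 1)) = 0) :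
    (cpoly x' (d + 1)).map r = (cpoly x d).map l * (X - C ξ) := by
  have e1 : (cpoly x' (d + 1)).map r = C (l (x 0)) * X ^ (d + 1) +
      ∑ j ∈ Finset.range (d + 1),
        (C ((-1) ^ (j + 1) * l (x (j + 1))) * X ^ (d - j) -
          C ((-1) ^ j * l (x j)) * X ^ (d - j) * C ξ) := by
    rw [cpoly, Polynomial.map_sum, Finset.sum_range_succ', add_comm]
    refine congrArg₂ (fun p q => p + q) ?_ ?_
    · simp [h0]
    · refine Finset.sum_congr rfl fun j _ => ?_
      rw [Polynomial.map_mul, map_C, Polynomial.map_pow, map_X, Nat.add_sub_add_right]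
      simp only [map_mul, map_pow, map_neg, map_one, h, map_add]
      ring
  have e2 : (cpoly x d).map l * (X - C ξ) =
      ∑ j ∈ Finset.range (d + 1), C ((-1) ^ j * l (x j)) * X ^ (d + 1 - j) -
        ∑ j ∈ Finset.range (d + 1), C ((-1) ^ j * l (x j)) * X ^ (d - j) * C ξ := by
    rw [cpoly, Polynomial.map_sum, mul_sub, Finset.sum_mul, Finset.sum_mul]
    refine congrArg₂ (fun p q => p - q) ?_ ?_
    · refine Finset.sum_congr rfl fun j hj => ?_
      have hj' : j ≤ d := Nat.lt_succ_iff.1 (Finset.mem_range.1 hj)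
      rw [Nat.succ_sub hj', pow_succ]
      simp [mul_assoc]
    · refine Finset.sum_congr rfl fun j _ => ?_
      simp
  rw [e1, e2, Finset.sum_sub_distrib, ← add_sub_assoc]
  congr 1
  rw [Finset.sum_range_succ, hd, Finset.sum_range_succ' _ d]
  simp only [mul_zero, map_zero, zero_mul, add_zero, Nat.add_sub_add_right, pow_zero, one_mul,
    Nat.sub_zero]
  rw [add_comm]

/-- The divided difference `(F(a) - F(b)) / (a - b)`. -/
def dd (a b : A) : A[X] →ₗ[A] A :=
  Polynomial.lsum fun m => LinearMap.mulRight A (∑ j ∈ Finset.range m, a ^ j * b ^ (m - 1 - j))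

theorem dd_monomial (a b c : A) (m : ℕ) :
    dd a b (monomial m c) = c * ∑ j ∈ Finset.range m, a ^ j * b ^ (m - 1 - j) := by
  simp [dd, lsum_apply, sum_monomial_index]

theorem dd_X_pow (a b : A) (m : ℕ) :
    dd a b (X ^ m) = ∑ j ∈ Finset.range m, a ^ j * b ^ (m - 1 - j) := by
  rw [X_pow_eq_monomial, dd_monomial, one_mul]

theorem dd_C (a b c : A) : dd a b (C c) = 0 := by
  rw [← monomial_zero_left, dd_monomial]; simp

theorem dd_X (a b : A) : dd a b X = 1 := by
  rw [← monomial_one_one_eq_X, dd_monomial]; simp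

theorem dd_symm (a b : A) (F : A[X]) : dd a b F = dd b a F := by
  induction F using Polynomial.induction_on' with
  | add F G hF hG => rw [map_add, map_add, hF, hG]
  | monomial m c =>
    rw [dd_monomial, dd_monomial, ← Finset.sum_range_reflect]
    congr 1
    refine Finset.sum_congr rfl fun j hj => ?_
    have := Finset.mem_range.1 hj
    rw [mul_comm, show m - 1 - (m - 1 - j) = j by omega]

/-- Twisted Leibniz rule, from `F(a)G(a) - F(b)G(b) = F(a)(G(a) - G(b)) + (F(a) - F(b))G(b)`. It is
verified on monomials because `a - b` may be a zero divisor. -/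
theorem dd_mul (a b : A) (F G : A[X]) :
    dd a b (F * G) = F.eval a * dd a b G + dd a b F * G.eval b := by
  induction F using Polynomial.induction_on' with
  | add F F' hF hF' => simp only [add_mul, map_add, eval_add, hF, hF']; ring
  | monomial m c =>
    induction G using Polynomial.induction_on' with
    | add G G' hG hG' => simp only [mul_add, map_add, eval_add, hG, hG']; ring
    | monomial n d =>
      rw [monomial_mul_monomial, dd_monomial, dd_monomial, dd_monomial, eval_monomial,
        eval_monomial, Finset.sum_range_add, mul_add, add_comm]
      congr 1
      · rw [Finset.mul_sum, Finset.mul_sum, Finset.mul_sum]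
        refine Finset.sum_congr rfl fun j hj => ?_
        rw [show m + n - 1 - (m + j) = n - 1 - j by omega, pow_add]
        ring
      · rw [Finset.mul_sum, Finset.mul_sum, Finset.sum_mul]
        refine Finset.sum_congr rfl fun j hj => ?_
        have := Finset.mem_range.1 hj
        rw [show m + n - 1 - j = (m - 1 - j) + n by omega, pow_add]
        ring

theorem dd_mul_self (a b : A) (F : A[X]) : (a - b) * dd a b F = F.eval a - F.eval b := by
  induction F using Polynomial.induction_on' with
  | add F F' hF hF' => simp only [map_add, eval_add, mul_add, hF, hF']; ring
  | monomial m c =>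
    rw [dd_monomial, eval_monomial, eval_monomial]
    have := (Commute.all a b).mul_geom_sum₂ m
    calc (a - b) * (c * ∑ j ∈ Finset.range m, a ^ j * b ^ (m - 1 - j))
        = c * ((a - b) * ∑ j ∈ Finset.range m, a ^ j * b ^ (m - 1 - j)) := by ring
      _ = _ := by rw [this]; ring

/-- Expresses the value of a cofactor at a second root through the divided difference, which is
symmetric in the two roots. This is the source of the two forms of each cup. -/
theorem dd_X_sub_C_mul (a b : A) (F : A[X]) : dd a b ((X - C a) * F) = F.eval b := by
  rw [dd_mul, map_sub, dd_X, dd_C]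
  simp

/-- The divided difference of `F(a) G(b)`. -/
def demazure (a b : A) (F G : A[X]) : A := F.eval a * dd a b G - dd a b F * G.eval a

theorem dd_X_mul (a b : A) (F : A[X]) : dd a b (X * F) = F.eval a + b * dd a b F := by
  have := dd_mul_self a b F
  rw [dd_mul, dd_X, eval_X]
  linear_combination this

/-- Formally `demazure a b F G` is `(F(b) G(a) - F(a) G(b)) / (a - b)`, so symmetric factors such as
`a * b` come out; the next lemma does the same for `a + b`. -/
theorem demazure_X_X (a b : A) (F G : A[X]) :
    demazure a b (X * F) (X * G) = a * b * demazure a b F G := by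
  simp only [demazure, dd_X_mul, eval_mul, eval_X]
  ring

theorem demazure_X_left (a b : A) (F G : A[X]) :
    demazure a b (X * F) G = (a + b) * demazure a b F G - demazure a b F (X * G) := by
  simp only [demazure, dd_X_mul, eval_mul, eval_X]
  ring

theorem demazure_X_pow (a b : A) (m n : ℕ) : demazure a b (X ^ m) (X ^ n) =
    ∑ j ∈ Finset.range n, a ^ j * b ^ (m + n - 1 - j) -
      ∑ j ∈ Finset.range m, a ^ j * b ^ (m + n - 1 - j) := by
  have h1 := Finset.sum_range_add (fun j => a ^ j * b ^ (m + n - 1 - j)) m n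
  have h2 := Finset.sum_range_add (fun j => a ^ j * b ^ (m + n - 1 - j)) n m
  have e1 : a ^ m * ∑ j ∈ Finset.range n, a ^ j * b ^ (n - 1 - j) =
      ∑ j ∈ Finset.range n, a ^ (m + j) * b ^ (m + n - 1 - (m + j)) := by
    rw [Finset.mul_sum]
    refine Finset.sum_congr rfl fun j hj => ?_
    rw [show m + n - 1 - (m + j) = n - 1 - j by omega, pow_add]; ring
  have e2 : (∑ j ∈ Finset.range m, a ^ j * b ^ (m - 1 - j)) * a ^ n =
      ∑ j ∈ Finset.range m, a ^ (n + j) * b ^ (m + n - 1 - (n + j)) := by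
    rw [Finset.sum_mul]
    refine Finset.sum_congr rfl fun j hj => ?_
    rw [show m + n - 1 - (n + j) = m - 1 - j by omega, pow_add]; ring
  rw [demazure, dd_X_pow, dd_X_pow, eval_pow, eval_pow, eval_X, e1, e2]
  rw [add_comm n m] at h2
  linear_combination h2 - h1

/-- Multiples of `(X - a)(X - b)` satisfy the three hypotheses, so this lets the operator pass to
quotients by characteristic polynomials that contain both roots. -/
theorem demazure_mul_left (a b : A) (F H G : A[X]) (h1 : F.eval a = 0) (h2 : F.eval b = 0)
    (h3 : dd a b F = 0) : demazure a b (F * H) G = 0 := by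
  have : dd a b (F * H) = 0 := by rw [mul_comm, dd_mul, h2, h3]; ring
  rw [demazure, this, eval_mul, h1]; ring

theorem demazure_mul_right (a b : A) (F H G : A[X]) (h1 : F.eval a = 0)
    (h3 : dd a b F = 0) : demazure a b G (F * H) = 0 := by
  have : dd a b (F * H) = 0 := by rw [dd_mul, h1, h3]; ring
  rw [demazure, this, eval_mul, h1]; ring

end Poly

end EqFlagRep
end

noncomputable section

namespace EqFlagRep

/-! ### Ring extensions by a root of a characteristic polynomial -/

section RootExt

open Polynomial

variable {S A : Type} [CommRing S] [CommRing A]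

theorem cpoly_zero (x : ℕ → S) (hx : x 0 = 1) : cpoly x 0 = 1 := by simp [cpoly, hx]

theorem cpoly_succ (x : ℕ → S) (m : ℕ) :
    cpoly x (m + 1) = cpoly x m * X + C ((-1) ^ (m + 1) * x (m + 1)) := by
  rw [cpoly, Finset.sum_range_succ, cpoly, Finset.sum_mul]
  refine congrArg₂ (fun p q => p + q) ?_ ?_
  · refine Finset.sum_congr rfl fun j hj => ?_
    have hj' : j ≤ m := Nat.lt_succ_iff.1 (Finset.mem_range.1 hj)
    rw [Nat.succ_sub hj', pow_succ, mul_assoc]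
  · simp

/-- Horner's scheme: up to sign the `W m` are the coefficients of the quotient by `X - a`, and also
the successive remainders. With `W` the classes `w_j` or `z_j`, the vanishing of the first class
beyond the range says that `ξ` is a root. -/
theorem eval₂_cpoly_eq (f : S →+* A) (a : A) (x : ℕ → S) (W : ℕ → A) (h0 : W 0 = f (x 0))
    (h : ∀ m, W (m + 1) = f (x (m + 1)) - a * W m) (m : ℕ) :
    (cpoly x m).eval₂ f a = (-1) ^ m * W m := by
  induction m with
  | zero => simp [cpoly, h0]
  | succ m ih =>
    rw [cpoly_succ, eval₂_add, eval₂_mul, ih, eval₂_X, eval₂_C, h]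
    simp only [map_mul, map_pow, map_neg, map_one]
    ring

/-- `A` is generated over `S` by a root `ξ` of the polynomial `cpoly x d`, with no other
relations. -/
structure RootExt (r : S →+* A) (ξ : A) (x : ℕ → S) (d : ℕ) : Prop where
  span : ∀ G : AddSubgroup A, (∀ i < d, ∀ s, r s * ξ ^ i ∈ G) → ∀ a, a ∈ G
  ker : ∀ F : S[X], F.eval₂ r ξ = 0 → cpoly x d ∣ F
  root : (cpoly x d).eval₂ r ξ = 0

/-- Applying `φ` to `F(ξ) = 0` gives `F = 0` in the universal extension `S[X]/(P)`, so `P` divides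
`F`; no inverse of `φ` is needed. Spanning follows from ring generation and the monic relation. -/
theorem RootExt.of_hom {r : S →+* A} {ξ : A} {x : ℕ → S} {d : ℕ} (hx : x 0 = 1)
    (root : (cpoly x d).eval₂ r ξ = 0) (φ : A →+* AdjoinRoot (cpoly x d))
    (hr : ∀ s, φ (r s) = AdjoinRoot.of _ s) (hξ : φ ξ = AdjoinRoot.root _)
    (gen : ∀ T : Subring A, (∀ s, r s ∈ T) → ξ ∈ T → ∀ a, a ∈ T) : RootExt r ξ x d where
  root := root
  ker F hF := by
    have h1 : φ (F.eval₂ r ξ) = F.eval₂ (φ.comp r) (φ ξ) := Polynomial.hom_eval₂ F r φ ξ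
    have h2 : φ.comp r = AdjoinRoot.of _ := RingHom.ext hr
    rw [hF, map_zero, h2, hξ] at h1
    rw [← AdjoinRoot.mk_eq_zero, ← AdjoinRoot.aeval_eq, aeval_def]
    exact h1.symm
  span G hG a := by
    rcases Nat.eq_zero_or_pos d with rfl | hd
    -- For `d = 0` the polynomial is `1`, so the root relation says `1 = 0` in `A`.
    · rw [cpoly_zero x hx, eval₂_one] at root
      rw [show a = 0 by rw [← mul_one a, root, mul_zero]]
      exact zero_mem _
    · let G' : AddSubgroup A := AddSubgroup.closure {a | ∃ i < d, ∃ s, a = r s * ξ ^ i}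
      have hG' : ∀ i < d, ∀ s, r s * ξ ^ i ∈ G' := fun i hi s =>
        AddSubgroup.subset_closure ⟨i, hi, s, rfl⟩
      have hle : G' ≤ G := by
        rw [AddSubgroup.closure_le]
        rintro _ ⟨i, hi, s, rfl⟩
        exact hG i hi s
      -- The multipliers that preserve the span of the reduced monomials form a subring; it is
      -- therefore enough that it contains `S` and `ξ`.
      let T : Subring A :=
        { carrier := {p | ∀ g ∈ G', p * g ∈ G'}
          mul_mem' := fun {p q} hp hq g hg => by rw [mul_assoc]; exact hp _ (hq g hg)
          one_mem' := fun g hg => by rwa [one_mul]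
          add_mem' := fun {p q} hp hq g hg => by rw [add_mul]; exact add_mem (hp g hg) (hq g hg)
          zero_mem' := fun g hg => by rw [zero_mul]; exact zero_mem _
          neg_mem' := fun {p} hp g hg => by rw [neg_mul]; exact neg_mem (hp g hg) }
      have of_gen : ∀ p : A, (∀ i < d, ∀ s, p * (r s * ξ ^ i) ∈ G') → p ∈ T := by
        intro p hp g hg
        have : G' ≤ G'.comap (AddMonoidHom.mulLeft p) := by
          rw [AddSubgroup.closure_le]
          rintro _ ⟨i, hi, s, rfl⟩
          exact hp i hi s
        exact this hg
      have hT : a ∈ T := by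
        refine gen T (fun s => of_gen _ fun i hi s' => ?_) (of_gen _ fun i hi s => ?_) a
        · rw [← mul_assoc, ← map_mul]; exact hG' i hi _
        · rcases Nat.lt_or_ge (i + 1) d with h | h
          · rw [show ξ * (r s * ξ ^ i) = r s * ξ ^ (i + 1) by ring]
            exact hG' _ h _
          -- Only the top power overflows; it is rewritten with the monic relation.
          · obtain rfl : d = i + 1 := by omega
            rw [eval₂_cpoly, Finset.sum_range_succ'] at root
            simp only [pow_zero, hx, map_one, one_mul, Nat.sub_zero] at root
            have e : ξ * (r s * ξ ^ i) = ∑ j ∈ Finset.range (i + 1),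
                r (-(s * ((-1) ^ (j + 1) * x (j + 1)))) * ξ ^ (i + 1 - (j + 1)) := by
              have : ξ * (r s * ξ ^ i) = -(r s * ∑ j ∈ Finset.range (i + 1),
                  (-1) ^ (j + 1) * r (x (j + 1)) * ξ ^ (i + 1 - (j + 1))) := by
                linear_combination r s * root
              rw [this, Finset.mul_sum, ← Finset.sum_neg_distrib]
              refine Finset.sum_congr rfl fun j _ => ?_
              simp only [map_neg, map_mul, map_pow, map_one]
              ring
            rw [e]
            exact sum_mem fun j hj => hG' _ (by omega) _
      have h1 : (1 : A) ∈ G' := by simpa using hG' 0 hd 1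
      have := hT 1 h1
      rw [mul_one] at this
      exact hle this

/-- For the ends of the weight range: a zero extension is still a root extension if the polynomial
is the constant `1` or if the base ring is zero. -/
theorem RootExt.of_subsingleton [Subsingleton A] (r : S →+* A) (ξ : A) (x : ℕ → S) (d : ℕ)
    (h : (d = 0 ∧ x 0 = 1) ∨ Subsingleton S) : RootExt r ξ x d where
  span G _ a := by rw [Subsingleton.elim a 0]; exact zero_mem _
  root := Subsingleton.elim _ _
  ker F _ := by
    rcases h with ⟨rfl, h⟩ | h
    · rw [cpoly_zero x h]; exact one_dvd _
    · exact ⟨0, Subsingleton.elim _ _⟩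

namespace RootExt

variable {r : S →+* A} {ξ : A} {x : ℕ → S} {d : ℕ}

theorem exists_poly (h : RootExt r ξ x d) (a : A) : ∃ F : S[X], F.eval₂ r ξ = a := by
  refine h.span (eval₂RingHom r ξ).toAddMonoidHom.range (fun i _ s => ?_) a
  exact ⟨C s * X ^ i, by simp⟩

/-- Additive maps out of `A` from additive maps out of the polynomial ring. -/
theorem exists_desc (h : RootExt r ξ x d) {M : Type*} [AddCommGroup M] (f : S[X] →+ M)
    (hf : ∀ F, f (cpoly x d * F) = 0) : ∃ t : A →+ M, ∀ F : S[X], t (F.eval₂ r ξ) = f F := by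
  have hs : Function.Surjective (eval₂RingHom r ξ).toAddMonoidHom := h.exists_poly
  have key : ∀ F G : S[X], F.eval₂ r ξ = G.eval₂ r ξ → f F = f G := by
    intro F G e
    obtain ⟨H, hH⟩ := h.ker (F - G) (by rw [eval₂_sub, e, sub_self])
    rw [← sub_eq_zero, ← map_sub, hH, hf]
  refine ⟨AddMonoidHom.mk' (fun a => f (h.exists_poly a).choose) (fun a b => ?_), fun F => ?_⟩
  · rw [← map_add]
    apply key
    rw [eval₂_add, (h.exists_poly _).choose_spec, (h.exists_poly _).choose_spec,
      (h.exists_poly _).choose_spec]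
  · exact key _ _ (h.exists_poly _).choose_spec

/-- The values on powers of `ξ` are prescribed on the polynomial ring. They descend because `cpoly x
d * X^m` is sent to the coefficient of `t^{m+1}` in `E · E⁻¹ = 1`, which is zero. -/
theorem exists_trace (h : RootExt r ξ x d) (hx : x 0 = 1) (hd : ∀ j, d < j → x j = 0) :
    ∃ t : A →+ S, (∀ s a, t (r s * a) = s * t a) ∧
      ∀ m : ℕ, t (ξ ^ m) = signed (invCoeff x) (m + 1 - d) := by
  let τ : S[X] →ₗ[S] S :=
    Polynomial.lsum fun m => LinearMap.mulRight S (signed (invCoeff x) (m + 1 - d))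
  have hτ : ∀ m s, τ (monomial m s) = s * signed (invCoeff x) (m + 1 - d) := by
    intro m s; simp [τ, lsum_apply, sum_monomial_index]
  obtain ⟨t, ht⟩ := h.exists_desc τ.toAddMonoidHom (fun F => by
    induction F using Polynomial.induction_on' with
    | add F G hF hG => rw [mul_add, map_add, hF, hG, add_zero]
    | monomial m s =>
      have e : cpoly x d * monomial m s =
          ∑ j ∈ Finset.range (d + 1), monomial (d - j + m) ((-1) ^ j * x j * s) := by
        rw [cpoly, Finset.sum_mul]
        refine Finset.sum_congr rfl fun j _ => ?_
        rw [C_mul_X_pow_eq_monomial, monomial_mul_monomial]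
      have e2 := sum_mul_signed_self x hx d hd (m + 1)
      rw [if_neg (by omega)] at e2
      change τ _ = 0
      rw [e, map_sum, ← mul_zero s, ← e2, Finset.mul_sum]
      refine Finset.sum_congr rfl fun j hj => ?_
      have hj' : j ≤ d := Nat.lt_succ_iff.1 (Finset.mem_range.1 hj)
      rw [hτ, show ((d - j + m : ℕ) : ℤ) + 1 - d = m + 1 - j by push_cast [hj']; ring]
      ring)
  refine ⟨t, fun s a => ?_, fun m => ?_⟩
  · obtain ⟨F, rfl⟩ := h.exists_poly a
    have : r s * F.eval₂ r ξ = (C s * F).eval₂ r ξ := by simp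
    rw [this, ht, ht]
    change τ _ = s * τ _
    rw [← smul_eq_C_mul, map_smul, smul_eq_mul]
  · have : ξ ^ m = (monomial m (1 : S)).eval₂ r ξ := by simp
    rw [this, ht]
    exact (hτ m 1).trans (one_mul _)

end RootExt

end RootExt

/-! ### Weighted polynomial rings -/

section WPoly

variable {σ : Type} {wt : σ → ℤ}

/-- A variable of a weighted polynomial ring. -/
def wVar (wt : σ → ℤ) (i : σ) : wPoly σ wt := (MvPolynomial.X i : MvPolynomial σ ℚ)

/-- The constants of a weighted polynomial ring. -/
def wConst (wt : σ → ℤ) : ℚ →+* wPoly σ wt := (MvPolynomial.C : ℚ →+* MvPolynomial σ ℚ)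

/-- The universal property of polynomial rings. -/
def wLift {A : Type} [CommRing A] (f : ℚ →+* A) (v : σ → A) : wPoly σ wt →+* A :=
  (MvPolynomial.eval₂Hom f v : MvPolynomial σ ℚ →+* A)

theorem wLift_wVar {A : Type} [CommRing A] (f : ℚ →+* A) (v : σ → A) (i : σ) :
    wLift f v (wVar wt i) = v i := MvPolynomial.eval₂Hom_X' f v i

theorem wPoly_subring (T : Subring (wPoly σ wt)) (hC : ∀ q, wConst wt q ∈ T)
    (hX : ∀ i, wVar wt i ∈ T) (p : wPoly σ wt) : p ∈ T :=
  MvPolynomial.induction_on (motive := fun p : MvPolynomial σ ℚ => p ∈ T) p hC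
    (fun _ _ hp hq => add_mem hp hq) (fun _ i hp => mul_mem hp (hX i))

/-- No condition on constants is needed, since there is at most one ring map out of `ℚ`. -/
theorem wPoly_hom_ext {A : Type} [CommRing A] {f g : wPoly σ wt →+* A}
    (h : ∀ i, f (wVar wt i) = g (wVar wt i)) : f = g := by
  ext p
  refine wPoly_subring (RingHom.eqLocus f g) (fun q => ?_) h p
  exact DFunLike.congr_fun (Subsingleton.elim (f.comp (wConst wt)) (g.comp (wConst wt))) q

end WPoly

/-! ### The structure of the rings of one step flags -/

section Flag

open Polynomial

/-- The generators `x_j` of `grass a b`. -/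
def gx (a b : ℕ) : ℕ → grass a b := chern fun j => wVar (grassWt a b) (Sum.inl j)

/-- The generators `y_j` of `grass a b`. -/
def gy (a b : ℕ) : ℕ → grass a b := chern fun j => wVar (grassWt a b) (Sum.inr j)

theorem chern_succ {A : Type} [CommRing A] {k : ℕ} (v : Fin k → A) {j : ℕ} (h : j < k) :
    chern v (j + 1) = v ⟨j, h⟩ := by rw [chern, dif_pos h]

theorem chern_of_lt {A : Type} [CommRing A] {k : ℕ} (v : Fin k → A) {j : ℕ} (h : k < j) :
    chern v j = 0 := by
  cases j with
  | zero => omega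
  | succ j => rw [chern, dif_neg (by omega)]

namespace flag

variable (a b : ℕ)

theorem w_succ {j : ℕ} (h : j < a) : w a b (j + 1) = wVar (flagWt a b) (Sum.inl ⟨j, h⟩) :=
  chern_succ (A := flag a b) _ h

theorem z_succ {j : ℕ} (h : j < b) :
    z a b (j + 1) = wVar (flagWt a b) (Sum.inr (Sum.inr ⟨j, h⟩)) :=
  chern_succ (A := flag a b) _ h

theorem w_of_lt {j : ℕ} (h : a < j) : w a b j = 0 := chern_of_lt (A := flag a b) _ h

theorem z_of_lt {j : ℕ} (h : b < j) : z a b j = 0 := chern_of_lt (A := flag a b) _ h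

theorem fromLower_gx (c j : ℕ) : fromLower a b c (gx a c j) = w a b j := by
  cases j with
  | zero => exact map_one _
  | succ j =>
    by_cases h : j < a
    · rw [gx, chern_succ _ h]
      exact MvPolynomial.aeval_X (R := ℚ) (S₁ := MvPolynomial (Fin a ⊕ Unit ⊕ Fin b) ℚ) _ _
    · rw [gx, w_of_lt a b (by omega), chern_of_lt _ (by omega), map_zero]

theorem fromLower_gy (j : ℕ) :
    fromLower a b (b + 1) (gy a (b + 1) (j + 1)) = z a b (j + 1) + xi a b * z a b j := by
  by_cases h : j < b + 1
  · rw [gy, chern_succ _ h]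
    exact MvPolynomial.aeval_X (R := ℚ) (S₁ := MvPolynomial (Fin a ⊕ Unit ⊕ Fin b) ℚ) _ _
  · rw [gy, z_of_lt a b (by omega), z_of_lt a b (by omega), chern_of_lt _ (by omega),
      map_zero]
    ring

theorem fromUpper_gy (c j : ℕ) : fromUpper a b c (gy c b j) = z a b j := by
  cases j with
  | zero => exact map_one _
  | succ j =>
    by_cases h : j < b
    · rw [gy, chern_succ _ h]
      exact MvPolynomial.aeval_X (R := ℚ) (S₁ := MvPolynomial (Fin a ⊕ Unit ⊕ Fin b) ℚ) _ _
    · rw [gy, z_of_lt a b (by omega), chern_of_lt _ (by omega), map_zero]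

theorem fromUpper_gx (j : ℕ) :
    fromUpper a b (a + 1) (gx (a + 1) b (j + 1)) = w a b (j + 1) + xi a b * w a b j := by
  by_cases h : j < a + 1
  · rw [gx, chern_succ _ h]
    exact MvPolynomial.aeval_X (R := ℚ) (S₁ := MvPolynomial (Fin a ⊕ Unit ⊕ Fin b) ℚ) _ _
  · rw [gx, w_of_lt a b (by omega), w_of_lt a b (by omega), chern_of_lt _ (by omega),
      map_zero]
    ring

theorem subring_eq_top {S : Type} [CommRing S] (ι : ℚ →+* S) (f : S →+* flag a b)
    (T : Subring (flag a b)) (hf : ∀ s, f s ∈ T) (hw : ∀ j, w a b j ∈ T)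
    (hxi : xi a b ∈ T) (hz : ∀ j, z a b j ∈ T) (p : flag a b) : p ∈ T := by
  refine wPoly_subring T (fun q => ?_) ?_ p
  · have : wConst (flagWt a b) = f.comp ι := Subsingleton.elim _ _
    rw [this]
    exact hf _
  · rintro (j | _ | j)
    · rw [← w_succ a b j.2]; exact hw _
    · exact hxi
    · rw [← z_succ a b j.2]; exact hz _

/-- The sequence `W_0 = f x_0`, `W_{j+1} = f x_{j+1} - u W_j`. -/
def quotSeq {S A : Type} [CommRing S] [CommRing A] (f : S →+* A) (u : A) (x : ℕ → S) : ℕ → A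
  | 0 => f (x 0)
  | j + 1 => f (x (j + 1)) - u * quotSeq f u x j

/-- The last Horner term is, up to sign, the value of the polynomial at its adjoined root. -/
theorem quotSeq_root {S : Type} [CommRing S] (x : ℕ → S) (d : ℕ) :
    quotSeq (AdjoinRoot.of (cpoly x d)) (AdjoinRoot.root _) x d = 0 := by
  have h1 := eval₂_cpoly_eq (AdjoinRoot.of (cpoly x d)) (AdjoinRoot.root _) x
    (quotSeq (AdjoinRoot.of (cpoly x d)) (AdjoinRoot.root _) x) rfl (fun _ => rfl) d
  rw [AdjoinRoot.eval₂_root] at h1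
  have h2 := congrArg (fun y => (-1) ^ d * y) h1
  simpa [← mul_assoc, ← mul_pow] using h2.symm

/-- The `w_j` are, up to sign, the coefficients of the quotient of the characteristic polynomial by
`X - ξ`, hence polynomials in `ξ` over the upper ring. Conversely a map to `S[X]/(P)` can be
prescribed freely on the variables; it sends `w_j` to the Horner term `W j`. -/
theorem rootExt_upper :
    RootExt (fromUpper a b (a + 1)) (xi a b) (gx (a + 1) b) (a + 1) := by
  set P := cpoly (gx (a + 1) b) (a + 1) with hP
  let W := quotSeq (AdjoinRoot.of P) (AdjoinRoot.root P) (gx (a + 1) b)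
  -- Matches the convention `w_{a+1} = 0`, so that `φ` respects the Whitney formula in the top
  -- degree as well.
  have hWa : W (a + 1) = 0 := quotSeq_root _ _
  let φ : flag a b →+* AdjoinRoot P :=
    wLift ((AdjoinRoot.of P).comp (wConst (grassWt (a + 1) b)))
      (Sum.elim (fun j => W (j + 1)) (Sum.elim (fun _ => AdjoinRoot.root P)
        (fun j => AdjoinRoot.of P (gy (a + 1) b (j + 1)))))
  have φX : ∀ i, φ (wVar _ i) = _ := fun i => wLift_wVar _ _ i
  have φξ : φ (xi a b) = AdjoinRoot.root P := φX (Sum.inr (Sum.inl ()))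
  have φw : ∀ j, j ≤ a + 1 → φ (w a b j) = W j := by
    intro j hj
    cases j with
    | zero => exact (map_one φ).trans (map_one (AdjoinRoot.of P)).symm
    | succ j =>
      by_cases h : j < a
      · rw [w_succ a b h, φX]; rfl
      · rw [w_of_lt a b (by omega), map_zero, show j = a by omega, hWa]
  have φz : ∀ j, φ (z a b j) = AdjoinRoot.of P (gy (a + 1) b j) := by
    intro j
    cases j with
    | zero => exact (map_one φ).trans (map_one (AdjoinRoot.of P)).symm
    | succ j =>
      by_cases h : j < b
      · rw [z_succ a b h, φX]; rfl
      · rw [z_of_lt a b (by omega), gy, chern_of_lt _ (by omega), map_zero, map_zero]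
  refine RootExt.of_hom rfl ?_ φ (fun s => ?_) φξ ?_
  · rw [eval₂_cpoly_eq _ _ _ (w a b) (map_one _).symm (fun m => by rw [fromUpper_gx]; ring)]
    rw [w_of_lt a b (by omega), mul_zero]
  · have : φ.comp (fromUpper a b (a + 1)) = AdjoinRoot.of P := by
      refine wPoly_hom_ext ?_
      rintro (j | j)
      · have e : wVar (grassWt (a + 1) b) (Sum.inl j) = gx (a + 1) b (j + 1) := by rw [gx, chern_succ _ j.2]
        rw [e, RingHom.comp_apply, fromUpper_gx, map_add, map_mul, φw _ (by omega),
          φw _ (by omega), φξ]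
        change AdjoinRoot.of P _ - _ + _ = _
        ring
      · have e : wVar (grassWt (a + 1) b) (Sum.inr j) = gy (a + 1) b (j + 1) := by rw [gy, chern_succ _ j.2]
        rw [e, RingHom.comp_apply, fromUpper_gy, φz]
    exact DFunLike.congr_fun this s
  · intro T hT hξ
    refine subring_eq_top a b (wConst _) _ T hT (fun j => ?_) hξ (fun j => ?_)
    · induction j with
      | zero => exact one_mem _
      | succ j ih =>
        rw [show w a b (j + 1) = fromUpper a b (a + 1) (gx (a + 1) b (j + 1)) - xi a b * w a b j by
          rw [fromUpper_gx]; ring]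
        exact sub_mem (hT _) (mul_mem hξ ih)
    · rw [← fromUpper_gy a b (a + 1)]; exact hT _

/-- Mirror image: over the lower ring the `z_j` are the Horner terms, and the `w_j` come from the
base. -/
theorem rootExt_lower :
    RootExt (fromLower a b (b + 1)) (xi a b) (gy a (b + 1)) (b + 1) := by
  set P := cpoly (gy a (b + 1)) (b + 1) with hP
  let W := quotSeq (AdjoinRoot.of P) (AdjoinRoot.root P) (gy a (b + 1))
  have hWb : W (b + 1) = 0 := quotSeq_root _ _
  let φ : flag a b →+* AdjoinRoot P :=
    wLift ((AdjoinRoot.of P).comp (wConst (grassWt a (b + 1))))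
      (Sum.elim (fun j => AdjoinRoot.of P (gx a (b + 1) (j + 1)))
        (Sum.elim (fun _ => AdjoinRoot.root P) (fun j => W (j + 1))))
  have φX : ∀ i, φ (wVar _ i) = _ := fun i => wLift_wVar _ _ i
  have φξ : φ (xi a b) = AdjoinRoot.root P := φX (Sum.inr (Sum.inl ()))
  have φz : ∀ j, j ≤ b + 1 → φ (z a b j) = W j := by
    intro j hj
    cases j with
    | zero => exact (map_one φ).trans (map_one (AdjoinRoot.of P)).symm
    | succ j =>
      by_cases h : j < b
      · rw [z_succ a b h, φX]; rfl
      · rw [z_of_lt a b (by omega), map_zero, show j = b by omega, hWb]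
  have φw : ∀ j, φ (w a b j) = AdjoinRoot.of P (gx a (b + 1) j) := by
    intro j
    cases j with
    | zero => exact (map_one φ).trans (map_one (AdjoinRoot.of P)).symm
    | succ j =>
      by_cases h : j < a
      · rw [w_succ a b h, φX]; rfl
      · rw [w_of_lt a b (by omega), gx, chern_of_lt _ (by omega), map_zero, map_zero]
  refine RootExt.of_hom rfl ?_ φ (fun s => ?_) φξ ?_
  · rw [eval₂_cpoly_eq _ _ _ (z a b) (map_one _).symm (fun m => by rw [fromLower_gy]; ring)]
    rw [z_of_lt a b (by omega), mul_zero]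
  · have : φ.comp (fromLower a b (b + 1)) = AdjoinRoot.of P := by
      refine wPoly_hom_ext ?_
      rintro (j | j)
      · have e : wVar (grassWt a (b + 1)) (Sum.inl j) = gx a (b + 1) (j + 1) := by rw [gx, chern_succ _ j.2]
        rw [e, RingHom.comp_apply, fromLower_gx, φw]
      · have e : wVar (grassWt a (b + 1)) (Sum.inr j) = gy a (b + 1) (j + 1) := by rw [gy, chern_succ _ j.2]
        rw [e, RingHom.comp_apply, fromLower_gy, map_add, map_mul, φz _ (by omega),
          φz _ (by omega), φξ]
        change AdjoinRoot.of P _ - _ + _ = _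
        ring
    exact DFunLike.congr_fun this s
  · intro T hT hξ
    refine subring_eq_top a b (wConst _) _ T hT (fun j => ?_) hξ (fun j => ?_)
    · rw [← fromLower_gx a b (b + 1)]; exact hT _
    · induction j with
      | zero => exact one_mem _
      | succ j ih =>
        rw [show z a b (j + 1) = fromLower a b (b + 1) (gy a (b + 1) (j + 1)) - xi a b * z a b j by
          rw [fromLower_gy]; ring]
        exact sub_mem (hT _) (mul_mem hξ ih)

end flag

end Flag

end EqFlagRep
end

noncomputable section

namespace EqFlagRep

/-! ### The cospans of one step flags -/

section Step

open Polynomial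

variable {N : ℕ}

theorem gx_of_lt {a b j : ℕ} (h : a < j) : gx a b j = 0 := chern_of_lt _ h

theorem gy_of_lt {a b j : ℕ} (h : b < j) : gy a b j = 0 := chern_of_lt _ h

theorem gx_succ (a b : ℕ) (j : Fin a) : gx a b (j + 1) = wVar (grassWt a b) (Sum.inl j) :=
  chern_succ _ j.2

theorem gy_succ (a b : ℕ) (j : Fin b) : gy a b (j + 1) = wVar (grassWt a b) (Sum.inr j) :=
  chern_succ _ j.2

theorem xcl_zero (o : Option (Fin (N + 1))) : xcl o 0 = 1 := by cases o <;> rfl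

theorem ycl_zero (o : Option (Fin (N + 1))) : ycl o 0 = 1 := by cases o <;> rfl

theorem xcl_of_lt (o : Option (Fin (N + 1))) {j : ℕ} (h : idx o < j) : xcl o j = 0 := by
  cases o with
  | none => rfl
  | some k => exact gx_of_lt h

theorem ycl_of_lt (o : Option (Fin (N + 1))) {j : ℕ} (h : N - idx o < j) : ycl o j = 0 := by
  cases o with
  | none => rfl
  | some k => exact gy_of_lt h

theorem xcl_mem (o : Option (Fin (N + 1))) (j : ℕ) : xcl o j ∈ (ring o).gr (2 * j) := by
  cases o with
  | none => exact zero_mem _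
  | some k =>
    exact chern_mem (A := grass k (N - k)) _
      (fun _ => MvPolynomial.isWeightedHomogeneous_X ℚ (grassWt k (N - k)) _) j

theorem ycl_mem (o : Option (Fin (N + 1))) (j : ℕ) : ycl o j ∈ (ring o).gr (2 * j) := by
  cases o with
  | none => exact zero_mem _
  | some k =>
    exact chern_mem (A := grass k (N - k)) _
      (fun _ => MvPolynomial.isWeightedHomogeneous_X ℚ (grassWt k (N - k)) _) j

/-- The rational constants. -/
def ratHom : (o : Option (Fin (N + 1))) → ℚ →+* ring o
  | some k => wConst (grassWt k (N - k))
  | none =>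
    { toFun := fun _ => (0 : zeroRing), map_one' := rfl, map_mul' := fun _ _ => rfl,
      map_zero' := rfl, map_add' := fun _ _ => rfl }

theorem ring_subring (o : Option (Fin (N + 1))) (T : Subring (ring o))
    (hC : ∀ q, ratHom o q ∈ T) (hx : ∀ j, xcl o j ∈ T) (hy : ∀ j, ycl o j ∈ T) (s : ring o) :
    s ∈ T := by
  cases o with
  | none => exact zero_mem T
  | some k =>
    refine wPoly_subring (wt := grassWt k (N - k)) T hC ?_ s
    rintro (j | j)
    · exact gx_succ k (N - k) j ▸ hx (j + 1)
    · exact gy_succ k (N - k) j ▸ hy (j + 1)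

/-- The algebraic properties of the cospan `H_k → H_{k,k+1} ← H_{k+1}`. -/
structure CospanFacts (o o' : Option (Fin (N + 1))) (c : Cospan (ring o) (ring o')) : Prop where
  upper : RootExt c.right c.xi (xcl o') (idx o')
  lower : RootExt c.left c.xi (ycl o) (N - idx o)
  right_xcl : ∀ j, c.right (xcl o' (j + 1)) = c.left (xcl o (j + 1)) + c.xi * c.left (xcl o j)
  left_ycl : ∀ j, c.left (ycl o (j + 1)) = c.right (ycl o' (j + 1)) + c.xi * c.right (ycl o' j)
  map_x : (cpoly (xcl o') (idx o')).map c.right =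
    (cpoly (xcl o) (idx o)).map c.left * (X - C c.xi)
  map_y : (cpoly (ycl o) (N - idx o)).map c.left =
    (cpoly (ycl o') (N - idx o')).map c.right * (X - C c.xi)
  xi_mem : c.xi ∈ c.A.gr 2
  degen : Subsingleton c.A ∨ (idx o' = idx o + 1 ∧ idx o < N)

theorem CospanFacts.of_subsingleton {o o' : Option (Fin (N + 1))} (c : Cospan (ring o) (ring o'))
    (hA : Subsingleton c.A) (h1 : idx o' = 0 ∨ Subsingleton (ring o'))
    (h2 : N - idx o = 0 ∨ Subsingleton (ring o)) : CospanFacts o o' c where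
  upper := RootExt.of_subsingleton _ _ _ _ (h1.imp_left fun h => ⟨h, xcl_zero _⟩)
  lower := RootExt.of_subsingleton _ _ _ _ (h2.imp_left fun h => ⟨h, ycl_zero _⟩)
  right_xcl _ := Subsingleton.elim _ _
  left_ycl _ := Subsingleton.elim _ _
  map_x := Subsingleton.elim _ _
  map_y := Subsingleton.elim _ _
  xi_mem := by rw [Subsingleton.elim c.xi 0]; exact zero_mem _
  degen := Or.inl hA

theorem cospanFacts_flag (k l : Fin (N + 1)) (h : (l : ℕ) = k + 1) :
    CospanFacts (some k) (some l)
      { A := flag k (N - l)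
        left := flag.fromLower k (N - l) (N - k)
        right := flag.fromUpper k (N - l) l
        left_mem := flag.fromLower_mem k (N - l) (N - k)
        right_mem := flag.fromUpper_mem k (N - l) l
        xi := flag.xi k (N - l) } := by
  have hl : (l : ℕ) < N + 1 := l.2
  have hb : N - (k : ℕ) = N - (l : ℕ) + 1 := by omega
  -- The numbers of variables `l` and `N - k` are successors only propositionally, while the types
  -- depend on them. Each fact is stated for a free number `c`, for which the equation can be
  -- substituted.
  have upper : ∀ c : ℕ, c = k + 1 → RootExt (flag.fromUpper k (N - l) c) (flag.xi k (N - l))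
      (gx c (N - l)) c := by rintro _ rfl; exact flag.rootExt_upper _ _
  have lower : ∀ c : ℕ, c = N - l + 1 → RootExt (flag.fromLower k (N - l) c)
      (flag.xi k (N - l)) (gy k c) c := by rintro _ rfl; exact flag.rootExt_lower _ _
  have hx : ∀ c : ℕ, c = k + 1 → ∀ j, flag.fromUpper k (N - l) c (gx c (N - l) (j + 1)) =
      flag.fromLower k (N - l) (N - k) (gx k (N - k) (j + 1)) +
        flag.xi k (N - l) * flag.fromLower k (N - l) (N - k) (gx k (N - k) j) := by
    rintro _ rfl j
    rw [flag.fromUpper_gx, flag.fromLower_gx, flag.fromLower_gx]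
  have hy : ∀ c : ℕ, c = N - l + 1 → ∀ j, flag.fromLower k (N - l) c (gy k c (j + 1)) =
      flag.fromUpper k (N - l) l (gy l (N - l) (j + 1)) +
        flag.xi k (N - l) * flag.fromUpper k (N - l) l (gy l (N - l) j) := by
    rintro _ rfl j
    rw [flag.fromLower_gy, flag.fromUpper_gy, flag.fromUpper_gy]
  have mx : ∀ c : ℕ, c = k + 1 → (cpoly (gx c (N - l)) c).map (flag.fromUpper k (N - l) c) =
      (cpoly (gx k (N - k)) k).map (flag.fromLower k (N - l) (N - k)) *
        (X - C (flag.xi k (N - l))) := by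
    rintro _ rfl
    exact map_cpoly_succ _ _ _ _ _ _ ((map_one _).trans (map_one _).symm) (hx _ rfl)
      ((flag.fromLower_gx _ _ _ _).trans (flag.w_of_lt _ _ (Nat.lt_succ_self _)))
  have my : ∀ c : ℕ, c = N - l + 1 → (cpoly (gy k c) c).map (flag.fromLower k (N - l) c) =
      (cpoly (gy l (N - l)) (N - l)).map (flag.fromUpper k (N - l) l) *
        (X - C (flag.xi k (N - l))) := by
    rintro _ rfl
    exact map_cpoly_succ _ _ _ _ _ _ ((map_one _).trans (map_one _).symm) (hy _ rfl)
      ((flag.fromUpper_gy _ _ _ _).trans (flag.z_of_lt _ _ (Nat.lt_succ_self _)))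
  exact
    { upper := upper l h
      lower := lower _ hb
      right_xcl := hx l h
      left_ycl := hy _ hb
      map_x := mx l h
      map_y := my _ hb
      xi_mem := flag.xi_mem _ _
      degen := Or.inr ⟨h, by change (k : ℕ) < N; omega⟩ }

theorem ofWeight_eq_some (n : ℤ) (k : Fin (N + 1)) :
    ofWeight N n = some k ↔ n = 2 * ((k : ℕ) : ℤ) - N := by
  unfold ofWeight
  split_ifs with h
  · have hs := h.choose_spec
    rw [Option.some_inj]
    refine ⟨fun e => e ▸ hs, fun e => ?_⟩
    have := e.symm.trans hs
    exact Fin.ext (by omega)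
  · simp only [false_iff]
    exact fun e => h ⟨k, e⟩

/-- The alternative is unavoidable: at weights of the zero ring `kAt` has the default value `0`,
which is unrelated to `n`. -/
theorem kAt_eq (n : ℤ) : ofWeight N n = none ∨
    (n = 2 * (kAt N n : ℤ) - N ∧ kAt N n ≤ N) := by
  cases h : ofWeight N n with
  | none => exact Or.inl rfl
  | some k =>
    refine Or.inr ?_
    rw [kAt, h]
    exact ⟨(ofWeight_eq_some n k).1 h, Nat.lt_succ_iff.1 k.2⟩

instance : Subsingleton (zeroRing : Type) := inferInstanceAs (Subsingleton PUnit)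

theorem subsingleton_ring {o : Option (Fin (N + 1))} (h : o = none) : Subsingleton (ring o) := by
  subst h
  exact inferInstanceAs (Subsingleton zeroRing)

/-- At the two ends of the chain the step ring is zero although one neighbour is not. There `k + 1 =
0` or `N - k = 0` holds for the non-zero neighbour, so its characteristic polynomial is `1` and the
uniform statement survives. -/
theorem stepFacts (n : ℤ) : CospanFacts (ofWeight N n) (ofWeight N (n + 2)) (stepAt N n) := by
  unfold stepAt
  cases h : ofWeight N n with
  | none =>
    have e : step none (ofWeight N (n + 2)) = Cospan.zero _ _ := by
      cases ofWeight N (n + 2) <;> rfl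
    rw [e]
    refine CospanFacts.of_subsingleton _ (inferInstanceAs (Subsingleton zeroRing)) ?_
      (Or.inr (subsingleton_ring rfl))
    cases h' : ofWeight N (n + 2) with
    | none => exact Or.inr (subsingleton_ring rfl)
    | some l =>
      left
      -- If `l` were positive, `l - 1` would be an index for the weight `n`.
      by_contra hl
      have hl' : (l : ℕ) ≠ 0 := hl
      have e' := (ofWeight_eq_some _ _).1 h'
      have : ofWeight N n = some ⟨l - 1, by omega⟩ :=
        (ofWeight_eq_some _ _).2 (by push_cast [Nat.one_le_iff_ne_zero.2 hl']; omega)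
      rw [h] at this
      cases this
  | some k =>
    have e' := (ofWeight_eq_some _ _).1 h
    cases h' : ofWeight N (n + 2) with
    | none =>
      refine CospanFacts.of_subsingleton _ (inferInstanceAs (Subsingleton zeroRing))
        (Or.inr (subsingleton_ring rfl)) (Or.inl ?_)
      by_contra hk
      have hk' : N - (k : ℕ) ≠ 0 := hk
      have : ofWeight N (n + 2) = some ⟨k + 1, by omega⟩ :=
        (ofWeight_eq_some _ _).2 (by push_cast; omega)
      rw [h'] at this
      cases this
    | some l =>
      have e'' := (ofWeight_eq_some _ _).1 h'
      have hl : (l : ℕ) = k + 1 := by omega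
      have e : step (some k) (some l) = _ := if_pos hl
      rw [e]
      exact cospanFacts_flag k l hl

/-- The pushforward `H_{k,k+1} → H_{k+1}`. -/
def trUp (N : ℕ) (n : ℤ) : (stepAt N n).A →+ ring (ofWeight N (n + 2)) :=
  ((stepFacts n).upper.exists_trace (xcl_zero _) (fun _ => xcl_of_lt _)).choose

theorem trUp_mul (n : ℤ) (s) (a) : trUp N n ((stepAt N n).right s * a) = s * trUp N n a :=
  ((stepFacts n).upper.exists_trace (xcl_zero _) (fun _ => xcl_of_lt _)).choose_spec.1 s a

theorem trUp_pow (n : ℤ) (m : ℕ) : trUp N n ((stepAt N n).xi ^ m) =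
    signed (Ycl (ofWeight N (n + 2))) (m + 1 - kAt N (n + 2)) :=
  ((stepFacts n).upper.exists_trace (xcl_zero _) (fun _ => xcl_of_lt _)).choose_spec.2 m

/-- The pushforward `H_{k,k+1} → H_k`. -/
def trDown (N : ℕ) (n : ℤ) : (stepAt N n).A →+ ring (ofWeight N n) :=
  ((stepFacts n).lower.exists_trace (ycl_zero _) (fun _ => ycl_of_lt _)).choose

theorem trDown_mul (n : ℤ) (s) (a) : trDown N n ((stepAt N n).left s * a) = s * trDown N n a :=
  ((stepFacts n).lower.exists_trace (ycl_zero _) (fun _ => ycl_of_lt _)).choose_spec.1 s a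

theorem trDown_pow (n : ℤ) (m : ℕ) : trDown N n ((stepAt N n).xi ^ m) =
    signed (Xcl (ofWeight N n)) (m + 1 - (N - kAt N n : ℕ)) :=
  ((stepFacts n).lower.exists_trace (ycl_zero _) (fun _ => ycl_of_lt _)).choose_spec.2 m

end Step

/-! ### Tensor products of rings over a ring -/

section PushoutRing

variable {S A B : Type} [CommRing S] [CommRing A] [CommRing B]

/-- The ring `A ⊗_S B` for two ring maps `A ← S → B`. -/
def PushoutRing (p : S →+* A) (q : S →+* B) : Type :=
  @TensorProduct S _ A B _ _ p.toAlgebra.toModule q.toAlgebra.toModule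

namespace PushoutRing

variable (p : S →+* A) (q : S →+* B)

instance : CommRing (PushoutRing p q) :=
  @Algebra.TensorProduct.instCommRing S A B _ _ p.toAlgebra _ q.toAlgebra

/-- The map of the left factor. -/
def inl : A →+* PushoutRing p q :=
  letI := p.toAlgebra
  letI := q.toAlgebra
  (Algebra.TensorProduct.includeLeft (R := S) (S := S) (A := A) (B := B)).toRingHom

/-- The map of the right factor. -/
def inr : B →+* PushoutRing p q :=
  letI := p.toAlgebra
  letI := q.toAlgebra
  (Algebra.TensorProduct.includeRight (R := S) (A := A) (B := B)).toRingHom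

theorem inl_comp (s : S) : inl p q (p s) = inr p q (q s) := by
  let := p.toAlgebra
  let := q.toAlgebra
  have h := (Algebra.TensorProduct.includeLeft (R := S) (S := S) (A := A) (B := B)).commutes s
  have h' := (Algebra.TensorProduct.includeRight (R := S) (A := A) (B := B)).commutes s
  exact h.trans h'.symm

/-- The universal property of the underlying group of `A ⊗_S B`. -/
def lift {M : Type*} [AddCommGroup M] (f : A →+ B →+ M)
    (hf : ∀ a s b, f (p s * a) b = f a (q s * b)) : PushoutRing p q →+ M :=
  letI := p.toAlgebra
  letI := q.toAlgebra
  TensorProduct.liftAddHom f (fun s a b => by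
    rw [Algebra.smul_def, Algebra.smul_def]
    exact hf a s b)

theorem lift_mul {M : Type*} [AddCommGroup M] (f : A →+ B →+ M)
    (hf : ∀ a s b, f (p s * a) b = f a (q s * b)) (a : A) (b : B) :
    lift p q f hf (inl p q a * inr p q b) = f a b := by
  let := p.toAlgebra
  let := q.toAlgebra
  have : inl p q a * inr p q b = (a ⊗ₜ[S] b : A ⊗[S] B) :=
    (Algebra.TensorProduct.tmul_mul_tmul a 1 1 b).trans (by rw [mul_one, one_mul])
  rw [this]
  rfl

theorem induction {P : PushoutRing p q → Prop} (h0 : P 0)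
    (ht : ∀ a b, P (inl p q a * inr p q b)) (hadd : ∀ x y, P x → P y → P (x + y))
    (x : PushoutRing p q) : P x := by
  let := p.toAlgebra
  let := q.toAlgebra
  refine TensorProduct.induction_on (motive := P) x h0 (fun a b => ?_) hadd
  have : inl p q a * inr p q b = (a ⊗ₜ[S] b : A ⊗[S] B) :=
    (Algebra.TensorProduct.tmul_mul_tmul a 1 1 b).trans (by rw [mul_one, one_mul])
  rw [← this]
  exact ht a b

end PushoutRing

end PushoutRing

end EqFlagRep
end

noncomputable section

namespace EqFlagRep

/-! ### Frobenius extensions -/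

section Frob

open Polynomial PushoutRing

variable {S S' A : Type} [CommRing S] [CommRing S'] [CommRing A]

theorem map_neg_one_pow_mul {B C : Type*} [Ring B] [Ring C] (φ : B →+ C) (j : ℕ) (b : B) :
    φ ((-1) ^ j * b) = (-1) ^ j * φ b := by
  rcases Nat.even_or_odd j with h | h <;> simp [h.neg_one_pow]

/-- Two rings `S → A ← S'` such that `A` is obtained from `S` by splitting off the root `ξ` of a
polynomial with coefficients `x`, the other factor having coefficients `x'`. The classes `y` and
`y'` are those of the complementary polynomials. -/
structure FrobStep (r : S →+* A) (l : S' →+* A) (ξ : A) (x y : ℕ → S) (d : ℕ) (x' y' : ℕ → S')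
    (e : ℕ) : Prop where
  ext : RootExt r ξ x d
  x'_zero : x' 0 = 1
  y'_zero : y' 0 = 1
  fac : (cpoly x d).map r = (cpoly x' e).map l * (X - C ξ)
  degen : Subsingleton A ∨ d = e + 1
  rel_x : ∀ j, r (x (j + 1)) = l (x' (j + 1)) + ξ * l (x' j)
  rel_y : ∀ j, l (y' (j + 1)) = r (y (j + 1)) + ξ * r (y j)
  gen : ∀ T : Subring S', (∀ f : ℚ →+* S', ∀ q, f q ∈ T) → (∀ j, x' j ∈ T) → (∀ j, y' j ∈ T) →
    ∀ s, s ∈ T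

namespace FrobStep

variable {r : S →+* A} {l : S' →+* A} {ξ : A} {x y : ℕ → S} {d : ℕ} {x' y' : ℕ → S'} {e : ℕ}

/-- The dual element `∑ (-1)^j x'_j ⊗ ξ^{e-j}`. -/
def dual (r : S →+* A) (l : S' →+* A) (ξ : A) (x' : ℕ → S') (e : ℕ) : PushoutRing r r :=
  ∑ j ∈ Finset.range (e + 1), (-1) ^ j * (inl r r (l (x' j)) * inr r r (ξ ^ (e - j)))

/-- Identifies the dual element as the cofactor of `X - ξ`, with coefficients in the left copy and
evaluated at the root of the right copy. -/
theorem dual_eq (r : S →+* A) (l : S' →+* A) (ξ : A) (x' : ℕ → S') (e : ℕ) :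
    dual r l ξ x' e = (((cpoly x' e).map l).map (inl r r)).eval (inr r r ξ) := by
  rw [Polynomial.map_map, eval_map_cpoly, dual]
  refine Finset.sum_congr rfl fun j _ => ?_
  rw [map_pow, RingHom.comp_apply]
  ring

/-- The difference of the two roots times the cofactor is the full polynomial at the right root. Its
coefficients come from the base ring, so they may be moved to the right copy, where the polynomial
vanishes. -/
theorem dual_slide (h : FrobStep r l ξ x y d x' y' e) :
    inl r r ξ * dual r l ξ x' e = inr r r ξ * dual r l ξ x' e := by
  have e1 : (((cpoly x d).map r).map (inl r r)).eval (inr r r ξ) = 0 := by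
    have : (inl r r).comp r = (inr r r).comp r := RingHom.ext (inl_comp r r)
    rw [Polynomial.map_map, this, Polynomial.eval_map, ← Polynomial.hom_eval₂, h.ext.root, map_zero]
  rw [h.fac, Polynomial.map_mul, eval_mul, ← dual_eq, Polynomial.map_sub, map_X, map_C, eval_sub,
    eval_X, eval_C] at e1
  linear_combination -e1

/-- Both sides are the divided difference of the characteristic polynomial at the two roots, and
divided differences are symmetric. This yields the two formulas for each cup. -/
theorem dual_symm (h : FrobStep r l ξ x y d x' y' e) :
    dual r l ξ x' e =
    ∑ j ∈ Finset.range (e + 1), (-1) ^ j * (inl r r (ξ ^ (e - j)) * inr r r (l (x' j))) := by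
  have e1 : (inl r r).comp r = (inr r r).comp r := RingHom.ext (inl_comp r r)
  have e2 : dual r l ξ x' e = (((cpoly x' e).map l).map (inr r r)).eval (inl r r ξ) := by
    rw [dual_eq, ← dd_X_sub_C_mul (inl r r ξ), dd_symm, ← dd_X_sub_C_mul (inr r r ξ)]
    have := congrArg (fun p => dd (inr r r ξ) (inl r r ξ) (p.map (inl r r))) h.fac
    simp only [Polynomial.map_map, e1] at this
    rw [← Polynomial.map_map, h.fac] at this
    simpa only [Polynomial.map_mul, Polynomial.map_sub, map_X, map_C, mul_comm,
      Polynomial.map_map] using this.symm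
  rw [e2, Polynomial.map_map, eval_map_cpoly]
  refine Finset.sum_congr rfl fun j _ => ?_
  rw [map_pow, RingHom.comp_apply]
  ring

/-- The scalars that satisfy this form a subring. Its generators are reached recursively, since each
class of `S'` is a combination of classes of `S`, which are balanced, and of `ξ`, which slides. This
gives the missing linearity of the cups. -/
theorem dual_central (h : FrobStep r l ξ x y d x' y' e) (s : S') :
    inl r r (l s) * dual r l ξ x' e = inr r r (l s) * dual r l ξ x' e := by
  set θ := dual r l ξ x' e
  have hθ : inl r r ξ * θ = inr r r ξ * θ := h.dual_slide
  let T : Subring S' :=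
    { carrier := {s | inl r r (l s) * θ = inr r r (l s) * θ}
      one_mem' := by simp
      zero_mem' := by simp
      add_mem' := fun {a b} ha hb => by
        change _ = _ at ha hb
        change inl r r (l (a + b)) * θ = inr r r (l (a + b)) * θ
        simp only [map_add]
        linear_combination ha + hb
      mul_mem' := fun {a b} ha hb => by
        change _ = _ at ha hb
        change inl r r (l (a * b)) * θ = inr r r (l (a * b)) * θ
        simp only [map_mul]
        linear_combination inl r r (l b) * ha + inr r r (l a) * hb
      neg_mem' := fun {a} ha => by
        change _ = _ at ha
        change inl r r (l (-a)) * θ = inr r r (l (-a)) * θ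
        simp only [map_neg]
        linear_combination -ha }
  refine h.gen T (fun f q => ?_) (fun j => ?_) (fun j => ?_) s
  · change inl r r (l (f q)) * θ = inr r r (l (f q)) * θ
    have := Subsingleton.elim (((inl r r).comp l).comp f) (((inr r r).comp l).comp f)
    exact congrArg (fun g : ℚ →+* PushoutRing r r => g q * θ) this
  · induction j with
    | zero => rw [h.x'_zero]; exact one_mem T
    | succ j ih =>
      change inl r r (l (x' j)) * θ = inr r r (l (x' j)) * θ at ih
      change inl r r (l (x' (j + 1))) * θ = inr r r (l (x' (j + 1))) * θ
      have e0 : l (x' (j + 1)) = r (x (j + 1)) - ξ * l (x' j) := by rw [h.rel_x]; ring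
      rw [e0]
      simp only [map_sub, map_mul, inl_comp]
      linear_combination -inl r r ξ * ih - inr r r (l (x' j)) * hθ
  · cases j with
    | zero => rw [h.y'_zero]; exact one_mem T
    | succ j =>
      change inl r r (l (y' (j + 1))) * θ = inr r r (l (y' (j + 1))) * θ
      rw [h.rel_y]
      simp only [map_add, map_mul, inl_comp]
      linear_combination inr r r (r (y j)) * hθ

/-- A trace on `A`, with the complete symmetric functions as values. -/
structure IsTrace (r : S →+* A) (ξ : A) (x : ℕ → S) (d : ℕ) (t : A →+ S) : Prop where
  mul : ∀ s a, t (r s * a) = s * t a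
  pow : ∀ m : ℕ, t (ξ ^ m) = signed (invCoeff x) (m + 1 - d)

theorem IsTrace.exists_pairing {t : A →+ S} (ht : IsTrace r ξ x d t) (a : A) :
    ∃ φ : PushoutRing r r →+ A, ∀ p q, φ (inl r r p * inr r r q) = p * r (t (q * a)) := by
  refine ⟨PushoutRing.lift r r (AddMonoidHom.mk' (fun p => AddMonoidHom.mk'
    (fun q => p * r (t (q * a))) ?_) ?_) ?_, fun p q => lift_mul _ _ _ _ p q⟩
  · intro u v; simp only [add_mul, map_add, mul_add]
  · intro u v; ext q; simp only [AddMonoidHom.mk'_apply, AddMonoidHom.add_apply, add_mul]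
  · intro u s v
    simp only [AddMonoidHom.mk'_apply]
    rw [mul_assoc (r s) v, ht.mul, map_mul r]
    ring

/-- The dual element is dual with respect to the trace. -/
theorem pairing_dual (h : FrobStep r l ξ x y d x' y' e) {t : A →+ S}
    (ht : IsTrace r ξ x d t) (a : A) (ψ : PushoutRing r r →+ A)
    (hψ : ∀ p q, ψ (inl r r p * inr r r q) = p * r (t (q * a))) : ψ (dual r l ξ x' e) = a := by
  choose φ hφ using ht.exists_pairing
  have hψφ : ψ = φ a := by
    ext w
    induction w using PushoutRing.induction with
    | h0 => simp
    | hadd u v hu hv => simp only [map_add, hu, hv]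
    | ht p q => rw [hφ, hψ]
  have hl : ∀ a w, φ a (inl r r ξ * w) = ξ * φ a w := by
    intro a w
    induction w using PushoutRing.induction with
    | h0 => simp
    | hadd u v hu hv => simp only [mul_add, map_add, hu, hv]
    | ht p q => rw [← mul_assoc, ← map_mul, hφ, hφ, mul_assoc]
  have hr : ∀ a w, φ a (inr r r ξ * w) = φ (ξ * a) w := by
    intro a w
    induction w using PushoutRing.induction with
    | h0 => simp
    | hadd u v hu hv => simp only [mul_add, map_add, hu, hv]
    | ht p q => rw [mul_left_comm, ← map_mul, hφ, hφ]; congr 3; ring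
  have hrs : ∀ s a w, φ (r s * a) w = r s * φ a w := by
    intro s a w
    induction w using PushoutRing.induction with
    | h0 => simp
    | hadd u v hu hv => simp only [mul_add, map_add, hu, hv]
    | ht p q => rw [hφ, hφ, mul_left_comm, ht.mul, map_mul]; ring
  -- Only `j = 0` contributes: with `d = e + 1` the trace vanishes on `ξ^i` for `i < e` and equals
  -- `1` on `ξ^e`.
  have h1 : φ 1 (dual r l ξ x' e) = 1 := by
    rcases h.degen with h0 | h0
    · exact Subsingleton.elim _ _
    · rw [dual, map_sum]
      simp only [map_neg_one_pow_mul, hφ, mul_one]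
      rw [Finset.sum_range_succ', Finset.sum_eq_zero]
      · have := ht.pow e
        rw [h0, show ((e : ℤ) + 1 - ((e + 1 : ℕ) : ℤ)) = 0 by push_cast; ring,
          signed_invCoeff_zero] at this
        simp [h.x'_zero, this]
      · intro j hj
        rw [ht.pow, signed_of_neg]
        · simp
        · have := Finset.mem_range.1 hj
          omega
  -- Multiplying by the right root replaces `a` by `ξ * a`, multiplying by the left root multiplies
  -- the result; on the dual element the two agree.
  have hpow : ∀ i, φ (ξ ^ i) (dual r l ξ x' e) = ξ ^ i := by
    intro i
    induction i with
    | zero => rw [pow_zero, h1]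
    | succ i ih => rw [pow_succ', ← hr, ← h.dual_slide, hl, ih]
  have hadd : ∀ a b w, φ (a + b) w = φ a w + φ b w := by
    intro a b w
    induction w using PushoutRing.induction with
    | h0 => simp
    | hadd u v hu hv => rw [map_add, map_add, map_add, hu, hv]; abel
    | ht p q => rw [hφ, hφ, hφ, mul_add, map_add, map_add, mul_add]
  let G : AddSubgroup A :=
    (AddMonoidHom.mk' (fun a => φ a (dual r l ξ x' e) - a) (fun a b => by
      simp only [hadd]; abel)).ker
  have : a ∈ G := by
    refine h.ext.span G (fun i _ s => ?_) a
    change φ _ _ - _ = 0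
    rw [hrs, hpow, sub_self]
  rw [hψφ]
  exact sub_eq_zero.1 this

/-- Expansion of `a` in dual bases. This and the version with the other form of the dual element are
the zigzag identities, written in `A`. -/
theorem sum_dual (h : FrobStep r l ξ x y d x' y' e) {t : A →+ S}
    (ht : IsTrace r ξ x d t) (a : A) :
    ∑ j ∈ Finset.range (e + 1), (-1) ^ j * (l (x' j) * r (t (ξ ^ (e - j) * a))) = a := by
  obtain ⟨φ, hφ⟩ := ht.exists_pairing a
  have := h.pairing_dual ht a φ hφ
  rw [dual, map_sum] at this
  simpa only [map_neg_one_pow_mul, hφ] using this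

theorem sum_dual_symm (h : FrobStep r l ξ x y d x' y' e) {t : A →+ S}
    (ht : IsTrace r ξ x d t) (a : A) :
    ∑ j ∈ Finset.range (e + 1), (-1) ^ j * (ξ ^ (e - j) * r (t (l (x' j) * a))) = a := by
  obtain ⟨φ, hφ⟩ := ht.exists_pairing a
  have := h.pairing_dual ht a φ hφ
  rw [h.dual_symm, map_sum] at this
  simpa only [map_neg_one_pow_mul, hφ] using this

end FrobStep

variable {N : ℕ} {o o' : Option (Fin (N + 1))} {c : Cospan (ring o) (ring o')}

theorem ring_gen (o : Option (Fin (N + 1))) (T : Subring (ring o))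
    (hC : ∀ f : ℚ →+* ring o, ∀ q, f q ∈ T) (hx : ∀ j, xcl o j ∈ T) (hy : ∀ j, ycl o j ∈ T)
    (s : ring o) : s ∈ T := ring_subring o T (hC (ratHom o)) hx hy s

/-- The extension `H_{k+1} → H_{k,k+1}`, responsible for `η` and `ε`. -/
theorem CospanFacts.frobUp (h : CospanFacts o o' c) :
    FrobStep c.right c.left c.xi (xcl o') (ycl o') (idx o') (xcl o) (ycl o) (idx o) where
  ext := h.upper
  x'_zero := xcl_zero _
  y'_zero := ycl_zero _
  fac := h.map_x
  degen := h.degen.imp_right fun h => h.1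
  rel_x := h.right_xcl
  rel_y := h.left_ycl
  gen := ring_gen _

/-- The extension `H_k → H_{k,k+1}`, responsible for `ε̂` and `η̂`. It is the previous one with `x`
and `y`, left and right, exchanged, so one theory serves both adjunctions. -/
theorem CospanFacts.frobDown (h : CospanFacts o o' c) :
    FrobStep c.left c.right c.xi (ycl o) (xcl o) (N - idx o) (ycl o') (xcl o') (N - idx o') where
  ext := h.lower
  x'_zero := ycl_zero _
  y'_zero := xcl_zero _
  fac := h.map_y
  degen := h.degen.imp_right fun h => by omega
  rel_x := h.left_ycl
  rel_y := h.right_xcl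
  gen T hC hy hx := ring_gen _ T hC hx hy

end Frob

end EqFlagRep
end

noncomputable section

namespace EqFlagRep

/-! ### The divided difference operator on two step flags -/

section Demazure

open Polynomial PushoutRing

variable {N : ℕ} {o o' o'' : Option (Fin (N + 1))} {c : Cospan (ring o) (ring o')}
  {c' : Cospan (ring o') (ring o'')}

/-- The ring of the two step flags. -/
abbrev TwoStep (c : Cospan (ring o) (ring o')) (c' : Cospan (ring o') (ring o'')) : Type :=
  PushoutRing c.right c'.left

/-- The first root. -/
abbrev TwoStep.xi₁ (c : Cospan (ring o) (ring o')) (c' : Cospan (ring o') (ring o'')) :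
    TwoStep c c' := inl c.right c'.left c.xi

/-- The second root. -/
abbrev TwoStep.xi₂ (c : Cospan (ring o) (ring o')) (c' : Cospan (ring o') (ring o'')) :
    TwoStep c c' := inr c.right c'.left c'.xi

open TwoStep

/-- The map from the first ring to the ring of the two step flags. -/
abbrev TwoStep.fst (c : Cospan (ring o) (ring o')) (c' : Cospan (ring o') (ring o'')) :
    ring o →+* TwoStep c c' := (inl c.right c'.left).comp c.left

/-- The map from the last ring to the ring of the two step flags. -/
abbrev TwoStep.lst (c : Cospan (ring o) (ring o')) (c' : Cospan (ring o') (ring o'')) :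
    ring o'' →+* TwoStep c c' := (inr c.right c'.left).comp c'.right

theorem dd_two_roots {A : Type} [CommRing A] (a b : A) (H : A[X]) :
    dd a b (H * (X - C a) * (X - C b)) = 0 := by
  rw [show H * (X - C a) * (X - C b) = (X - C a) * (H * (X - C b)) by ring, dd_X_sub_C_mul]
  simp

/-- The factor that remains after splitting off the first root lives over the middle ring, so it can
be moved to the second tensor factor and split again. -/
theorem map_ycl_two (h : CospanFacts o o' c) (h' : CospanFacts o' o'' c') :
    (cpoly (ycl o) (N - idx o)).map (fst c c') =
      (cpoly (ycl o'') (N - idx o'')).map (lst c c') * (X - C (xi₁ c c')) * (X - C (xi₂ c c')) := by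
  have e1 : (inl c.right c'.left).comp c.right = (inr c.right c'.left).comp c'.left :=
    RingHom.ext (inl_comp _ _)
  rw [fst, ← Polynomial.map_map, h.map_y, Polynomial.map_mul, Polynomial.map_map, e1,
    ← Polynomial.map_map, h'.map_y, Polynomial.map_mul, Polynomial.map_map]
  simp only [Polynomial.map_sub, map_X, map_C]
  ring

theorem map_xcl_two (h : CospanFacts o o' c) (h' : CospanFacts o' o'' c') :
    (cpoly (xcl o'') (idx o'')).map (lst c c') =
      (cpoly (xcl o) (idx o)).map (fst c c') * (X - C (xi₁ c c')) * (X - C (xi₂ c c')) := by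
  have e1 : (inl c.right c'.left).comp c.right = (inr c.right c'.left).comp c'.left :=
    RingHom.ext (inl_comp _ _)
  rw [lst, ← Polynomial.map_map, h'.map_x, Polynomial.map_mul, Polynomial.map_map, ← e1,
    ← Polynomial.map_map, h.map_x, Polynomial.map_mul, Polynomial.map_map]
  simp only [Polynomial.map_sub, map_X, map_C]

theorem demazure_add_left {A : Type} [CommRing A] (a b : A) (F F' G : A[X]) :
    demazure a b (F + F') G = demazure a b F G + demazure a b F' G := by
  simp only [demazure, eval_add, map_add]; ring

theorem demazure_add_right {A : Type} [CommRing A] (a b : A) (F G G' : A[X]) :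
    demazure a b F (G + G') = demazure a b F G + demazure a b F G' := by
  simp only [demazure, eval_add, map_add]; ring

/-- The first factor is presented over the first ring and the second factor over the last ring,
because scalars from these two are symmetric in the roots and pass through the divided difference.
Both defining polynomials contain `(X - ξ₁)(X - ξ₂)`, so the operator descends in each variable
separately. -/
theorem exists_demazure (h : CospanFacts o o' c) (h' : CospanFacts o' o'' c') :
    ∃ u : c.A →+ c'.A →+ TwoStep c c', ∀ (F : (ring o)[X]) (G : (ring o'')[X]),
      u (F.eval₂ c.left c.xi) (G.eval₂ c'.right c'.xi) =
        demazure (xi₁ c c') (xi₂ c c') (F.map (fst c c')) (G.map (lst c c')) := by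
  let f : (ring o)[X] →+ (ring o'')[X] →+ TwoStep c c' :=
    AddMonoidHom.mk' (fun F => AddMonoidHom.mk'
      (fun G => demazure (xi₁ c c') (xi₂ c c') (F.map (fst c c')) (G.map (lst c c')))
      (fun G G' => by rw [Polynomial.map_add, demazure_add_right]))
      (fun F F' => by
        refine AddMonoidHom.ext fun G => ?_
        simp only [AddMonoidHom.mk'_apply, AddMonoidHom.add_apply]
        rw [Polynomial.map_add, demazure_add_left])
  obtain ⟨t, ht⟩ := h.lower.exists_desc f (fun F => by
    refine AddMonoidHom.ext fun G => ?_
    change demazure _ _ _ _ = 0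
    rw [Polynomial.map_mul, map_ycl_two h h']
    refine demazure_mul_left _ _ _ _ _ (by simp) (by simp) (dd_two_roots _ _ _))
  obtain ⟨t', ht'⟩ := h'.upper.exists_desc t.flip (fun G => by
    refine AddMonoidHom.ext fun a => ?_
    obtain ⟨F, rfl⟩ := h.lower.exists_poly a
    rw [AddMonoidHom.flip_apply, ht]
    change demazure _ _ _ _ = 0
    rw [Polynomial.map_mul, map_xcl_two h h']
    exact demazure_mul_right _ _ _ _ _ (by simp) (dd_two_roots _ _ _))
  refine ⟨t'.flip, fun F G => ?_⟩
  rw [AddMonoidHom.flip_apply, ht', AddMonoidHom.flip_apply, ht]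
  rfl

/-- The properties of the divided difference operator. -/
structure IsDemazure (c : Cospan (ring o) (ring o')) (c' : Cospan (ring o') (ring o''))
    (u : c.A →+ c'.A →+ TwoStep c c') : Prop where
  left_mul : ∀ r a b, u (c.left r * a) b = fst c c' r * u a b
  right_mul : ∀ s a b, u a (c'.right s * b) = lst c c' s * u a b
  xi_left : ∀ a b, u (c.xi * a) b = (xi₁ c c' + xi₂ c c') * u a b - u a (c'.xi * b)
  xi_right : ∀ a b, u a (c'.xi * b) =
    xi₁ c c' * u a b + inl c.right c'.left a * inr c.right c'.left b
  one : u 1 1 = 0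
  bal : ∀ a s b, u (c.right s * a) b = u a (c'.left s * b)
  pow : ∀ m n, u (c.xi ^ m) (c'.xi ^ n) =
    ∑ j ∈ Finset.range n, inl c.right c'.left (c.xi ^ j) *
        inr c.right c'.left (c'.xi ^ (m + n - 1 - j)) -
      ∑ j ∈ Finset.range m, inl c.right c'.left (c.xi ^ j) *
        inr c.right c'.left (c'.xi ^ (m + n - 1 - j))

theorem demazure_X_right {A : Type} [CommRing A] (a b : A) (F G : A[X]) :
    demazure a b F (X * G) = a * demazure a b F G + F.eval a * G.eval b := by
  have := dd_mul_self a b G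
  simp only [demazure, dd_X_mul, eval_mul, eval_X]
  linear_combination -F.eval a * this

theorem demazure_C_left {A : Type} [CommRing A] (a b r : A) (F G : A[X]) :
    demazure a b (C r * F) G = r * demazure a b F G := by
  simp only [demazure, eval_mul, eval_C, dd_mul, dd_C]
  ring

theorem demazure_C_right {A : Type} [CommRing A] (a b r : A) (F G : A[X]) :
    demazure a b F (C r * G) = r * demazure a b F G := by
  simp only [demazure, eval_mul, eval_C, dd_mul, dd_C]
  ring

theorem exists_isDemazure (h : CospanFacts o o' c) (h' : CospanFacts o' o'' c') :
    ∃ u, IsDemazure c c' u := by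
  obtain ⟨u, hu⟩ := exists_demazure h h'
  have hF := h.lower.exists_poly
  have hG := h'.upper.exists_poly
  have left_mul : ∀ r a b, u (c.left r * a) b = fst c c' r * u a b := by
    intro r a b
    obtain ⟨F, rfl⟩ := hF a
    obtain ⟨G, rfl⟩ := hG b
    rw [hu, ← demazure_C_left, ← Polynomial.map_C, ← Polynomial.map_mul, ← hu, eval₂_mul, eval₂_C]
  have right_mul : ∀ s a b, u a (c'.right s * b) = lst c c' s * u a b := by
    intro r a b
    obtain ⟨F, rfl⟩ := hF a
    obtain ⟨G, rfl⟩ := hG b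
    rw [hu, ← demazure_C_right, ← Polynomial.map_C, ← Polynomial.map_mul, ← hu, eval₂_mul, eval₂_C]
  have hXF : ∀ F : (ring o)[X], c.xi * F.eval₂ c.left c.xi = (X * F).eval₂ c.left c.xi := by
    intro F; rw [eval₂_mul, eval₂_X]
  have hXG : ∀ G : (ring o'')[X], c'.xi * G.eval₂ c'.right c'.xi =
      (X * G).eval₂ c'.right c'.xi := by
    intro F; rw [eval₂_mul, eval₂_X]
  have xi_xi : ∀ a b, u (c.xi * a) (c'.xi * b) = xi₁ c c' * xi₂ c c' * u a b := by
    intro a b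
    obtain ⟨F, rfl⟩ := hF a
    obtain ⟨G, rfl⟩ := hG b
    rw [hXF, hXG, hu, hu, Polynomial.map_mul, Polynomial.map_mul, map_X, map_X, demazure_X_X]
  have xi_left : ∀ a b, u (c.xi * a) b = (xi₁ c c' + xi₂ c c') * u a b - u a (c'.xi * b) := by
    intro a b
    obtain ⟨F, rfl⟩ := hF a
    obtain ⟨G, rfl⟩ := hG b
    rw [hXF, hXG, hu, hu, hu, Polynomial.map_mul, Polynomial.map_mul, map_X, map_X,
      demazure_X_left]
  have xi_right : ∀ a b, u a (c'.xi * b) =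
      xi₁ c c' * u a b + inl c.right c'.left a * inr c.right c'.left b := by
    intro a b
    obtain ⟨F, rfl⟩ := hF a
    obtain ⟨G, rfl⟩ := hG b
    rw [hXG, hu, hu, Polynomial.map_mul, map_X, demazure_X_right, Polynomial.hom_eval₂,
      Polynomial.hom_eval₂, Polynomial.eval_map, Polynomial.eval_map]
  have e1 := inl_comp c.right c'.left
  refine ⟨u, left_mul, right_mul, xi_left, xi_right, ?_, ?_, ?_⟩
  · have := hu 1 1
    rw [eval₂_one, eval₂_one] at this
    rw [this, Polynomial.map_one, Polynomial.map_one, ← C_1]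
    simp [demazure]
  -- Compatibility with the middle ring is invisible in the chosen presentation. The scalars that
  -- satisfy it form a subring, so constants and the classes `x_j`, `y_j` are enough.
  · let T : Subring (ring o') :=
      { carrier := {s | ∀ a b, u (c.right s * a) b = u a (c'.left s * b)}
        one_mem' := fun a b => by simp
        zero_mem' := fun a b => by simp
        add_mem' := fun {s s'} hs hs' a b => by
          simp only [map_add, add_mul, AddMonoidHom.add_apply]
          rw [hs, hs']
        mul_mem' := fun {s s'} hs hs' a b => by
          simp only [map_mul, mul_assoc]
          rw [hs, hs', mul_left_comm]
        neg_mem' := fun {s} hs a b => by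
          simp only [map_neg, neg_mul, AddMonoidHom.neg_apply]
          rw [hs] }
    intro a s b
    refine ring_gen o' T (fun f q => ?_) (fun j => ?_) (fun j => ?_) s a b
    · intro a b
      -- Rational constants may be regarded as coming from either outer ring.
      have e2 := Subsingleton.elim (c.right.comp f) (c.left.comp (ratHom o))
      have e3 := Subsingleton.elim (c'.left.comp f) (c'.right.comp (ratHom o''))
      have e4 := Subsingleton.elim ((fst c c').comp (ratHom o)) ((lst c c').comp (ratHom o''))
      have e2' : c.right (f q) = c.left (ratHom o q) := DFunLike.congr_fun e2 q
      have e3' : c'.left (f q) = c'.right (ratHom o'' q) := DFunLike.congr_fun e3 q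
      have e4' : fst c c' (ratHom o q) = lst c c' (ratHom o'' q) := DFunLike.congr_fun e4 q
      rw [e2', e3', left_mul, right_mul, e4']
    · induction j with
      | zero => rw [xcl_zero]; exact one_mem T
      | succ j ih =>
        intro a b
        -- The classes of the last ring are `x_{j+1} + (ξ₁ + ξ₂) x_j + ξ₁ ξ₂ x_{j-1}` in terms of
        -- those of the first. The variable `z` stands for the last summand, absent when `j = 0`.
        have key : ∀ z : TwoStep c c', (∀ a b, u (c.right (xcl o' j) * a) (c'.xi * b) =
            fst c c' (xcl o j) * u a (c'.xi * b) + z * u a b) →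
            lst c c' (xcl o'' (j + 1)) = fst c c' (xcl o (j + 1)) +
              (xi₁ c c' + xi₂ c c') * fst c c' (xcl o j) + z →
            u (c.right (xcl o' (j + 1)) * a) b = u a (c'.left (xcl o' (j + 1)) * b) := by
          intro z hz hz'
          have f1 : c'.left (xcl o' (j + 1)) * b =
              c'.right (xcl o'' (j + 1)) * b - c'.left (xcl o' j) * (c'.xi * b) := by
            rw [h'.right_xcl]; ring
          rw [f1, map_sub, ← ih, hz, h.right_xcl, add_mul, map_add, AddMonoidHom.add_apply,
            left_mul, right_mul, hz', show c.xi * c.left (xcl o j) * a =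
              c.left (xcl o j) * (c.xi * a) by ring, left_mul, xi_left]
          ring
        cases j with
        | zero =>
          refine key 0 (fun a b => ?_) ?_
          · simp only [xcl_zero, map_one, one_mul, zero_mul, add_zero]
          · simp only [xcl_zero, map_one, mul_one, add_zero]
            change inr _ _ _ = inl _ _ _ + _
            have f2 := h.right_xcl 0
            have f3 := h'.right_xcl 0
            simp only [xcl_zero, map_one, mul_one] at f2 f3
            have f4 := e1 (xcl o' (0 + 1))
            rw [f2, map_add] at f4
            rw [f3, map_add]
            linear_combination -f4
        | succ j =>
          refine key (xi₁ c c' * xi₂ c c' * fst c c' (xcl o j)) (fun a b => ?_) ?_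
          · rw [h.right_xcl, add_mul, map_add, AddMonoidHom.add_apply, left_mul, mul_assoc,
              xi_xi, left_mul]
            ring
          · change inr _ _ _ = inl _ _ _ + _ * inl _ _ _ + _ * inl _ _ _
            have f2 := congrArg (inl c.right c'.left) (h.right_xcl (j + 1))
            have f2' := congrArg (inl c.right c'.left) (h.right_xcl j)
            rw [e1] at f2 f2'
            rw [h'.right_xcl]
            simp only [map_add, map_mul] at f2 f2' ⊢
            linear_combination f2 + xi₂ c c' * f2'
    · induction j with
      | zero => rw [ycl_zero]; exact one_mem T
      | succ j ih =>
        intro a b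
        -- The same argument for the classes `y_j`, with the roles of the first and the last ring
        -- exchanged.
        have key : ∀ z : TwoStep c c', (∀ a b, u (c.xi * a) (c'.left (ycl o' j) * b) =
            lst c c' (ycl o'' j) * u (c.xi * a) b + z * u a b) →
            fst c c' (ycl o (j + 1)) = lst c c' (ycl o'' (j + 1)) +
              (xi₁ c c' + xi₂ c c') * lst c c' (ycl o'' j) + z →
            u (c.right (ycl o' (j + 1)) * a) b = u a (c'.left (ycl o' (j + 1)) * b) := by
          intro z hz hz'
          have f1 : c.right (ycl o' (j + 1)) * a =
              c.left (ycl o (j + 1)) * a - c.right (ycl o' j) * (c.xi * a) := by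
            rw [h.left_ycl]; ring
          rw [f1, map_sub, AddMonoidHom.sub_apply, ih, hz, h'.left_ycl, add_mul, map_add,
            left_mul, right_mul, hz', show c'.xi * c'.right (ycl o'' j) * b =
              c'.right (ycl o'' j) * (c'.xi * b) by ring, right_mul, xi_left]
          ring
        cases j with
        | zero =>
          refine key 0 (fun a b => ?_) ?_
          · simp only [ycl_zero, map_one, one_mul, zero_mul, add_zero]
          · simp only [ycl_zero, map_one, mul_one, add_zero]
            change inl _ _ _ = inr _ _ _ + _
            have f2 := h.left_ycl 0
            have f3 := h'.left_ycl 0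
            simp only [ycl_zero, map_one, mul_one] at f2 f3
            have f4 := e1 (ycl o' (0 + 1))
            rw [f3, map_add] at f4
            rw [f2, map_add]
            linear_combination f4
        | succ j =>
          refine key (xi₁ c c' * xi₂ c c' * lst c c' (ycl o'' j)) (fun a b => ?_) ?_
          · rw [h'.left_ycl, add_mul, map_add, right_mul, show c'.xi * c'.right (ycl o'' j) * b =
              c'.right (ycl o'' j) * (c'.xi * b) by ring, right_mul, xi_xi]
            ring
          · change inl _ _ _ = inr _ _ _ + _ * inr _ _ _ + _ * inr _ _ _
            have f2 := congrArg (inr c.right c'.left) (h'.left_ycl (j + 1))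
            have f2' := congrArg (inr c.right c'.left) (h'.left_ycl j)
            rw [← e1] at f2 f2'
            rw [h.left_ycl]
            simp only [map_add, map_mul] at f2 f2' ⊢
            linear_combination f2 + xi₁ c c' * f2'
  · intro m n
    have := hu (X ^ m) (X ^ n)
    rw [eval₂_X_pow, eval₂_X_pow, Polynomial.map_pow, Polynomial.map_pow, map_X, map_X,
      demazure_X_pow] at this
    rw [this]
    simp only [map_pow]

end Demazure

end EqFlagRep
end

noncomputable section

namespace EqFlagRep

/-! ### Generators of bimodules -/

namespace GrBimod

variable {R S T : GrRing}

/-- `X` generates `M` as a left module. -/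
def LGen (M : GrBimod R S) (X : Set M) : Prop :=
  ∀ G : AddSubgroup M, (∀ r, ∀ m ∈ G, M.lact r m ∈ G) → X ⊆ G → ∀ m, m ∈ G

/-- Scalars in front of a generator of `N` can be absorbed into the first factor, which is then
expanded in generators of `M`. -/
theorem LGen.tensor {M : GrBimod R S} {N : GrBimod S T} {X : Set M} {Y : Set N}
    (hX : LGen M X) (hY : LGen N Y) :
    LGen (GrBimod.tensor M N) (Set.image2 (fun m n => (tmul m n : Tens M N)) X Y) := by
  intro G hG hXY
  have h1 : ∀ y ∈ Y, ∀ m : M, (tmul m y : Tens M N) ∈ G := by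
    intro y hy
    refine hX (G.comap (AddMonoidHom.flip (tmulHom M N) y)) (fun r m hm => ?_) (fun x hx => ?_)
    · exact hG r _ hm
    · exact hXY ⟨x, hx, y, hy, rfl⟩
  have h2 : ∀ (n : N) (m : M), (tmul m n : Tens M N) ∈ G := by
    intro n
    -- All `m` are treated at once, since moving a scalar across the tensor sign changes `m`.
    have := hY (⨅ m : M, G.comap (tmulHom M N m)) (fun s n hn => ?_) (fun y hy => ?_) n
    · intro m
      exact (AddSubgroup.mem_iInf.1 this) m
    · rw [AddSubgroup.mem_iInf] at hn ⊢
      intro m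
      have := hn (M.ract s m)
      change (tmul (M.ract s m) n : Tens M N) ∈ G at this
      rw [tmul_bal] at this
      exact this
    · change y ∈ (⨅ m : M, G.comap (tmulHom M N m))
      rw [AddSubgroup.mem_iInf]
      exact h1 y hy
  intro x
  exact tens_induction (M := M) (N := N) (P := fun x => x ∈ G) (zero_mem G) (fun m n => h2 n m)
    (fun _ _ hx hy => add_mem hx hy) x

theorem LGen.hom_ext {M M' : GrBimod R S} {X : Set M} (hX : LGen M X) {f g : M →+ M'}
    (hf : f ∈ lin M M') (hg : g ∈ lin M M') (h : ∀ x ∈ X, f x = g x) : f = g := by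
  ext m
  refine hX (AddMonoidHom.eqLocus f g) (fun r m hm => ?_) h m
  change f _ = g _
  rw [hf.1, hg.1]
  exact congrArg _ hm

/-- The sum of the subgroups of homogeneous elements with image of the right degree is a submodule
containing the generators, hence everything. Projecting to degree `i` then recovers the claim for
each single homogeneous element. -/
theorem LGen.homog {M M' : GrBimod R S} {X : Set M} (hX : LGen M X) {f : M →+ M'}
    (hf : f ∈ lin M M') {d : ℤ} (h : ∀ x ∈ X, ∃ i, x ∈ M.gr i ∧ f x ∈ M'.gr (i + d)) :
    f ∈ homogMaps M M' d := by
  refine ⟨hf, ?_⟩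
  let H : ℤ → AddSubgroup M := fun i => M.gr i ⊓ (M'.gr (i + d)).comap f
  have htop : ∀ m, m ∈ ⨆ i, H i := by
    refine hX _ (fun r m hm => ?_) (fun x hx => ?_)
    · induction r using induction_gr R.isInternal with
      | h0 => rw [lact_zero]; exact zero_mem _
      | hadd a b ha hb => rw [lact_add]; exact add_mem ha hb
      | hom j r hr =>
        induction hm using AddSubgroup.iSup_induction' with
        | h1 => rw [map_zero]; exact zero_mem _
        | hadd x y _ _ hx hy => rw [map_add]; exact add_mem hx hy
        | hp i x hx =>
          refine AddSubgroup.mem_iSup_of_mem (j + i) ⟨M.lact_mem hr hx.1, ?_⟩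
          change f (M.lact r x) ∈ M'.gr (j + i + d)
          rw [hf.1, add_assoc]
          exact M'.lact_mem hr hx.2
    · obtain ⟨i, h1, h2⟩ := h x hx
      exact AddSubgroup.mem_iSup_of_mem i ⟨h1, h2⟩
  obtain ⟨p, -, -, h3⟩ := exists_proj M.isInternal
  have key : ∀ m, m ∈ ⨆ i, H i → ∀ i, p m i ∈ H i := by
    intro m hm i
    induction hm using AddSubgroup.iSup_induction' with
    | h1 => rw [map_zero]; exact zero_mem _
    | hadd x y _ _ hx hy => rw [map_add]; exact add_mem hx hy
    | hp j x hx =>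
      rw [h3 j x hx.1]
      by_cases e : j = i
      · subst e; rw [Finsupp.single_eq_same]; exact hx
      · rw [Finsupp.single_eq_of_ne' e]; exact zero_mem _
  intro i m hm
  have := key m (htop m) i
  rw [h3 i m hm, Finsupp.single_eq_same] at this
  exact this.2

end GrBimod

open GrBimod

/-! ### Elements of the bimodules -/

section Elements

variable {N : ℕ}

open FreeU

/-- Pure tensors in the bimodule of a composite. -/
def tm {a b c : FreeU} (f : a ⟶ b) (g : b ⟶ c) :
    bimod N f →+ bimod N g →+ bimod N (f ≫ g) :=
  tmulHom (bimod N f) (bimod N g)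

/-- Elements of the bimodule of an identity. -/
def eI (N : ℕ) (a : FreeU) : ring (ofWeight N a.wt) →+ bimod N (𝟙 a) := AddMonoidHom.id _

/-- Elements of the bimodule of `ℰ 1_n`. -/
def eE (N : ℕ) (n : ℤ) : (stepAt N n).A →+ bimod N (E n) := AddMonoidHom.id _

/-- Elements of the bimodule of `ℱ 1_{n+2}`. -/
def eF (N : ℕ) (n : ℤ) : (stepAt N n).A →+ bimod N (F n) := AddMonoidHom.id _

section Tm

variable {a b c : FreeU} (f : a ⟶ b) (g : b ⟶ c)

theorem tm_bal (m : bimod N f) (s : ring (ofWeight N b.wt)) (n : bimod N g) :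
    tm f g ((bimod N f).ract s m) n = tm f g m ((bimod N g).lact s n) :=
  tmul_bal (M := bimod N f) (N := bimod N g) m s n

theorem lact_tm (r : ring (ofWeight N a.wt)) (m : bimod N f) (n : bimod N g) :
    (bimod N (f ≫ g)).lact r (tm f g m n) = tm f g ((bimod N f).lact r m) n := rfl

theorem ract_tm (t : ring (ofWeight N c.wt)) (m : bimod N f) (n : bimod N g) :
    (bimod N (f ≫ g)).ract t (tm f g m n) = tm f g m ((bimod N g).ract t n) := rfl

variable {f g}

theorem tm_induction {P : bimod N (f ≫ g) → Prop} (h0 : P 0) (ht : ∀ m n, P (tm f g m n))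
    (hadd : ∀ x y, P x → P y → P (x + y)) (x : bimod N (f ≫ g)) : P x :=
  tens_induction (M := bimod N f) (N := bimod N g) h0 ht hadd x

theorem tm_mem {i j d : ℤ} {m : bimod N f} {n : bimod N g} (hd : i + j = d)
    (hm : m ∈ (bimod N f).gr i) (hn : n ∈ (bimod N g).gr j) :
    tm f g m n ∈ (bimod N (f ≫ g)).gr d := tmul_mem hd hm hn

variable (f g) in
/-- The universal property of the bimodule of a composite. -/
def tmLift {A : Type} [AddCommGroup A] (φ : bimod N f →+ bimod N g →+ A)
    (h : ∀ m s n, φ ((bimod N f).ract s m) n = φ m ((bimod N g).lact s n)) :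
    bimod N (f ≫ g) →+ A := GrBimod.lift (M := bimod N f) (N := bimod N g) φ h

end Tm

@[simp]
theorem lact_eE (n : ℤ) (r : ring (ofWeight N n)) (a : (stepAt N n).A) :
    (bimod N (E n)).lact r (eE N n a) = eE N n ((stepAt N n).left r * a) := rfl

@[simp]
theorem ract_eE (n : ℤ) (s : ring (ofWeight N (n + 2))) (a : (stepAt N n).A) :
    (bimod N (E n)).ract s (eE N n a) = eE N n ((stepAt N n).right s * a) := rfl

@[simp]
theorem lact_eF (n : ℤ) (s : ring (ofWeight N (n + 2))) (a : (stepAt N n).A) :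
    (bimod N (F n)).lact s (eF N n a) = eF N n ((stepAt N n).right s * a) := rfl

@[simp]
theorem ract_eF (n : ℤ) (r : ring (ofWeight N n)) (a : (stepAt N n).A) :
    (bimod N (F n)).ract r (eF N n a) = eF N n ((stepAt N n).left r * a) := rfl

@[simp]
theorem lact_eI (a : FreeU) (r s : ring (ofWeight N a.wt)) :
    (bimod N (𝟙 a)).lact r (eI N a s) = eI N a (r * s) := rfl

theorem eE_mem (n : ℤ) {d d' : ℤ} {a : (stepAt N n).A} (h : a ∈ (stepAt N n).A.gr d)
    (e : d' = d + (1 - N + kAt N n)) : eE N n a ∈ (bimod N (E n)).gr d' := by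
  subst e
  change a ∈ (stepAt N n).A.gr (d + (1 - N + kAt N n) - (1 - N + kAt N n))
  rwa [add_sub_cancel_right]

theorem eF_mem (n : ℤ) {d d' : ℤ} {a : (stepAt N n).A} (h : a ∈ (stepAt N n).A.gr d)
    (e : d' = d - kAt N n) : eF N n a ∈ (bimod N (F n)).gr d' := by
  subst e
  change a ∈ (stepAt N n).A.gr (d - kAt N n - (-kAt N n))
  rwa [sub_neg_eq_add, sub_add_cancel]

theorem eI_mem (a : FreeU) {d : ℤ} {r : ring (ofWeight N a.wt)}
    (h : r ∈ (ring (ofWeight N a.wt)).gr d) : eI N a r ∈ (bimod N (𝟙 a)).gr d := h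

theorem xi_pow_mem (n : ℤ) (m : ℕ) : (stepAt N n).xi ^ m ∈ (stepAt N n).A.gr (2 * m) := by
  induction m with
  | zero => rw [pow_zero]; exact (stepAt N n).A.one_mem
  | succ m ih =>
    rw [pow_succ']
    have := (stepAt N n).A.mul_mem (stepFacts n).xi_mem ih
    rwa [show (2 : ℤ) + 2 * m = 2 * ((m + 1 : ℕ) : ℤ) by push_cast; ring] at this

theorem lgen_E (n : ℤ) : LGen (bimod N (E n)) (Set.range fun i => eE N n ((stepAt N n).xi ^ i)) := by
  intro G hG hX a
  refine (stepFacts n).lower.span (G.comap (eE N n)) (fun i _ s => ?_) a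
  exact hG s _ (hX ⟨i, rfl⟩)

theorem lgen_F (n : ℤ) : LGen (bimod N (F n)) (Set.range fun i => eF N n ((stepAt N n).xi ^ i)) := by
  intro G hG hX a
  refine (stepFacts n).upper.span (G.comap (eF N n)) (fun i _ s => ?_) a
  exact hG s _ (hX ⟨i, rfl⟩)

theorem lgen_I (a : FreeU) : LGen (bimod N (𝟙 a)) {eI N a 1} := by
  intro G hG hX r
  have h1 : ∀ s : ring (ofWeight N a.wt), eI N a s ∈ G := fun s => by
    have := hG s _ (hX rfl)
    rwa [lact_eI, mul_one] at this
  exact h1 r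

theorem lgen_tm {a b c : FreeU} {f : a ⟶ b} {g : b ⟶ c} {X : Set (bimod N f)}
    {Y : Set (bimod N g)} (hX : LGen (bimod N f) X) (hY : LGen (bimod N g) Y) :
    LGen (bimod N (f ≫ g)) (Set.image2 (fun m n => tm f g m n) X Y) := hX.tensor hY

end Elements

end EqFlagRep
end

noncomputable section

namespace EqFlagRep

open GrBimod FreeU

/-! ### The bimodule maps of the generators -/

section Maps

open PushoutRing

variable {N : ℕ}

theorem mul_mul_bal {A : Type*} [CommRing A] (x a b : A) : x * a * b = a * (x * b) := by ring

/-! ### Two-strand bimodules as images of commutative rings -/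

section Rings

variable (N : ℕ) (n : ℤ)

/-- The ring `A ⊗ A` over `H_{k+1}`. -/
abbrev RingEF : Type := PushoutRing (stepAt N n).right (stepAt N n).right

/-- The ring `A ⊗ A` over `H_k`. -/
abbrev RingFE : Type := PushoutRing (stepAt N n).left (stepAt N n).left

/-- The ring of two step flags. -/
abbrev RingEE : Type := TwoStep (stepAt N n) (stepAt N (n + 2))

/-- Elements of the bimodule of `ℱℰ 1_n`. -/
def tEF : RingEF N n →+ bimod N (E n ≫ F n) :=
  PushoutRing.lift _ _ (((tm (E n) (F n)).comp (eE N n)).compl₂ (eF N n)) fun a s b =>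
    tm_bal (E n) (F n) (eE N n a) s (eF N n b)

/-- Elements of the bimodule of `ℰℱ 1_{n+2}`. -/
def tFE : RingFE N n →+ bimod N (F n ≫ E n) :=
  PushoutRing.lift _ _ (((tm (F n) (E n)).comp (eF N n)).compl₂ (eE N n)) fun a s b =>
    tm_bal (F n) (E n) (eF N n a) s (eE N n b)

/-- Elements of the bimodule of `ℰℰ 1_n`. -/
def tEE : RingEE N n →+ bimod N (E n ≫ E (n + 2)) :=
  PushoutRing.lift _ _ (((tm (E n) (E (n + 2))).comp (eE N n)).compl₂ (eE N (n + 2))) fun a s b =>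
    tm_bal (E n) (E (n + 2)) (eE N n a) s (eE N (n + 2) b)

/-- Elements of the bimodule of `ℱℱ 1_{n+4}`. -/
def tFF : RingEE N n →+ bimod N (F (n + 2) ≫ F n) :=
  PushoutRing.lift _ _ (AddMonoidHom.flip (((tm (F (n + 2)) (F n)).comp (eF N (n + 2))).compl₂
    (eF N n))) fun a s b => (tm_bal (F (n + 2)) (F n) (eF N (n + 2) b) s (eF N n a)).symm

variable {N}

theorem tEF_mul (a b : (stepAt N n).A) :
    tEF N n (inl _ _ a * inr _ _ b) = tm (E n) (F n) (eE N n a) (eF N n b) :=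
  lift_mul _ _ _ _ a b

theorem tFE_mul (a b : (stepAt N n).A) :
    tFE N n (inl _ _ a * inr _ _ b) = tm (F n) (E n) (eF N n a) (eE N n b) :=
  lift_mul _ _ _ _ a b

theorem tEE_mul (a : (stepAt N n).A) (b : (stepAt N (n + 2)).A) :
    tEE N n (inl _ _ a * inr _ _ b) = tm (E n) (E (n + 2)) (eE N n a) (eE N (n + 2) b) :=
  lift_mul _ _ _ _ a b

theorem tFF_mul (a : (stepAt N n).A) (b : (stepAt N (n + 2)).A) :
    tFF N n (inl _ _ a * inr _ _ b) = tm (F (n + 2)) (F n) (eF N (n + 2) b) (eF N n a) :=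
  lift_mul _ _ _ _ a b

theorem lact_tEF (r : ring (ofWeight N n)) (w : RingEF N n) :
    (bimod N (E n ≫ F n)).lact r (tEF N n w) = tEF N n (inl _ _ ((stepAt N n).left r) * w) := by
  induction w using PushoutRing.induction with
  | h0 => simp
  | hadd u v hu hv => simp only [mul_add, map_add, hu, hv]
  | ht p q => rw [← mul_assoc, ← map_mul, tEF_mul, tEF_mul, lact_tm, lact_eE]

theorem ract_tEF (r : ring (ofWeight N n)) (w : RingEF N n) :
    (bimod N (E n ≫ F n)).ract r (tEF N n w) = tEF N n (inr _ _ ((stepAt N n).left r) * w) := by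
  induction w using PushoutRing.induction with
  | h0 => simp
  | hadd u v hu hv => simp only [mul_add, map_add, hu, hv]
  | ht p q => rw [mul_left_comm, ← map_mul, tEF_mul, tEF_mul, ract_tm, ract_eF]

theorem lact_tFE (r : ring (ofWeight N (n + 2))) (w : RingFE N n) :
    (bimod N (F n ≫ E n)).lact r (tFE N n w) = tFE N n (inl _ _ ((stepAt N n).right r) * w) := by
  induction w using PushoutRing.induction with
  | h0 => simp
  | hadd u v hu hv => simp only [mul_add, map_add, hu, hv]
  | ht p q => rw [← mul_assoc, ← map_mul, tFE_mul, tFE_mul, lact_tm, lact_eF]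

theorem ract_tFE (r : ring (ofWeight N (n + 2))) (w : RingFE N n) :
    (bimod N (F n ≫ E n)).ract r (tFE N n w) = tFE N n (inr _ _ ((stepAt N n).right r) * w) := by
  induction w using PushoutRing.induction with
  | h0 => simp
  | hadd u v hu hv => simp only [mul_add, map_add, hu, hv]
  | ht p q => rw [mul_left_comm, ← map_mul, tFE_mul, tFE_mul, ract_tm, ract_eE]

theorem lact_tEE (r : ring (ofWeight N n)) (w : RingEE N n) :
    (bimod N (E n ≫ E (n + 2))).lact r (tEE N n w) = tEE N n (TwoStep.fst _ _ r * w) := by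
  induction w using PushoutRing.induction with
  | h0 => simp
  | hadd u v hu hv => simp only [mul_add, map_add, hu, hv]
  | ht p q => rw [RingHom.comp_apply, ← mul_assoc, ← map_mul, tEE_mul, tEE_mul, lact_tm, lact_eE]

theorem ract_tEE (r : ring (ofWeight N (n + 2 + 2))) (w : RingEE N n) :
    (bimod N (E n ≫ E (n + 2))).ract r (tEE N n w) = tEE N n (TwoStep.lst _ _ r * w) := by
  induction w using PushoutRing.induction with
  | h0 => simp
  | hadd u v hu hv => simp only [mul_add, map_add, hu, hv]
  | ht p q =>
    rw [RingHom.comp_apply, mul_left_comm, ← map_mul, tEE_mul, tEE_mul, ract_tm, ract_eE]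

theorem lact_tFF (r : ring (ofWeight N (n + 2 + 2))) (w : RingEE N n) :
    (bimod N (F (n + 2) ≫ F n)).lact r (tFF N n w) = tFF N n (TwoStep.lst _ _ r * w) := by
  induction w using PushoutRing.induction with
  | h0 => simp
  | hadd u v hu hv => simp only [mul_add, map_add, hu, hv]
  | ht p q =>
    rw [RingHom.comp_apply, mul_left_comm, ← map_mul, tFF_mul, tFF_mul, lact_tm, lact_eF]

theorem ract_tFF (r : ring (ofWeight N n)) (w : RingEE N n) :
    (bimod N (F (n + 2) ≫ F n)).ract r (tFF N n w) = tFF N n (TwoStep.fst _ _ r * w) := by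
  induction w using PushoutRing.induction with
  | h0 => simp
  | hadd u v hu hv => simp only [mul_add, map_add, hu, hv]
  | ht p q => rw [RingHom.comp_apply, ← mul_assoc, ← map_mul, tFF_mul, tFF_mul, ract_tm, ract_eF]

end Rings

section Defs

variable (N : ℕ) (n : ℤ)

/-- The element `η_n(1)`. -/
def etaElt : RingEF N n :=
  FrobStep.dual (stepAt N n).right (stepAt N n).left (stepAt N n).xi (xcl _) (kAt N n)

/-- The element `ε̂_{n+2}(1)`. -/
def epshElt : RingFE N n :=
  FrobStep.dual (stepAt N n).left (stepAt N n).right (stepAt N n).xi (ycl _) (N - kAt N (n + 2))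

/-- The divided difference operator. -/
def dem : (stepAt N n).A →+ (stepAt N (n + 2)).A →+ RingEE N n :=
  (exists_isDemazure (stepFacts n) (stepFacts (n + 2))).choose

theorem dem_spec : IsDemazure (stepAt N n) (stepAt N (n + 2)) (dem N n) :=
  (exists_isDemazure (stepFacts n) (stepFacts (n + 2))).choose_spec

theorem trUp_spec : FrobStep.IsTrace (stepAt N n).right (stepAt N n).xi (xcl _) (kAt N (n + 2))
    (trUp N n) := ⟨trUp_mul n, trUp_pow n⟩

theorem trDown_spec : FrobStep.IsTrace (stepAt N n).left (stepAt N n).xi (ycl _) (N - kAt N n)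
    (trDown N n) := ⟨trDown_mul n, trDown_pow n⟩

/-- `z_n`. -/
def zMap : bimod N (E n) →+ bimod N (E n) := AddMonoidHom.mulLeft (stepAt N n).xi

/-- `ẑ_n`. -/
def zhMap : bimod N (F n) →+ bimod N (F n) := AddMonoidHom.mulLeft (stepAt N n).xi

/-- `U_n`. -/
def uMap : bimod N (E n ≫ E (n + 2)) →+ bimod N (E n ≫ E (n + 2)) :=
  tmLift (E n) (E (n + 2)) ((dem N n).compr₂ (tEE N n)) fun a s b =>
    congrArg (tEE N n) ((dem_spec N n).bal a s b)

/-- `Û_n`. -/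
def uhMap : bimod N (F (n + 2) ≫ F n) →+ bimod N (F (n + 2) ≫ F n) :=
  tmLift (F (n + 2)) (F n) (AddMonoidHom.flip ((dem N n).compr₂ (tFF N n))) fun b s a =>
    (congrArg (tFF N n) ((dem_spec N n).bal a s b)).symm

/-- `η_n`. -/
def etaMap : bimod N (𝟙 (⟨n⟩ : FreeU)) →+ bimod N (E n ≫ F n) :=
  (tEF N n).comp ((AddMonoidHom.mulRight (etaElt N n)).comp
    ((inl (stepAt N n).right (stepAt N n).right).comp (stepAt N n).left).toAddMonoidHom)

/-- `ε̂_{n+2}`. -/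
def epshMap : bimod N (𝟙 (⟨n + 2⟩ : FreeU)) →+ bimod N (F n ≫ E n) :=
  (tFE N n).comp ((AddMonoidHom.mulRight (epshElt N n)).comp
    ((inl (stepAt N n).left (stepAt N n).left).comp (stepAt N n).right).toAddMonoidHom)

/-- `ε_{n+2}`. -/
def epsMap : bimod N (F n ≫ E n) →+ bimod N (𝟙 (⟨n + 2⟩ : FreeU)) :=
  tmLift (F n) (E n) ((AddMonoidHom.mul (R := (stepAt N n).A)).compr₂ (trUp N n)) fun a s b =>
    congrArg (trUp N n) (mul_mul_bal ((stepAt N n).left s) a b)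

/-- `η̂_n`. -/
def etahMap : bimod N (E n ≫ F n) →+ bimod N (𝟙 (⟨n⟩ : FreeU)) :=
  tmLift (E n) (F n) ((AddMonoidHom.mul (R := (stepAt N n).A)).compr₂ (trDown N n)) fun a s b =>
    congrArg (trDown N n) (mul_mul_bal ((stepAt N n).right s) a b)

variable {N}

theorem zMap_apply (a : (stepAt N n).A) :
    zMap N n (eE N n a) = eE N n ((stepAt N n).xi * a) := rfl

theorem zhMap_apply (a : (stepAt N n).A) :
    zhMap N n (eF N n a) = eF N n ((stepAt N n).xi * a) := rfl

theorem uMap_apply (a : (stepAt N n).A) (b : (stepAt N (n + 2)).A) :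
    uMap N n (tm (E n) (E (n + 2)) (eE N n a) (eE N (n + 2) b)) = tEE N n (dem N n a b) := rfl

theorem uhMap_apply (a : (stepAt N n).A) (b : (stepAt N (n + 2)).A) :
    uhMap N n (tm (F (n + 2)) (F n) (eF N (n + 2) b) (eF N n a)) = tFF N n (dem N n a b) := rfl

theorem etaMap_apply (r : ring (ofWeight N n)) :
    etaMap N n (eI N ⟨n⟩ r) = tEF N n (inl _ _ ((stepAt N n).left r) * etaElt N n) := rfl

theorem epshMap_apply (r : ring (ofWeight N (n + 2))) :
    epshMap N n (eI N ⟨n + 2⟩ r) = tFE N n (inl _ _ ((stepAt N n).right r) * epshElt N n) := rfl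

theorem epsMap_apply (a b : (stepAt N n).A) :
    epsMap N n (tm (F n) (E n) (eF N n a) (eE N n b)) = eI N ⟨n + 2⟩ (trUp N n (a * b)) := rfl

theorem etahMap_apply (a b : (stepAt N n).A) :
    etahMap N n (tm (E n) (F n) (eE N n a) (eF N n b)) = eI N ⟨n⟩ (trDown N n (a * b)) := rfl

end Defs

/-! ### Linearity and degrees -/

theorem forall_tm {a b c : FreeU} {f : a ⟶ b} {g : b ⟶ c} {A : Type} [AddCommGroup A]
    {φ ψ : bimod N (f ≫ g) →+ A} (h : ∀ m n, φ (tm f g m n) = ψ (tm f g m n))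
    (x : bimod N (f ≫ g)) : φ x = ψ x := by
  induction x using tm_induction with
  | h0 => simp
  | ht m n => exact h m n
  | hadd x y hx hy => simp only [map_add, hx, hy]

theorem mem_lin {a b : FreeU} {f g : a ⟶ b} {φ : bimod N f →+ bimod N g}
    (h1 : ∀ r, φ.comp ((bimod N f).lact r) = AddMonoidHom.comp ((bimod N g).lact r) φ)
    (h2 : ∀ r, φ.comp ((bimod N f).ract r) = AddMonoidHom.comp ((bimod N g).ract r) φ) :
    φ ∈ lin (bimod N f) (bimod N g) :=
  ⟨fun r m => DFunLike.congr_fun (h1 r) m, fun r m => DFunLike.congr_fun (h2 r) m⟩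

theorem zMap_lin (n : ℤ) : zMap N n ∈ lin (bimod N (E n)) (bimod N (E n)) :=
  ⟨fun _ _ => mul_left_comm (G := (stepAt N n).A) _ _ _,
    fun _ _ => mul_left_comm (G := (stepAt N n).A) _ _ _⟩

theorem zhMap_lin (n : ℤ) : zhMap N n ∈ lin (bimod N (F n)) (bimod N (F n)) :=
  ⟨fun _ _ => mul_left_comm (G := (stepAt N n).A) _ _ _,
    fun _ _ => mul_left_comm (G := (stepAt N n).A) _ _ _⟩

theorem uMap_lin (n : ℤ) : uMap N n ∈ lin (bimod N (E n ≫ E (n + 2))) (bimod N _) := by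
  refine mem_lin (fun r => ?_) (fun r => ?_)
  · refine AddMonoidHom.ext (forall_tm fun a b => ?_)
    exact (congrArg (tEE N n) ((dem_spec N n).left_mul r a b)).trans (lact_tEE n r _).symm
  · refine AddMonoidHom.ext (forall_tm fun a b => ?_)
    exact (congrArg (tEE N n) ((dem_spec N n).right_mul r a b)).trans (ract_tEE n r _).symm

theorem uhMap_lin (n : ℤ) : uhMap N n ∈ lin (bimod N (F (n + 2) ≫ F n)) (bimod N _) := by
  refine mem_lin (fun r => ?_) (fun r => ?_)
  · refine AddMonoidHom.ext (forall_tm fun b a => ?_)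
    exact (congrArg (tFF N n) ((dem_spec N n).right_mul r a b)).trans (lact_tFF n r _).symm
  · refine AddMonoidHom.ext (forall_tm fun b a => ?_)
    exact (congrArg (tFF N n) ((dem_spec N n).left_mul r a b)).trans (ract_tFF n r _).symm

/-- Left linearity is built into the definition; right linearity is the centrality of the dual
element. -/
theorem etaMap_lin (n : ℤ) : etaMap N n ∈ lin (bimod N (𝟙 (⟨n⟩ : FreeU))) (bimod N (E n ≫ F n)) := by
  have h1 : ∀ r s : ring (ofWeight N n), etaMap N n (eI N ⟨n⟩ (r * s)) =
      (bimod N (E n ≫ F n)).lact r (etaMap N n (eI N ⟨n⟩ s)) := by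
    intro r s
    rw [etaMap_apply, etaMap_apply, lact_tEF, map_mul (stepAt N n).left, map_mul (inl _ _),
      mul_assoc]
  refine ⟨h1, fun r s => (h1 r s).trans ?_⟩
  have h2 := (stepFacts (N := N) n).frobUp.dual_central r
  refine (lact_tEF n r _).trans (Eq.trans ?_ (ract_tEF n r _).symm)
  refine congrArg (tEF N n) ?_
  change _ * (_ * etaElt N n) = _ * (_ * etaElt N n)
  rw [mul_left_comm, mul_left_comm (inr _ _ _)]
  exact congrArg _ h2

theorem epshMap_lin (n : ℤ) :
    epshMap N n ∈ lin (bimod N (𝟙 (⟨n + 2⟩ : FreeU))) (bimod N (F n ≫ E n)) := by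
  have h1 : ∀ r s : ring (ofWeight N (n + 2)), epshMap N n (eI N ⟨n + 2⟩ (r * s)) =
      (bimod N (F n ≫ E n)).lact r (epshMap N n (eI N ⟨n + 2⟩ s)) := by
    intro r s
    rw [epshMap_apply, epshMap_apply, lact_tFE, map_mul (stepAt N n).right, map_mul (inl _ _),
      mul_assoc]
  refine ⟨h1, fun r s => (h1 r s).trans ?_⟩
  have h2 := (stepFacts (N := N) n).frobDown.dual_central r
  refine (lact_tFE n r _).trans (Eq.trans ?_ (ract_tFE n r _).symm)
  refine congrArg (tFE N n) ?_
  change _ * (_ * epshElt N n) = _ * (_ * epshElt N n)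
  rw [mul_left_comm, mul_left_comm (inr _ _ _)]
  exact congrArg _ h2

theorem epsMap_lin (n : ℤ) :
    epsMap N n ∈ lin (bimod N (F n ≫ E n)) (bimod N (𝟙 (⟨n + 2⟩ : FreeU))) := by
  refine mem_lin (fun r => ?_) (fun r => ?_)
  · refine AddMonoidHom.ext (forall_tm fun a b => ?_)
    exact (congrArg (trUp N n) (mul_assoc (G := (stepAt N n).A) _ a b)).trans (trUp_mul n r _)
  · refine AddMonoidHom.ext (forall_tm fun a b => ?_)
    exact (congrArg (trUp N n) (mul_left_comm (G := (stepAt N n).A) a _ b)).trans (trUp_mul n r _)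

theorem etahMap_lin (n : ℤ) :
    etahMap N n ∈ lin (bimod N (E n ≫ F n)) (bimod N (𝟙 (⟨n⟩ : FreeU))) := by
  refine mem_lin (fun r => ?_) (fun r => ?_)
  · refine AddMonoidHom.ext (forall_tm fun a b => ?_)
    exact (congrArg (trDown N n) (mul_assoc (G := (stepAt N n).A) _ a b)).trans (trDown_mul n r _)
  · refine AddMonoidHom.ext (forall_tm fun a b => ?_)
    exact (congrArg (trDown N n) (mul_left_comm (G := (stepAt N n).A) a _ b)).trans
      (trDown_mul n r _)

end Maps

end EqFlagRep
end

noncomputable section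

namespace EqFlagRep

open GrBimod FreeU

/-! ### Degrees of the generating bimodule maps -/

section Degrees

open PushoutRing

variable {N : ℕ}

theorem map_neg_one_pow_zsmul {B C : Type*} [Ring B] [AddCommGroup C] (φ : B →+ C) (j : ℕ) (b : B) :
    φ ((-1) ^ j * b) = (-1 : ℤ) ^ j • φ b := by
  rcases Nat.even_or_odd j with h | h <;> simp [h.neg_one_pow]

theorem tEF_etaElt (n : ℤ) : tEF N n (etaElt N n) = ∑ j ∈ Finset.range (kAt N n + 1),
    (-1 : ℤ) ^ j • tm (E n) (F n) (eE N n ((stepAt N n).left (xcl _ j)))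
      (eF N n ((stepAt N n).xi ^ (kAt N n - j))) := by
  rw [etaElt, FrobStep.dual, map_sum]
  exact Finset.sum_congr rfl fun j _ => by rw [map_neg_one_pow_zsmul, tEF_mul]

theorem tEF_etaElt' (n : ℤ) : tEF N n (etaElt N n) = ∑ j ∈ Finset.range (kAt N n + 1),
    (-1 : ℤ) ^ j • tm (E n) (F n) (eE N n ((stepAt N n).xi ^ (kAt N n - j)))
      (eF N n ((stepAt N n).left (xcl _ j))) := by
  rw [etaElt, (stepFacts n).frobUp.dual_symm, map_sum]
  exact Finset.sum_congr rfl fun j _ => by rw [map_neg_one_pow_zsmul, tEF_mul]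

theorem tFE_epshElt (n : ℤ) : tFE N n (epshElt N n) = ∑ j ∈ Finset.range (N - kAt N (n + 2) + 1),
    (-1 : ℤ) ^ j • tm (F n) (E n) (eF N n ((stepAt N n).right (ycl _ j)))
      (eE N n ((stepAt N n).xi ^ (N - kAt N (n + 2) - j))) := by
  rw [epshElt, FrobStep.dual, map_sum]
  exact Finset.sum_congr rfl fun j _ => by rw [map_neg_one_pow_zsmul, tFE_mul]

theorem tFE_epshElt' (n : ℤ) : tFE N n (epshElt N n) =
    ∑ j ∈ Finset.range (N - kAt N (n + 2) + 1),
    (-1 : ℤ) ^ j • tm (F n) (E n) (eF N n ((stepAt N n).xi ^ (N - kAt N (n + 2) - j)))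
      (eE N n ((stepAt N n).right (ycl _ j))) := by
  rw [epshElt, (stepFacts n).frobDown.dual_symm, map_sum]
  exact Finset.sum_congr rfl fun j _ => by rw [map_neg_one_pow_zsmul, tFE_mul]

theorem etaMap_one (n : ℤ) : etaMap N n (eI N ⟨n⟩ 1) = tEF N n (etaElt N n) := by
  rw [etaMap_apply, map_one, map_one, one_mul]

theorem epshMap_one (n : ℤ) : epshMap N n (eI N ⟨n + 2⟩ 1) = tFE N n (epshElt N n) := by
  rw [epshMap_apply, map_one, map_one, one_mul]

theorem invCoeff_mem {R : GrRing} (a : ℕ → R) (h : ∀ j : ℕ, a j ∈ R.gr (2 * j)) (k : ℕ) :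
    invCoeff a k ∈ R.gr (2 * k) := by
  induction k using Nat.strong_induction_on with
  | _ k ih =>
    cases k with
    | zero => rw [invCoeff]; exact R.one_mem
    | succ k =>
      rw [invCoeff]
      refine neg_mem (sum_mem fun i _ => ?_)
      have := R.mul_mem (h (k + 1 - i)) (ih i i.2)
      have hi := i.2
      rwa [show (2 * ((k + 1 - i : ℕ) : ℤ) + 2 * ((i : ℕ) : ℤ)) = 2 * ((k + 1 : ℕ) : ℤ) by omega]
        at this

theorem signed_mem {R : GrRing} (c : ℕ → R) (h : ∀ j : ℕ, c j ∈ R.gr (2 * j)) (e : ℤ) :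
    signed c e ∈ R.gr (2 * e) := by
  by_cases he : 0 ≤ e
  · lift e to ℕ using he
    rw [signed_natCast]
    rcases Nat.even_or_odd e with h' | h' <;> rw [h'.neg_one_pow]
    · rw [one_mul]; exact h e
    · rw [neg_one_mul]; exact neg_mem (h e)
  · rw [signed_of_neg c (not_le.1 he)]
    exact zero_mem _

theorem forall_range_tm {a b c : FreeU} {f : a ⟶ b} {g : b ⟶ c} {ι κ : Type} {u : ι → bimod N f}
    {v : κ → bimod N g} {P : bimod N (f ≫ g) → Prop} (h : ∀ i j, P (tm f g (u i) (v j))) :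
    ∀ x ∈ Set.image2 (fun m n => tm f g m n) (Set.range u) (Set.range v), P x := by
  rintro _ ⟨_, ⟨i, rfl⟩, _, ⟨j, rfl⟩, rfl⟩
  exact h i j

theorem zMap_homog (n : ℤ) : zMap N n ∈ homogMaps (bimod N (E n)) (bimod N (E n)) 2 := by
  refine (lgen_E n).homog (zMap_lin n) ?_
  rintro _ ⟨i, rfl⟩
  refine ⟨_, eE_mem n (xi_pow_mem n i) rfl, ?_⟩
  rw [zMap_apply, ← pow_succ']
  exact eE_mem n (xi_pow_mem n (i + 1)) (by push_cast; ring)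

theorem zhMap_homog (n : ℤ) : zhMap N n ∈ homogMaps (bimod N (F n)) (bimod N (F n)) 2 := by
  refine (lgen_F n).homog (zhMap_lin n) ?_
  rintro _ ⟨i, rfl⟩
  refine ⟨_, eF_mem n (xi_pow_mem n i) rfl, ?_⟩
  rw [zhMap_apply, ← pow_succ']
  exact eF_mem n (xi_pow_mem n (i + 1)) (by push_cast; ring)

theorem uMap_pow (n : ℤ) (a b : ℕ) :
    uMap N n (tm (E n) (E (n + 2)) (eE N n ((stepAt N n).xi ^ a))
      (eE N (n + 2) ((stepAt N (n + 2)).xi ^ b))) =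
    ∑ j ∈ Finset.range b, tm (E n) (E (n + 2)) (eE N n ((stepAt N n).xi ^ j))
        (eE N (n + 2) ((stepAt N (n + 2)).xi ^ (a + b - 1 - j))) -
      ∑ j ∈ Finset.range a, tm (E n) (E (n + 2)) (eE N n ((stepAt N n).xi ^ j))
        (eE N (n + 2) ((stepAt N (n + 2)).xi ^ (a + b - 1 - j))) := by
  rw [uMap_apply, (dem_spec N n).pow, map_sub, map_sum, map_sum]
  simp only [tEE_mul]

/-- A sum over the first `a` points of an antidiagonal and the sum over its last `b` points complete
each other to the whole antidiagonal. -/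
theorem sum_range_reflect_sub {M : Type*} [AddCommGroup M] (f : ℕ → ℕ → M) (a b : ℕ) :
    ∑ j ∈ Finset.range a, f j (a + b - 1 - j) - ∑ j ∈ Finset.range b, f j (a + b - 1 - j) =
    ∑ j ∈ Finset.range a, f (a + b - 1 - j) j - ∑ j ∈ Finset.range b, f (a + b - 1 - j) j := by
  have key : ∀ a b : ℕ, ∑ j ∈ Finset.range a, f j (a + b - 1 - j) +
      ∑ j ∈ Finset.range b, f (a + b - 1 - j) j =
      ∑ j ∈ Finset.range (a + b), f j (a + b - 1 - j) := by
    intro a b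
    rw [Finset.sum_range_add]
    congr 1
    rw [← Finset.sum_range_reflect]
    refine Finset.sum_congr rfl fun j hj => ?_
    have := Finset.mem_range.1 hj
    congr 1 <;> omega
  have h1 := key a b
  have h2 := key b a
  rw [add_comm b a] at h2
  rw [sub_eq_sub_iff_add_eq_add, h1, ← h2]
  abel

/-- In `ℱℱ` the tensor factors stand in the opposite order, so the formula for `dem` has to be read
from the other end of the antidiagonal. -/
theorem uhMap_pow (n : ℤ) (a b : ℕ) :
    uhMap N n (tm (F (n + 2)) (F n) (eF N (n + 2) ((stepAt N (n + 2)).xi ^ a))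
      (eF N n ((stepAt N n).xi ^ b))) =
    ∑ j ∈ Finset.range a, tm (F (n + 2)) (F n) (eF N (n + 2) ((stepAt N (n + 2)).xi ^ j))
        (eF N n ((stepAt N n).xi ^ (a + b - 1 - j))) -
      ∑ j ∈ Finset.range b, tm (F (n + 2)) (F n) (eF N (n + 2) ((stepAt N (n + 2)).xi ^ j))
        (eF N n ((stepAt N n).xi ^ (a + b - 1 - j))) := by
  rw [uhMap_apply, (dem_spec N n).pow, map_sub, map_sum, map_sum]
  simp only [tFF_mul]
  rw [add_comm b a]
  exact (sum_range_reflect_sub (fun i j => tm (F (n + 2)) (F n)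
    (eF N (n + 2) ((stepAt N (n + 2)).xi ^ i)) (eF N n ((stepAt N n).xi ^ j))) a b).symm

theorem uMap_homog (n : ℤ) :
    uMap N n ∈ homogMaps (bimod N (E n ≫ E (n + 2))) (bimod N (E n ≫ E (n + 2))) (-2) := by
  refine (lgen_tm (lgen_E n) (lgen_E (n + 2))).homog (uMap_lin n)
    (forall_range_tm fun a b => ⟨_, tm_mem rfl (eE_mem n (xi_pow_mem n a) rfl)
      (eE_mem (n + 2) (xi_pow_mem (n + 2) b) rfl), ?_⟩)
  rw [uMap_pow]
  refine sub_mem (sum_mem fun j hj => ?_) (sum_mem fun j hj => ?_) <;>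
  · have := Finset.mem_range.1 hj
    exact tm_mem (by omega) (eE_mem n (xi_pow_mem n j) rfl)
      (eE_mem (n + 2) (xi_pow_mem (n + 2) _) rfl)

theorem uhMap_homog (n : ℤ) :
    uhMap N n ∈ homogMaps (bimod N (F (n + 2) ≫ F n)) (bimod N (F (n + 2) ≫ F n)) (-2) := by
  refine (lgen_tm (lgen_F (n + 2)) (lgen_F n)).homog (uhMap_lin n)
    (forall_range_tm fun a b => ⟨_, tm_mem rfl (eF_mem (n + 2) (xi_pow_mem (n + 2) a) rfl)
      (eF_mem n (xi_pow_mem n b) rfl), ?_⟩)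
  rw [uhMap_pow]
  refine sub_mem (sum_mem fun j hj => ?_) (sum_mem fun j hj => ?_) <;>
  · have := Finset.mem_range.1 hj
    exact tm_mem (by omega) (eF_mem (n + 2) (xi_pow_mem (n + 2) j) rfl)
      (eF_mem n (xi_pow_mem n _) rfl)

theorem etaMap_homog (n : ℤ) :
    etaMap N n ∈ homogMaps (bimod N (𝟙 (⟨n⟩ : FreeU))) (bimod N (E n ≫ F n)) (n + 1) := by
  refine (lgen_I ⟨n⟩).homog (etaMap_lin n) ?_
  rintro _ rfl
  refine ⟨0, GrRing.one_mem _, ?_⟩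
  -- At weights of the zero ring the degree count with `n = 2k - N` is unavailable, but there the
  -- source is zero.
  rcases kAt_eq (N := N) n with h | ⟨h1, h2⟩
  · have := subsingleton_ring h
    rw [Subsingleton.elim (1 : ring (ofWeight N n)) 0, map_zero, map_zero]
    exact zero_mem _
  · rw [etaMap_one, tEF_etaElt]
    refine sum_mem fun j hj => zsmul_mem ?_ _
    have := Finset.mem_range.1 hj
    exact tm_mem (by omega) (eE_mem n ((stepAt N n).left_mem (xcl_mem _ j)) rfl)
      (eF_mem n (xi_pow_mem n _) rfl)

theorem epshMap_homog (n : ℤ) : epshMap N n ∈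
    homogMaps (bimod N (𝟙 (⟨n + 2⟩ : FreeU))) (bimod N (F n ≫ E n)) (1 - (n + 2)) := by
  refine (lgen_I ⟨n + 2⟩).homog (epshMap_lin n) ?_
  rintro _ rfl
  refine ⟨0, GrRing.one_mem _, ?_⟩
  rcases kAt_eq (N := N) (n + 2) with h | ⟨h1, h2⟩
  · have := subsingleton_ring h
    rw [Subsingleton.elim (1 : ring (ofWeight N (n + 2))) 0, map_zero, map_zero]
    exact zero_mem _
  · rw [epshMap_one, tFE_epshElt]
    refine sum_mem fun j hj => zsmul_mem ?_ _
    have := Finset.mem_range.1 hj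
    exact tm_mem (by omega) (eF_mem n ((stepAt N n).right_mem (ycl_mem _ j)) rfl)
      (eE_mem n (xi_pow_mem n _) rfl)

theorem eI_mem_of_eq (a : FreeU) {d d' : ℤ} {r : ring (ofWeight N a.wt)}
    (h : r ∈ (ring (ofWeight N a.wt)).gr d) (e : d' = d) : eI N a r ∈ (bimod N (𝟙 a)).gr d' :=
  eI_mem a (e ▸ h)

theorem epsMap_homog (n : ℤ) : epsMap N n ∈
    homogMaps (bimod N (F n ≫ E n)) (bimod N (𝟙 (⟨n + 2⟩ : FreeU))) (1 - (n + 2)) := by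
  refine (lgen_tm (lgen_F n) (lgen_E n)).homog (epsMap_lin n)
    (forall_range_tm fun a b => ⟨_, tm_mem rfl (eF_mem n (xi_pow_mem n a) rfl)
      (eE_mem n (xi_pow_mem n b) rfl), ?_⟩)
  rw [epsMap_apply, ← pow_add, trUp_pow]
  rcases kAt_eq (N := N) (n + 2) with h | ⟨h1, h2⟩
  · have := subsingleton_ring h
    rw [Subsingleton.elim (signed _ _ : ring (ofWeight N (n + 2))) 0, map_zero]
    exact zero_mem _
  · have := signed_mem _ (invCoeff_mem _ (xcl_mem (ofWeight N (n + 2))))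
      (((a + b : ℕ) : ℤ) + 1 - kAt N (n + 2))
    exact eI_mem_of_eq (⟨n + 2⟩ : FreeU) this (by push_cast; linarith)

theorem etahMap_homog (n : ℤ) : etahMap N n ∈
    homogMaps (bimod N (E n ≫ F n)) (bimod N (𝟙 (⟨n⟩ : FreeU))) (n + 1) := by
  refine (lgen_tm (lgen_E n) (lgen_F n)).homog (etahMap_lin n)
    (forall_range_tm fun a b => ⟨_, tm_mem rfl (eE_mem n (xi_pow_mem n a) rfl)
      (eF_mem n (xi_pow_mem n b) rfl), ?_⟩)
  rw [etahMap_apply, ← pow_add, trDown_pow]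
  rcases kAt_eq (N := N) n with h | ⟨h1, h2⟩
  · have := subsingleton_ring h
    rw [Subsingleton.elim (signed _ _ : ring (ofWeight N n)) 0, map_zero]
    exact zero_mem _
  · have := signed_mem _ (invCoeff_mem _ (ycl_mem (ofWeight N n)))
      (((a + b : ℕ) : ℤ) + 1 - (N - kAt N n : ℕ))
    exact eI_mem_of_eq (⟨n⟩ : FreeU) this (by push_cast [h2]; linarith)

end Degrees

/-! ### The bimodule map of an expression -/

section Functor

variable (N : ℕ)

theorem shiftHom_homog {R S : GrRing} (M : GrBimod R S) (s : ℤ) :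
    AddMonoidHom.id M ∈ homogMaps M (M.shift s) s :=
  ⟨⟨fun _ _ => rfl, fun _ _ => rfl⟩, fun i m hm => by
    change m ∈ M.gr (i + s - s)
    rwa [add_sub_cancel_right]⟩

theorem shiftInv_homog {R S : GrRing} (M : GrBimod R S) (s : ℤ) :
    AddMonoidHom.id M ∈ homogMaps (M.shift s) M (-s) :=
  ⟨⟨fun _ _ => rfl, fun _ _ => rfl⟩, fun _ _ hm => hm⟩

theorem inl_homog {R S : GrRing} (M M' : GrBimod R S) :
    AddMonoidHom.inl M M' ∈ homogMaps M (M.sum M') 0 :=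
  ⟨⟨fun r _ => Prod.ext rfl (map_zero (M'.lact r)).symm,
    fun r _ => Prod.ext rfl (map_zero (M'.ract r)).symm⟩, fun i m hm => by
      rw [add_zero]; exact ⟨hm, zero_mem _⟩⟩

theorem inr_homog {R S : GrRing} (M M' : GrBimod R S) :
    AddMonoidHom.inr M M' ∈ homogMaps M' (M.sum M') 0 :=
  ⟨⟨fun r _ => Prod.ext (map_zero (M.lact r)).symm rfl,
    fun r _ => Prod.ext (map_zero (M.ract r)).symm rfl⟩, fun i m hm => by
      rw [add_zero]; exact ⟨zero_mem _, hm⟩⟩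

theorem fst_homog {R S : GrRing} (M M' : GrBimod R S) :
    AddMonoidHom.fst M M' ∈ homogMaps (M.sum M') M 0 :=
  ⟨⟨fun _ _ => rfl, fun _ _ => rfl⟩, fun i m hm => by rw [add_zero]; exact hm.1⟩

theorem snd_homog {R S : GrRing} (M M' : GrBimod R S) :
    AddMonoidHom.snd M M' ∈ homogMaps (M.sum M') M' 0 :=
  ⟨⟨fun _ _ => rfl, fun _ _ => rfl⟩, fun i m hm => by rw [add_zero]; exact hm.2⟩

/-- The bimodule map of an expression. -/
def preMap : {a b : ℤ} → {f g : UHom a b} → Pre f g → (bimod N f ⟶ bimod N g)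
  | _, _, _, _, .id f => 𝟙 (bimod N f)
  | _, _, _, _, .vcomp η θ => preMap η ≫ preMap θ
  | _, _, _, _, .whiskerLeft f η => bimStar.whiskerLeft (bimod N f) (preMap η)
  | _, _, _, _, .whiskerRight η h => bimStar.whiskerRight (preMap η) (bimod N h)
  | _, _, _, _, .associator f g h => (assoc (bimod N f) (bimod N g) (bimod N h)).hom
  | _, _, _, _, .associatorInv f g h => (assoc (bimod N f) (bimod N g) (bimod N h)).inv
  | _, _, _, _, .leftUnitor f => (leftUnit (bimod N f)).hom
  | _, _, _, _, .leftUnitorInv f => (leftUnit (bimod N f)).inv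
  | _, _, _, _, .rightUnitor f => (rightUnit (bimod N f)).hom
  | _, _, _, _, .rightUnitorInv f => (rightUnit (bimod N f)).inv
  | _, _, _, _, .zero f g => (0 : bimod N f ⟶ bimod N g)
  | _, _, _, _, .add η θ => preMap η + preMap θ
  | _, _, _, _, .neg η => -preMap η
  | _, _, _, _, .z n => ofHomog (zMap N n) (zMap_homog n)
  | _, _, _, _, .zh n => ofHomog (zhMap N n) (zhMap_homog n)
  | _, _, _, _, .U n => ofHomog (uMap N n) (uMap_homog n)
  | _, _, _, _, .Uh n => ofHomog (uhMap N n) (uhMap_homog n)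
  | _, _, _, _, .eta n => ofHomog (etaMap N n) (etaMap_homog n)
  | _, _, _, _, .eps n => ofHomog (epsMap N n) (epsMap_homog n)
  | _, _, _, _, .epsh n => ofHomog (epshMap N n) (epshMap_homog n)
  | _, _, _, _, .etah n => ofHomog (etahMap N n) (etahMap_homog n)
  | _, _, _, _, .shiftHom f s => ofHomog _ (shiftHom_homog (bimod N f) s)
  | _, _, _, _, .shiftInv f s => ofHomog _ (shiftInv_homog (bimod N f) s)
  | _, _, _, _, .inl f g => ofHomog _ (inl_homog (bimod N f) (bimod N g))
  | _, _, _, _, .inr f g => ofHomog _ (inr_homog (bimod N f) (bimod N g))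
  | _, _, _, _, .fst f g => ofHomog _ (fst_homog (bimod N f) (bimod N g))
  | _, _, _, _, .snd f g => ofHomog _ (snd_homog (bimod N f) (bimod N g))

/-- The relations `R` hold between the bimodule maps. -/
def Sound (R : RelFam) : Prop :=
  ∀ {a b : ℤ} {f g : UHom a b} (η θ : Pre f g), R η θ → preMap N η = preMap N θ

/-- Makes it possible to evaluate 2-morphisms of the free 2-category before any relation of `U*` has
been verified. -/
theorem sound_noRel : Sound N noRel := fun _ _ h => h.elim

variable {N}

-- Each structural relation is either a law already known for bimodules or true on pure tensors;
-- `hR` enters only for the given relations.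
set_option maxHeartbeats 2000000 in
theorem preMap_rel {R : RelFam} (hR : Sound N R) {a b : ℤ} {f g : UHom a b} {η θ : Pre f g}
    (h : Rel R η θ) : preMap N η = preMap N θ := by
  induction h with
  | of h => exact hR _ _ h
  | refl η => rfl
  | symm _ h => exact h.symm
  | trans _ _ h h' => exact h.trans h'
  | vcomp _ _ h h' => exact congrArg₂ (fun x y => x ≫ y) h h'
  | whiskerLeft f _ h => exact congrArg (fun x => bimStar.whiskerLeft (bimod N f) x) h
  | whiskerRight f _ h => exact congrArg (fun x => bimStar.whiskerRight x (bimod N f)) h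
  | add _ _ h h' => exact congrArg₂ (fun x y => x + y) h h'
  | neg _ h => exact congrArg (fun x => -x) h
  | id_comp η => exact Category.id_comp (preMap N η)
  | comp_id η => exact Category.comp_id (preMap N η)
  | assoc η θ ι => exact Category.assoc (preMap N η) (preMap N θ) (preMap N ι)
  | whiskerLeft_id f g => exact bimStar.whiskerLeft_id (bimod N f) (bimod N g)
  | whiskerLeft_comp f η θ => exact bimStar.whiskerLeft_comp (bimod N f) (preMap N η) (preMap N θ)
  | id_whiskerLeft η => exact bimStar.id_whiskerLeft (preMap N η)
  | comp_whiskerLeft f g η => exact bimStar.comp_whiskerLeft (bimod N f) (bimod N g) (preMap N η)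
  | id_whiskerRight f g => exact bimStar.id_whiskerRight (bimod N f) (bimod N g)
  | comp_whiskerRight η θ i => exact bimStar.comp_whiskerRight (preMap N η) (preMap N θ) (bimod N i)
  | whiskerRight_id η => exact bimStar.whiskerRight_id (preMap N η)
  | whiskerRight_comp η g h => exact bimStar.whiskerRight_comp (preMap N η) (bimod N g) (bimod N h)
  | whisker_assoc f η h => exact bimStar.whisker_assoc (bimod N f) (preMap N η) (bimod N h)
  | whisker_exchange η θ => exact bimStar.whisker_exchange (preMap N η) (preMap N θ)
  | associator_hom_inv f g h => exact (assoc (bimod N f) (bimod N g) (bimod N h)).hom_inv_id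
  | associator_inv_hom f g h => exact (assoc (bimod N f) (bimod N g) (bimod N h)).inv_hom_id
  | leftUnitor_hom_inv f => exact (leftUnit (bimod N f)).hom_inv_id
  | leftUnitor_inv_hom f => exact (leftUnit (bimod N f)).inv_hom_id
  | rightUnitor_hom_inv f => exact (rightUnit (bimod N f)).hom_inv_id
  | rightUnitor_inv_hom f => exact (rightUnit (bimod N f)).inv_hom_id
  | pentagon f g h i =>
    exact tens_hom_ext₄ (M := bimod N f) (N := bimod N g) (P := bimod N h) (Q := bimod N i)
      fun m n p q => rfl
  | triangle f g =>
    exact tens_hom_ext₃ (M := bimod N f) (N := unit _) (P := bimod N g)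
      fun m s n => (tmul_bal m s n).symm
  | add_assoc η θ ι => exact add_assoc (preMap N η) (preMap N θ) (preMap N ι)
  | add_comm η θ => exact add_comm (preMap N η) (preMap N θ)
  | zero_add η => exact zero_add (preMap N η)
  | neg_add_cancel η => exact neg_add_cancel (preMap N η)
  | add_comp η η' θ => exact Preadditive.add_comp _ _ _ (preMap N η) (preMap N η') (preMap N θ)
  | comp_add η θ θ' => exact Preadditive.comp_add _ _ _ (preMap N η) (preMap N θ) (preMap N θ')
  | whiskerLeft_add f η θ => exact tens_hom_ext fun m n => tmul_add m _ _
  | add_whiskerRight η θ h => exact tens_hom_ext fun m n => add_tmul _ _ n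
  | shift_hom_inv f s => rfl
  | shift_inv_hom f s => rfl
  | zero_id a b => rfl
  | inl_fst f g => rfl
  | inl_snd f g => rfl
  | inr_fst f g => rfl
  | inr_snd f g => rfl
  | sum_total f g =>
    exact hom_ext fun m => Prod.ext (add_zero (M := bimod N f) _) (zero_add (M := bimod N g) _)

/-- The bimodule map of a 2-morphism. -/
def cellMap {R : RelFam} (hR : Sound N R) {a b : ℤ} {f g : UHom a b} :
    Cell R f g → (bimod N f ⟶ bimod N g) :=
  Quot.lift (preMap N) fun _ _ h => preMap_rel hR h

end Functor

end EqFlagRep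
end

noncomputable section

namespace EqFlagRep

open GrBimod FreeU

/-! ### Evaluation of 2-morphisms of the free 2-category -/

section Ev

variable {N : ℕ}

variable (N) in
/-- The bimodule map of a 2-morphism, as a map of abelian groups. -/
def ev {a b : FreeU} {f g : a ⟶ b} (η : f ⟶ g) : bimod N f →+ bimod N g :=
  (cellMap (sound_noRel N) η).1

variable (N) in
/-- The unit element of the bimodule of an identity. -/
def uI (a : FreeU) : bimod N (𝟙 a) := eI N a 1

variable (N) in
/-- The element `r` of the bimodule of an identity. -/
def sI (a : FreeU) (r : ring (ofWeight N a.wt)) : bimod N (𝟙 a) := eI N a r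

theorem sI_sum {ι : Type*} (s : Finset ι) (a : FreeU) (r : ι → ring (ofWeight N a.wt)) :
    sI N a (∑ i ∈ s, r i) = ∑ i ∈ s, sI N a (r i) := map_sum (eI N a) r s

section Formal

variable {a b c d : FreeU}

/-- The left action. -/
def la (f : a ⟶ b) (r : ring (ofWeight N a.wt)) (x : bimod N f) : bimod N f := (bimod N f).lact r x

/-- The right action. -/
def ra (f : a ⟶ b) (r : ring (ofWeight N b.wt)) (x : bimod N f) : bimod N f := (bimod N f).ract r x

@[simp]
theorem la_tm (f : a ⟶ b) (g : b ⟶ c) (r : ring (ofWeight N a.wt)) (x : bimod N f)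
    (y : bimod N g) : la (f ≫ g) r (tm f g x y) = tm f g (la f r x) y := rfl

@[simp]
theorem ra_tm (f : a ⟶ b) (g : b ⟶ c) (r : ring (ofWeight N c.wt)) (x : bimod N f)
    (y : bimod N g) : ra (f ≫ g) r (tm f g x y) = tm f g x (ra g r y) := rfl

theorem tm_ra (f : a ⟶ b) (g : b ⟶ c) (s : ring (ofWeight N b.wt)) (x : bimod N f)
    (y : bimod N g) : tm f g (ra f s x) y = tm f g x (la g s y) := tm_bal f g x s y

theorem ev_lin {f g : a ⟶ b} (η : f ⟶ g) : ev N η ∈ lin (bimod N f) (bimod N g) :=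
  gradedMaps_le _ _ (cellMap (sound_noRel N) η).2

theorem ev_lact {f g : a ⟶ b} (η : f ⟶ g) (r : ring (ofWeight N a.wt)) (x : bimod N f) :
    ev N η (la f r x) = la g r (ev N η x) := (ev_lin η).1 r x

theorem ev_ract {f g : a ⟶ b} (η : f ⟶ g) (r : ring (ofWeight N b.wt)) (x : bimod N f) :
    ev N η (ra f r x) = ra g r (ev N η x) := (ev_lin η).2 r x

@[simp]
theorem ev_id (f : a ⟶ b) (x : bimod N f) : ev N (𝟙 f) x = x := rfl

@[simp]
theorem ev_comp {f g h : a ⟶ b} (η : f ⟶ g) (θ : g ⟶ h) (x : bimod N f) :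
    ev N (η ≫ θ) x = ev N θ (ev N η x) := by
  induction η using Cell.ind with | _ η => induction θ using Cell.ind with | _ θ => rfl

@[simp]
theorem ev_zero (f g : a ⟶ b) (x : bimod N f) : ev N (0 : f ⟶ g) x = 0 := rfl

@[simp]
theorem ev_add {f g : a ⟶ b} (η θ : f ⟶ g) (x : bimod N f) :
    ev N (η + θ) x = ev N η x + ev N θ x := by
  induction η using Cell.ind with | _ η => induction θ using Cell.ind with | _ θ => rfl

@[simp]
theorem ev_neg {f g : a ⟶ b} (η : f ⟶ g) (x : bimod N f) : ev N (-η) x = -ev N η x := by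
  induction η using Cell.ind with | _ η => rfl

@[simp]
theorem ev_sub {f g : a ⟶ b} (η θ : f ⟶ g) (x : bimod N f) :
    ev N (η - θ) x = ev N η x - ev N θ x := by
  rw [sub_eq_add_neg, ev_add, ev_neg, sub_eq_add_neg]

@[simp]
theorem ev_sum {f g : a ⟶ b} {ι : Type*} (s : Finset ι) (η : ι → (f ⟶ g)) (x : bimod N f) :
    ev N (∑ i ∈ s, η i) x = ∑ i ∈ s, ev N (η i) x := by
  classical
  induction s using Finset.induction_on with
  | empty => simp
  | insert i s hi ih => rw [Finset.sum_insert hi, Finset.sum_insert hi, ev_add, ih]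

@[simp]
theorem ev_whiskerLeft (f : a ⟶ b) {g h : b ⟶ c} (η : g ⟶ h) (x : bimod N f) (y : bimod N g) :
    ev N (f ◁ η) (tm f g x y) = tm f h x (ev N η y) := by
  induction η using Cell.ind with | _ η => rfl

@[simp]
theorem ev_whiskerRight {f g : a ⟶ b} (η : f ⟶ g) (h : b ⟶ c) (x : bimod N f) (y : bimod N h) :
    ev N (η ▷ h) (tm f h x y) = tm g h (ev N η x) y := by
  induction η using Cell.ind with | _ η => rfl

@[simp]
theorem ev_associator_hom (f : a ⟶ b) (g : b ⟶ c) (h : c ⟶ d) (x : bimod N f) (y : bimod N g)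
    (w : bimod N h) :
    ev N (α_ f g h).hom (tm (f ≫ g) h (tm f g x y) w) = tm f (g ≫ h) x (tm g h y w) := rfl

@[simp]
theorem ev_associator_inv (f : a ⟶ b) (g : b ⟶ c) (h : c ⟶ d) (x : bimod N f) (y : bimod N g)
    (w : bimod N h) :
    ev N (α_ f g h).inv (tm f (g ≫ h) x (tm g h y w)) = tm (f ≫ g) h (tm f g x y) w := rfl

@[simp]
theorem ev_leftUnitor_hom (f : a ⟶ b) (r : ring (ofWeight N a.wt)) (x : bimod N f) :
    ev N (λ_ f).hom (tm (𝟙 a) f (sI N a r) x) = la f r x := rfl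

@[simp]
theorem ev_leftUnitor_inv (f : a ⟶ b) (x : bimod N f) :
    ev N (λ_ f).inv x = tm (𝟙 a) f (uI N a) x := rfl

@[simp]
theorem ev_rightUnitor_hom (f : a ⟶ b) (r : ring (ofWeight N b.wt)) (x : bimod N f) :
    ev N (ρ_ f).hom (tm f (𝟙 b) x (sI N b r)) = ra f r x := rfl

@[simp]
theorem ev_rightUnitor_inv (f : a ⟶ b) (x : bimod N f) :
    ev N (ρ_ f).inv x = tm f (𝟙 b) x (uI N b) := rfl

end Formal

section Generators

variable (n : ℤ)

@[simp]
theorem la_E (r : ring (ofWeight N n)) (a : (stepAt N n).A) :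
    la (E n) r (eE N n a) = eE N n ((stepAt N n).left r * a) := rfl

@[simp]
theorem ra_E (s : ring (ofWeight N (n + 2))) (a : (stepAt N n).A) :
    ra (E n) s (eE N n a) = eE N n ((stepAt N n).right s * a) := rfl

@[simp]
theorem la_F (s : ring (ofWeight N (n + 2))) (a : (stepAt N n).A) :
    la (F n) s (eF N n a) = eF N n ((stepAt N n).right s * a) := rfl

@[simp]
theorem ra_F (r : ring (ofWeight N n)) (a : (stepAt N n).A) :
    ra (F n) r (eF N n a) = eF N n ((stepAt N n).left r * a) := rfl

@[simp]
theorem la_I (a : FreeU) (r s : ring (ofWeight N a.wt)) :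
    la (𝟙 a) r (sI N a s) = sI N a (r * s) := rfl

@[simp]
theorem ra_I (a : FreeU) (r s : ring (ofWeight N a.wt)) :
    ra (𝟙 a) r (sI N a s) = sI N a (r * s) := rfl

@[simp]
theorem ev_z (a : (stepAt N n).A) : ev N (z n) (eE N n a) = eE N n ((stepAt N n).xi * a) := rfl

@[simp]
theorem ev_zh (a : (stepAt N n).A) : ev N (zh n) (eF N n a) = eF N n ((stepAt N n).xi * a) := rfl

theorem ev_U (a : (stepAt N n).A) (b : (stepAt N (n + 2)).A) :
    ev N (U n) (tm (E n) (E (n + 2)) (eE N n a) (eE N (n + 2) b)) = tEE N n (dem N n a b) := rfl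

theorem ev_Uh (a : (stepAt N n).A) (b : (stepAt N (n + 2)).A) :
    ev N (Uh n) (tm (F (n + 2)) (F n) (eF N (n + 2) b) (eF N n a)) = tFF N n (dem N n a b) := rfl

theorem ev_eta : ev N (eta n) (uI N ⟨n⟩) = ∑ j ∈ Finset.range (kAt N n + 1),
    (-1 : ℤ) ^ j • tm (E n) (F n) (eE N n ((stepAt N n).left (xcl _ j)))
      (eF N n ((stepAt N n).xi ^ (kAt N n - j))) := (etaMap_one n).trans (tEF_etaElt n)

/-- The second form of the cup, with pure powers of `ξ` in the first factor. It is preferred when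
that factor is fed into a crossing. -/
theorem ev_eta' : ev N (eta n) (uI N ⟨n⟩) = ∑ j ∈ Finset.range (kAt N n + 1),
    (-1 : ℤ) ^ j • tm (E n) (F n) (eE N n ((stepAt N n).xi ^ (kAt N n - j)))
      (eF N n ((stepAt N n).left (xcl _ j))) := (etaMap_one n).trans (tEF_etaElt' n)

theorem ev_epsh : ev N (epsh n) (uI N ⟨n + 2⟩) = ∑ j ∈ Finset.range (N - kAt N (n + 2) + 1),
    (-1 : ℤ) ^ j • tm (F n) (E n) (eF N n ((stepAt N n).right (ycl _ j)))
      (eE N n ((stepAt N n).xi ^ (N - kAt N (n + 2) - j))) :=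
  (epshMap_one n).trans (tFE_epshElt n)

theorem ev_epsh' : ev N (epsh n) (uI N ⟨n + 2⟩) = ∑ j ∈ Finset.range (N - kAt N (n + 2) + 1),
    (-1 : ℤ) ^ j • tm (F n) (E n) (eF N n ((stepAt N n).xi ^ (N - kAt N (n + 2) - j)))
      (eE N n ((stepAt N n).right (ycl _ j))) :=
  (epshMap_one n).trans (tFE_epshElt' n)

@[simp]
theorem ev_eps (a b : (stepAt N n).A) :
    ev N (eps n) (tm (F n) (E n) (eF N n a) (eE N n b)) = sI N ⟨n + 2⟩ (trUp N n (a * b)) := rfl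

@[simp]
theorem ev_etah (a b : (stepAt N n).A) :
    ev N (etah n) (tm (E n) (F n) (eE N n a) (eF N n b)) = sI N ⟨n⟩ (trDown N n (a * b)) := rfl

@[simp]
theorem ev_dots (d : ℕ) (a : (stepAt N n).A) :
    ev N (dots n d) (eE N n a) = eE N n ((stepAt N n).xi ^ d * a) := by
  induction d generalizing a with
  | zero => rw [pow_zero, one_mul]; rfl
  | succ d ih =>
    rw [dots, pow_succ]
    change ev N (z n ≫ dots n d) _ = _
    rw [ev_comp, ev_z, ih, pow_succ, mul_assoc]

end Generators

/-- Two 2-morphisms with the same bimodule map. -/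
def EvEq (N : ℕ) {a b : FreeU} {f g : a ⟶ b} (η θ : f ⟶ g) : Prop := ev N η = ev N θ

theorem evEq_E {n : ℤ} {g : (⟨n⟩ : FreeU) ⟶ ⟨n + 2⟩} {η θ : E n ⟶ g}
    (h : ∀ a, ev N η (eE N n a) = ev N θ (eE N n a)) : EvEq N η θ := AddMonoidHom.ext h

theorem evEq_F {n : ℤ} {g : (⟨n + 2⟩ : FreeU) ⟶ ⟨n⟩} {η θ : F n ⟶ g}
    (h : ∀ a, ev N η (eF N n a) = ev N θ (eF N n a)) : EvEq N η θ := AddMonoidHom.ext h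

theorem evEq_I {a : FreeU} {g : a ⟶ a} {η θ : 𝟙 a ⟶ g}
    (h : ev N η (uI N a) = ev N θ (uI N a)) : EvEq N η θ :=
  (lgen_I a).hom_ext (ev_lin η) (ev_lin θ) fun _ hx => hx ▸ h

theorem sum_neg_one_pow_zsmul {B C : Type*} [Ring B] [AddCommGroup C] (φ : B →+ C) (s : Finset ℕ)
    (f : ℕ → B) : ∑ j ∈ s, (-1 : ℤ) ^ j • φ (f j) = φ (∑ j ∈ s, (-1) ^ j * f j) := by
  rw [map_sum]
  exact Finset.sum_congr rfl fun j _ => (map_neg_one_pow_zsmul φ j (f j)).symm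

end Ev

end EqFlagRep
end

noncomputable section

namespace EqFlagRep

open GrBimod FreeU

/-! ### Biadjointness and cyclicity of dots -/

section Biadjoint

variable {N : ℕ} (n : ℤ)

/-- On an element `a` the diagram computes the expansion of `a` in dual bases; the three other
zigzags are its variants for the other side and the other adjunction. -/
theorem evEq_zigzagE :
    EvEq N (𝟙 (E n) ⊗≫ eta n ▷ E n ⊗≫ E n ◁ eps n ⊗≫ 𝟙 (E n)) (𝟙 (E n)) := by
  refine evEq_E fun a => ?_
  simp [bicategoricalComp, ev_eta, mul_comm ((stepAt N n).right _)]
  rw [sum_neg_one_pow_zsmul]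
  exact congrArg _ ((stepFacts n).frobUp.sum_dual (trUp_spec N n) a)

theorem evEq_zigzagF :
    EvEq N (𝟙 (F n) ⊗≫ F n ◁ eta n ⊗≫ eps n ▷ F n ⊗≫ 𝟙 (F n)) (𝟙 (F n)) := by
  refine evEq_F fun a => ?_
  simp [bicategoricalComp, ev_eta]
  rw [sum_neg_one_pow_zsmul]
  refine congrArg _ (Eq.trans ?_ ((stepFacts n).frobUp.sum_dual_symm (trUp_spec N n) a))
  exact Finset.sum_congr rfl fun j _ => by simp only [kAt]; ring_nf

theorem evEq_zigzagF' :
    EvEq N (𝟙 (F n) ⊗≫ epsh n ▷ F n ⊗≫ F n ◁ etah n ⊗≫ 𝟙 (F n)) (𝟙 (F n)) := by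
  refine evEq_F fun a => ?_
  simp [bicategoricalComp, ev_epsh, mul_comm ((stepAt N n).left _)]
  rw [sum_neg_one_pow_zsmul]
  exact congrArg _ ((stepFacts n).frobDown.sum_dual (trDown_spec N n) a)

theorem evEq_zigzagE' :
    EvEq N (𝟙 (E n) ⊗≫ E n ◁ epsh n ⊗≫ etah n ▷ E n ⊗≫ 𝟙 (E n)) (𝟙 (E n)) := by
  refine evEq_E fun a => ?_
  simp [bicategoricalComp, ev_epsh]
  rw [sum_neg_one_pow_zsmul]
  refine congrArg _ (Eq.trans ?_ ((stepFacts n).frobDown.sum_dual_symm (trDown_spec N n) a))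
  exact Finset.sum_congr rfl fun j _ => by simp only [kAt]; ring_nf

/-- The dot ends up inside the trace, so this is the dual basis expansion of `ξ * a`. -/
theorem evEq_cyclicZ :
    EvEq N (𝟙 (F n) ⊗≫ epsh n ▷ F n ⊗≫ F n ◁ z n ▷ F n ⊗≫ F n ◁ etah n ⊗≫ 𝟙 (F n)) (zh n) := by
  refine evEq_F fun a => ?_
  simp [bicategoricalComp, ev_epsh]
  rw [sum_neg_one_pow_zsmul]
  refine congrArg _ (Eq.trans ?_ ((stepFacts n).frobDown.sum_dual (trDown_spec N n)
    ((stepAt N n).xi * a)))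
  exact Finset.sum_congr rfl fun j _ => by simp only [kAt]; ring_nf

theorem evEq_cyclicZ' :
    EvEq N (𝟙 (F n) ⊗≫ F n ◁ eta n ⊗≫ F n ◁ z n ▷ F n ⊗≫ eps n ▷ F n ⊗≫ 𝟙 (F n)) (zh n) := by
  refine evEq_F fun a => ?_
  simp [bicategoricalComp, ev_eta]
  rw [sum_neg_one_pow_zsmul]
  refine congrArg _ (Eq.trans ?_ ((stepFacts n).frobUp.sum_dual_symm (trUp_spec N n)
    ((stepAt N n).xi * a)))
  exact Finset.sum_congr rfl fun j _ => by simp only [kAt]; ring_nf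

end Biadjoint

end EqFlagRep
end

noncomputable section

namespace EqFlagRep

open GrBimod FreeU

/-! ### The nilHecke relations -/

section NilHecke

open PushoutRing TwoStep

variable {N : ℕ} (n : ℤ)

theorem ev_z_tEE (w : RingEE N n) :
    ev N (z n ▷ E (n + 2)) (tEE N n w) = tEE N n (xi₁ _ _ * w) := by
  induction w using PushoutRing.induction with
  | h0 => simp
  | hadd u v hu hv => simp only [mul_add, map_add, hu, hv]
  | ht p q => rw [xi₁, ← mul_assoc, ← map_mul, tEE_mul, tEE_mul, ev_whiskerRight, ev_z]

theorem ev_z_tEE' (w : RingEE N n) :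
    ev N (E n ◁ z (n + 2)) (tEE N n w) = tEE N n (xi₂ _ _ * w) := by
  induction w using PushoutRing.induction with
  | h0 => simp
  | hadd u v hu hv => simp only [mul_add, map_add, hu, hv]
  | ht p q => rw [xi₂, mul_left_comm, ← map_mul, tEE_mul, tEE_mul, ev_whiskerLeft, ev_z]

theorem dem_xi_left (a : (stepAt N n).A) (b : (stepAt N (n + 2)).A) :
    dem N n ((stepAt N n).xi * a) b = xi₂ _ _ * dem N n a b - inl _ _ a * inr _ _ b := by
  rw [(dem_spec N n).xi_left, (dem_spec N n).xi_right]
  ring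

theorem evEq_EE {g : (⟨n⟩ : FreeU) ⟶ ⟨n + 2 + 2⟩} {η θ : E n ≫ E (n + 2) ⟶ g}
    (h : ∀ a b, ev N η (tm (E n) (E (n + 2)) (eE N n a) (eE N (n + 2) b)) =
      ev N θ (tm (E n) (E (n + 2)) (eE N n a) (eE N (n + 2) b))) : EvEq N η θ :=
  AddMonoidHom.ext (forall_tm h)

theorem evEq_nilHecke :
    EvEq N (E n ◁ z (n + 2) ≫ U n - U n ≫ z n ▷ E (n + 2)) (𝟙 (E n ≫ E (n + 2))) := by
  refine evEq_EE n fun a b => ?_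
  rw [ev_sub, ev_comp, ev_comp, ev_whiskerLeft, ev_z, ev_U, ev_U, ev_z_tEE, ev_id,
    (dem_spec N n).xi_right, map_add, add_sub_cancel_left, tEE_mul]

theorem evEq_nilHecke' :
    EvEq N (U n ≫ E n ◁ z (n + 2) - z n ▷ E (n + 2) ≫ U n) (𝟙 (E n ≫ E (n + 2))) := by
  refine evEq_EE n fun a b => ?_
  rw [ev_sub, ev_comp, ev_comp, ev_whiskerRight, ev_z, ev_U, ev_U, ev_z_tEE', ev_id,
    dem_xi_left, map_sub, sub_sub_cancel, tEE_mul]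

theorem ev_U_z' (x : bimod N (E n ≫ E (n + 2))) : ev N (U n) (ev N (E n ◁ z (n + 2)) x) =
    ev N (z n ▷ E (n + 2)) (ev N (U n) x) + x := by
  have := DFunLike.congr_fun (evEq_nilHecke (N := N) n) x
  rw [ev_sub, ev_comp, ev_comp, ev_id] at this
  exact sub_eq_iff_eq_add'.1 this

theorem ev_U_z (x : bimod N (E n ≫ E (n + 2))) : ev N (U n) (ev N (z n ▷ E (n + 2)) x) =
    ev N (E n ◁ z (n + 2)) (ev N (U n) x) - x := by
  have := DFunLike.congr_fun (evEq_nilHecke' (N := N) n) x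
  rw [ev_sub, ev_comp, ev_comp, ev_id] at this
  exact eq_sub_of_add_eq' (sub_eq_iff_eq_add.1 this).symm

theorem ev_U_one : ev N (U n) (tm (E n) (E (n + 2)) (eE N n 1) (eE N (n + 2) 1)) = 0 := by
  rw [ev_U, (dem_spec N n).one, map_zero]

/-- The elements of the bimodule of `ℰℰ 1_n` are generated by `1 ⊗ 1` under dots. -/
theorem gen_EE (G : AddSubgroup (bimod N (E n ≫ E (n + 2))))
    (h1 : tm (E n) (E (n + 2)) (eE N n 1) (eE N (n + 2) 1) ∈ G)
    (hl : ∀ r, ∀ x ∈ G, la (E n ≫ E (n + 2)) r x ∈ G)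
    (hz : ∀ x ∈ G, ev N (z n ▷ E (n + 2)) x ∈ G)
    (hz' : ∀ x ∈ G, ev N (E n ◁ z (n + 2)) x ∈ G) (x) : x ∈ G := by
  refine lgen_tm (lgen_E n) (lgen_E (n + 2)) G hl (forall_range_tm fun i j => ?_) x
  have h2 : tm (E n) (E (n + 2)) (eE N n ((stepAt N n).xi ^ i)) (eE N (n + 2) 1) ∈ G := by
    induction i with
    | zero => rw [pow_zero]; exact h1
    | succ i ih => have := hz _ ih; rwa [ev_whiskerRight, ev_z, ← pow_succ'] at this
  induction j with
  | zero => rw [pow_zero]; exact h2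
  | succ j ih => have := hz' _ ih; rwa [ev_whiskerLeft, ev_z, ← pow_succ'] at this

/-- The kernel of the square of the crossing is closed under scalars and under both dots, because
the correction terms of the two dot relations cancel. It contains `1 ⊗ 1`, which generates
everything under dots. -/
theorem evEq_nilpotent : EvEq N (U n ≫ U n) 0 := by
  refine AddMonoidHom.ext fun x => ?_
  refine gen_EE n (AddMonoidHom.ker (ev N (U n ≫ U n))) ?_ (fun r x hx => ?_) (fun x hx => ?_)
    (fun x hx => ?_) x
  · rw [AddMonoidHom.mem_ker, ev_comp, ev_U_one, map_zero]
  · rw [AddMonoidHom.mem_ker] at hx ⊢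
    rw [ev_lact, hx]
    exact map_zero _
  · rw [AddMonoidHom.mem_ker, ev_comp] at hx ⊢
    rw [ev_U_z, map_sub, ev_U_z', hx, map_zero, zero_add, sub_self]
  · rw [AddMonoidHom.mem_ker, ev_comp] at hx ⊢
    rw [ev_U_z', map_add, ev_U_z, hx, map_zero, zero_sub, neg_add_cancel]

theorem ev_U_U (x : bimod N (E n ≫ E (n + 2))) : ev N (U n) (ev N (U n) x) = 0 := by
  have := DFunLike.congr_fun (evEq_nilpotent (N := N) n) x
  rwa [ev_comp] at this

section Braid

variable {M : Type*} [AddCommGroup M] {u v z₁ z₂ z₃ : M →+ M}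

/-- Pushing a dot through either triple product gives the same permuted dot and correction terms
that match by `uu` and `vv`. Hence elements on which the braid relation holds are closed under
adding dots. -/
theorem braid_ker (uu : ∀ x, u (u x) = 0) (vv : ∀ x, v (v x) = 0)
    (uz₁ : ∀ x, u (z₁ x) = z₂ (u x) - x) (uz₂ : ∀ x, u (z₂ x) = z₁ (u x) + x)
    (uz₃ : ∀ x, u (z₃ x) = z₃ (u x)) (vz₁ : ∀ x, v (z₁ x) = z₁ (v x))
    (vz₂ : ∀ x, v (z₂ x) = z₃ (v x) - x) (vz₃ : ∀ x, v (z₃ x) = z₂ (v x) + x) (x : M)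
    (h : v (u (v x)) = u (v (u x))) :
    v (u (v (z₁ x))) = u (v (u (z₁ x))) ∧ v (u (v (z₂ x))) = u (v (u (z₂ x))) ∧
      v (u (v (z₃ x))) = u (v (u (z₃ x))) := by
  refine ⟨?_, ?_, ?_⟩ <;>
  · simp only [uz₁, uz₂, uz₃, vz₁, vz₂, vz₃, map_add, map_sub, uu, vv, h]
    abel

end Braid

/-- The crossing of the first two strands of `ℰℰℰ 1_n`. -/
def crossFst : E n ≫ E (n + 2) ≫ E (n + 2 + 2) ⟶ E n ≫ E (n + 2) ≫ E (n + 2 + 2) :=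
  (α_ (E n) (E (n + 2)) (E (n + 2 + 2))).inv ≫ U n ▷ E (n + 2 + 2) ≫
    (α_ (E n) (E (n + 2)) (E (n + 2 + 2))).hom

theorem ev_congr {a b : FreeU} {f g : a ⟶ b} {η θ : f ⟶ g} (h : η = θ) (x : bimod N f) :
    ev N η x = ev N θ x := by rw [h]

/-! ### Dots and crossings on three strands -/

section Crossings

variable (x : bimod N (E n ≫ E (n + 2) ≫ E (n + 2 + 2)))

theorem ev_crossFst : ev N (crossFst n) x =
    ev N (α_ (E n) (E (n + 2)) (E (n + 2 + 2))).hom (ev N (U n ▷ E (n + 2 + 2))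
      (ev N (α_ (E n) (E (n + 2)) (E (n + 2 + 2))).inv x)) := by
  rw [crossFst, ev_comp, ev_comp]

theorem ev_crossFst_crossFst : ev N (crossFst n) (ev N (crossFst n) x) = 0 := by
  refine forall_tm (φ := (ev N (crossFst n)).comp (ev N (crossFst n))) (ψ := 0) (fun a y => ?_) x
  have h : ∀ y, ev N (U n ▷ E (n + 2 + 2)) (ev N (U n ▷ E (n + 2 + 2)) y) = 0 := by
    refine forall_tm (φ := (ev N (U n ▷ E (n + 2 + 2))).comp (ev N (U n ▷ E (n + 2 + 2)))) (ψ := 0)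
      fun y c => ?_
    rw [AddMonoidHom.comp_apply, ev_whiskerRight, ev_whiskerRight, ev_U_U, map_zero]
    rfl
  rw [AddMonoidHom.comp_apply, ev_crossFst, ev_crossFst, ← ev_comp (α_ _ _ _).hom,
    Iso.hom_inv_id, ev_id, h, map_zero]
  rfl

/-- The two-strand dot relation, transported along the associators hidden in `crossFst` by their
naturality. -/
theorem ev_crossFst_z₁ : ev N (crossFst n) (ev N (z n ▷ (E (n + 2) ≫ E (n + 2 + 2))) x) =
    ev N (E n ◁ z (n + 2) ▷ E (n + 2 + 2)) (ev N (crossFst n) x) - x := by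
  have h : ∀ y, ev N (U n ▷ E (n + 2 + 2)) (ev N (z n ▷ E (n + 2) ▷ E (n + 2 + 2)) y) =
      ev N ((E n ◁ z (n + 2)) ▷ E (n + 2 + 2)) (ev N (U n ▷ E (n + 2 + 2)) y) - y := by
    refine forall_tm (φ := (ev N (U n ▷ E (n + 2 + 2))).comp
      (ev N (z n ▷ E (n + 2) ▷ E (n + 2 + 2))))
      (ψ := (ev N ((E n ◁ z (n + 2)) ▷ E (n + 2 + 2))).comp (ev N (U n ▷ E (n + 2 + 2))) -
        AddMonoidHom.id _) fun y c => ?_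
    simp only [AddMonoidHom.comp_apply, AddMonoidHom.sub_apply, AddMonoidHom.id_apply,
      ev_whiskerRight, ev_U_z, map_sub]
  rw [ev_crossFst, ← ev_comp (z n ▷ _), associator_inv_naturality_left, ev_comp, h, map_sub,
    ← ev_comp _ (α_ _ _ _).hom, associator_naturality_middle, ev_comp, ← ev_crossFst,
    ← ev_comp (α_ _ _ _).inv, Iso.inv_hom_id, ev_id]

theorem ev_crossFst_z₂ : ev N (crossFst n) (ev N (E n ◁ z (n + 2) ▷ E (n + 2 + 2)) x) =
    ev N (z n ▷ (E (n + 2) ≫ E (n + 2 + 2))) (ev N (crossFst n) x) + x := by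
  have h : ∀ y, ev N (U n ▷ E (n + 2 + 2)) (ev N ((E n ◁ z (n + 2)) ▷ E (n + 2 + 2)) y) =
      ev N (z n ▷ E (n + 2) ▷ E (n + 2 + 2)) (ev N (U n ▷ E (n + 2 + 2)) y) + y := by
    refine forall_tm (φ := (ev N (U n ▷ E (n + 2 + 2))).comp
      (ev N ((E n ◁ z (n + 2)) ▷ E (n + 2 + 2))))
      (ψ := (ev N (z n ▷ E (n + 2) ▷ E (n + 2 + 2))).comp (ev N (U n ▷ E (n + 2 + 2))) +
        AddMonoidHom.id _) fun y c => ?_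
    simp only [AddMonoidHom.comp_apply, AddMonoidHom.add_apply, AddMonoidHom.id_apply,
      ev_whiskerRight, ev_U_z', map_add]
  rw [ev_crossFst, ← ev_comp (E n ◁ z (n + 2) ▷ _), associator_inv_naturality_middle, ev_comp, h,
    map_add, ← ev_comp _ (α_ _ _ _).hom, associator_naturality_left, ev_comp, ← ev_crossFst,
    ← ev_comp (α_ _ _ _).inv, Iso.inv_hom_id, ev_id]

theorem ev_crossFst_z₃ : ev N (crossFst n) (ev N (E n ◁ E (n + 2) ◁ z (n + 2 + 2)) x) =
    ev N (E n ◁ E (n + 2) ◁ z (n + 2 + 2)) (ev N (crossFst n) x) := by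
  rw [← ev_comp, ← ev_comp]
  refine ev_congr ?_ x
  rw [crossFst, associator_inv_naturality_right_assoc, Category.assoc, Category.assoc,
    whisker_exchange_assoc, associator_naturality_right]

theorem ev_crossSnd_z₁ :
    ev N (E n ◁ U (n + 2)) (ev N (z n ▷ (E (n + 2) ≫ E (n + 2 + 2))) x) =
    ev N (z n ▷ (E (n + 2) ≫ E (n + 2 + 2))) (ev N (E n ◁ U (n + 2)) x) := by
  rw [← ev_comp, ← ev_comp, whisker_exchange]

theorem ev_crossSnd_z₂ :
    ev N (E n ◁ U (n + 2)) (ev N (E n ◁ z (n + 2) ▷ E (n + 2 + 2)) x) =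
    ev N (E n ◁ E (n + 2) ◁ z (n + 2 + 2)) (ev N (E n ◁ U (n + 2)) x) - x := by
  refine forall_tm (φ := (ev N (E n ◁ U (n + 2))).comp (ev N (E n ◁ z (n + 2) ▷ E (n + 2 + 2))))
    (ψ := (ev N (E n ◁ E (n + 2) ◁ z (n + 2 + 2))).comp (ev N (E n ◁ U (n + 2))) -
      AddMonoidHom.id _) (fun c y => ?_) x
  simp only [AddMonoidHom.comp_apply, AddMonoidHom.sub_apply, AddMonoidHom.id_apply,
    ev_whiskerLeft, ev_U_z, map_sub]

theorem ev_crossSnd_z₃ :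
    ev N (E n ◁ U (n + 2)) (ev N (E n ◁ E (n + 2) ◁ z (n + 2 + 2)) x) =
    ev N (E n ◁ z (n + 2) ▷ E (n + 2 + 2)) (ev N (E n ◁ U (n + 2)) x) + x := by
  refine forall_tm (φ := (ev N (E n ◁ U (n + 2))).comp (ev N (E n ◁ E (n + 2) ◁ z (n + 2 + 2))))
    (ψ := (ev N (E n ◁ z (n + 2) ▷ E (n + 2 + 2))).comp (ev N (E n ◁ U (n + 2))) +
      AddMonoidHom.id _) (fun c y => ?_) x
  simp only [AddMonoidHom.comp_apply, AddMonoidHom.add_apply, AddMonoidHom.id_apply,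
    ev_whiskerLeft, ev_U_z', map_add]

theorem ev_crossSnd_crossSnd : ev N (E n ◁ U (n + 2)) (ev N (E n ◁ U (n + 2)) x) = 0 := by
  refine forall_tm (φ := (ev N (E n ◁ U (n + 2))).comp (ev N (E n ◁ U (n + 2)))) (ψ := 0)
    (fun c y => ?_) x
  rw [AddMonoidHom.comp_apply, ev_whiskerLeft, ev_whiskerLeft, ev_U_U, map_zero]
  rfl

/-- Both triple products kill `1 ⊗ 1 ⊗ 1`, and `braid_ker` propagates the equality to all monomials.
-/
theorem ev_braid : ev N (E n ◁ U (n + 2)) (ev N (crossFst n) (ev N (E n ◁ U (n + 2)) x)) =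
    ev N (crossFst n) (ev N (E n ◁ U (n + 2)) (ev N (crossFst n) x)) := by
  have key := braid_ker (ev_crossFst_crossFst (N := N) n) (ev_crossSnd_crossSnd n)
    (ev_crossFst_z₁ n) (ev_crossFst_z₂ n) (ev_crossFst_z₃ n) (ev_crossSnd_z₁ n)
    (ev_crossSnd_z₂ n) (ev_crossSnd_z₃ n)
  have h := (lgen_tm (lgen_E n) (lgen_tm (lgen_E (n + 2)) (lgen_E (n + 2 + 2)))).hom_ext
    (ev_lin (N := N) (E n ◁ U (n + 2) ≫ crossFst n ≫ E n ◁ U (n + 2)))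
    (ev_lin (N := N) (crossFst n ≫ E n ◁ U (n + 2) ≫ crossFst n)) ?_
  · have := DFunLike.congr_fun h x
    simpa only [ev_comp] using this
  · rintro _ ⟨_, ⟨i, rfl⟩, _, ⟨_, ⟨j, rfl⟩, _, ⟨l, rfl⟩, rfl⟩, rfl⟩
    simp only [ev_comp]
    -- Monomials are built by adding dots to the third, then the second, then the first strand, so
    -- the exponents are removed in the opposite order.
    induction i with
    | succ i ih =>
      have := (key _ ih).1
      simp only [ev_whiskerRight, ev_z, ← pow_succ'] at this
      exact this
    | zero =>
      induction j with
      | succ j ih =>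
        have := (key _ ih).2.1
        simp only [ev_whiskerLeft, ev_whiskerRight, ev_z, ← pow_succ'] at this
        exact this
      | zero =>
        induction l with
        | succ l ih =>
          have := (key _ ih).2.2
          simp only [ev_whiskerLeft, ev_z, ← pow_succ'] at this
          exact this
        | zero =>
          simp only [pow_zero, ev_whiskerLeft, ev_U_one, map_zero, ev_crossFst, ev_associator_inv,
            ev_whiskerRight, AddMonoidHom.zero_apply]

end Crossings

theorem evEq_reidemeister :
    EvEq N (E n ◁ U (n + 2) ⊗≫ U n ▷ E (n + 2 + 2) ⊗≫ E n ◁ U (n + 2))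
      (𝟙 (E n ≫ E (n + 2) ≫ E (n + 2 + 2)) ⊗≫ U n ▷ E (n + 2 + 2) ⊗≫ E n ◁ U (n + 2) ⊗≫
        U n ▷ E (n + 2 + 2) ⊗≫ 𝟙 (E n ≫ E (n + 2) ≫ E (n + 2 + 2))) := by
  refine AddMonoidHom.ext fun x => ?_
  have := ev_braid n x
  simp only [ev_crossFst] at this
  simpa [bicategoricalComp] using this

end NilHecke

end EqFlagRep
end

noncomputable section

namespace EqFlagRep

open GrBimod FreeU

/-! ### Cyclicity of crossings -/

section Cyclic

open PushoutRing TwoStep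

variable {N : ℕ}

/-- The rings contain `1/2`. Needed to deduce vanishing from antisymmetry. -/
theorem ring_two_torsion_free (o : Option (Fin (N + 1))) {x : ring o} (h : x + x = 0) : x = 0 := by
  have h1 : ratHom o 2⁻¹ * (ratHom o 2 * x) = x := by
    rw [← mul_assoc, ← map_mul, show (2⁻¹ * 2 : ℚ) = 1 by norm_num, map_one, one_mul]
  rw [← h1, show (2 : ℚ) = 1 + 1 by norm_num, map_add, map_one, add_mul, one_mul, h, mul_zero]

theorem map_signed {A B : Type} [Ring A] [Ring B] (φ : A →+* B) (c : ℕ → A) (e : ℤ) :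
    φ (signed c e) = signed (fun j => φ (c j)) e := by
  rw [signed, signed]
  split_ifs <;> simp

theorem map_signed_invCoeff {A B : Type} [Ring A] [Ring B] (φ : A →+* B) (c : ℕ → A) (e : ℤ) :
    φ (signed (invCoeff c) e) = signed (invCoeff fun j => φ (c j)) e := by
  rw [map_signed]
  exact congrArg (signed · e) (funext fun j => map_invCoeff φ c j)

/-- On generating series the hypothesis reads `E_f = E_g (1 - ξ t)`; inverting gives `H_g = H_f (1 -
ξ t)`. -/
theorem signed_invCoeff_succ {A : Type} [CommRing A] {f g : ℕ → A} {ξ : A} (hf : f 0 = 1)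
    (hg : g 0 = 1) (h : ∀ j, f (j + 1) = g (j + 1) + ξ * g j) (e : ℤ) :
    signed (invCoeff g) e = signed (invCoeff f) e - ξ * signed (invCoeff f) (e - 1) := by
  have h1 : elemSeries f = elemSeries g * (1 - PowerSeries.C ξ * PowerSeries.X) := by
    ext j
    cases j with
    | zero => simp [elemSeries, hf, hg]
    | succ j =>
      rw [mul_sub, mul_one, ← mul_assoc, map_sub, PowerSeries.coeff_succ_mul_X, mul_comm,
        PowerSeries.coeff_C_mul]
      simp only [elemSeries, PowerSeries.coeff_mk, h]
      ring
  have h2 : complSeries g = complSeries f * (1 - PowerSeries.C ξ * PowerSeries.X) := by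
    have hF := elemSeries_mul_complSeries f hf
    have hG := elemSeries_mul_complSeries g hg
    rw [h1] at hF
    linear_combination (1 - PowerSeries.C ξ * PowerSeries.X) * complSeries f * hG -
      complSeries g * hF
  rcases lt_or_ge e 0 with he | he
  · rw [signed_of_neg _ he, signed_of_neg _ he, signed_of_neg _ (by omega)]
    ring
  · lift e to ℕ using he
    have := congrArg (PowerSeries.coeff e) h2
    cases e with
    | zero =>
      have h3 : signed (invCoeff f) (((0 : ℕ) : ℤ) - 1) = 0 := signed_of_neg _ (by norm_num)
      rw [h3, signed_natCast, signed_natCast]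
      simpa [complSeries] using this
    | succ e =>
      rw [show (((e + 1 : ℕ) : ℤ) - 1) = (e : ℤ) by push_cast; ring, signed_natCast, signed_natCast,
        signed_natCast]
      rw [mul_sub, mul_one, ← mul_assoc, map_sub, PowerSeries.coeff_succ_mul_X, mul_comm,
        PowerSeries.coeff_C_mul] at this
      simpa only [complSeries, PowerSeries.coeff_mk] using this

/-! ### Traces of two step flags and the divided difference -/

section Steps

variable (n : ℤ)

theorem right_signed_Xcl (e : ℤ) : (stepAt N n).right (signed (Xcl (ofWeight N (n + 2))) e) =
    (stepAt N n).left (signed (Xcl (ofWeight N n)) e) -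
      (stepAt N n).xi * (stepAt N n).left (signed (Xcl (ofWeight N n)) (e - 1)) := by
  rw [Xcl, Xcl, map_signed_invCoeff, map_signed_invCoeff, map_signed_invCoeff]
  exact signed_invCoeff_succ (by rw [ycl_zero, map_one]) (by rw [ycl_zero, map_one])
    (stepFacts n).left_ycl e

theorem left_signed_Ycl (e : ℤ) : (stepAt N n).left (signed (Ycl (ofWeight N n)) e) =
    (stepAt N n).right (signed (Ycl (ofWeight N (n + 2))) e) -
      (stepAt N n).xi * (stepAt N n).right (signed (Ycl (ofWeight N (n + 2))) (e - 1)) := by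
  rw [Ycl, Ycl, map_signed_invCoeff, map_signed_invCoeff, map_signed_invCoeff]
  exact signed_invCoeff_succ (by rw [xcl_zero, map_one]) (by rw [xcl_zero, map_one])
    (stepFacts n).right_xcl e

/-- Monomials in the two roots span over the first ring: the second factor is spanned by powers of
its root over the middle ring, whose scalars move to the first factor, itself spanned by powers of
`ξ₁` over the first ring. -/
theorem forall_fst_mul (G : AddSubgroup (RingEE N n))
    (h : ∀ r i j, fst _ _ r * (inl _ _ ((stepAt N n).xi ^ i) *
      inr _ _ ((stepAt N (n + 2)).xi ^ j)) ∈ G) (w) : w ∈ G := by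
  have h1 : ∀ a j, inl _ _ a * inr _ _ ((stepAt N (n + 2)).xi ^ j) ∈ G := fun a j => by
    refine (stepFacts n).lower.span
      (G.comap ((AddMonoidHom.mulRight (inr _ _ ((stepAt N (n + 2)).xi ^ j))).comp
        (inl _ _).toAddMonoidHom)) (fun i _ r => ?_) a
    change inl _ _ (_ * _) * _ ∈ G
    rw [map_mul, mul_assoc]
    exact h r i j
  have h2 : ∀ b a, inl _ _ a * inr _ _ b ∈ G := fun b => by
    have := (stepFacts (N := N) (n + 2)).lower.span
      (⨅ a, G.comap ((AddMonoidHom.mulLeft (inl (stepAt N n).right (stepAt N (n + 2)).left a)).comp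
        (inr _ _).toAddMonoidHom)) (fun i _ s => ?_) b
    · exact fun a => (AddSubgroup.mem_iInf.1 this) a
    · rw [AddSubgroup.mem_iInf]
      intro a
      change _ * inr _ _ (_ * _) ∈ G
      rw [map_mul, ← inl_comp, ← mul_assoc, ← map_mul]
      exact h1 _ i
  induction w using PushoutRing.induction with
  | h0 => exact zero_mem G
  | ht a b => exact h2 b a
  | hadd u v hu hv => exact add_mem hu hv

theorem forall_lst_mul (G : AddSubgroup (RingEE N n))
    (h : ∀ r i j, lst _ _ r * (inl _ _ ((stepAt N n).xi ^ i) *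
      inr _ _ ((stepAt N (n + 2)).xi ^ j)) ∈ G) (w) : w ∈ G := by
  have h1 : ∀ b i, inl _ _ ((stepAt N n).xi ^ i) * inr _ _ b ∈ G := fun b i => by
    refine (stepFacts (n + 2)).upper.span
      (G.comap ((AddMonoidHom.mulLeft (inl _ _ ((stepAt N n).xi ^ i))).comp
        (inr _ _).toAddMonoidHom)) (fun j _ r => ?_) b
    change _ * inr _ _ (_ * _) ∈ G
    rw [map_mul, mul_left_comm]
    exact h r i j
  have h2 : ∀ a b, inl _ _ a * inr _ _ b ∈ G := fun a => by
    have := (stepFacts (N := N) n).upper.span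
      (⨅ b, G.comap ((AddMonoidHom.mulRight (inr (stepAt N n).right (stepAt N (n + 2)).left b)).comp
        (inl _ _).toAddMonoidHom)) (fun i _ s => ?_) a
    · exact fun b => (AddSubgroup.mem_iInf.1 this) b
    · rw [AddSubgroup.mem_iInf]
      intro b
      change inl _ _ (_ * _) * _ ∈ G
      rw [map_mul, inl_comp, mul_comm (inr _ _ _), mul_assoc, ← map_mul]
      exact h1 _ i
  induction w using PushoutRing.induction with
  | h0 => exact zero_mem G
  | ht a b => exact h2 a b
  | hadd u v hu hv => exact add_mem hu hv

variable (N) in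
/-- The divided difference operator as an endomorphism. -/
def demEnd : RingEE N n →+ RingEE N n := PushoutRing.lift _ _ (dem N n) (dem_spec N n).bal

theorem demEnd_mul (a b) : demEnd N n (inl _ _ a * inr _ _ b) = dem N n a b := lift_mul _ _ _ _ a b

theorem demEnd_one : demEnd N n 1 = 0 := by
  have := demEnd_mul (N := N) n 1 1
  rwa [map_one, map_one, mul_one, (dem_spec N n).one] at this

theorem demEnd_fst (r w) : demEnd N n (fst _ _ r * w) = fst _ _ r * demEnd N n w := by
  induction w using PushoutRing.induction with
  | h0 => simp
  | hadd u v hu hv => simp only [mul_add, map_add, hu, hv]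
  | ht a b =>
    rw [RingHom.comp_apply, ← mul_assoc, ← map_mul, demEnd_mul, demEnd_mul, (dem_spec N n).left_mul,
      RingHom.comp_apply]

theorem demEnd_lst (r w) : demEnd N n (lst _ _ r * w) = lst _ _ r * demEnd N n w := by
  induction w using PushoutRing.induction with
  | h0 => simp
  | hadd u v hu hv => simp only [mul_add, map_add, hu, hv]
  | ht a b =>
    rw [RingHom.comp_apply, mul_left_comm, ← map_mul, demEnd_mul, demEnd_mul,
      (dem_spec N n).right_mul, RingHom.comp_apply]

theorem demEnd_xi₁ (w) : demEnd N n (xi₁ _ _ * w) = xi₂ _ _ * demEnd N n w - w := by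
  induction w using PushoutRing.induction with
  | h0 => simp
  | hadd u v hu hv => simp only [mul_add, map_add, hu, hv]; abel
  | ht a b => rw [xi₁, ← mul_assoc, ← map_mul, demEnd_mul, demEnd_mul, dem_xi_left]

theorem demEnd_xi₂ (w) : demEnd N n (xi₂ _ _ * w) = xi₁ _ _ * demEnd N n w + w := by
  induction w using PushoutRing.induction with
  | h0 => simp
  | hadd u v hu hv => simp only [mul_add, map_add, hu, hv]; abel
  | ht a b => rw [xi₂, mul_left_comm, ← map_mul, demEnd_mul, demEnd_mul, (dem_spec N n).xi_right]

/-- The `w` satisfying this for all `v` contain `1` by `hT`. Adding a dot on either strand moves a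
root to `v`, interchanged, with error terms `∓ w * v` that cancel on the two sides; monomials and
scalars of the first ring then suffice. -/
theorem demEnd_adjoint {C : Type*} [AddCommGroup C] (T : RingEE N n →+ C)
    (hT : ∀ w, T (demEnd N n w) = 0) (w v : RingEE N n) :
    T (demEnd N n w * v) = T (w * demEnd N n v) := by
  let G : AddSubgroup (RingEE N n) :=
    { carrier := {w | ∀ v, T (demEnd N n w * v) = T (w * demEnd N n v)}
      zero_mem' := fun v => by simp
      add_mem' := fun ha hb v => by simp only [map_add, add_mul, ha v, hb v]
      neg_mem' := fun ha v => by simp only [map_neg, neg_mul, ha v] }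
  have h1 : (1 : RingEE N n) ∈ G := fun v => by
    rw [demEnd_one, zero_mul, one_mul, hT, map_zero]
  have h2 : ∀ w ∈ G, xi₁ _ _ * w ∈ G := fun w hw v => by
    have := hw (xi₂ _ _ * v)
    rw [demEnd_xi₂, mul_add, map_add] at this
    rw [demEnd_xi₁, show (xi₂ _ _ * demEnd N n w - w) * v =
      demEnd N n w * (xi₂ _ _ * v) - w * v by ring, map_sub, this, add_sub_cancel_right]
    exact congrArg T (by ring)
  have h3 : ∀ w ∈ G, xi₂ _ _ * w ∈ G := fun w hw v => by
    have := hw (xi₁ _ _ * v)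
    rw [demEnd_xi₁, mul_sub, map_sub] at this
    rw [demEnd_xi₂, show (xi₁ _ _ * demEnd N n w + w) * v =
      demEnd N n w * (xi₁ _ _ * v) + w * v by ring, map_add, this, sub_add_cancel]
    exact congrArg T (by ring)
  refine forall_fst_mul n G (fun r i j => ?_) w v
  have h4 : inl _ _ ((stepAt N n).xi ^ i) * inr _ _ ((stepAt N (n + 2)).xi ^ j) ∈ G := by
    rw [map_pow, map_pow]
    have h5 : xi₂ (stepAt N n) (stepAt N (n + 2)) ^ j ∈ G := by
      induction j with
      | zero => rw [pow_zero]; exact h1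
      | succ j ih => rw [pow_succ']; exact h3 _ ih
    induction i with
    | zero => rw [pow_zero, one_mul]; exact h5
    | succ i ih => rw [pow_succ', mul_assoc]; exact h2 _ ih
  intro v
  have h6 := h4 (fst _ _ r * v)
  rw [demEnd_fst] at h6
  rw [demEnd_fst, mul_assoc, mul_left_comm, h6]
  exact congrArg T (by ring)

/-- A function that is antisymmetric on monomials vanishes on divided differences. -/
theorem map_demEnd_pow {o : Option (Fin (N + 1))} (T : RingEE N n →+ ring o)
    (hT : ∀ i j, T (inl _ _ ((stepAt N n).xi ^ i) * inr _ _ ((stepAt N (n + 2)).xi ^ j)) =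
      -T (inl _ _ ((stepAt N n).xi ^ j) * inr _ _ ((stepAt N (n + 2)).xi ^ i))) (i j : ℕ) :
    T (demEnd N n (inl _ _ ((stepAt N n).xi ^ i) * inr _ _ ((stepAt N (n + 2)).xi ^ j))) = 0 := by
  rw [demEnd_mul, (dem_spec N n).pow, map_sub, map_sum, map_sum]
  -- Reading the antidiagonal sums backwards and applying antisymmetry shows that the value equals
  -- its own negative.
  refine ring_two_torsion_free _ ?_
  have := sum_range_reflect_sub (fun i j =>
    T (inl _ _ ((stepAt N n).xi ^ i) * inr _ _ ((stepAt N (n + 2)).xi ^ j))) j i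
  rw [add_comm j i] at this
  nth_rewrite 1 [this]
  rw [Finset.sum_congr rfl fun x _ => hT (i + j - 1 - x) x,
    Finset.sum_congr (s₁ := Finset.range i) rfl fun x _ => hT (i + j - 1 - x) x]
  simp only [Finset.sum_neg_distrib]
  abel

variable (N) in
/-- The pushforward from two step flags to the first ring. -/
def trDownTwo : RingEE N n →+ ring (ofWeight N n) :=
  PushoutRing.lift _ _ (AddMonoidHom.compl₂ (AddMonoidHom.compr₂ (AddMonoidHom.mul
      (R := (stepAt N n).A)) (trDown N n))
      ((stepAt N n).right.toAddMonoidHom.comp (trDown N (n + 2)))) fun a s b => by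
    change trDown N n (_ * a * (stepAt N n).right (trDown N (n + 2) b)) =
      trDown N n (a * (stepAt N n).right (trDown N (n + 2) (_ * b)))
    rw [trDown_mul, map_mul (stepAt N n).right, mul_mul_bal]

theorem trDownTwo_mul (a b) : trDownTwo N n (inl _ _ a * inr _ _ b) =
    trDown N n (a * (stepAt N n).right (trDown N (n + 2) b)) := lift_mul _ _ _ _ a b

variable (N) in
/-- The pushforward from two step flags to the last ring. -/
def trUpTwo : RingEE N n →+ ring (ofWeight N (n + 2 + 2)) :=
  PushoutRing.lift _ _ (AddMonoidHom.comp (AddMonoidHom.compr₂ (AddMonoidHom.mul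
      (R := (stepAt N (n + 2)).A)) (trUp N (n + 2)))
      ((stepAt N (n + 2)).left.toAddMonoidHom.comp (trUp N n))) fun a s b => by
    change trUp N (n + 2) ((stepAt N (n + 2)).left (trUp N n (_ * a)) * b) =
      trUp N (n + 2) ((stepAt N (n + 2)).left (trUp N n a) * (_ * b))
    rw [trUp_mul, map_mul (stepAt N (n + 2)).left, mul_mul_bal]

theorem trUpTwo_mul (a b) : trUpTwo N n (inl _ _ a * inr _ _ b) =
    trUp N (n + 2) ((stepAt N (n + 2)).left (trUp N n a) * b) := lift_mul _ _ _ _ a b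

/-- On `ξ₁^i ξ₂^j` the iterated trace is a two by two determinant in the signed classes `X`, hence
antisymmetric in `i` and `j`, and antisymmetric functionals kill divided differences. -/
theorem trDownTwo_demEnd (w) : trDownTwo N n (demEnd N n w) = 0 := by
  refine forall_fst_mul n (AddMonoidHom.ker ((trDownTwo N n).comp (demEnd N n)))
    (fun r i j => ?_) w
  have hl : ∀ r w, trDownTwo N n (fst _ _ r * w) = r * trDownTwo N n w := fun r w => by
    induction w using PushoutRing.induction with
    | h0 => simp
    | hadd u v hu hv => simp only [mul_add, map_add, hu, hv]
    | ht a b =>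
      rw [RingHom.comp_apply, ← mul_assoc, ← map_mul, trDownTwo_mul, trDownTwo_mul, mul_assoc,
        trDown_mul]
  rw [AddMonoidHom.mem_ker, AddMonoidHom.comp_apply, demEnd_fst, hl, map_demEnd_pow, mul_zero]
  intro i j
  rcases (stepFacts (N := N) n).degen with h | ⟨h1, h2⟩
  · rw [trDownTwo_mul, trDownTwo_mul, Subsingleton.elim (_ * _) 0, Subsingleton.elim (_ * _) 0,
      map_zero, neg_zero]
  · have key : ∀ i j : ℕ, trDownTwo N n (inl _ _ ((stepAt N n).xi ^ i) *
        inr _ _ ((stepAt N (n + 2)).xi ^ j)) =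
        signed (Xcl (ofWeight N n)) (j + 2 - (N - kAt N n : ℕ)) *
          signed (Xcl (ofWeight N n)) (i + 1 - (N - kAt N n : ℕ)) -
        signed (Xcl (ofWeight N n)) (i + 2 - (N - kAt N n : ℕ)) *
          signed (Xcl (ofWeight N n)) (j + 1 - (N - kAt N n : ℕ)) := by
      intro i j
      -- The second trace lowers the index by one unit less; this shift between the rows makes the
      -- determinant.
      have e : ((N - kAt N (n + 2) : ℕ) : ℤ) = (N - kAt N n : ℕ) - 1 := by
        change ((N - idx _ : ℕ) : ℤ) = (N - idx _ : ℕ) - 1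
        omega
      rw [trDownTwo_mul, trDown_pow, right_signed_Xcl, mul_sub, map_sub, ← mul_assoc,
        mul_comm (_ ^ i), mul_comm (_ ^ i * _), trDown_mul, trDown_mul, ← pow_succ, trDown_pow,
        trDown_pow, e]
      push_cast
      ring_nf
    rw [key i j, key j i]
    ring

/-- The same with determinants in the classes `Y` of the last ring. -/
theorem trUpTwo_demEnd (w) : trUpTwo N n (demEnd N n w) = 0 := by
  refine forall_lst_mul n (AddMonoidHom.ker ((trUpTwo N n).comp (demEnd N n)))
    (fun r i j => ?_) w
  have hl : ∀ r w, trUpTwo N n (lst _ _ r * w) = r * trUpTwo N n w := fun r w => by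
    induction w using PushoutRing.induction with
    | h0 => simp
    | hadd u v hu hv => simp only [mul_add, map_add, hu, hv]
    | ht a b =>
      rw [RingHom.comp_apply, mul_left_comm, ← map_mul, trUpTwo_mul, trUpTwo_mul, mul_left_comm,
        trUp_mul]
  rw [AddMonoidHom.mem_ker, AddMonoidHom.comp_apply, demEnd_lst, hl, map_demEnd_pow, mul_zero]
  intro i j
  rcases (stepFacts (N := N) (n + 2)).degen with h | ⟨h1, h2⟩
  · rw [trUpTwo_mul, trUpTwo_mul, Subsingleton.elim (_ * _) 0, Subsingleton.elim (_ * _) 0,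
      map_zero, neg_zero]
  · have key : ∀ i j : ℕ, trUpTwo N n (inl _ _ ((stepAt N n).xi ^ i) *
        inr _ _ ((stepAt N (n + 2)).xi ^ j)) =
        signed (Ycl (ofWeight N (n + 2 + 2))) (i + 1 - kAt N (n + 2)) *
          signed (Ycl (ofWeight N (n + 2 + 2))) (j - kAt N (n + 2)) -
        signed (Ycl (ofWeight N (n + 2 + 2))) (j + 1 - kAt N (n + 2)) *
          signed (Ycl (ofWeight N (n + 2 + 2))) (i - kAt N (n + 2)) := by
      intro i j
      have e : (kAt N (n + 2 + 2) : ℤ) = kAt N (n + 2) + 1 := by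
        change ((idx _ : ℕ) : ℤ) = (idx _ : ℕ) + 1
        omega
      rw [trUpTwo_mul, trUp_pow, left_signed_Ycl, sub_mul, map_sub, mul_right_comm,
        mul_comm (_ * _) ((stepAt N (n + 2)).right _), trUp_mul, trUp_mul, ← pow_succ', trUp_pow,
        trUp_pow, e]
      push_cast
      ring_nf
    rw [key i j, key j i]
    ring

end Steps

end Cyclic

end EqFlagRep
end

noncomputable section

namespace EqFlagRep

open GrBimod FreeU

/-! ### Rotation of the crossing -/

section Cyclic

open PushoutRing TwoStep

variable {N : ℕ}

/-- Used to write the output of a crossing as a sum of pure tensors, the only elements on which the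
remaining caps can be evaluated directly. -/
theorem PushoutRing.exists_rep {S A B : Type} [CommRing S] [CommRing A] [CommRing B] (p : S →+* A)
    (q : S →+* B) (w : PushoutRing p q) :
    ∃ (s : ℕ) (f : ℕ → A) (g : ℕ → B), w = ∑ i ∈ Finset.range s, inl p q (f i) * inr p q (g i) := by
  induction w using PushoutRing.induction with
  | h0 => exact ⟨0, 0, 0, by simp⟩
  | ht a b => exact ⟨1, fun _ => a, fun _ => b, by simp⟩
  | hadd u v hu hv =>
    obtain ⟨s, f, g, rfl⟩ := hu
    obtain ⟨t, f', g', rfl⟩ := hv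
    refine ⟨s + t, fun i => if i < s then f i else f' (i - s),
      fun i => if i < s then g i else g' (i - s), ?_⟩
    rw [Finset.sum_range_add]
    congr 1
    · refine Finset.sum_congr rfl fun i hi => ?_
      simp [Finset.mem_range.1 hi]
    · refine Finset.sum_congr rfl fun i _ => ?_
      simp

theorem evEq_FF {n : ℤ} {g : (⟨n + 2 + 2⟩ : FreeU) ⟶ ⟨n⟩} {η θ : F (n + 2) ≫ F n ⟶ g}
    (h : ∀ a b, ev N η (tm (F (n + 2)) (F n) (eF N (n + 2) b) (eF N n a)) =
      ev N θ (tm (F (n + 2)) (F n) (eF N (n + 2) b) (eF N n a))) : EvEq N η θ :=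
  AddMonoidHom.ext (forall_tm fun b a => h a b)

theorem PushoutRing.map_sum_mul {S A B C : Type} [CommRing S] [CommRing A] [CommRing B]
    [AddCommGroup C] {p : S →+* A} {q : S →+* B} (T : PushoutRing p q →+ C) (s : Finset ℕ)
    (f : ℕ → A) (g : ℕ → B) (a : A) (b : B) :
    T ((∑ i ∈ s, inl p q (f i) * inr p q (g i)) * (inl p q a * inr p q b)) =
      ∑ i ∈ s, T (inl p q (f i * a) * inr p q (g i * b)) := by
  refine (map_sum (T.comp (AddMonoidHom.mulRight (inl p q a * inr p q b))) _ s).trans ?_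
  refine Finset.sum_congr rfl fun i _ => ?_
  rw [map_mul (inl p q), map_mul (inr p q)]
  exact congrArg T (mul_mul_mul_comm _ _ _ _)

theorem sum_zsmul_tm_right {a b c : FreeU} (f : a ⟶ b) (g : b ⟶ c) (s : Finset ℕ) (e : ℕ → ℤ)
    (x : bimod N f) (y : ℕ → bimod N g) :
    ∑ j ∈ s, e j • tm f g x (y j) = tm f g x (∑ j ∈ s, e j • y j) := by
  simp only [map_sum, map_zsmul]

theorem sum_zsmul_tm_left {a b c : FreeU} (f : a ⟶ b) (g : b ⟶ c) (s : Finset ℕ) (e : ℕ → ℤ)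
    (x : ℕ → bimod N f) (y : bimod N g) :
    ∑ j ∈ s, e j • tm f g (x j) y = tm f g (∑ j ∈ s, e j • x j) y := by
  simp only [map_sum, map_zsmul, AddMonoidHom.finsetSum_apply, AddMonoidHom.smul_apply]

/-- Two nested dual basis expansions. For a pure tensor the inner sum reproduces the first factor
times a trace from the middle ring; that scalar is moved across, and the outer sum reproduces the
second factor. -/
theorem sum_tm_trDownTwo (n : ℤ) (w : RingEE N n) :
    ∑ i ∈ Finset.range (N - kAt N (n + 2 + 2) + 1), (-1 : ℤ) ^ i •
      ∑ j ∈ Finset.range (N - kAt N (n + 2) + 1), (-1 : ℤ) ^ j •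
        tm (F (n + 2)) (F n) (eF N (n + 2) ((stepAt N (n + 2)).right (ycl _ i)))
          (eF N n ((stepAt N n).left (trDownTwo N n (inl _ _ ((stepAt N n).xi ^
            (N - kAt N (n + 2) - j)) * inr _ _ ((stepAt N (n + 2)).xi ^
              (N - kAt N (n + 2 + 2) - i)) * w)) * (stepAt N n).right (ycl _ j))) =
    tFF N n w := by
  induction w using PushoutRing.induction with
  | h0 => simp
  | hadd u v hu hv =>
    rw [map_add, ← hu, ← hv]
    simp only [mul_add, map_add, add_mul, smul_add, Finset.sum_add_distrib]
  | ht a b =>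
    have h1 : ∀ q, ∑ j ∈ Finset.range (N - kAt N (n + 2) + 1), (-1 : ℤ) ^ j •
        eF N n ((stepAt N n).left (trDownTwo N n (inl _ _ ((stepAt N n).xi ^
            (N - kAt N (n + 2) - j)) * inr _ _ q * (inl _ _ a * inr _ _ b))) *
              (stepAt N n).right (ycl _ j)) =
        la (F n) (trDown N (n + 2) (q * b)) (eF N n a) := fun q => by
      rw [sum_neg_one_pow_zsmul, la_F]
      refine congrArg _ (Eq.trans ?_ ((stepFacts n).frobDown.sum_dual (trDown_spec N n) _))
      refine Finset.sum_congr rfl fun j _ => ?_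
      rw [mul_mul_mul_comm, ← map_mul, ← map_mul, trDownTwo_mul]
      simp only [kAt]
      ring_nf
    simp only [sum_zsmul_tm_right, h1, ← tm_ra, ra_F]
    rw [sum_zsmul_tm_left, sum_neg_one_pow_zsmul, tFF_mul]
    refine congrArg (fun c => tm (F (n + 2)) (F n) (eF N (n + 2) c) (eF N n a))
      (Eq.trans ?_ ((stepFacts (n + 2)).frobDown.sum_dual (trDown_spec N (n + 2)) b))
    exact Finset.sum_congr rfl fun j _ => by simp only [kAt]; ring_nf

/-- Mirror image, with the traces towards the last ring; the inner sum now reproduces the factor of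
the second step. -/
theorem sum_tm_trUpTwo (n : ℤ) (w : RingEE N n) :
    ∑ i ∈ Finset.range (kAt N n + 1), (-1 : ℤ) ^ i •
      ∑ j ∈ Finset.range (kAt N (n + 2) + 1), (-1 : ℤ) ^ j •
        tm (F (n + 2)) (F n) (eF N (n + 2) ((stepAt N (n + 2)).right (trUpTwo N n
          (inl _ _ ((stepAt N n).xi ^ (kAt N n - i)) * inr _ _ ((stepAt N (n + 2)).xi ^
              (kAt N (n + 2) - j)) * w)) * (stepAt N (n + 2)).left (xcl _ j)))
          (eF N n ((stepAt N n).left (xcl _ i))) =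
    tFF N n w := by
  induction w using PushoutRing.induction with
  | h0 => simp
  | hadd u v hu hv =>
    rw [map_add, ← hu, ← hv]
    simp only [mul_add, map_add, add_mul, smul_add, Finset.sum_add_distrib, AddMonoidHom.add_apply]
  | ht a b =>
    have h1 : ∀ q, ∑ j ∈ Finset.range (kAt N (n + 2) + 1), (-1 : ℤ) ^ j •
        eF N (n + 2) ((stepAt N (n + 2)).right (trUpTwo N n
          (inl _ _ q * inr _ _ ((stepAt N (n + 2)).xi ^ (kAt N (n + 2) - j)) *
            (inl _ _ a * inr _ _ b))) * (stepAt N (n + 2)).left (xcl _ j)) =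
        ra (F (n + 2)) (trUp N n (q * a)) (eF N (n + 2) b) := fun q => by
      rw [sum_neg_one_pow_zsmul, ra_F]
      refine congrArg _ (Eq.trans ?_ ((stepFacts (n + 2)).frobUp.sum_dual (trUp_spec N (n + 2)) _))
      refine Finset.sum_congr rfl fun j _ => ?_
      rw [mul_mul_mul_comm, ← map_mul, ← map_mul, trUpTwo_mul]
      simp only [kAt]
      ring_nf
    simp only [sum_zsmul_tm_left, h1, tm_ra, la_F]
    rw [sum_zsmul_tm_right, sum_neg_one_pow_zsmul, tFF_mul]
    refine congrArg (fun c => tm (F (n + 2)) (F n) (eF N (n + 2) b) (eF N n c))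
      (Eq.trans ?_ ((stepFacts n).frobUp.sum_dual (trUp_spec N n) a))
    exact Finset.sum_congr rfl fun j _ => by simp only [kAt]; ring_nf

-- Evaluating the rotated crossing gives the expansion of the preceding kind, with the divided
-- difference applied to the dual monomial instead of to the argument. Self-adjointness moves it to
-- the argument.
set_option maxHeartbeats 1000000 in
theorem evEq_cyclicU (n : ℤ) :
      EvEq N (𝟙 (F (n + 2) ≫ F n) ⊗≫
        epsh (n + 2) ▷ (F (n + 2) ≫ F n) ⊗≫
        F (n + 2) ◁ epsh n ▷ (E (n + 2) ≫ F (n + 2) ≫ F n) ⊗≫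
        (F (n + 2) ≫ F n) ◁ U n ▷ (F (n + 2) ≫ F n) ⊗≫
        (F (n + 2) ≫ F n ≫ E n) ◁ etah (n + 2) ▷ F n ⊗≫
        (F (n + 2) ≫ F n) ◁ etah n ⊗≫ 𝟙 (F (n + 2) ≫ F n)) (Uh n) := by
  refine evEq_FF fun a b => ?_
  choose s f g h using fun a b => PushoutRing.exists_rep _ _ (dem N n a b)
  have hU : ∀ a b, ev N (U n) (tm (E n) (E (n + 2)) (eE N n a) (eE N (n + 2) b)) =
      ∑ i ∈ Finset.range (s a b), tm (E n) (E (n + 2)) (eE N n (f a b i)) (eE N (n + 2) (g a b i)) := by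
    intro a b
    rw [ev_U, h a b, map_sum]
    simp only [tEE_mul]
  rw [ev_Uh]
  simp [bicategoricalComp, ev_epsh, hU]
  rw [← sum_tm_trDownTwo]
  refine Finset.sum_congr rfl fun i _ => congrArg _ (Finset.sum_congr rfl fun j _ => congrArg _ ?_)
  -- Adjointness is applied to each summand of the double expansion, so that the terms agree one by
  -- one with those of the diagram.
  rw [← demEnd_mul n a b, ← demEnd_adjoint n _ (trDownTwo_demEnd n), demEnd_mul, h,
    PushoutRing.map_sum_mul, map_sum, Finset.sum_mul, map_sum, map_sum]
  refine Finset.sum_congr rfl fun l _ => ?_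
  rw [trDownTwo_mul, mul_right_comm, mul_assoc]

-- Rotation in the other direction: the other cups and caps replace the trace towards the first ring
-- by the one towards the last.
set_option maxHeartbeats 1000000 in
theorem evEq_cyclicU' (n : ℤ) :
      EvEq N (𝟙 (F (n + 2) ≫ F n) ⊗≫
        (F (n + 2) ≫ F n) ◁ eta n ⊗≫
        (F (n + 2) ≫ F n ≫ E n) ◁ eta (n + 2) ▷ F n ⊗≫
        (F (n + 2) ≫ F n) ◁ U n ▷ (F (n + 2) ≫ F n) ⊗≫
        F (n + 2) ◁ eps n ▷ (E (n + 2) ≫ F (n + 2) ≫ F n) ⊗≫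
        eps (n + 2) ▷ (F (n + 2) ≫ F n) ⊗≫ 𝟙 (F (n + 2) ≫ F n)) (Uh n) := by
  refine evEq_FF fun a b => ?_
  choose s f g h using fun a b => PushoutRing.exists_rep _ _ (dem N n a b)
  have hU : ∀ a b, ev N (U n) (tm (E n) (E (n + 2)) (eE N n a) (eE N (n + 2) b)) =
      ∑ i ∈ Finset.range (s a b), tm (E n) (E (n + 2)) (eE N n (f a b i)) (eE N (n + 2) (g a b i)) := by
    intro a b
    rw [ev_U, h a b, map_sum]
    simp only [tEE_mul]
  rw [ev_Uh]
  simp [bicategoricalComp, ev_eta', hU]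
  rw [← sum_tm_trUpTwo]
  refine Finset.sum_congr rfl fun i _ => congrArg _ (Finset.sum_congr rfl fun j _ => congrArg _ ?_)
  rw [← demEnd_mul n a b, ← demEnd_adjoint n _ (trUpTwo_demEnd n), demEnd_mul, h,
    PushoutRing.map_sum_mul, map_sum, Finset.sum_mul, map_sum, map_sum,
    AddMonoidHom.finsetSum_apply]
  refine Finset.sum_congr rfl fun l _ => ?_
  rw [trUpTwo_mul, mul_comm a, mul_left_comm b, mul_comm b]

end Cyclic

end EqFlagRep
end

noncomputable section

namespace EqFlagRep

open GrBimod FreeU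

/-! ### Bubbles -/

section Bubbles

variable {N : ℕ}

theorem ev_sI {a : FreeU} {f : a ⟶ a} (η : 𝟙 a ⟶ f) (r : ring (ofWeight N a.wt)) :
    ev N η (sI N a r) = la f r (ev N η (uI N a)) := by
  rw [← ev_lact]
  exact congrArg (ev N η) (mul_one r).symm

variable (N) in
/-- The element of the ring of a region by which an endomorphism of the identity acts. -/
def bubVal (a : FreeU) : End (𝟙 a) →+* ring (ofWeight N a.wt) where
  toFun η := ev N η (uI N a)
  map_one' := rfl
  map_mul' η θ := (ev_comp (N := N) θ η (uI N a)).trans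
    ((ev_sI (N := N) η (ev N θ (uI N a))).trans (mul_comm (G := ring (ofWeight N a.wt)) _ _))
  map_zero' := rfl
  map_add' η θ := ev_add η θ _

theorem ev_End {a : FreeU} (η : End (𝟙 a)) (r : ring (ofWeight N a.wt)) :
    ev N η (sI N a r) = sI N a (r * bubVal N a η) := ev_sI η r

theorem ev_End_one {a : FreeU} (η : End (𝟙 a)) :
    ev N η (uI N a) = sI N a (bubVal N a η) := rfl

theorem evEq_End {a : FreeU} {η θ : End (𝟙 a)} (h : bubVal N a η = bubVal N a θ) :
    EvEq N (f := 𝟙 a) (g := 𝟙 a) η θ := evEq_I h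

variable (N) in
/-- The generating series of the clockwise bubbles. -/
def cSeries (n : ℤ) : PowerSeries (ring (ofWeight N n)) :=
  elemSeries (ycl (ofWeight N n)) * complSeries (xcl (ofWeight N n))

variable (N) in
/-- The generating series of the counterclockwise bubbles. -/
def ccSeries (n : ℤ) : PowerSeries (ring (ofWeight N n)) :=
  elemSeries (xcl (ofWeight N n)) * complSeries (ycl (ofWeight N n))

theorem ccSeries_mul_cSeries (n : ℤ) : ccSeries N n * cSeries N n = 1 := by
  have h1 := elemSeries_mul_complSeries _ (xcl_zero (ofWeight N n))
  have h2 := elemSeries_mul_complSeries _ (ycl_zero (ofWeight N n))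
  rw [ccSeries, cSeries, mul_mul_mul_comm, mul_comm (complSeries _), mul_mul_mul_comm, h1, h2,
    mul_one]

theorem coeff_zero_cSeries (n : ℤ) : PowerSeries.coeff 0 (cSeries N n) = 1 := by
  rw [cSeries, PowerSeries.coeff_mul]
  simp [elemSeries, complSeries, invCoeff, ycl_zero]

theorem coeff_zero_ccSeries (n : ℤ) : PowerSeries.coeff 0 (ccSeries N n) = 1 := by
  rw [ccSeries, PowerSeries.coeff_mul]
  simp [elemSeries, complSeries, invCoeff, xcl_zero]

/-- The coefficients of a power series, extended by zero. -/
def zcoeff {A : Type} [CommRing A] (f : PowerSeries A) (e : ℤ) : A :=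
  if 0 ≤ e then PowerSeries.coeff e.toNat f else 0

/-- The cup contributes the coefficients `(-1)^j y_j` and the dotted cap signed classes `Y`; their
convolution is a coefficient of `E_y / E_x`. The label shift by `n - 1` comes from `N - k` powers of
`ξ` in the cup and the offset of the trace. -/
theorem bubVal_cBub (m : ℤ) (d : ℕ) :
    bubVal N ⟨m + 2⟩ (cBub m d) = zcoeff (cSeries N (m + 2)) (d - (m + 1)) := by
  rcases kAt_eq (N := N) (m + 2) with h | ⟨h1, h2⟩
  · have := subsingleton_ring h
    exact Subsingleton.elim (α := ring (ofWeight N (m + 2))) _ _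
  · have h3 : ev N (cBub m d) (uI N ⟨m + 2⟩) = sI N ⟨m + 2⟩
        (∑ j ∈ Finset.range (N - kAt N (m + 2) + 1), (-1) ^ j * ycl (ofWeight N (m + 2)) j *
          signed (invCoeff (xcl (ofWeight N (m + 2)))) ((d - (m + 1) : ℤ) - j)) := by
      rw [cBub, ev_comp, ev_comp, ev_epsh, map_sum, map_sum]
      refine Eq.trans ?_ (sI_sum _ (⟨m + 2⟩ : FreeU) _).symm
      refine Finset.sum_congr rfl fun j hj => ?_
      have := Finset.mem_range.1 hj
      rw [map_zsmul, map_zsmul, ev_whiskerLeft, ev_dots, ev_eps, ← pow_add, trUp_mul, trUp_pow]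
      refine (map_neg_one_pow_zsmul (eI N (⟨m + 2⟩ : FreeU)) j _).symm.trans ?_
      refine congrArg (sI N (⟨m + 2⟩ : FreeU)) ?_
      rw [mul_assoc]
      refine congrArg (fun e => (-1) ^ j * (ycl (ofWeight N (m + 2)) j *
        signed (invCoeff (xcl (ofWeight N (m + 2)))) e)) ?_
      push_cast [show j ≤ N - kAt N (m + 2) by omega, h2]
      linarith
    refine Eq.trans h3 ?_
    exact sum_mul_signed _ _ _ (fun _ => ycl_of_lt _) _

/-- As for clockwise bubbles, with `x` and `y` exchanged, so the series is the inverse one. -/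
theorem bubVal_ccBub (n : ℤ) (d : ℕ) :
    bubVal N ⟨n⟩ (ccBub n d) = zcoeff (ccSeries N n) (d + (n + 1)) := by
  rcases kAt_eq (N := N) n with h | ⟨h1, h2⟩
  · have := subsingleton_ring h
    exact Subsingleton.elim (α := ring (ofWeight N n)) _ _
  · have h3 : ev N (ccBub n d) (uI N ⟨n⟩) = sI N ⟨n⟩
        (∑ j ∈ Finset.range (kAt N n + 1), (-1) ^ j * xcl (ofWeight N n) j *
          signed (invCoeff (ycl (ofWeight N n))) ((d + (n + 1) : ℤ) - j)) := by
      rw [ccBub, ev_comp, ev_comp, ev_eta, map_sum, map_sum]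
      refine Eq.trans ?_ (sI_sum _ (⟨n⟩ : FreeU) _).symm
      refine Finset.sum_congr rfl fun j hj => ?_
      have := Finset.mem_range.1 hj
      rw [map_zsmul, map_zsmul, ev_whiskerRight, ev_dots, ev_etah, mul_comm (_ ^ _), mul_assoc,
        ← pow_add, trDown_mul, trDown_pow]
      refine (map_neg_one_pow_zsmul (eI N (⟨n⟩ : FreeU)) j _).symm.trans ?_
      refine congrArg (sI N (⟨n⟩ : FreeU)) ?_
      rw [mul_assoc]
      refine congrArg (fun e => (-1) ^ j * (xcl (ofWeight N n) j *
        signed (invCoeff (ycl (ofWeight N n))) e)) ?_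
      push_cast [show j ≤ kAt N n by omega, h2]
      linarith
    refine Eq.trans h3 ?_
    exact sum_mul_signed _ _ _ (fun _ => xcl_of_lt _) _

theorem zcoeff_natCast {A : Type} [CommRing A] (f : PowerSeries A) (i : ℕ) :
    zcoeff f i = PowerSeries.coeff i f := by
  rw [zcoeff, if_pos (Int.natCast_nonneg i), Int.toNat_natCast]

theorem zcoeff_of_neg {A : Type} [CommRing A] (f : PowerSeries A) {e : ℤ} (h : e < 0) :
    zcoeff f e = 0 := if_neg (not_le.2 h)

theorem bubVal_cBub_toNat (m : ℤ) (i : ℕ) (h : 0 ≤ m + 1 + i) :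
    bubVal N ⟨m + 2⟩ (cBub m (m + 1 + i).toNat) = PowerSeries.coeff i (cSeries N (m + 2)) := by
  rw [bubVal_cBub, Int.toNat_of_nonneg h, add_sub_cancel_left, zcoeff_natCast]

theorem bubVal_ccBub_toNat (m : ℤ) (i : ℕ) (h : 0 ≤ -(m + 2) - 1 + i) :
    bubVal N ⟨m + 2⟩ (ccBub (m + 2) (-(m + 2) - 1 + i).toNat) =
      PowerSeries.coeff i (ccSeries N (m + 2)) := by
  rw [bubVal_ccBub, Int.toNat_of_nonneg h, show -(m + 2) - 1 + (i : ℤ) + (m + 2 + 1) = i by ring,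
    zcoeff_natCast]

/-- For a fake bubble the recursion reads opposite bubbles only at indices `1 ≤ j ≤ i`, and these
have non-negative labels when the label of index `i` is negative. Truncation to natural numbers
therefore does no harm, and uniqueness of inverse series applies. -/
theorem bubVal_cB (m : ℤ) (i : ℕ) :
    bubVal N ⟨m + 2⟩ (cB m i) = PowerSeries.coeff i (cSeries N (m + 2)) := by
  rw [cB]
  split_ifs with h
  · exact bubVal_cBub_toNat m i h
  · rw [map_invCoeff]
    refine invCoeff_eq_coeff _ (ccSeries N (m + 2)) _ (coeff_zero_ccSeries _)
      (ccSeries_mul_cSeries _) i fun j hj hi => bubVal_ccBub_toNat m j (by omega)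

theorem bubVal_ccB (m : ℤ) (i : ℕ) :
    bubVal N ⟨m + 2⟩ (ccB m i) = PowerSeries.coeff i (ccSeries N (m + 2)) := by
  rw [ccB]
  split_ifs with h
  · exact bubVal_ccBub_toNat m i h
  · rw [map_invCoeff]
    refine invCoeff_eq_coeff _ (cSeries N (m + 2)) _ (coeff_zero_cSeries _)
      ((mul_comm _ _).trans (ccSeries_mul_cSeries _)) i fun j hj hi =>
        bubVal_cBub_toNat m j (by omega)

theorem evEq_cBub_neg (m : ℤ) (d : ℕ) (h : d < m + 1) :
    EvEq N (f := 𝟙 (⟨m + 2⟩ : FreeU)) (g := 𝟙 _) (cBub m d) 0 :=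
  evEq_End ((bubVal_cBub m d).trans ((zcoeff_of_neg _ (by omega)).trans (map_zero _).symm))

theorem evEq_ccBub_neg (n : ℤ) (d : ℕ) (h : d < -n - 1) :
    EvEq N (f := 𝟙 (⟨n⟩ : FreeU)) (g := 𝟙 _) (ccBub n d) 0 :=
  evEq_End ((bubVal_ccBub n d).trans ((zcoeff_of_neg _ (by omega)).trans (map_zero _).symm))

theorem evEq_cBub_zero (m : ℤ) (d : ℕ) (h : d = m + 1) :
    EvEq N (f := 𝟙 (⟨m + 2⟩ : FreeU)) (g := 𝟙 _) (cBub m d) (𝟙 _) := by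
  refine evEq_End ((bubVal_cBub m d).trans (Eq.trans ?_ (map_one _).symm))
  rw [h, sub_self]
  exact (zcoeff_natCast _ 0).trans (coeff_zero_cSeries _)

theorem evEq_ccBub_zero (n : ℤ) (d : ℕ) (h : d = -n - 1) :
    EvEq N (f := 𝟙 (⟨n⟩ : FreeU)) (g := 𝟙 _) (ccBub n d) (𝟙 _) := by
  refine evEq_End ((bubVal_ccBub n d).trans (Eq.trans ?_ (map_one _).symm))
  rw [h, show -n - 1 + (n + 1) = ((0 : ℕ) : ℤ) by push_cast; ring]
  exact (zcoeff_natCast _ 0).trans (coeff_zero_ccSeries _)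

theorem evEq_grassmannian (m : ℤ) (k : ℕ) (h : 0 < k) :
    EvEq N (f := 𝟙 (⟨m + 2⟩ : FreeU)) (g := 𝟙 _)
      (∑ i ∈ Finset.range (k + 1), ccB m i * cB m (k - i)) 0 := by
  refine evEq_End (Eq.trans ?_ (map_zero _).symm)
  have h1 := congrArg (PowerSeries.coeff k) (ccSeries_mul_cSeries (N := N) (m + 2))
  rw [PowerSeries.coeff_mul, Finset.Nat.sum_antidiagonal_eq_sum_range_succ_mk,
    PowerSeries.coeff_one, if_neg h.ne'] at h1
  rw [map_sum]
  refine Eq.trans (Finset.sum_congr rfl fun i _ => ?_) h1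
  exact (map_mul _ _ _).trans (congrArg₂ (fun x y : ring (ofWeight N (m + 2)) => x * y)
    (bubVal_ccB m i) (bubVal_cB m (k - i)))

end Bubbles

end EqFlagRep
end

noncomputable section

namespace EqFlagRep

open GrBimod FreeU

/-! ### Curls -/

section Curls

variable {N : ℕ}

/-- The root is a difference of scalars, `ξ = x_1(H_{k+1}) - x_1(H_k)`, so the step ring is
generated by `1` as a bimodule. -/
theorem stepAt_gen (n : ℤ) (G : AddSubgroup (stepAt N n).A)
    (h : ∀ r s, (stepAt N n).left r * (stepAt N n).right s ∈ G) (a) : a ∈ G := by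
  have hξ : (stepAt N n).xi = (stepAt N n).right (xcl _ 1) - (stepAt N n).left (xcl _ 1) := by
    rw [(stepFacts n).right_xcl 0, xcl_zero, map_one]
    ring
  have h1 : ∀ (i : ℕ) r s, (stepAt N n).left r * (stepAt N n).right s * (stepAt N n).xi ^ i ∈ G := by
    intro i
    induction i with
    | zero => intro r s; rw [pow_zero, mul_one]; exact h r s
    | succ i ih =>
      intro r s
      have h2 : (stepAt N n).left r * (stepAt N n).right s * (stepAt N n).xi ^ (i + 1) =
          (stepAt N n).left r * (stepAt N n).right (s * xcl _ 1) * (stepAt N n).xi ^ i -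
          (stepAt N n).left (r * xcl _ 1) * (stepAt N n).right s * (stepAt N n).xi ^ i := by
        rw [pow_succ, map_mul (stepAt N n).right, map_mul (stepAt N n).left]
        linear_combination (stepAt N n).left r * (stepAt N n).right s * (stepAt N n).xi ^ i * hξ
      rw [h2]
      exact sub_mem (ih _ _) (ih _ _)
  refine (stepFacts n).lower.span G (fun i _ r => ?_) a
  have := h1 i r 1
  rwa [map_one, mul_one] at this

/-- Since the bimodule is cyclic, relations on a single strand need only be tested at `1`. -/
theorem evEq_E_one {n : ℤ} {g : (⟨n⟩ : FreeU) ⟶ ⟨n + 2⟩} {η θ : E n ⟶ g}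
    (h : ev N η (eE N n 1) = ev N θ (eE N n 1)) : EvEq N η θ := by
  refine evEq_E fun a => ?_
  refine stepAt_gen n (AddSubgroup.comap (eE N n) (AddMonoidHom.eqLocus (ev N η) (ev N θ)))
    (fun r s => ?_) a
  have h1 : eE N n ((stepAt N n).left r * (stepAt N n).right s) =
      la (E n) r (ra (E n) s (eE N n 1)) := by rw [ra_E, la_E, mul_one]
  change ev N η (eE N n _) = ev N θ (eE N n _)
  rw [h1, ev_lact, ev_lact, ev_ract, ev_ract, h]

theorem ev_U_pow_one (n : ℤ) (c : ℕ) :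
    ev N (U n) (tm (E n) (E (n + 2)) (eE N n ((stepAt N n).xi ^ c)) (eE N (n + 2) 1)) =
      -∑ j ∈ Finset.range c, tm (E n) (E (n + 2)) (eE N n ((stepAt N n).xi ^ j))
        (eE N (n + 2) ((stepAt N (n + 2)).xi ^ (c - 1 - j))) := by
  have := uMap_pow (N := N) n c 0
  simp only [pow_zero, Finset.range_zero, Finset.sum_empty, zero_sub, add_zero] at this
  exact this

theorem ev_U_one_pow (n : ℤ) (c : ℕ) :
    ev N (U n) (tm (E n) (E (n + 2)) (eE N n 1) (eE N (n + 2) ((stepAt N (n + 2)).xi ^ c))) =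
      ∑ j ∈ Finset.range c, tm (E n) (E (n + 2)) (eE N n ((stepAt N n).xi ^ j))
        (eE N (n + 2) ((stepAt N (n + 2)).xi ^ (c - 1 - j))) := by
  have := uMap_pow (N := N) n 0 c
  simp only [pow_zero, Finset.range_zero, Finset.sum_empty, sub_zero, zero_add] at this
  exact this

/-- The inner range can be made independent of `i`, as the extra terms have `S` at a negative index;
this is where `0 < k` is needed. Summing over `i` first then produces the bubble coefficient `C`,
and the substitution `l = d - k - j` gives the stated form. -/
theorem sum_curl {A : Type} [CommRing A] (ξ : A) (y : ℕ → A) (S : ℤ → A)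
    (hS : ∀ e < 0, S e = 0) (C : ℤ → A) (hC' : ∀ e < 0, C e = 0) (d k : ℕ) (hk : 0 < k)
    (hC : ∀ e : ℤ, ∑ i ∈ Finset.range (d + 1), (-1) ^ i * y i * S (e - i) = C e) :
    ∑ i ∈ Finset.range (d + 1), ∑ j ∈ Finset.range (d - i),
      (-1) ^ i * y i * S (d - k - i - j) * ξ ^ j =
    ∑ l ∈ Finset.range ((1 : ℤ) - (k - d)).toNat, C l * ξ ^ (-((k : ℤ) - d) - l).toNat := by
  have h1 : ∀ i ∈ Finset.range (d + 1), ∑ j ∈ Finset.range (d - i),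
      (-1) ^ i * y i * S (d - k - i - j) * ξ ^ j =
      ∑ j ∈ Finset.range d, (-1) ^ i * y i * S (d - k - i - j) * ξ ^ j := by
    intro i _
    refine Finset.sum_subset (Finset.range_subset_range.2 (Nat.sub_le _ _)) fun j h1 h2 => ?_
    rw [Finset.mem_range] at h1 h2
    rw [hS _ (by omega), mul_zero, zero_mul]
  rw [Finset.sum_congr rfl h1, Finset.sum_comm]
  have h2 : ∀ j ∈ Finset.range d, ∑ i ∈ Finset.range (d + 1),
      (-1) ^ i * y i * S (d - k - i - j) * ξ ^ j = C (d - k - j) * ξ ^ j := by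
    intro j _
    rw [← hC, Finset.sum_mul]
    exact Finset.sum_congr rfl fun i _ => by rw [sub_right_comm]
  rw [Finset.sum_congr rfl h2]
  rcases lt_or_ge d k with h | h
  · rw [show ((1 : ℤ) - (k - d)).toNat = 0 by omega, Finset.range_zero, Finset.sum_empty]
    exact Finset.sum_eq_zero fun j _ => by rw [hC' _ (by omega), zero_mul]
  · rw [show ((1 : ℤ) - (k - d)).toNat = d - k + 1 by omega,
      ← Finset.sum_range_reflect (fun l : ℕ => C l * ξ ^ (-((k : ℤ) - d) - l).toNat)]
    symm
    refine Finset.sum_subset_zero_on_sdiff (Finset.range_subset_range.2 (by omega)) ?_ ?_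
    · intro j hj
      rw [Finset.mem_sdiff, Finset.mem_range, Finset.mem_range] at hj
      rw [hC' _ (by omega), zero_mul]
    · intro j hj
      rw [Finset.mem_range] at hj
      congr 2 <;> omega

theorem subsingleton_stepAt_left {n : ℤ} (h : ofWeight N n = none) :
    Subsingleton (stepAt N n).A := by
  have := subsingleton_ring h
  refine subsingleton_of_zero_eq_one ?_
  rw [← map_one (stepAt N n).left, Subsingleton.elim (1 : ring (ofWeight N n)) 0, map_zero]

theorem subsingleton_stepAt_right {n : ℤ} (h : ofWeight N (n + 2) = none) :
    Subsingleton (stepAt N n).A := by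
  have := subsingleton_ring h
  refine subsingleton_of_zero_eq_one ?_
  rw [← map_one (stepAt N n).right, Subsingleton.elim (1 : ring (ofWeight N (n + 2))) 0, map_zero]

theorem complSeries_eq_one {A : Type} [CommRing A] {x : ℕ → A} (h0 : x 0 = 1)
    (h : ∀ j, 0 < j → x j = 0) : complSeries x = 1 := by
  have h1 : elemSeries x = 1 := by
    ext j
    rw [elemSeries, PowerSeries.coeff_mk, PowerSeries.coeff_one]
    split_ifs with hj
    · rw [hj, h0, pow_zero, mul_one]
    · rw [h j (Nat.pos_of_ne_zero hj), mul_zero]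
  have := elemSeries_mul_complSeries x h0
  rwa [h1, one_mul] at this

/-- At `1` the crossing spreads a power of `ξ` over two strands and the cap turns one of them into a
signed class `Y`; collecting terms gives bubble coefficients by `sum_curl`. -/
theorem evEq_curlRight (m : ℤ) :
    EvEq N (𝟙 (E (m + 2)) ⊗≫ epsh m ▷ E (m + 2) ⊗≫ F m ◁ U m ⊗≫ eps m ▷ E (m + 2) ⊗≫
        𝟙 (E (m + 2)))
      (-∑ l ∈ Finset.range (1 - (m + 2)).toNat,
        (𝟙 (E (m + 2)) ⊗≫ cB m l ▷ E (m + 2) ⊗≫ dots (m + 2) (-(m + 2) - l).toNat)) := by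
  refine evEq_E_one ?_
  simp [bicategoricalComp, ev_epsh, ev_U_pow_one, ev_End_one]
  simp only [← map_sum, ← map_neg_one_pow_zsmul (eE N (m + 2))]
  refine congrArg _ ?_
  rcases kAt_eq (N := N) (m + 2) with h | ⟨h1, h2⟩
  · have := subsingleton_stepAt_left h
    exact Subsingleton.elim _ _
  · rcases Nat.eq_zero_or_pos (kAt N (m + 2)) with hk | hk
    · have h3 : Subsingleton (stepAt N m).A := by
        rcases (stepFacts (N := N) m).degen with h | ⟨h, -⟩
        · exact h
        · exact absurd hk (by change idx _ ≠ 0; omega)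
      refine (Finset.sum_eq_zero fun i _ => ?_).trans (Eq.trans (stepFacts (m + 2)).lower.root.symm ?_)
      · rw [Finset.sum_eq_zero fun j _ => ?_, mul_zero]
        rw [Subsingleton.elim (_ * (stepAt N m).xi ^ _) 0, map_zero, map_zero, zero_mul]
      · have h4 : complSeries (xcl (ofWeight N (m + 2))) = 1 :=
          complSeries_eq_one (xcl_zero _) fun j hj => xcl_of_lt _ (by change idx _ = 0 at hk; omega)
        change Polynomial.eval₂ _ _ (cpoly _ (N - kAt N (m + 2))) = _
        rw [eval₂_cpoly, hk, show (1 - (m + 2)).toNat = N - 0 + 1 by omega]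
        refine Finset.sum_congr rfl fun l hl => ?_
        have h5 := bubVal_cB (N := N) m l
        rw [cSeries, h4, mul_one, elemSeries, PowerSeries.coeff_mk] at h5
        rw [h5, map_mul (stepAt N (m + 2)).left, map_pow, map_neg, map_one, mul_comm, show (-2 + -m).toNat = N - 0 by omega]
    · have key := sum_curl (stepAt N (m + 2)).xi (fun j => (stepAt N (m + 2)).left (ycl _ j))
        (fun e => (stepAt N (m + 2)).left (signed (Ycl (ofWeight N (m + 2))) e))
        (fun e he => by rw [signed_of_neg _ he, map_zero])
        (fun e => (stepAt N (m + 2)).left (zcoeff (cSeries N (m + 2)) e))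
        (fun e he => by rw [zcoeff_of_neg _ he, map_zero]) (N - kAt N (m + 2)) (kAt N (m + 2)) hk
        fun e => ?_
      · rw [show (1 : ℤ) - (kAt N (m + 2) - (N - kAt N (m + 2) : ℕ)) = 1 - (m + 2) by
          push_cast [h2]; linarith] at key
        refine Eq.trans (Finset.sum_congr rfl fun i hi => ?_) (key.trans
          (Finset.sum_congr rfl fun l hl => ?_))
        -- The crossing formula counts powers on the strand that is capped off; the index is
        -- reversed to count those on the surviving strand.
        · rw [Finset.mul_sum, ← Finset.sum_range_reflect]
          refine Finset.sum_congr rfl fun j hj => ?_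
          rw [Finset.mem_range] at hi hj
          rw [trUp_mul, trUp_pow, map_mul, mul_assoc, mul_assoc, mul_assoc,
            show N - kAt N (m + 2) - i - 1 - (N - kAt N (m + 2) - i - 1 - j) = j by omega,
            show ((N - kAt N (m + 2) - i - 1 - j : ℕ) : ℤ) + 1 - kAt N (m + 2) =
              (N - kAt N (m + 2) : ℕ) - kAt N (m + 2) - i - j by omega]
        · rw [bubVal_cB, zcoeff_natCast, mul_comm]
          rw [Finset.mem_range] at hl
          congr 2
          omega
      · have := congrArg (stepAt N (m + 2)).left (sum_mul_signed (ycl (ofWeight N (m + 2)))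
          (xcl (ofWeight N (m + 2))) (N - kAt N (m + 2)) (fun _ => ycl_of_lt _) e)
        rw [map_sum] at this
        refine Eq.trans (Finset.sum_congr rfl fun i _ => ?_) this
        rw [mul_assoc, mul_assoc, map_mul (stepAt N (m + 2)).left, map_pow, map_neg, map_one,
          map_mul (stepAt N (m + 2)).left]
        rfl

/-- The mirror image with the classes `X` and traces towards the lower ring. -/
theorem evEq_curlLeft (m : ℤ) :
    EvEq N (𝟙 (E m) ⊗≫ E m ◁ eta (m + 2) ⊗≫ U m ▷ F (m + 2) ⊗≫ E m ◁ etah (m + 2) ⊗≫ 𝟙 (E m))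
      (∑ j ∈ Finset.range (m + 2 + 1).toNat,
        (𝟙 (E m) ⊗≫ E m ◁ ccB m j ⊗≫ dots m (m + 2 - j).toNat)) := by
  refine evEq_E_one ?_
  simp [bicategoricalComp, ev_eta', ev_U_one_pow, ev_End_one]
  simp only [← map_sum, ← map_neg_one_pow_zsmul (eE N m)]
  refine congrArg _ ?_
  rcases kAt_eq (N := N) (m + 2) with h | ⟨h1, h2⟩
  · have := subsingleton_stepAt_right h
    exact Subsingleton.elim _ _
  · rcases Nat.eq_zero_or_pos (N - kAt N (m + 2)) with hk | hk
    · have h3 : Subsingleton (stepAt N (m + 2)).A := by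
        rcases (stepFacts (N := N) (m + 2)).degen with h | ⟨-, h⟩
        · exact h
        · exact absurd hk (by change N - idx _ ≠ 0; omega)
      refine (Finset.sum_eq_zero fun i _ => ?_).trans (Eq.trans (stepFacts m).upper.root.symm ?_)
      · rw [Finset.sum_eq_zero fun j _ => ?_, mul_zero]
        rw [Subsingleton.elim (_ * (stepAt N (m + 2)).left _) 0, map_zero, map_zero, zero_mul]
      · have h4 : complSeries (ycl (ofWeight N (m + 2))) = 1 :=
          complSeries_eq_one (ycl_zero _) fun j hj => ycl_of_lt _
            (by change N - idx _ = 0 at hk; omega)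
        change Polynomial.eval₂ _ _ (cpoly _ (kAt N (m + 2))) = _
        rw [eval₂_cpoly, show (m + 2 + 1).toNat = kAt N (m + 2) + 1 by omega]
        refine Finset.sum_congr rfl fun l hl => ?_
        have h5 := bubVal_ccB (N := N) m l
        rw [ccSeries, h4, mul_one, elemSeries, PowerSeries.coeff_mk] at h5
        rw [h5, map_mul (stepAt N m).right, map_pow, map_neg, map_one, mul_comm,
          show (m + 2).toNat = kAt N (m + 2) by omega]
    · have key := sum_curl (stepAt N m).xi (fun j => (stepAt N m).right (xcl _ j))
        (fun e => (stepAt N m).right (signed (Xcl (ofWeight N (m + 2))) e))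
        (fun e he => by rw [signed_of_neg _ he, map_zero])
        (fun e => (stepAt N m).right (zcoeff (ccSeries N (m + 2)) e))
        (fun e he => by rw [zcoeff_of_neg _ he, map_zero]) (kAt N (m + 2)) (N - kAt N (m + 2)) hk
        fun e => ?_
      · rw [show (1 : ℤ) - ((N - kAt N (m + 2) : ℕ) - kAt N (m + 2)) = m + 2 + 1 by
          push_cast [h2]; linarith] at key
        refine Eq.trans (Finset.sum_congr rfl fun i hi => ?_) (key.trans
          (Finset.sum_congr rfl fun l hl => ?_))
        · rw [Finset.mul_sum]
          refine Finset.sum_congr rfl fun j hj => ?_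
          rw [Finset.mem_range] at hi hj
          rw [mul_comm (_ ^ _) ((stepAt N (m + 2)).left _), trDown_mul, trDown_pow, map_mul,
            mul_assoc, mul_assoc, mul_assoc,
            show ((kAt N (m + 2) - i - 1 - j : ℕ) : ℤ) + 1 - (N - kAt N (m + 2) : ℕ) =
              kAt N (m + 2) - (N - kAt N (m + 2) : ℕ) - i - j by omega]
        · rw [bubVal_ccB, zcoeff_natCast, mul_comm]
          rw [Finset.mem_range] at hl
          congr 2
          omega
      · have := congrArg (stepAt N m).right (sum_mul_signed (xcl (ofWeight N (m + 2)))
          (ycl (ofWeight N (m + 2))) (kAt N (m + 2)) (fun _ => xcl_of_lt _) e)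
        rw [map_sum] at this
        refine Eq.trans (Finset.sum_congr rfl fun i _ => ?_) this
        rw [mul_assoc, mul_assoc, map_mul (stepAt N m).right, map_pow, map_neg, map_one,
          map_mul (stepAt N m).right]
        rfl

end Curls

end EqFlagRep
end

noncomputable section

namespace EqFlagRep

open GrBimod FreeU

/-! ### Sideways crossings -/

section Sideways

variable {N : ℕ}

variable (N) in
/-- The element `1 ⊗ ξ^b` of the bimodule of `ℰℱ`. -/
def genFE (m : ℤ) (b : ℕ) : bimod N (F m ≫ E m) :=
  tm (F m) (E m) (eF N m 1) (eE N m ((stepAt N m).xi ^ b))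

variable (N) in
/-- The element `ξ^b ⊗ 1` of the bimodule of `ℱℰ`. -/
def genEF (m : ℤ) (b : ℕ) : bimod N (E m ≫ F m) :=
  tm (E m) (F m) (eE N m ((stepAt N m).xi ^ b)) (eF N m 1)

/-- As a bimodule the composite is generated by these few elements: the first factor is generated by
two-sided scalars, of which those from the middle ring pass to the second factor, and the second is
spanned by low powers of `ξ` over the right ring. -/
theorem evEq_FE {m : ℤ} {g : (⟨m + 2⟩ : FreeU) ⟶ ⟨m + 2⟩} {η θ : F m ≫ E m ⟶ g}
    (h : ∀ b < kAt N (m + 2), ev N η (genFE N m b) = ev N θ (genFE N m b)) : EvEq N η θ := by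
  have h1 : ∀ b, ev N η (tm (F m) (E m) (eF N m 1) (eE N m b)) =
      ev N θ (tm (F m) (E m) (eF N m 1) (eE N m b)) := by
    refine (stepFacts m).upper.span (AddSubgroup.comap ((tm (F m) (E m) (eF N m 1)).comp (eE N m))
      (AddMonoidHom.eqLocus (ev N η) (ev N θ))) fun i hi s => ?_
    have h2 : tm (F m) (E m) (eF N m 1) (eE N m ((stepAt N m).right s * (stepAt N m).xi ^ i)) =
      ra (F m ≫ E m) s (genFE N m i) := by rw [genFE, ra_tm, ra_E]
    refine (congrArg (ev N η) h2).trans (Eq.trans ?_ (congrArg (ev N θ) h2).symm)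
    rw [ev_ract, ev_ract, h i hi]
  refine AddMonoidHom.ext (forall_tm fun (a b : (stepAt N m).A) => ?_)
  refine stepAt_gen m (AddSubgroup.comap (((tm (F m) (E m)).flip (eE N m b)).comp (eF N m))
      (AddMonoidHom.eqLocus (ev N η) (ev N θ))) (fun r s => ?_) a
  have h2 : tm (F m) (E m) (eF N m ((stepAt N m).left r * (stepAt N m).right s)) (eE N m b) =
      la (F m ≫ E m) s (tm (F m) (E m) (eF N m 1) (eE N m ((stepAt N m).left r * b))) := by
    rw [la_tm, ← la_E, ← tm_ra, la_F, ra_F, mul_one]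
  refine (congrArg (ev N η) h2).trans (Eq.trans ?_ (congrArg (ev N θ) h2).symm)
  rw [ev_lact, ev_lact, h1]

theorem evEq_EF {m : ℤ} {g : (⟨m⟩ : FreeU) ⟶ ⟨m⟩} {η θ : E m ≫ F m ⟶ g}
    (h : ∀ b < N - kAt N m, ev N η (genEF N m b) = ev N θ (genEF N m b)) : EvEq N η θ := by
  have h1 : ∀ b, ev N η (tm (E m) (F m) (eE N m b) (eF N m 1)) =
      ev N θ (tm (E m) (F m) (eE N m b) (eF N m 1)) := by
    refine (stepFacts m).lower.span (AddSubgroup.comap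
      (((tm (E m) (F m)).flip (eF N m 1)).comp (eE N m))
      (AddMonoidHom.eqLocus (ev N η) (ev N θ))) fun i hi s => ?_
    have h2 : tm (E m) (F m) (eE N m ((stepAt N m).left s * (stepAt N m).xi ^ i)) (eF N m 1) =
      la (E m ≫ F m) s (genEF N m i) := by rw [genEF, la_tm, la_E]
    refine (congrArg (ev N η) h2).trans (Eq.trans ?_ (congrArg (ev N θ) h2).symm)
    rw [ev_lact, ev_lact, h i hi]
  refine AddMonoidHom.ext (forall_tm fun (a b : (stepAt N m).A) => ?_)
  refine stepAt_gen m (AddSubgroup.comap ((tm (E m) (F m) (eE N m a)).comp (eF N m))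
      (AddMonoidHom.eqLocus (ev N η) (ev N θ))) (fun r s => ?_) b
  have h2 : tm (E m) (F m) (eE N m a) (eF N m ((stepAt N m).left r * (stepAt N m).right s)) =
      ra (E m ≫ F m) r (tm (E m) (F m) (eE N m ((stepAt N m).right s * a)) (eF N m 1)) := by
    rw [ra_tm, ← ra_E, tm_ra, ra_F, la_F, mul_one, mul_comm]
  refine (congrArg (ev N η) h2).trans (Eq.trans ?_ (congrArg (ev N θ) h2).symm)
  rw [ev_ract, ev_ract, h1]

theorem ev_U_pow (n : ℤ) (a b : ℕ) :
    ev N (U n) (tm (E n) (E (n + 2)) (eE N n ((stepAt N n).xi ^ a))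
      (eE N (n + 2) ((stepAt N (n + 2)).xi ^ b))) =
    ∑ j ∈ Finset.range b, tm (E n) (E (n + 2)) (eE N n ((stepAt N n).xi ^ j))
        (eE N (n + 2) ((stepAt N (n + 2)).xi ^ (a + b - 1 - j))) -
      ∑ j ∈ Finset.range a, tm (E n) (E (n + 2)) (eE N n ((stepAt N n).xi ^ j))
        (eE N (n + 2) ((stepAt N (n + 2)).xi ^ (a + b - 1 - j))) := uMap_pow n a b

theorem trUp_pow_of_lt (n : ℤ) {i : ℕ} (h : i + 1 < kAt N (n + 2)) :
    trUp N n ((stepAt N n).xi ^ i) = 0 := by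
  rw [trUp_pow, signed_of_neg _ (by omega)]

theorem trUp_pow_pred (n : ℤ) {i : ℕ} (h : i + 1 = kAt N (n + 2)) :
    trUp N n ((stepAt N n).xi ^ i) = 1 := by
  rw [trUp_pow, ← h]
  push_cast
  rw [sub_self]
  exact signed_invCoeff_zero _

theorem trDown_pow_of_lt (n : ℤ) {i : ℕ} (h : i + 1 < N - kAt N n) :
    trDown N n ((stepAt N n).xi ^ i) = 0 := by
  rw [trDown_pow, signed_of_neg _ (by omega)]

theorem trDown_pow_pred (n : ℤ) {i : ℕ} (h : i + 1 = N - kAt N n) :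
    trDown N n ((stepAt N n).xi ^ i) = 1 := by
  rw [trDown_pow, ← h]
  push_cast
  rw [sub_self]
  exact signed_invCoeff_zero _

/-- The trace kills powers below `K - 1`, so the subtracted sum disappears entirely and, of the
rest, only the top term with `x = 0` remains. -/
theorem sum_cross {M : Type*} [AddCommGroup M] (K b : ℕ) (hb : b < K) (f : ℕ → ℕ → M)
    (hf : ∀ x i, i + 1 < K → f x i = 0) :
    ∑ x ∈ Finset.range (K + 1), (-1 : ℤ) ^ x •
      (∑ i ∈ Finset.range (K - x), f x i - ∑ i ∈ Finset.range b, f x i) = f 0 (K - 1) := by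
  have h1 : ∀ x, ∑ i ∈ Finset.range b, f x i = 0 := fun x =>
    Finset.sum_eq_zero fun i hi => hf _ _ (by have := Finset.mem_range.1 hi; omega)
  rw [Finset.sum_eq_single 0]
  · rw [h1, sub_zero, pow_zero, one_smul, Finset.sum_eq_single (K - 1)]
    · intro i hi h
      exact hf _ _ (by have := Finset.mem_range.1 hi; omega)
    · intro h
      exact absurd (Finset.mem_range.2 (by omega)) h
  · intro x _ hx
    rw [h1, sub_zero, Finset.sum_eq_zero fun i hi => hf _ _ ?_, smul_zero]
    have := Finset.mem_range.1 hi
    omega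
  · intro h
    exact absurd (Finset.mem_range.2 (Nat.succ_pos K)) h

/-- In this range of exponents only the leading term of the cup meets a non-vanishing trace, which
is `1`. -/
theorem ev_crossEF (m : ℤ) (b : ℕ) (hb : b < kAt N (m + 2)) :
    ev N (crossEF m) (genFE N m b) = genEF N (m + 2) b := by
  simp [crossEF, genFE, bicategoricalComp, ev_eta', ev_U_pow]
  refine (sum_cross (kAt N (m + 2)) b hb (fun x i => tm (E (m + 2)) (F (m + 2))
    (eE N (m + 2) ((stepAt N (m + 2)).left (trUp N m ((stepAt N m).xi ^ i)) *
      (stepAt N (m + 2)).xi ^ (b + (kAt N (m + 2) - x) - 1 - i)))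
    (eF N (m + 2) ((stepAt N (m + 2)).left (xcl (ofWeight N (m + 2)) x)))) fun x i hi => ?_).trans ?_
  · rw [trUp_pow_of_lt m hi, map_zero, zero_mul, map_zero, map_zero]
    rfl
  · rw [trUp_pow_pred m (by omega), map_one, one_mul, xcl_zero, map_one, genEF,
      show b + (kAt N (m + 2) - 0) - 1 - (kAt N (m + 2) - 1) = b by omega]

/-- As before; the sign appears because the exponents now enter the divided difference in the
opposite order. -/
theorem ev_crossFE (m : ℤ) (c : ℕ) (hc : c < N - kAt N (m + 2)) :
    ev N (crossFE m) (genEF N (m + 2) c) = -genFE N m c := by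
  simp [crossFE, genEF, bicategoricalComp, ev_epsh, ev_U_pow]
  have key := sum_cross (N - kAt N (m + 2)) c hc (fun x i => tm (F m) (E m)
    (eF N m ((stepAt N m).right (ycl (ofWeight N (m + 2)) x)))
    (eE N m ((stepAt N m).right (trDown N (m + 2) ((stepAt N (m + 2)).xi ^ i)) *
      (stepAt N m).xi ^ (c + (N - kAt N (m + 2) - x) - 1 - i)))) fun x i hi => by
    rw [trDown_pow_of_lt (m + 2) hi, map_zero, zero_mul, map_zero, map_zero]
  beta_reduce at key
  rw [trDown_pow_pred (m + 2) (by omega), map_one, one_mul, ycl_zero, map_one,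
    show c + (N - kAt N (m + 2) - 0) - 1 - (N - kAt N (m + 2) - 1) = c by omega] at key
  rw [genFE, ← key, ← Finset.sum_neg_distrib]
  refine Finset.sum_congr rfl fun x _ => ?_
  rw [← smul_neg, neg_sub]
  refine congrArg _ ?_
  -- Reversing the antidiagonal puts the traced strand into the form required by `sum_cross`.
  have := sum_range_reflect_sub (fun i j => tm (F m) (E m)
    (eF N m ((stepAt N m).right (ycl (ofWeight N (m + 2)) x)))
    (eE N m ((stepAt N m).right (trDown N (m + 2) ((stepAt N (m + 2)).xi ^ j)) *
      (stepAt N m).xi ^ i))) c (N - kAt N (m + 2) - x)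
  rw [add_comm _ c]
  exact this

end Sideways

end EqFlagRep
end

noncomputable section

namespace EqFlagRep

open GrBimod FreeU

/-! ### The decompositions of the identities -/

section Decomposition

variable {N : ℕ}

theorem dots_comp (m : ℤ) (p q : ℕ) : dots m p ≫ dots m q = dots m (p + q) :=
  (pow_add (show End (E m) from z m) q p).symm.trans (congrArg (dots m) (add_comm q p))

theorem la_zero {a b : FreeU} (f : a ⟶ b) (x : bimod N f) : la f 0 x = 0 :=
  (bimod N f).lact_zero x

theorem la_one {a b : FreeU} (f : a ⟶ b) (x : bimod N f) : la f 1 x = x :=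
  (bimod N f).lact_one x

theorem ra_one {a b : FreeU} (f : a ⟶ b) (x : bimod N f) : ra f 1 x = x :=
  (bimod N f).ract_one x

theorem la_sum {a b : FreeU} (f : a ⟶ b) (s : Finset ℕ) (r : ℕ → ring (ofWeight N a.wt))
    (x : bimod N f) : la f (∑ i ∈ s, r i) x = ∑ i ∈ s, la f (r i) x := by
  rw [la, map_sum]
  exact AddMonoidHom.finsetSum_apply _ _ _

theorem sum_zcoeff_mul_coeff {A : Type} [CommRing A] (f g : PowerSeries A) (l : ℕ) (e : ℤ)
    (he : e ≤ l) : ∑ j ∈ Finset.range (l + 1), zcoeff f (e - j) * PowerSeries.coeff j g =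
      zcoeff (g * f) e := by
  rcases lt_or_ge e 0 with h | h
  · rw [zcoeff_of_neg _ h]
    exact Finset.sum_eq_zero fun j _ => by rw [zcoeff_of_neg _ (by omega), zero_mul]
  · lift e to ℕ using h
    rw [zcoeff_natCast, PowerSeries.coeff_mul, Finset.Nat.sum_antidiagonal_eq_sum_range_succ_mk]
    symm
    refine Finset.sum_subset_zero_on_sdiff (Finset.range_subset_range.2 (by omega)) ?_ ?_
    · intro j hj
      rw [Finset.mem_sdiff, Finset.mem_range, Finset.mem_range] at hj
      rw [zcoeff_of_neg _ (by omega), zero_mul]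
    · intro j hj
      rw [Finset.mem_range] at hj
      rw [← Nat.cast_sub (by omega), zcoeff_natCast, mul_comm]

theorem zcoeff_one {A : Type} [CommRing A] (e : ℤ) :
    zcoeff (1 : PowerSeries A) e = if e = 0 then 1 else 0 := by
  rcases lt_or_ge e 0 with h | h
  · rw [zcoeff_of_neg _ h, if_neg h.ne]
  · lift e to ℕ using h
    rw [zcoeff_natCast, PowerSeries.coeff_one]
    simp

/-- A coefficient of `g * f = 1`. The bound `hp` guarantees that cutting the convolution at `l`
loses nothing. -/
theorem sum_zcoeff_sub_mul_coeff {A : Type} [CommRing A] {f g : PowerSeries A} (h : g * f = 1)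
    (p l : ℕ) (t : ℤ) (hp : (p : ℤ) ≤ t) :
    ∑ j ∈ Finset.range (l + 1), zcoeff f ((p + (l - j) : ℕ) - t) * PowerSeries.coeff j g =
      if (p : ℤ) + l = t then 1 else 0 := by
  have h1 := sum_zcoeff_mul_coeff f g l (p + l - t) (by omega)
  rw [h, zcoeff_one] at h1
  simp only [sub_eq_zero] at h1
  rw [← h1]
  refine Finset.sum_congr rfl fun j hj => ?_
  rw [Finset.mem_range] at hj
  congr 2
  omega

/-- Triangularity step: if a sum and all its lower terms are fixed, so is the leading term. -/
theorem map_eq_self_of_sum {M : Type*} [AddCommGroup M] (T : M →+ M) (f : ℕ → M) (d : ℕ)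
    (h : T (∑ i ∈ Finset.range (d + 1), f i) = ∑ i ∈ Finset.range (d + 1), f i)
    (hi : ∀ i < d, T (f (i + 1)) = f (i + 1)) : T (f 0) = f 0 := by
  rw [Finset.sum_range_succ', map_add, map_sum,
    Finset.sum_congr rfl fun i h' => hi i (Finset.mem_range.1 h')] at h
  exact add_left_cancel h

/-! ### The identity of `ℰℱ` -/

section FE

variable (m : ℤ)

variable (N) in
/-- The image of `1` under a cup with `p` dots. -/
def cupFE (p : ℕ) : bimod N (F m ≫ E m) := ev N (F m ◁ dots m p) (ev N (epsh m) (uI N ⟨m + 2⟩))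

/-- The term `i = 0` is the generator with exponent `p + N - k`; all other terms involve smaller
exponents. So dotted cups replace the generators of high exponent. -/
theorem cupFE_eq (p : ℕ) : cupFE N m p = ∑ i ∈ Finset.range (N - kAt N (m + 2) + 1),
    (-1 : ℤ) ^ i • la (F m ≫ E m) (ycl _ i) (genFE N m (p + (N - kAt N (m + 2) - i))) := by
  rw [cupFE, ev_epsh, map_sum]
  refine Finset.sum_congr rfl fun i _ => ?_
  rw [map_zsmul, ev_whiskerLeft, ev_dots, genFE, la_tm, la_F, mul_one, pow_add]

theorem ev_eps_dots_genFE (q b : ℕ) (h : q + b + 1 < kAt N (m + 2)) :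
    ev N (eps m) (ev N (F m ◁ dots m q) (genFE N m b)) = sI N ⟨m + 2⟩ 0 := by
  rw [genFE, ev_whiskerLeft, ev_dots, ev_eps, one_mul, ← pow_add, trUp_pow_of_lt m h]

theorem ev_eps_dots_cupFE (q p : ℕ) :
    ev N (eps m) (ev N (F m ◁ dots m q) (cupFE N m p)) =
      sI N ⟨m + 2⟩ (zcoeff (cSeries N (m + 2)) ((p + q : ℕ) - (m + 1))) := by
  rw [← bubVal_cBub m (p + q), ← ev_End_one, cBub, cupFE, ← ev_comp, ← ev_comp, ← ev_comp,
    ← whiskerLeft_comp_assoc, dots_comp]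

/-- All exponents are in the range where the crossing just moves `ξ^b` across; the resulting sum is
`ξ^p` times the root relation over `H_k`. -/
theorem ev_crossEF_cupFE (p : ℕ) (h : p + (N - kAt N (m + 2)) < kAt N (m + 2)) :
    ev N (crossEF m) (cupFE N m p) = 0 := by
  rw [cupFE_eq, map_sum]
  have h1 : ∀ i ∈ Finset.range (N - kAt N (m + 2) + 1), ev N (crossEF m) ((-1 : ℤ) ^ i •
      la (F m ≫ E m) (ycl _ i) (genFE N m (p + (N - kAt N (m + 2) - i)))) =
      (((tm (E (m + 2)) (F (m + 2))).flip (eF N (m + 2) 1)).comp (eE N (m + 2)))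
        ((-1) ^ i * (stepAt N (m + 2)).left (ycl _ i) *
          (stepAt N (m + 2)).xi ^ (N - kAt N (m + 2) - i) * (stepAt N (m + 2)).xi ^ p) := by
    intro i hi
    rw [Finset.mem_range] at hi
    rw [map_zsmul, ev_lact, ev_crossEF m _ (by omega), genEF, la_tm, la_E, mul_assoc, mul_assoc,
      map_neg_one_pow_zsmul, ← pow_add, add_comm p]
    rfl
  rw [Finset.sum_congr rfl h1, ← map_sum, ← Finset.sum_mul]
  have h2 := (stepFacts (N := N) (m + 2)).lower.root
  rw [eval₂_cpoly] at h2
  refine Eq.trans (congrArg _ (congrArg (· * (stepAt N (m + 2)).xi ^ p) h2)) ?_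
  exact (congrArg _ (zero_mul _)).trans (map_zero _)

/-- The sum in the decomposition of the identity of `ℰℱ`. -/
def sumFE : F m ≫ E m ⟶ F m ≫ E m :=
  ∑ l ∈ Finset.range (m + 2).toNat, ∑ j ∈ Finset.range (l + 1),
    F m ◁ dots m (l - j) ≫ eps m ≫ ccB m j ≫ epsh m ≫ F m ◁ dots m (m + 2 - 1 - l).toNat

theorem ev_sumFE (x : bimod N (F m ≫ E m)) (c : ℕ → ring (ofWeight N (m + 2)))
    (hx : ∀ q : ℕ, ((q : ℤ) < m + 2) → ev N (eps m) (ev N (F m ◁ dots m q) x) = sI N ⟨m + 2⟩ (c q)) :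
    ev N (sumFE m) x = ∑ l ∈ Finset.range (m + 2).toNat,
      la (F m ≫ E m) (∑ j ∈ Finset.range (l + 1),
        c (l - j) * PowerSeries.coeff j (ccSeries N (m + 2))) (cupFE N m (m + 2 - 1 - l).toNat) := by
  rw [sumFE, ev_sum]
  refine Finset.sum_congr rfl fun l hl => ?_
  rw [ev_sum]
  refine Eq.trans (Finset.sum_congr rfl fun j hj => ?_) (la_sum (F m ≫ E m) _ _ _).symm
  rw [Finset.mem_range] at hl hj
  rw [ev_comp, ev_comp, ev_comp, ev_comp, hx _ (by omega), ev_End, bubVal_ccB, ev_sI, ev_lact]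
  rfl

/-- Strong induction on the exponent `b` of the generator. For `b < N - k` the crossings alone give
the identity; otherwise the generator is the leading term of a dotted cup, which only the bubble sum
sees. -/
theorem evEq_decompEF :
    EvEq N (-(crossEF m ≫ crossFE m) +
        ∑ l ∈ Finset.range (m + 2).toNat, ∑ j ∈ Finset.range (l + 1),
          F m ◁ dots m (l - j) ≫ eps m ≫ ccB m j ≫ epsh m ≫ F m ◁ dots m (m + 2 - 1 - l).toNat)
        (𝟙 (F m ≫ E m)) := by
  change EvEq N (-(crossEF m ≫ crossFE m) + sumFE m) _
  refine evEq_FE fun b => ?_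
  rcases kAt_eq (N := N) (m + 2) with h | ⟨h1, h2⟩
  · intro hb
    change b < idx _ at hb
    rw [h] at hb
    exact absurd hb (Nat.not_lt_zero b)
  induction b using Nat.strong_induction_on with
  | _ b ih =>
  intro hb
  rw [ev_id]
  -- In the first case every cap in the sum has fewer than `n` dots, and with `n = k - (N - k)` its
  -- trace is taken of a power below `k - 1`.
  rcases lt_or_ge b (N - kAt N (m + 2)) with hd | hd
  · rw [ev_add, ev_neg, ev_comp, ev_crossEF m b hb, ev_crossFE m b hd, neg_neg,
      ev_sumFE m _ (fun _ => 0) fun q hq => ev_eps_dots_genFE m q b (by omega)]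
    simp [la_zero]
  · obtain ⟨p, rfl⟩ := Nat.exists_eq_add_of_le' hd
    have h3 : ev N (-(crossEF m ≫ crossFE m) + sumFE m) (cupFE N m p) = cupFE N m p := by
      rw [ev_add, ev_neg, ev_comp, ev_crossEF_cupFE m p hb, map_zero, neg_zero, zero_add,
        ev_sumFE m _ _ fun q _ => ev_eps_dots_cupFE m q p,
        -- The inner sums are coefficients of the product of the inverse bubble series. Only `l = n
        -- - 1 - p` contributes, and the cup it creates carries `p` dots again.
        Finset.sum_eq_single (m + 2 - 1 - p).toNat]
      · rw [sum_zcoeff_sub_mul_coeff (ccSeries_mul_cSeries _) _ _ _ (by omega), if_pos (by omega),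
          la_one, show (m + 2 - 1 - (m + 2 - 1 - p).toNat).toNat = p by omega]
      · intro l hl hlp
        rw [Finset.mem_range] at hl
        rw [sum_zcoeff_sub_mul_coeff (ccSeries_mul_cSeries _) _ _ _ (by omega), if_neg (by omega),
          la_zero]
      · intro hl
        exact absurd (Finset.mem_range.2 (by omega)) hl
    rw [cupFE_eq] at h3
    have h4 := map_eq_self_of_sum _ _ _ h3 fun i hi => by
      rw [map_zsmul, ev_lact, ih _ (by omega) (by omega), ev_id]
    rwa [pow_zero, one_smul, ycl_zero, la_one, Nat.sub_zero] at h4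

end FE

/-! ### The identity of `ℱℰ` -/

section EF

variable (m : ℤ)

variable (N) in
/-- The image of `1` under a cup with `p` dots. -/
def cupEF (p : ℕ) : bimod N (E m ≫ F m) := ev N (dots m p ▷ F m) (ev N (eta m) (uI N ⟨m⟩))

theorem cupEF_eq (p : ℕ) : cupEF N m p = ∑ i ∈ Finset.range (kAt N m + 1),
    (-1 : ℤ) ^ i • ra (E m ≫ F m) (xcl _ i) (genEF N m (p + (kAt N m - i))) := by
  rw [cupEF, ev_eta', map_sum]
  refine Finset.sum_congr rfl fun i _ => ?_
  rw [map_zsmul, ev_whiskerRight, ev_dots, genEF, ra_tm, ra_F, mul_one, pow_add]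

theorem ev_etah_dots_genEF (q b : ℕ) (h : q + b + 1 < N - kAt N m) :
    ev N (etah m) (ev N (dots m q ▷ F m) (genEF N m b)) = sI N ⟨m⟩ 0 := by
  rw [genEF, ev_whiskerRight, ev_dots, ev_etah, mul_one, ← pow_add, trDown_pow_of_lt m h]

theorem ev_etah_dots_cupEF (q p : ℕ) :
    ev N (etah m) (ev N (dots m q ▷ F m) (cupEF N m p)) =
      sI N ⟨m⟩ (zcoeff (ccSeries N m) ((p + q : ℕ) - -(m + 1))) := by
  rw [sub_neg_eq_add, ← bubVal_ccBub m (p + q), ← ev_End_one, ccBub, cupEF, ← ev_comp, ← ev_comp,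
    ← ev_comp, ← comp_whiskerRight_assoc, dots_comp]

/-- The image is, up to sign, `ξ^p` times the root relation over the upper ring. -/
theorem ev_crossFE_cupEF (p : ℕ) (h : p + kAt N (m + 2) < N - kAt N (m + 2)) :
    ev N (crossFE m) (cupEF N (m + 2) p) = 0 := by
  rw [cupEF_eq, map_sum]
  have h1 : ∀ i ∈ Finset.range (kAt N (m + 2) + 1), ev N (crossFE m) ((-1 : ℤ) ^ i •
      ra (E (m + 2) ≫ F (m + 2)) (xcl _ i) (genEF N (m + 2) (p + (kAt N (m + 2) - i)))) =
      ((tm (F m) (E m) (eF N m 1)).comp (eE N m))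
        ((-1) ^ i * (stepAt N m).right (xcl _ i) *
          (stepAt N m).xi ^ (kAt N (m + 2) - i) * -(stepAt N m).xi ^ p) := by
    intro i hi
    rw [Finset.mem_range] at hi
    rw [map_zsmul, ev_ract, ev_crossFE m _ (by omega), genFE, ← map_neg (tm (F m) (E m) (eF N m 1)),
      ← map_neg (eE N m), ra_tm, ra_E, mul_assoc, mul_assoc, map_neg_one_pow_zsmul, mul_neg,
      mul_neg, mul_neg, ← pow_add, add_comm p]
    rfl
  rw [Finset.sum_congr rfl h1, ← map_sum, ← Finset.sum_mul]
  have h2 := (stepFacts (N := N) m).upper.root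
  rw [eval₂_cpoly] at h2
  refine Eq.trans (congrArg _ (congrArg (· * -(stepAt N m).xi ^ p) h2)) ?_
  exact (congrArg _ (zero_mul _)).trans (map_zero _)

/-- The sum in the decomposition of the identity of `ℱℰ`. -/
def sumEF : E (m + 2) ≫ F (m + 2) ⟶ E (m + 2) ≫ F (m + 2) :=
  ∑ l ∈ Finset.range (-(m + 2)).toNat, ∑ j ∈ Finset.range (l + 1),
    dots (m + 2) (l - j) ▷ F (m + 2) ≫ etah (m + 2) ≫ cB m j ≫ eta (m + 2) ≫
      dots (m + 2) (-(m + 2) - 1 - l).toNat ▷ F (m + 2)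

theorem ev_sumEF (x : bimod N (E (m + 2) ≫ F (m + 2))) (c : ℕ → ring (ofWeight N (m + 2)))
    (hx : ∀ q : ℕ, ((q : ℤ) < -(m + 2)) →
      ev N (etah (m + 2)) (ev N (dots (m + 2) q ▷ F (m + 2)) x) = sI N ⟨m + 2⟩ (c q)) :
    ev N (sumEF m) x = ∑ l ∈ Finset.range (-(m + 2)).toNat,
      la (E (m + 2) ≫ F (m + 2)) (∑ j ∈ Finset.range (l + 1),
        c (l - j) * PowerSeries.coeff j (cSeries N (m + 2)))
        (cupEF N (m + 2) (-(m + 2) - 1 - l).toNat) := by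
  rw [sumEF, ev_sum]
  refine Finset.sum_congr rfl fun l hl => ?_
  rw [ev_sum]
  refine Eq.trans (Finset.sum_congr rfl fun j hj => ?_) (la_sum (E (m + 2) ≫ F (m + 2)) _ _ _).symm
  rw [Finset.mem_range] at hl hj
  rw [ev_comp, ev_comp, ev_comp, ev_comp, hx _ (by omega), ev_End, bubVal_cB, ev_sI, ev_lact]
  rfl

/-- The argument for `ℰℱ` with `k` and `N - k` exchanged. The composite of the two crossings again
yields the sign that cancels the one in the relation. -/
theorem evEq_decompFE :
    EvEq N (-(crossFE m ≫ crossEF m) +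
        ∑ l ∈ Finset.range (-(m + 2)).toNat, ∑ j ∈ Finset.range (l + 1),
          dots (m + 2) (l - j) ▷ F (m + 2) ≫ etah (m + 2) ≫ cB m j ≫ eta (m + 2) ≫
            dots (m + 2) (-(m + 2) - 1 - l).toNat ▷ F (m + 2))
        (𝟙 (E (m + 2) ≫ F (m + 2))) := by
  change EvEq N (-(crossFE m ≫ crossEF m) + sumEF m) _
  rcases kAt_eq (N := N) (m + 2) with h | ⟨h1, h2⟩
  · have := subsingleton_stepAt_left h
    -- At the zero ring the default `kAt = 0` leaves `N` exponents to test, so the generators have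
    -- to be seen to vanish.
    refine evEq_EF fun b _ => ?_
    rw [genEF, Subsingleton.elim (_ ^ b) 0, map_zero (eE N (m + 2)), map_zero (tm _ _)]
    exact (map_zero _).trans (map_zero _).symm
  refine evEq_EF fun b => ?_
  induction b using Nat.strong_induction_on with
  | _ b ih =>
  intro hb
  rw [ev_id]
  rcases lt_or_ge b (kAt N (m + 2)) with hd | hd
  · rw [ev_add, ev_neg, ev_comp, ev_crossFE m b hb, map_neg, ev_crossEF m b hd, neg_neg,
      ev_sumEF m _ (fun _ => 0) fun q hq => ev_etah_dots_genEF (m + 2) q b (by omega)]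
    simp [la_zero]
  · obtain ⟨p, rfl⟩ := Nat.exists_eq_add_of_le' hd
    have h3 : ev N (-(crossFE m ≫ crossEF m) + sumEF m) (cupEF N (m + 2) p) =
        cupEF N (m + 2) p := by
      have h4 := (mul_comm _ _).trans (ccSeries_mul_cSeries (N := N) (m + 2))
      rw [ev_add, ev_neg, ev_comp, ev_crossFE_cupEF m p hb, map_zero, neg_zero, zero_add,
        ev_sumEF m _ _ fun q _ => ev_etah_dots_cupEF (m + 2) q p,
        Finset.sum_eq_single (-(m + 2) - 1 - p).toNat]
      · rw [sum_zcoeff_sub_mul_coeff h4 _ _ _ (by omega), if_pos (by omega),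
          la_one, show (-(m + 2) - 1 - (-(m + 2) - 1 - p).toNat).toNat = p by omega]
      · intro l hl hlp
        rw [Finset.mem_range] at hl
        rw [sum_zcoeff_sub_mul_coeff h4 _ _ _ (by omega), if_neg (by omega), la_zero]
      · intro hl
        exact absurd (Finset.mem_range.2 (by omega)) hl
    rw [cupEF_eq] at h3
    have h4 := map_eq_self_of_sum _ _ _ h3 fun i hi => by
      rw [map_zsmul, ev_ract, ih _ (by omega) (by omega), ev_id]
    rwa [pow_zero, one_smul, xcl_zero, ra_one, Nat.sub_zero] at h4

end EF

end Decomposition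

end EqFlagRep
end

noncomputable section

namespace EqFlagRep

open GrBimod FreeU GradedBicategory

/-! ### The 2-functor -/

theorem evEq_of_uRel (N : ℕ) {a b : FreeU} {f g : a ⟶ b} {η θ : f ⟶ g} (h : URel η θ) :
    EvEq N η θ := by
  cases h with
  | zigzagE n => exact evEq_zigzagE n
  | zigzagF n => exact evEq_zigzagF n
  | zigzagF' n => exact evEq_zigzagF' n
  | zigzagE' n => exact evEq_zigzagE' n
  | cyclicZ n => exact evEq_cyclicZ n
  | cyclicZ' n => exact evEq_cyclicZ' n
  | cyclicU n => exact evEq_cyclicU n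
  | cyclicU' n => exact evEq_cyclicU' n
  | cBub_neg m d h => exact evEq_cBub_neg m d h
  | ccBub_neg n d h => exact evEq_ccBub_neg n d h
  | cBub_zero m d h => exact evEq_cBub_zero m d h
  | ccBub_zero n d h => exact evEq_ccBub_zero n d h
  | grassmannian m k h => exact evEq_grassmannian m k h
  | nilpotent n => exact evEq_nilpotent n
  | nilHecke n => exact evEq_nilHecke n
  | nilHecke' n => exact evEq_nilHecke' n
  | reidemeister n => exact evEq_reidemeister n
  | curlRight m => exact evEq_curlRight m
  | curlLeft m => exact evEq_curlLeft m
  | decompEF m => exact evEq_decompEF m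
  | decompFE m => exact evEq_decompFE m

/-- A relation of `U*` compares classes of expressions in the free 2-category, and `ev` of such a
class is the underlying map of `preMap`. -/
theorem sound_uRel (N : ℕ) : Sound N uRel := fun _ _ h => Subtype.ext (evEq_of_uRel N h)

/-! ### Coherence isomorphisms that come from equalities -/

section Coherence

universe w v u

variable {C : Type u} [Bicategory.{w, v} C] {a b c d : C}

/-- The images of composites are replaced by variables, so that the equalities can be eliminated and
the coherence law reduces to a simplification. -/
theorem eq_eqToIso_associator {f : a ⟶ b} {g : b ⟶ c} {h : c ⟶ d} {fg : a ⟶ c} {gh : b ⟶ d}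
    {x y : a ⟶ d} (h1 : fg = f ≫ g) (h2 : gh = g ≫ h) (h3 : x = fg ≫ h) (h4 : y = f ≫ gh)
    {φ : x ⟶ y} (hφ : HEq φ (α_ f g h).hom) :
    φ = (eqToIso h3).hom ≫ (eqToIso h1).hom ▷ h ≫ (α_ f g h).hom ≫ f ◁ (eqToIso h2).inv ≫
      (eqToIso h4).inv := by
  subst h1 h2 h3 h4
  rw [eq_of_heq hφ]
  simp

theorem eq_eqToIso_leftUnitor {f : a ⟶ b} {i : a ⟶ a} {x : a ⟶ b} (h1 : i = 𝟙 a)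
    (h2 : x = i ≫ f) {φ : x ⟶ f} (hφ : HEq φ (λ_ f).hom) :
    φ = (eqToIso h2).hom ≫ (eqToIso h1).hom ▷ f ≫ (λ_ f).hom := by
  subst h1 h2
  rw [eq_of_heq hφ]
  simp

theorem eq_eqToIso_rightUnitor {f : a ⟶ b} {i : b ⟶ b} {x : a ⟶ b} (h1 : i = 𝟙 b)
    (h2 : x = f ≫ i) {φ : x ⟶ f} (hφ : HEq φ (ρ_ f).hom) :
    φ = (eqToIso h2).hom ≫ f ◁ (eqToIso h1).hom ≫ (ρ_ f).hom := by
  subst h1 h2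
  rw [eq_of_heq hφ]
  simp

theorem eqToIso_mem_zero [∀ a b : C, Preadditive (a ⟶ b)] [GradedBicategory C] {f g : a ⟶ b}
    (h : f = g) : (eqToIso h).hom ∈ homog f g 0 ∧ (eqToIso h).inv ∈ homog g f 0 := by
  subst h
  exact ⟨id_mem f, id_mem f⟩

end Coherence

/-! ### Images of associators and unitors -/

section Structure

variable {N : ℕ}

theorem associator_hom_heq {a b c d : EqFlagStar N} (f : a ⟶ b) (g : b ⟶ c) (h : c ⟶ d) :
    HEq (α_ f g h).hom (assoc f.bim g.bim h.bim).hom := by rfl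

theorem leftUnitor_hom_heq {a b : EqFlagStar N} (f : a ⟶ b) :
    HEq (λ_ f).hom (leftUnit f.bim).hom := by rfl

theorem rightUnitor_hom_heq {a b : EqFlagStar N} (f : a ⟶ b) :
    HEq (ρ_ f).hom (rightUnit f.bim).hom := by rfl

variable {a b c d : UStar} (f : a ⟶ b) (g : b ⟶ c) (h : c ⟶ d)

theorem cellMap_associator : cellMap (sound_uRel N) (α_ f g h).hom =
    (assoc (bimod N f) (bimod N g) (bimod N h)).hom := by rfl

theorem cellMap_leftUnitor :
    cellMap (sound_uRel N) (λ_ f).hom = (leftUnit (bimod N f)).hom := by rfl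

theorem cellMap_rightUnitor :
    cellMap (sound_uRel N) (ρ_ f).hom = (rightUnit (bimod N f)).hom := by rfl

theorem cellMap_associator_heq_assoc : HEq (cellMap (sound_uRel N) (α_ f g h).hom)
    (assoc (bimod N f) (bimod N g) (bimod N h)).hom := by
  apply heq_of_eq (cellMap_associator f g h)

/-- Heterogeneous equality bridges the hom-groups of bimodules and of the target 2-category, which
agree only after unfolding. -/
theorem cellMap_associator_heq : HEq (cellMap (sound_uRel N) (α_ f g h).hom)
    (α_ ((gamma N).map f) ((gamma N).map g) ((gamma N).map h)).hom :=
  (cellMap_associator_heq_assoc f g h).trans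
    (associator_hom_heq ((gamma N).map f) ((gamma N).map g) ((gamma N).map h)).symm

theorem cellMap_leftUnitor_heq_leftUnit :
    HEq (cellMap (sound_uRel N) (λ_ f).hom) (leftUnit (bimod N f)).hom := by
  apply heq_of_eq (cellMap_leftUnitor f)

theorem cellMap_leftUnitor_heq :
    HEq (cellMap (sound_uRel N) (λ_ f).hom) (λ_ ((gamma N).map f)).hom :=
  (cellMap_leftUnitor_heq_leftUnit f).trans (leftUnitor_hom_heq ((gamma N).map f)).symm

theorem cellMap_rightUnitor_heq_rightUnit :
    HEq (cellMap (sound_uRel N) (ρ_ f).hom) (rightUnit (bimod N f)).hom := by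
  apply heq_of_eq (cellMap_rightUnitor f)

theorem cellMap_rightUnitor_heq :
    HEq (cellMap (sound_uRel N) (ρ_ f).hom) (ρ_ ((gamma N).map f)).hom :=
  (cellMap_rightUnitor_heq_rightUnit f).trans (rightUnitor_hom_heq ((gamma N).map f)).symm

end Structure

/-- The 2-functor. -/
def gammaFunctor (N : ℕ) : PseudofunctorOn (gamma N : UStar ⥤q EqFlagStar N) where
  map₂ η := cellMap (sound_uRel N) η
  map₂_id f := rfl
  map₂_comp η θ := by
    induction η using Cell.ind with | _ η => induction θ using Cell.ind with | _ θ => rfl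
  mapId a := eqToIso (gamma_id N a)
  mapComp f g := eqToIso (gamma_comp N f g)
  map₂_whisker_left f _ _ η := by
    induction η using Cell.ind with | _ η => rfl
  map₂_whisker_right η h := by
    induction η using Cell.ind with | _ η => rfl
  map₂_associator f g h := eq_eqToIso_associator (gamma_comp N f g) (gamma_comp N g h)
    (gamma_comp N (f ≫ g) h) (gamma_comp N f (g ≫ h)) (cellMap_associator_heq f g h)
  map₂_left_unitor {a _} f := eq_eqToIso_leftUnitor (gamma_id N a) (gamma_comp N (𝟙 a) f)
    (cellMap_leftUnitor_heq f)
  map₂_right_unitor {_ b} f := eq_eqToIso_rightUnitor (gamma_id N b) (gamma_comp N f (𝟙 b))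
    (cellMap_rightUnitor_heq f)

theorem cellMap_add (N : ℕ) {a b : UStar} {f g : a ⟶ b} (η θ : f ⟶ g) :
    cellMap (sound_uRel N) (η + θ) = cellMap (sound_uRel N) η + cellMap (sound_uRel N) θ := by
  induction η using Cell.ind with | _ η => induction θ using Cell.ind with | _ θ => rfl

theorem gammaFunctor_isAdditive (N : ℕ) : (gammaFunctor N).IsAdditive := cellMap_add N

/-- Degrees in the source are generated by those of the generators, and bimodule maps obey the same
rules for sums, composites and whiskerings. -/
theorem cellMap_homog (N : ℕ) {a b : UStar} {f g : a ⟶ b} {d : ℤ} {η : f ⟶ g} (h : HasDeg d η) :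
    (cellMap (sound_uRel N) η).1 ∈ homogMaps (bimod N f) (bimod N g) d := by
  induction h with
  | zero f g d => exact zero_mem _
  | add _ _ h h' => rw [cellMap_add]; exact add_mem h h'
  | @neg a b f g d η _ h =>
    induction η using Cell.ind with | _ η => exact neg_mem h
  | id f => exact id_homog (bimod N f)
  | @comp a b f g h d e η θ _ _ h1 h2 =>
    induction η using Cell.ind with | _ η =>
    induction θ using Cell.ind with | _ θ => exact comp_homog h1 h2
  | @whiskerLeft a b c f g h d η _ ih =>
    induction η using Cell.ind with | _ η => exact wl_homog (bimod N f) _ ih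
  | @whiskerRight a b c f g d η h _ ih =>
    induction η using Cell.ind with | _ η => exact wr_homog _ (bimod N h) ih
  | associator f g h => exact (assoc_mem (bimod N f) (bimod N g) (bimod N h)).1
  | associatorInv f g h => exact (assoc_mem (bimod N f) (bimod N g) (bimod N h)).2
  | leftUnitor f => exact (leftUnit_mem (bimod N f)).1
  | leftUnitorInv f => exact (leftUnit_mem (bimod N f)).2
  | rightUnitor f => exact (rightUnit_mem (bimod N f)).1
  | rightUnitorInv f => exact (rightUnit_mem (bimod N f)).2
  | z n => exact zMap_homog n
  | zh n => exact zhMap_homog n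
  | U n => exact uMap_homog n
  | Uh n => exact uhMap_homog n
  | eta n => exact etaMap_homog n
  | eps n => exact epsMap_homog n
  | epsh n => exact epshMap_homog n
  | etah n => exact etahMap_homog n
  | shiftHom f s => exact shiftHom_homog (bimod N f) s
  | shiftInv f s => exact shiftInv_homog (bimod N f) s
  | inl f g => exact inl_homog (bimod N f) (bimod N g)
  | inr f g => exact inr_homog (bimod N f) (bimod N g)
  | fst f g => exact fst_homog (bimod N f) (bimod N g)
  | snd f g => exact snd_homog (bimod N f) (bimod N g)

theorem gammaFunctor_isGraded (N : ℕ) : (gammaFunctor N).IsGraded :=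
  ⟨fun _ _ h => cellMap_homog N h, fun a => eqToIso_mem_zero (gamma_id N a),
    fun f g => eqToIso_mem_zero (gamma_comp N f g)⟩

theorem gammaFunctor_hasValues (N : ℕ) : HasValues (gammaFunctor N) where
  z n m := (pow_succ' (stepAt N n).xi m).symm
  zh n m := (pow_succ' (stepAt N n).xi m).symm
  U n a b := uMap_pow n a b
  Uh n a b := uhMap_pow n a b
  eta n := by
    -- The scalar acts on `ξ^0`, which the expansion of the cup leaves out.
    have h1 (j : ℕ) : (stepAt N n).left (xcl _ j) =
      (stepAt N n).left (xcl _ j) * (stepAt N n).xi ^ 0 := by rw [pow_zero, mul_one]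
    refine (ev_eta n).trans (Finset.sum_congr rfl fun j _ => congrArg _ ?_)
    exact congrArg (fun x => tm (E n) (F n) (eE N n x) (eF N n ((stepAt N n).xi ^ (kAt N n - j))))
      (h1 j)
  eta_right n := by
    have h1 (j : ℕ) : (stepAt N n).left (xcl _ j) =
      (stepAt N n).left (xcl _ j) * (stepAt N n).xi ^ 0 := by rw [pow_zero, mul_one]
    refine (ev_eta' n).trans (Finset.sum_congr rfl fun j _ => congrArg _ ?_)
    exact congrArg (fun x => tm (E n) (F n) (eE N n ((stepAt N n).xi ^ (kAt N n - j))) (eF N n x))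
      (h1 j)
  epsh n := by
    have h1 (j : ℕ) : (stepAt N n).right (ycl _ j) =
      (stepAt N n).right (ycl _ j) * (stepAt N n).xi ^ 0 := by rw [pow_zero, mul_one]
    refine (ev_epsh n).trans (Finset.sum_congr rfl fun j _ => congrArg _ ?_)
    exact congrArg (fun x => tm (F n) (E n) (eF N n x)
      (eE N n ((stepAt N n).xi ^ (N - kAt N (n + 2) - j))))
      (h1 j)
  epsh_right n := by
    have h1 (j : ℕ) : (stepAt N n).right (ycl _ j) =
      (stepAt N n).right (ycl _ j) * (stepAt N n).xi ^ 0 := by rw [pow_zero, mul_one]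
    refine (ev_epsh' n).trans (Finset.sum_congr rfl fun j _ => congrArg _ ?_)
    exact congrArg (fun x => tm (F n) (E n) (eF N n ((stepAt N n).xi ^ (N - kAt N (n + 2) - j)))
      (eE N n x)) (h1 j)
  etah n a b := by
    -- The bound on `kAt` turns the truncated difference in `trDown_pow` into an integer difference.
    rcases kAt_eq (N := N) n with h | ⟨-, h⟩
    · have := subsingleton_ring h
      exact Subsingleton.elim (α := ring (ofWeight N n)) _ _
    · refine (congrArg (trDown N n) (pow_add (stepAt N n).xi a b).symm).trans
        ((trDown_pow n (a + b)).trans (congrArg _ ?_))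
      push_cast [h]
      ring
  eps n a b := by
    refine (congrArg (trUp N n) (pow_add (stepAt N n).xi a b).symm).trans
      ((trUp_pow n (a + b)).trans (congrArg _ ?_))
    push_cast
    ring
  shiftHom f s m := rfl
  shiftInv f s m := rfl
  inl f g m := rfl
  inr f g m := rfl
  fst f g m := rfl
  snd f g m := rfl

/-! ### Restriction to 2-morphisms of degree zero -/

section Restriction

universe w v u w' v' u'

variable {B : Type u} [Bicategory.{w, v} B] {C : Type u'} [Bicategory.{w', v'} C]
  [∀ a b : B, Preadditive (a ⟶ b)] [∀ a b : C, Preadditive (a ⟶ b)]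
  [GradedBicategory B] [GradedBicategory C] {F : B ⥤q C}

/-- The restriction of a graded 2-functor to the 2-morphisms of degree zero. -/
def PseudofunctorOn.restrict (G : PseudofunctorOn F) (hG : G.IsGraded) :
    PseudofunctorOn (degZeroPrefunctor F) where
  map₂ η := ⟨G.map₂ η.1, hG.1 0 η.1 η.2⟩
  map₂_id f := Subtype.ext (G.map₂_id f.as)
  map₂_comp η θ := Subtype.ext (G.map₂_comp η.1 θ.1)
  mapId a := isoZero (G.mapId a.as) (hG.2.1 a.as).1 (hG.2.1 a.as).2
  mapComp f g := isoZero (G.mapComp f.as g.as) (hG.2.2 f.as g.as).1 (hG.2.2 f.as g.as).2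
  map₂_whisker_left f _ _ η := Subtype.ext (G.map₂_whisker_left f.as η.1)
  map₂_whisker_right η h := Subtype.ext (G.map₂_whisker_right η.1 h.as)
  map₂_associator f g h := Subtype.ext (G.map₂_associator f.as g.as h.as)
  map₂_left_unitor f := Subtype.ext (G.map₂_left_unitor f.as)
  map₂_right_unitor f := Subtype.ext (G.map₂_right_unitor f.as)

theorem PseudofunctorOn.restrict_isAdditive (G : PseudofunctorOn F) (hG : G.IsGraded)
    (h : G.IsAdditive) : (G.restrict hG).IsAdditive :=
  fun η θ => Subtype.ext (h η.1 θ.1)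

theorem PseudofunctorOn.restrict_isRestriction (G : PseudofunctorOn F) (hG : G.IsGraded) :
    (G.restrict hG).IsRestriction G :=
  ⟨fun _ => rfl, fun _ => rfl, fun _ _ => rfl⟩

end Restriction

end EqFlagRep

end

theorem mainTheorem1 (N : ℕ) (hN : 0 < N) :
    ∃ Γ : PseudofunctorOn (gamma N : UStar ⥤q EqFlagStar N),
      Γ.IsAdditive ∧ Γ.IsGraded ∧ HasValues Γ ∧
      (∀ a : UStar, Γ.mapId a = eqToIso (gamma_id N a)) ∧
      (∀ {a b c : UStar} (f : a ⟶ b) (g : b ⟶ c), Γ.mapComp f g = eqToIso (gamma_comp N f g)) ∧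
      ∃ Γ₀ : PseudofunctorOn (degZeroPrefunctor (gamma N) : UZero ⥤q EqFlag N),
        Γ₀.IsAdditive ∧ Γ₀.IsRestriction Γ :=
  ⟨gammaFunctor N, gammaFunctor_isAdditive N, gammaFunctor_isGraded N, gammaFunctor_hasValues N,
    fun _ => rfl, fun _ _ => rfl, (gammaFunctor N).restrict (gammaFunctor_isGraded N),
    (gammaFunctor N).restrict_isAdditive _ (gammaFunctor_isAdditive N),
    (gammaFunctor N).restrict_isRestriction _⟩
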